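/- Let $\alpha\in\mathbb C$ with $\alpha^2=-3$. Put $\phi_{a_0,a_1,c}(x)=-\frac{c^3}{a_0^2}\frac{(x^2+a_1x+a_0)^2}{(x-c)^3}$. A *normalized cover* $(\phi;\tau_1,\tau_2;\xi_1,\xi_2)$ is a rational function $\phi$ of degree $4$ on $\mathbb P^1$ over $\mathbb C$ such that $\phi^{-1}(0)$ consists of two double points, $\phi^{-1}(1)$ of the four distinct simple points $0,1,\tau_1,\tau_2\in\mathbb C$, $\phi^{-1}(\infty)$ of the simple point $\infty$ and a triple point, and the remaining critical points, counted with multiplicity, are $\xi_1,\xi_2$. Define $$a_0(s,t)=\frac{t^2-1}{(s+1)((s-1)^2t^2-(s+1)^2)},\quad a_1(s,t)=a_0(s,t)(s^3-1)-1,\quad c(s)=\frac1{1-s^2},$$ $$t_1(s,t)=-\frac{(t+1)(st-t-1-3s)}{(st-t-1-s)^2(s+1)},\qquad t_2(s,t)=-\frac{(t-1)(st-t+1+3s)}{(st-t+s+1)^2(s+1)},$$ $$\sigma(s,t)=\frac{t^2s^3+3s^3-4t^2s^2+4s^2+5t^2s+7s+2-2t^2}{(s-1)(s+1)(st-t+s+1)(st-t-1-s)},\qquad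 \pi(s,t)=-\frac{(st-t+1+3s)(st-t-1-3s)}{(s+1)^2(st-t+s+1)(st-t-1-s)(s-1)}.$$ Define also, with $w=2\alpha\frac{1+v^2}{1-v^2}$ (that is, $\frac{-2\alpha+w}{2\alpha+w}=v^2$), $$s(u,v)=-\frac{3u^2+wu-1}{u^2-3-uw},\qquad t(u,v)=-\frac{4u(wu+2)}{(u^2-3-uw)(s(u,v)-1)},$$ and, with $M=u^2v^2-u^2-2\alpha uv^2-2\alpha u+v^2-1$, $A_\pm=uv\pm u+\alpha v\mp\alpha$, $B_\pm=\alpha v-2v\pm(\alpha-2)+7uv\pm(u-4\alpha u)$, $C_\pm=2v+\alpha v\pm(2+\alpha)+7uv\pm(u+4\alpha u)$, $$t_1(u,v)=-\frac{353+9\alpha}{52}\cdot\frac{(-4\alpha u^2+2uv^2-2u-v^2+1+13u^2v^2+11u^2+4\alpha uv^2-4\alpha u-2\alpha v^2+2\alpha)\,u(2v-1+\alpha)(2v+1-\alpha)A_+^2A_-^2}{(u+1)M(v+1)(v-1)B_+^2B_-^2},$$ $$t_2(u,v)=\frac{9\alpha-353}{52}\cdot\frac{(-v^2+1+13u^2v^2+11u^2+4\alpha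 u^2-2uv^2+2u+2\alpha v^2-2\alpha+4\alpha uv^2-4\alpha u)\,u(2v-1-\alpha)(2v+1+\alpha)A_+^2A_-^2}{(u-1)M(v+1)(v-1)C_-^2C_+^2},$$ $$q_1(u,v)=-\frac72\cdot\frac{A_-A_+^2\,u(2v+1-\alpha)(2v+1+\alpha)}{M\,B_-C_-(v+1)},\qquad q_2(u,v)=-\frac72\cdot\frac{A_+A_-^2\,u(2v-1+\alpha)(2v-1-\alpha)}{M\,C_+B_+(v-1)}.$$ Then the following hold. 1. For complex $a_0\ne0$, $c\ne0,1$ and $a_1$, one has $\frac{a_0^2}{c^3}+\frac{(1+a_1+a_0)^2}{(1-c)^3}=0$ (that is, $\phi_{a_0,a_1,c}(1)=1$) if and only if there is a unique $s\in\mathbb C$ with $a_1=a_0(s^3-1)-1$ and $c=\frac1{1-s^2}$. 2. $(\phi;\tau_1,\tau_2;\xi_1,\xi_2)$ is a normalized cover if and only if there is a unique $(s,t)\in\mathbb C^2$ such that $s^2\ne1$, $(s-1)^2t^2\ne(s+1)^2$, $0,1,t_1(s,t),t_2(s,t)$ are pairwise distinct, $a_1(s,t)^2\neq4a_0(s,t)$,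 $\phi=\phi_{a_0(s,t),a_1(s,t),c(s)}$, $\tau_i=t_i(s,t)$, $\xi_1+\xi_2=\sigma(s,t)$ and $\xi_1\xi_2=\pi(s,t)$. 3. Let $k=\mathbb Q(\alpha)=\mathbb Q(\sqrt{-3})$ and work in the rational function field $k(u,v)$. With $s=s(u,v)$ and $t=t(u,v)$ one has $t_i(u,v)=t_i(s,t)$, $q_1+q_2=\sigma(s,t)$, $q_1q_2=\pi(s,t)$, $[k(u,v):k(s,t)]=2$ and $k(u,v)=k(s,t,q_1)$. So $(u,v)$ is a rational parametrization over $\mathbb Q(\sqrt{-3})$ of the family with marked critical points. 4. There is a nonzero $h\in\mathbb C[u,v]$ such that at each $(u,v)\in\mathbb C^2$ with $h(u,v)\ne0$ the parameters $s(u,v),t(u,v)$ give a normalized cover $\phi_{u,v}$ with $\tau_i=t_i(u,v)$, $\xi_i=q_i(u,v)$ and $q_1\ne q_2$, and such that for every $\theta\in\mathbb C$ there are $p_1,p_2\in\mathbb C[u,v,h^{-1}]$ for which $(t_1,t_2,q_1,q_2,p_1,p_2)(u,v)$ is a complete algebraic solution of the Garnier system of rank $2$ with exponents $(\theta_0,\theta_1,\theta_{t_1},\theta_{t_2},\theta_\infty)=(\theta,\theta,\theta,\theta,\frac13)$: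 through each point with $h\ne0$ there is a local holomorphic inverse of $(u,v)\mapsto(t_1,t_2)$, and along it $\partial q_k/\partial t_j=\partial H_j/\partial p_k$ and $\partial p_k/\partial t_j=-\partial H_j/\partial q_k$. Here $$H_j=-\frac{\prod_k(t_j-q_k)}{t_j(t_j-1)\prod_{i\ne j}(t_j-t_i)}\sum_k\frac{q_k(q_k-1)\prod_{i\ne j}(q_k-t_i)}{\prod_{m\ne k}(q_k-q_m)}\Bigl[p_k^2-\Bigl(\frac{\theta_0}{q_k}+\frac{\theta_1}{q_k-1}+\sum_i\frac{\theta_{t_i}-\delta_{ij}}{q_k-t_i}\Bigr)p_k+\frac{\kappa}{q_k(q_k-1)}\Bigr],$$ $\kappa=\frac14\bigl((\theta_0+\theta_1+\sum_i\theta_{t_i}-1)^2-\theta_\infty^2\bigr)$. Moreover, for suitable $a,b\in\mathbb C$, the Fuchsian equation $y''+fy'+gy=0$ with $$f=\frac{1-\theta_0}{x}+\frac{1-\theta_1}{x-1}+\sum_i\frac{1-\theta_{t_i}}{x-t_i}-\sum_i\frac1{x-q_i},\qquad g=\frac ax+\frac b{x-1}-\sum_i\frac{H_i}{x-t_i}+\sum_i\frac{p_i}{x-q_i}$$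 is equivalent, up to rescaling $y$ by a function of $x$, to the pull-back by $\phi_{u,v}$ of the hypergeometric equation with exponent differences $\frac12,\theta,\frac13$ at $0,1,\infty$. 5. The rational map $(s,t)\mapsto(t_1,t_2)$ to $\mathbb P^1\times\mathbb P^1$ has degree $9$, that is, $[\mathbb C(s,t):\mathbb C(t_1,t_2)]=9$. The branch locus of the normalization of $\mathbb P^1\times\mathbb P^1$ in $\mathbb C(s,t)$ is exactly the union of the curves $t_1=0,1,\infty$, $t_2=0,1,\infty$ and the diagonal $t_1=t_2$. -/

import Mathlib

open Polynomial

noncomputable section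

/-! ### The degree-4 family and its parameters

All formulas are written over an arbitrary field, so that they can be evaluated at complex
numbers, at rational functions in `x`, and at the generic point of a parameter plane. -/

section Formulas

variable {F : Type*} [Field F]

/-- The value at `x` of `-(c³/a₀²) (x² + a₁ x + a₀)² / (x - c)³`. -/
def coverMap (a₀ a₁ c x : F) : F :=
  -(c ^ 3 / a₀ ^ 2) * ((x ^ 2 + a₁ * x + a₀) ^ 2 / (x - c) ^ 3)

/-- The coefficient `a₀` as a function of the parameters `(s,t)`. -/
def coeffA0 (s t : F) : F :=
  (t ^ 2 - 1) / ((s + 1) * ((s - 1) ^ 2 * t ^ 2 - (s + 1) ^ 2))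

/-- The coefficient `a₁` as a function of the parameters `(s,t)`. -/
def coeffA1 (s t : F) : F :=
  coeffA0 s t * (s ^ 3 - 1) - 1

/-- The triple pole `c`, which depends on `s` only. -/
def poleC (s : F) : F :=
  1 / (1 - s ^ 2)

/-- The point `t₁` of the fibre over `1`, in terms of `(s,t)`. -/
def tOne (s t : F) : F :=
  -((t + 1) * (s * t - t - 1 - 3 * s)) / ((s * t - t - 1 - s) ^ 2 * (s + 1))

/-- The point `t₂` of the fibre over `1`, in terms of `(s,t)`. -/
def tTwo (s t : F) : F :=
  -((-1 + t) * (s * t - t + 1 + 3 * s)) / ((s * t - t + s + 1) ^ 2 * (s + 1))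

/-- The sum of the two free critical points, in terms of `(s,t)`. -/
def critSum (s t : F) : F :=
  (t ^ 2 * s ^ 3 + 3 * s ^ 3 - 4 * t ^ 2 * s ^ 2 + 4 * s ^ 2 + 5 * t ^ 2 * s + 7 * s + 2
      - 2 * t ^ 2)
    / ((s - 1) * (s + 1) * (s * t - t + s + 1) * (s * t - t - 1 - s))

/-- The product of the two free critical points, in terms of `(s,t)`. -/
def critProd (s t : F) : F :=
  -((s * t - t + 1 + 3 * s) * (s * t - t - 1 - 3 * s))
    / ((s + 1) ^ 2 * (s * t - t + s + 1) * (s * t - t - 1 - s) * (s - 1))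

/-- The solution `w` of `(-2α + w) / (2α + w) = v²`. -/
def paramW (α v : F) : F :=
  2 * α * (1 + v ^ 2) / (1 - v ^ 2)

/-- The parameter `s` in terms of `(u,v)`. -/
def paramS (α u v : F) : F :=
  -(3 * u ^ 2 + paramW α v * u - 1) / (u ^ 2 - 3 - u * paramW α v)

/-- The parameter `t` in terms of `(u,v)`. -/
def paramT (α u v : F) : F :=
  -(4 * u * (paramW α v * u + 2))
    / ((u ^ 2 - 3 - u * paramW α v) * (paramS α u v - 1))

/-- `t₁(u,v)`. -/
def solT1 (α u v : F) : F :=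
  -(1 / 52) * (353 + 9 * α)
    * (-4 * α * u ^ 2 + 2 * u * v ^ 2 - 2 * u - v ^ 2 + 1 + 13 * u ^ 2 * v ^ 2 + 11 * u ^ 2
        + 4 * α * u * v ^ 2 - 4 * α * u - 2 * α * v ^ 2 + 2 * α)
    * u * (2 * v - 1 + α) * (2 * v + 1 - α)
    * (u * v + u + α * v - α) ^ 2 * (u * v - u + α * v + α) ^ 2
    / ((u + 1) * (u ^ 2 * v ^ 2 - u ^ 2 - 2 * α * u * v ^ 2 - 2 * α * u + v ^ 2 - 1)
        * (v + 1) * (v - 1)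
        * (α * v - 2 * v + α - 2 + 7 * u * v + u - 4 * α * u) ^ 2
        * (α * v - 2 * v + 2 - α + 7 * u * v - u + 4 * α * u) ^ 2)

/-- `t₂(u,v)`. -/
def solT2 (α u v : F) : F :=
  1 / 52 * (9 * α - 353)
    * (-v ^ 2 + 1 + 13 * u ^ 2 * v ^ 2 + 11 * u ^ 2 + 4 * α * u ^ 2 - 2 * u * v ^ 2 + 2 * u
        + 2 * α * v ^ 2 - 2 * α + 4 * α * u * v ^ 2 - 4 * α * u)
    * u * (2 * v - 1 - α) * (2 * v + 1 + α)
    * (u * v + u + α * v - α) ^ 2 * (u * v - u + α * v + α) ^ 2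
    / ((u - 1) * (u ^ 2 * v ^ 2 - u ^ 2 - 2 * α * u * v ^ 2 - 2 * α * u + v ^ 2 - 1)
        * (v + 1) * (v - 1)
        * (2 * v + α * v - 2 - α + 7 * u * v - u - 4 * α * u) ^ 2
        * (2 * v + α * v + 2 + α + 7 * u * v + u + 4 * α * u) ^ 2)

/-- `q₁(u,v)`. -/
def solQ1 (α u v : F) : F :=
  -(7 / 2) * (u * v - u + α * v + α) * u * (2 * v + 1 - α) * (2 * v + 1 + α)
    * (u * v + u + α * v - α) ^ 2
    / ((u ^ 2 * v ^ 2 - u ^ 2 - 2 * α * u * v ^ 2 - 2 * α * u + v ^ 2 - 1)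
        * (α * v - 2 * v + 2 - α + 7 * u * v - u + 4 * α * u)
        * (2 * v + α * v - 2 - α + 7 * u * v - u - 4 * α * u) * (v + 1))

/-- `q₂(u,v)`. -/
def solQ2 (α u v : F) : F :=
  -(7 / 2) * (u * v + u + α * v - α) * u * (2 * v - 1 + α) * (2 * v - 1 - α)
    * (u * v - u + α * v + α) ^ 2
    / ((u ^ 2 * v ^ 2 - u ^ 2 - 2 * α * u * v ^ 2 - 2 * α * u + v ^ 2 - 1)
        * (2 * v + α * v + 2 + α + 7 * u * v + u + 4 * α * u)
        * (α * v - 2 * v + α - 2 + 7 * u * v + u - 4 * α * u) * (v - 1))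

end Formulas

/-- The family as a rational function of `x`. -/
def coverRat (a₀ a₁ c : ℂ) : RatFunc ℂ :=
  coverMap (RatFunc.C a₀) (RatFunc.C a₁) (RatFunc.C c) RatFunc.X

open Classical in
/-- `φ : ℙ¹ → ℙ¹` has degree 4; its fibre over `0` consists of two double points; its fibre over
`1` consists of the four distinct simple points `0, 1, τ₁, τ₂`; its fibre over `∞` consists of the
simple point `∞` and a triple point; and its remaining critical points are `ξ₁, ξ₂`, counted with
multiplicity. -/
structure IsNormalizedCover (φ : RatFunc ℂ) (τ₁ τ₂ ξ₁ ξ₂ : ℂ) : Prop where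
  natDegree_num : φ.num.natDegree = 4
  natDegree_denom : φ.denom.natDegree = 3
  fibre_infty : ∃ c : ℂ, φ.denom.rootMultiplicity c = 3
  fibre_zero : ∀ r : ℂ, φ.num.IsRoot r → φ.num.rootMultiplicity r = 2
  fibre_one : (φ.num - φ.denom).roots = {0, 1, τ₁, τ₂}
  fibre_one_nodup : (φ.num - φ.denom).roots.Nodup
  critical : (derivative φ.num * φ.denom - φ.num * derivative φ.denom).roots.filter
      (fun x => ¬ φ.num.IsRoot x ∧ ¬ φ.denom.IsRoot x) = {ξ₁, ξ₂}

/-- The pairs `(s,t)` at which the formulas have a meaning and the corresponding cover is not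
degenerate. -/
def Admissible (s t : ℂ) : Prop :=
  s ^ 2 ≠ 1 ∧ (s - 1) ^ 2 * t ^ 2 ≠ (s + 1) ^ 2 ∧
  tOne s t ≠ 0 ∧ tOne s t ≠ 1 ∧ tTwo s t ≠ 0 ∧ tTwo s t ≠ 1 ∧ tOne s t ≠ tTwo s t ∧
  coeffA1 s t ^ 2 ≠ 4 * coeffA0 s t

/-! ### Fuchsian equations and the Garnier system -/

section Garnier

variable {N : ℕ}

/-- The coefficient `f` of the normal form `y'' + f y' + g y = 0` of a Fuchsian equation with
singular points `0, 1, tᵢ, ∞` and apparent singular points `qᵢ` of exponent `2`. -/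
def fuchsF (θ₀ θ₁ : ℂ) (θ t q : Fin N → ℂ) (x : ℂ) : ℂ :=
  (1 - θ₀) / x + (1 - θ₁) / (x - 1) + ∑ i, (1 - θ i) / (x - t i) + ∑ i, (-1) / (x - q i)

/-- The coefficient `g` of the normal form. -/
def fuchsG (a b : ℂ) (t q H p : Fin N → ℂ) (x : ℂ) : ℂ :=
  a / x + b / (x - 1) - ∑ i, H i / (x - t i) + ∑ i, p i / (x - q i)

/-- The Hamiltonians `H_j(t,q,p)` of the Garnier system of rank `N` with exponents
`θ₀, θ₁, θᵢ, θ_∞` at `0, 1, tᵢ, ∞`. -/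
def garnierH (θ₀ θ₁ θinf : ℂ) (θ : Fin N → ℂ) (j : Fin N) (t q p : Fin N → ℂ) : ℂ :=
  -((∏ k, (t j - q k))
      / (t j * (t j - 1) * ∏ i ∈ Finset.univ.erase j, (t j - t i)))
    * ∑ k, (q k * (q k - 1) * ∏ i ∈ Finset.univ.erase j, (q k - t i))
        / (∏ m ∈ Finset.univ.erase k, (q k - q m))
      * (p k ^ 2
          - (θ₀ / q k + θ₁ / (q k - 1)
              + ∑ i, (θ i - if i = j then 1 else 0) / (q k - t i)) * p k
          + ((θ₀ + θ₁ + ∑ i, θ i - 1) ^ 2 - θinf ^ 2) / 4 / (q k * (q k - 1)))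

/-- `τ ↦ (q(τ), p(τ))` is a holomorphic solution on the open set `V` of the Garnier system
`∂q_k/∂t_j = ∂H_j/∂p_k`, `∂p_k/∂t_j = -∂H_j/∂q_k`, away from the polar locus of the system. -/
structure IsGarnierSolution (θ₀ θ₁ θinf : ℂ) (θ : Fin N → ℂ) (V : Set (Fin N → ℂ))
    (q p : (Fin N → ℂ) → Fin N → ℂ) : Prop where
  isOpen : IsOpen V
  times : ∀ τ ∈ V, Function.Injective τ ∧ ∀ i, τ i ≠ 0 ∧ τ i ≠ 1
  positions : ∀ τ ∈ V, Function.Injective (q τ) ∧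
    ∀ k, q τ k ≠ 0 ∧ q τ k ≠ 1 ∧ ∀ i, q τ k ≠ τ i
  holo_q : DifferentiableOn ℂ q V
  holo_p : DifferentiableOn ℂ p V
  deriv_q : ∀ τ ∈ V, ∀ j k, HasDerivAt (fun z => q (Function.update τ j z) k)
    (deriv (fun m => garnierH θ₀ θ₁ θinf θ j τ (q τ) (Function.update (p τ) k m)) (p τ k)) (τ j)
  deriv_p : ∀ τ ∈ V, ∀ j k, HasDerivAt (fun z => p (Function.update τ j z) k)
    (-deriv (fun l => garnierH θ₀ θ₁ θinf θ j τ (Function.update (q τ) k l) (p τ)) (q τ k)) (τ j)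

/-- The coefficient `Q` of the equation `y'' + Q y = 0` obtained from `y'' + f y' + g y = 0`
by rescaling `y`; it determines the equation up to such rescalings. -/
def potential (f g : ℂ → ℂ) (x : ℂ) : ℂ :=
  g x - deriv f x / 2 - f x ^ 2 / 4

/-- The hypergeometric equation `y'' + R y = 0` with exponent differences `θ₀, θ₁, θ_∞` at
`0, 1, ∞`. -/
def hypergeometricPotential (θ₀ θ₁ θinf z : ℂ) : ℂ :=
  (1 - θ₀ ^ 2) / (4 * z ^ 2) + (1 - θ₁ ^ 2) / (4 * (z - 1) ^ 2)
    + (θ₀ ^ 2 + θ₁ ^ 2 - θinf ^ 2 - 1) / (4 * (z * (z - 1)))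

/-- The Schwarzian derivative. -/
def schwarzian (φ : ℂ → ℂ) (x : ℂ) : ℂ :=
  deriv (deriv (deriv φ)) x / deriv φ x - 3 / 2 * (deriv (deriv φ) x / deriv φ x) ^ 2

/-- The coefficient of the pull-back of `y'' + R y = 0` by `z = φ(x)`, after the rescaling of `y`
that removes the term in `y'`. -/
def pullbackPotential (φ R : ℂ → ℂ) (x : ℂ) : ℂ :=
  deriv φ x ^ 2 * R (φ x) + schwarzian φ x / 2

end Garnier

/-- `(t₁, t₂)` as a function of `(u, v)`. -/
def solT (α : ℂ) (x : Fin 2 → ℂ) : Fin 2 → ℂ :=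
  ![solT1 α (x 0) (x 1), solT2 α (x 0) (x 1)]

/-- `(q₁, q₂)` as a function of `(u, v)`. -/
def solQ (α : ℂ) (x : Fin 2 → ℂ) : Fin 2 → ℂ :=
  ![solQ1 α (x 0) (x 1), solQ2 α (x 0) (x 1)]

/-! ### Function fields and ramification -/

/-- The field of rational functions in two variables over `k`. -/
abbrev FunctionField2 (k : Type*) [Field k] : Type _ :=
  FractionRing (MvPolynomial (Fin 2) k)

/-- The coordinate functions of the plane. -/
def coord (k : Type*) [Field k] (i : Fin 2) : FunctionField2 k :=
  algebraMap (MvPolynomial (Fin 2) k) (FunctionField2 k) (MvPolynomial.X i)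

/-- The normalization of `Spec A` in the field `L` is unramified at all points over `P`. -/
def IsUnramifiedOver {L : Type*} [Field L] [Algebra ℂ L] (A : Subalgebra ℂ L)
    (P : Ideal A) : Prop :=
  ∀ (Q : Ideal (integralClosure A L)) [Q.IsPrime], Q.under A = P → Algebra.IsUnramifiedAt A Q

/-- On the chart `Spec ℂ[a,b]`, the branch locus of the normalization in `L` is exactly the zero
locus of the function `f`. -/
def BranchLocusIs {L : Type*} [Field L] [Algebra ℂ L] (a b f : L) : Prop :=
  ∃ g : Algebra.adjoin ℂ ({a, b} : Set L), (g : L) = f ∧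
    ∀ P : Ideal (Algebra.adjoin ℂ ({a, b} : Set L)), P.IsPrime →
      (IsUnramifiedOver (Algebra.adjoin ℂ ({a, b} : Set L)) P ↔ g ∉ P)

end

/-! Write P = x² + a₁x + a₀ and k = a₀²/c³. A normalized cover amounts to an identity
x(x-1)(x-t₁)(x-t₂) = P² + k(x-c)³, and its free critical points are the roots of 2P'(x-c) - 3P. On
the fibre over 1 one has P² = -k(x-c)³, a cuspidal cubic, so the values of P at the four points
differ by cubes of rational functions. The parameter s is such a cube root, that of P(1)/P(0); t is
a square root that makes the discriminant of t₁, t₂ a square, and its sign decides which of the two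
points is t₁ (`value_one_iff_existsUnique`, `CoverEquations.discr`,
`CoverEquations.exists_parameter`, `isNormalizedCover_iff`).

For the double cover, u = (s-1)t/(s+3), then w is rational in t and u, and v² = (w-2α)/(w+2α). Hence
k(s,t) = k(u,w) = k(u,v²). The automorphism v ↦ -v fixes this field and exchanges q₁ and q₂
(`paramField_facts`).

For the Garnier system put θ = (4μ+1)/6. If F solves the hypergeometric equation with exponents 0,
1/2 at 0, exponents 0, θ at 1 and exponents -μ/3, (1-μ)/3 at infinity, then y = (x-c)^μ F(φ(x)) has
exponents 0, 1 at the triple pole, so c is not singular. At a free critical point q the derivative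
of φ vanishes, so y'/y = μ/(q-c); this is the momentum p. Hamilton's equations are checked directly.
When one tᵢ moves and the other stays, the motion of the coefficients is encoded by a cubic
polynomial with three known roots (`CoverVariation.field_eq`), which gives the velocities of c and
q. In the coordinate centred at c everything is a rational function of the positions of q₁, q₂, tᵢ
and of μ, and the equations become identities there (`centred_force`, `CoverVariation.velocity`,
`CoverVariation.force`). The value of the Hamiltonian (`CoverRelations.hamiltonian_eq`) identifies
the residues of the Fuchsian equation (`potential_fuchs`). A variation that leaves t₁, t₂ fixed is
trivial (`CoverVariation.rigid`), so (u,v) ↦ (t₁,t₂) is locally invertible and local branches exist.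

For the degree, the fibres of t₁ are conics with a rational point. The slope z through that point
generates ℂ(s,t) over ℂ(t₁), and t₂ is a reduced fraction of degree 9 in z
(`RegularParameter.fibreCoord_spec`, `finrank_fibration`).

For the branch locus, consider a valuation ring at which 0, 1, ∞, t₁, t₂ stay apart. A chart (r,t)
of the plane is then integral and all relevant factors are units (`EqualDifferences.units`); since
the Jacobian of (t₁,t₂) in (r,t) is a product of such units, there is no ramification
(`GenericParameter.isUnramifiedOver`). Conversely, along each of the seven curves there is a one-jet
in which t₁ and t₂, or their inverses in the chart concerned, have no first order term, while a cube
root of a product of values of P, which is integral by `RegularParameter.isIntegral_scaled_product`,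
has one. This forces ramification by `not_isUnramifiedOver_of_hasJet`. -/

noncomputable section

/-! ### Algebra of a normalized cover

The fibre of `φ = -k⁻¹ P² / (x - c)³` over `1`, where `P = x² + a₁ x + a₀`, is `{0, 1, t, t'}`, and
its free critical points are `q, r`. -/

/-- The relations between the coefficients of a cover, its fibre over `1` and its free critical
points. -/
structure CoverEquations (a₀ a₁ c k t t' q r : ℂ) : Prop where
  cubic : -(1 + t + t') = 2 * a₁ + k
  quadratic : t + t' + t * t' = a₁ ^ 2 + 2 * a₀ - 3 * k * c
  linear : -(t * t') = 2 * a₀ * a₁ + 3 * k * c ^ 2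
  constant : a₀ ^ 2 = k * c ^ 3
  sum : q + r = 4 * c + a₁
  prod : q * r = -(2 * a₁ * c) - 3 * a₀
  t_ne_zero : t ≠ 0
  t_ne_one : t ≠ 1
  t'_ne_zero : t' ≠ 0
  t'_ne_one : t' ≠ 1
  t_ne_t' : t ≠ t'

/-- The relations of a cover with distinct free critical points. -/
structure CoverRelations (a₀ a₁ c k t t' q r : ℂ) : Prop extends
    CoverEquations a₀ a₁ c k t t' q r where
  q_ne_r : q ≠ r

namespace CoverEquations

variable {a₀ a₁ c k t t' q r : ℂ}

theorem swap_times (h : CoverEquations a₀ a₁ c k t t' q r) :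
    CoverEquations a₀ a₁ c k t' t q r where
  cubic := by linear_combination h.cubic
  quadratic := by linear_combination h.quadratic
  linear := by linear_combination h.linear
  constant := h.constant
  sum := h.sum
  prod := h.prod
  t_ne_zero := h.t'_ne_zero
  t_ne_one := h.t'_ne_one
  t'_ne_zero := h.t_ne_zero
  t'_ne_one := h.t_ne_one
  t_ne_t' := h.t_ne_t'.symm

theorem swap_critical (h : CoverEquations a₀ a₁ c k t t' q r) :
    CoverEquations a₀ a₁ c k t t' r q where
  cubic := h.cubic
  quadratic := h.quadratic
  linear := h.linear
  constant := h.constant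
  sum := by linear_combination h.sum
  prod := by linear_combination h.prod
  t_ne_zero := h.t_ne_zero
  t_ne_one := h.t_ne_one
  t'_ne_zero := h.t'_ne_zero
  t'_ne_one := h.t'_ne_one
  t_ne_t' := h.t_ne_t'

theorem fibre (h : CoverEquations a₀ a₁ c k t t' q r) (x : ℂ) :
    x * (x - 1) * (x - t) * (x - t') = (x ^ 2 + a₁ * x + a₀) ^ 2 + k * (x - c) ^ 3 := by
  linear_combination x ^ 3 * h.cubic + x ^ 2 * h.quadratic + x * h.linear - h.constant

theorem fibre_deriv (h : CoverEquations a₀ a₁ c k t t' q r) (x : ℂ) :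
    (x - 1) * (x - t) * (x - t') + x * (x - t) * (x - t') + x * (x - 1) * (x - t')
      + x * (x - 1) * (x - t)
      = 2 * (x ^ 2 + a₁ * x + a₀) * (2 * x + a₁) + 3 * k * (x - c) ^ 2 := by
  linear_combination 3 * x ^ 2 * h.cubic + 2 * x * h.quadratic + h.linear

theorem critical (h : CoverEquations a₀ a₁ c k t t' q r) (x : ℂ) :
    (x - q) * (x - r) = 2 * (2 * x + a₁) * (x - c) - 3 * (x ^ 2 + a₁ * x + a₀) := by
  linear_combination -x * h.sum + h.prod

/-- The derivative of the fibre polynomial, multiplied by `x - c`. -/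
theorem deriv_mul (h : CoverEquations a₀ a₁ c k t t' q r) (x : ℂ) :
    ((x - 1) * (x - t) * (x - t') + x * (x - t) * (x - t') + x * (x - 1) * (x - t')
      + x * (x - 1) * (x - t)) * (x - c) - 3 * (x * (x - 1) * (x - t) * (x - t'))
      = (x ^ 2 + a₁ * x + a₀) * ((x - q) * (x - r)) := by
  rw [h.fibre_deriv, h.fibre, h.critical]
  ring

theorem k_ne_zero (h : CoverEquations a₀ a₁ c k t t' q r) : k ≠ 0 := by
  rintro rfl
  have h0 : a₀ = 0 := by simpa using h.constant
  have := h.linear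
  simp [h0, h.t_ne_zero, h.t'_ne_zero] at this

/-- At a simple point of the fibre over `1`. -/
theorem ne_zero_of_simple (h : CoverEquations a₀ a₁ c k t t' q r) {x : ℂ}
    (hx : x * (x - 1) * (x - t) * (x - t') = 0)
    (hx' : (x - 1) * (x - t) * (x - t') + x * (x - t) * (x - t') + x * (x - 1) * (x - t')
      + x * (x - 1) * (x - t) ≠ 0) :
    x - c ≠ 0 ∧ x ^ 2 + a₁ * x + a₀ ≠ 0 ∧ x - q ≠ 0 ∧ x - r ≠ 0 := by
  have hf := h.fibre x
  rw [hx] at hf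
  have hd := h.fibre_deriv x
  -- If x = c, then P(x) = 0 as well, and P² + k(x-c)³ has a multiple zero there.
  have hc : x - c ≠ 0 := by
    intro h0
    have hP : x ^ 2 + a₁ * x + a₀ = 0 := by
      have : (x ^ 2 + a₁ * x + a₀) ^ 2 = 0 := by linear_combination -hf - k * (x - c) ^ 2 * h0
      simpa using this
    apply hx'
    rw [hd, hP, h0]
    ring
  have hm := h.deriv_mul x
  rw [hx] at hm
  have : (x ^ 2 + a₁ * x + a₀) * ((x - q) * (x - r)) ≠ 0 := by
    rw [← hm]
    simpa using mul_ne_zero hx' hc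
  simp only [mul_ne_zero_iff] at this
  exact ⟨hc, this.1, this.2.1, this.2.2⟩

theorem at_zero (h : CoverEquations a₀ a₁ c k t t' q r) :
    c ≠ 0 ∧ a₀ ≠ 0 ∧ q ≠ 0 ∧ r ≠ 0 := by
  have := h.ne_zero_of_simple (x := 0) (by simp) (by simp [h.t_ne_zero, h.t'_ne_zero])
  simpa using this

theorem at_one (h : CoverEquations a₀ a₁ c k t t' q r) :
    1 - c ≠ 0 ∧ 1 + a₁ + a₀ ≠ 0 ∧ 1 - q ≠ 0 ∧ 1 - r ≠ 0 := by
  have := h.ne_zero_of_simple (x := 1) (by simp)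
    (by simp [sub_ne_zero.2 h.t_ne_one.symm, sub_ne_zero.2 h.t'_ne_one.symm])
  simpa using this

theorem at_t (h : CoverEquations a₀ a₁ c k t t' q r) :
    t - c ≠ 0 ∧ t ^ 2 + a₁ * t + a₀ ≠ 0 ∧ t - q ≠ 0 ∧ t - r ≠ 0 :=
  h.ne_zero_of_simple (x := t) (by simp)
    (by simp [h.t_ne_zero, sub_ne_zero.2 h.t_ne_one, sub_ne_zero.2 h.t_ne_t'])

/-- A common zero of P and x - c would lie in the fibre over 1, but c is already known to differ
from each of its four points. -/
theorem at_c (h : CoverEquations a₀ a₁ c k t t' q r) :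
    c ^ 2 + a₁ * c + a₀ ≠ 0 := by
  intro h0
  have hf := h.fibre c
  rw [h0] at hf
  simp [h.at_zero.1, sub_ne_zero.2 (sub_ne_zero.1 h.at_one.1).symm,
    sub_ne_zero.2 (sub_ne_zero.1 h.at_t.1).symm,
    sub_ne_zero.2 (sub_ne_zero.1 h.swap_times.at_t.1).symm] at hf

theorem critical_at_c (h : CoverEquations a₀ a₁ c k t t' q r) :
    (q - c) * (r - c) = -3 * (c ^ 2 + a₁ * c + a₀) := by
  linear_combination h.critical c

theorem q_sub_c (h : CoverEquations a₀ a₁ c k t t' q r) : q - c ≠ 0 := by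
  intro h0
  have := h.critical_at_c
  rw [h0] at this
  simp [h.at_c] at this

/-- `P` in the coordinate centred at `c`. -/
theorem centred (h : CoverEquations a₀ a₁ c k t t' q r) (x : ℂ) :
    x ^ 2 + a₁ * x + a₀ =
      (x - c) ^ 2 + ((q - c) + (r - c)) * (x - c) - (q - c) * (r - c) / 3 := by
  linear_combination -(x - c) * h.sum + h.critical_at_c / 3

theorem k_eq (h : CoverEquations a₀ a₁ c k t t' q r) :
    -k = (t ^ 2 + a₁ * t + a₀) ^ 2 / (t - c) ^ 3 := by
  have h0 := h.at_t.1
  rw [eq_div_iff (pow_ne_zero 3 h0)]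
  linear_combination h.fibre t

end CoverEquations

namespace CoverRelations

variable {a₀ a₁ c k t t' q r : ℂ}

theorem swap_times (h : CoverRelations a₀ a₁ c k t t' q r) :
    CoverRelations a₀ a₁ c k t' t q r :=
  ⟨h.toCoverEquations.swap_times, h.q_ne_r⟩

theorem swap_critical (h : CoverRelations a₀ a₁ c k t t' q r) :
    CoverRelations a₀ a₁ c k t t' r q :=
  ⟨h.toCoverEquations.swap_critical, h.q_ne_r.symm⟩

end CoverRelations

/-! ### The Hamiltonian of rank two and its partial derivatives. -/

/-- The Hamiltonian `H_j` of the Garnier system of rank `2` with exponents `θ, θ, θ, θ, 1/3`. -/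
def hamiltonian (θ t t' q r p p' : ℂ) : ℂ :=
  -((t - q) * (t - r) / (t * (t - 1) * (t - t')))
    * (q * (q - 1) * (q - t') / (q - r)
        * (p ^ 2 - (θ / q + θ / (q - 1) + ((θ - 1) / (q - t) + θ / (q - t'))) * p
          + ((4 * θ - 1) ^ 2 - (1 / 3) ^ 2) / 4 / (q * (q - 1)))
      + r * (r - 1) * (r - t') / (r - q)
        * (p' ^ 2 - (θ / r + θ / (r - 1) + ((θ - 1) / (r - t) + θ / (r - t'))) * p'
          + ((4 * θ - 1) ^ 2 - (1 / 3) ^ 2) / 4 / (r * (r - 1))))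

/-- In `Fin 2` the other index is 1 - j. Exchanging the two times or the two positions only relabels
one formula, so all four Hamilton equations of each kind reduce to a single computation. -/
theorem garnierH_fin_two (θ : ℂ) (j k : Fin 2) (t q p : Fin 2 → ℂ) :
    garnierH θ θ (1 / 3) ![θ, θ] j t q p
      = hamiltonian θ (t j) (t (1 - j)) (q k) (q (1 - k)) (p k) (p (1 - k)) := by
  have e0 : (Finset.univ.erase (0 : Fin 2)) = {1} := by decide
  have e1 : (Finset.univ.erase (1 : Fin 2)) = {0} := by decide
  fin_cases j <;> fin_cases k <;>
    simp [garnierH, hamiltonian, Fin.sum_univ_two, Fin.prod_univ_two, e0, e1,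
      -mul_eq_mul_left_iff, -mul_eq_mul_right_iff] <;> ring

theorem hasDerivAt_hamiltonian_momentum (θ t t' q r p p' : ℂ) :
    HasDerivAt (fun m => hamiltonian θ t t' q r m p')
      (-((t - q) * (t - r) / (t * (t - 1) * (t - t'))) * (q * (q - 1) * (q - t') / (q - r)
        * (2 * p - (θ / q + θ / (q - 1) + ((θ - 1) / (q - t) + θ / (q - t')))))) p := by
  unfold hamiltonian
  refine HasDerivAt.const_mul _ (HasDerivAt.add_const _ (HasDerivAt.const_mul _
    (HasDerivAt.add_const _ (HasDerivAt.sub ?_ ?_))))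
  · simpa using hasDerivAt_pow 2 p
  · simpa using (hasDerivAt_id p).const_mul
      (θ / q + θ / (q - 1) + ((θ - 1) / (q - t) + θ / (q - t')))

theorem hasDerivAt_const_div_sub (a b x : ℂ) (hx : x - b ≠ 0) :
    HasDerivAt (fun y => a / (y - b)) (-a / (x - b) ^ 2) x := by
  have h := (((hasDerivAt_id x).sub_const b).inv hx).const_mul a
  convert! h using 1
  simp only [id]
  ring

theorem hasDerivAt_const_div (a x : ℂ) (hx : x ≠ 0) :
    HasDerivAt (fun y => a / y) (-a / x ^ 2) x := by
  have := hasDerivAt_const_div_sub a 0 x (by simpa using hx)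
  simpa using this

/-- The rational prefactors are differentiated as prefactor times logarithmic derivative, so that
`sum_inv` and `sum_inv_sq` can be substituted afterwards. -/
theorem hasDerivAt_hamiltonian_position {θ t t' q r p p' : ℂ} (h0 : q ≠ 0) (h1 : q - 1 ≠ 0)
    (ht : q - t ≠ 0) (ht' : q - t' ≠ 0) (hr : q - r ≠ 0) :
    HasDerivAt (fun l => hamiltonian θ t t' l r p p')
      (-((t - q) * (t - r) / (t * (t - 1) * (t - t')))
        * (1 / (q - t) * (q * (q - 1) * (q - t') / (q - r)
              * (p ^ 2 - (θ / q + θ / (q - 1) + ((θ - 1) / (q - t) + θ / (q - t'))) * p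
                + ((4 * θ - 1) ^ 2 - (1 / 3) ^ 2) / 4 / (q * (q - 1)))
            + r * (r - 1) * (r - t') / (r - q)
              * (p' ^ 2 - (θ / r + θ / (r - 1) + ((θ - 1) / (r - t) + θ / (r - t'))) * p'
                + ((4 * θ - 1) ^ 2 - (1 / 3) ^ 2) / 4 / (r * (r - 1))))
          + q * (q - 1) * (q - t') / (q - r) * (1 / q + 1 / (q - 1) + 1 / (q - t') - 1 / (q - r))
              * (p ^ 2 - (θ / q + θ / (q - 1) + ((θ - 1) / (q - t) + θ / (q - t'))) * p
                + ((4 * θ - 1) ^ 2 - (1 / 3) ^ 2) / 4 / (q * (q - 1)))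
          + q * (q - 1) * (q - t') / (q - r)
              * ((θ / q ^ 2 + θ / (q - 1) ^ 2 + (θ - 1) / (q - t) ^ 2 + θ / (q - t') ^ 2) * p
                - ((4 * θ - 1) ^ 2 - (1 / 3) ^ 2) / 4 * (1 / q + 1 / (q - 1)) / (q * (q - 1)))
          + r * (r - 1) * (r - t') / (r - q) / (r - q)
              * (p' ^ 2 - (θ / r + θ / (r - 1) + ((θ - 1) / (r - t) + θ / (r - t'))) * p'
                + ((4 * θ - 1) ^ 2 - (1 / 3) ^ 2) / 4 / (r * (r - 1))))) q := by
  have hr' : r - q ≠ 0 := by rw [← neg_sub]; exact neg_ne_zero.2 hr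
  set W' := p' ^ 2 - (θ / r + θ / (r - 1) + ((θ - 1) / (r - t) + θ / (r - t'))) * p'
    + ((4 * θ - 1) ^ 2 - (1 / 3) ^ 2) / 4 / (r * (r - 1)) with hW'
  set κ := ((4 * θ - 1) ^ 2 - (1 / 3) ^ 2) / 4 with hκ
  have hid := hasDerivAt_id q
  have e1 : HasDerivAt (fun l : ℂ => -((t - l) * (t - r) / (t * (t - 1) * (t - t'))))
      (-((t - q) * (t - r) / (t * (t - 1) * (t - t'))) * (1 / (q - t))) q := by
    have := ((hid.const_sub t).mul_const ((t - r) / (t * (t - 1) * (t - t')))).neg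
    convert! this using 1
    · funext l; simp [mul_div_assoc]
    · have : t - q = -(q - t) := by ring
      rw [this]
      field_simp
  have e2 : HasDerivAt (fun l : ℂ => l * (l - 1) * (l - t') / (l - r))
      (q * (q - 1) * (q - t') / (q - r)
        * (1 / q + 1 / (q - 1) + 1 / (q - t') - 1 / (q - r))) q := by
    have := ((hid.mul (hid.sub_const 1)).mul (hid.sub_const t')).div (hid.sub_const r) hr
    convert! this using 1
    simp only [id, Pi.mul_apply]
    field_simp
  have e3 : HasDerivAt
      (fun l : ℂ => p ^ 2 - (θ / l + θ / (l - 1) + ((θ - 1) / (l - t) + θ / (l - t'))) * p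
        + κ / (l * (l - 1)))
      ((θ / q ^ 2 + θ / (q - 1) ^ 2 + (θ - 1) / (q - t) ^ 2 + θ / (q - t') ^ 2) * p
        - κ * (1 / q + 1 / (q - 1)) / (q * (q - 1))) q := by
    have f1 := ((((hasDerivAt_const_div θ q h0).add (hasDerivAt_const_div_sub θ 1 q h1)).add
      ((hasDerivAt_const_div_sub (θ - 1) t q ht).add (hasDerivAt_const_div_sub θ t' q ht'))).mul_const
        p).const_sub (p ^ 2)
    have f2 := ((hid.mul (hid.sub_const 1)).inv (mul_ne_zero h0 h1)).const_mul κ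
    convert! f1.add f2 using 1
    simp only [id, Pi.mul_apply]
    field_simp
    ring
  have e4 : HasDerivAt (fun l : ℂ => r * (r - 1) * (r - t') / (r - l))
      (r * (r - 1) * (r - t') / (r - q) / (r - q)) q := by
    have := ((hid.const_sub r).inv hr').const_mul (r * (r - 1) * (r - t'))
    convert! this using 1
    simp only [id]
    field_simp
  have key : ∀ C d₁ M₁ d₂ W₁ d₃ M₂ N₂ W₂ : ℂ,
      C * d₁ * (M₁ * W₁ + M₂ * W₂) + C * (M₁ * d₂ * W₁ + M₁ * d₃ + N₂ * W₂)
        = C * (d₁ * (M₁ * W₁ + M₂ * W₂) + M₁ * d₂ * W₁ + M₁ * d₃ + N₂ * W₂) := by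
    intros; ring
  exact (e1.mul ((e2.mul e3).add (e4.mul_const W'))).congr_deriv (key _ _ _ _ _ _ _ _ _)

/-! ### First order variations of a cover. -/

/-- A first order variation of the data of a cover. -/
structure CoverVariation (a₀ a₁ c k t t' q r a₀' a₁' c' k' τ τ' q' r' : ℂ) : Prop where
  cubic : -(τ + τ') = 2 * a₁' + k'
  quadratic : τ + τ' + (τ * t' + t * τ') = 2 * a₁ * a₁' + 2 * a₀' - 3 * (k' * c + k * c')
  linear : -(τ * t' + t * τ') = 2 * (a₀' * a₁ + a₀ * a₁') + 3 * (k' * c ^ 2 + 2 * k * c * c')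
  constant : 2 * a₀ * a₀' = k' * c ^ 3 + 3 * k * c ^ 2 * c'
  sum : q' + r' = 4 * c' + a₁'
  prod : q' * r + q * r' = -(2 * (a₁' * c + a₁ * c')) - 3 * a₀'

/-- A cubic polynomial with roots `0, 1, t`. -/
theorem cubic_eq_of_three_roots {b₀ b₁ b₂ b₃ t : ℂ} (t0 : t ≠ 0) (t1 : t ≠ 1) (h0 : b₀ = 0)
    (h1 : b₃ + b₂ + b₁ + b₀ = 0) (ht : b₃ * t ^ 3 + b₂ * t ^ 2 + b₁ * t + b₀ = 0) :
    b₂ = -b₃ * (1 + t) ∧ b₁ = b₃ * t := by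
  subst h0
  have e : b₃ * t ^ 2 + b₂ * t + b₁ = 0 := by
    apply mul_left_cancel₀ t0
    linear_combination ht
  have e2 : b₂ = -b₃ * (1 + t) := by
    apply mul_left_cancel₀ (sub_ne_zero.2 t1)
    linear_combination e - h1
  exact ⟨e2, by linear_combination h1 - e2⟩

section Variation

variable {a₀ a₁ c k t t' q r a₀' a₁' c' k' τ τ' q' r' : ℂ}

/-- The vector field that moves the cover. -/
theorem CoverVariation.field (h : CoverRelations a₀ a₁ c k t t' q r)
    (v : CoverVariation a₀ a₁ c k t t' q r a₀' a₁' c' k' τ τ' q' r') (x : ℂ) :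
    (x ^ 2 + a₁ * x + a₀) * (2 * (a₁' * x + a₀') * (x - c) + 3 * (x ^ 2 + a₁ * x + a₀) * c'
        - k' / k * (x ^ 2 + a₁ * x + a₀) * (x - c))
      = x * (x - 1) * (x - t) * (x - t') * (3 * c' - k' / k * (x - c))
        - (x - c) * (x * (x - 1) * (τ * (x - t') + τ' * (x - t))) := by
  -- The fibre identity differentiated along the variation.
  have e : -(x * (x - 1) * (τ * (x - t') + τ' * (x - t)))
      = 2 * (x ^ 2 + a₁ * x + a₀) * (a₁' * x + a₀') + k' * (x - c) ^ 3 - 3 * k * (x - c) ^ 2 * c' := by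
    linear_combination x ^ 3 * v.cubic + x ^ 2 * v.quadratic + x * v.linear - v.constant
  have ek : k' / k * k = k' := div_mul_cancel₀ _ h.k_ne_zero
  linear_combination -(3 * c' - k' / k * (x - c)) * h.fibre x - (x - c) * e + (x - c) ^ 4 * ek

/-- A variation that does not move the fibre over `1` is trivial. -/
theorem CoverVariation.rigid (h : CoverRelations a₀ a₁ c k t t' q r)
    (v : CoverVariation a₀ a₁ c k t t' q r a₀' a₁' c' k' 0 0 q' r') :
    a₀' = 0 ∧ a₁' = 0 ∧ c' = 0 := by
  -- With both speeds zero the right side of `field` vanishes on the whole fibre, where P does not.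
  -- The remaining factor is therefore a cubic with the four roots 0, 1, t, t'.
  have f0 := v.field h 0
  have f1 := v.field h 1
  have ft := v.field h t
  have ft' := v.field h t'
  have p0 := h.at_zero.2.1
  have p1 := h.at_one.2.1
  have pt := h.at_t.2.1
  have pt' := h.swap_times.at_t.2.1
  set κ := k' / k
  have g0 : -2 * a₀' * c + 3 * a₀ * c' + κ * a₀ * c = 0 := by
    apply mul_left_cancel₀ p0
    linear_combination f0
  have g1 : -κ + (2 * a₁' + 3 * c' - κ * (a₁ - c))
      + (2 * a₀' - 2 * a₁' * c + 3 * a₁ * c' - κ * (a₀ - a₁ * c))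
      + (-2 * a₀' * c + 3 * a₀ * c' + κ * a₀ * c) = 0 := by
    apply mul_left_cancel₀ p1
    linear_combination f1
  have gt : -κ * t ^ 3 + (2 * a₁' + 3 * c' - κ * (a₁ - c)) * t ^ 2
      + (2 * a₀' - 2 * a₁' * c + 3 * a₁ * c' - κ * (a₀ - a₁ * c)) * t
      + (-2 * a₀' * c + 3 * a₀ * c' + κ * a₀ * c) = 0 := by
    apply mul_left_cancel₀ pt
    linear_combination ft
  have gt' : -κ * t' ^ 3 + (2 * a₁' + 3 * c' - κ * (a₁ - c)) * t' ^ 2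
      + (2 * a₀' - 2 * a₁' * c + 3 * a₁ * c' - κ * (a₀ - a₁ * c)) * t'
      + (-2 * a₀' * c + 3 * a₀ * c' + κ * a₀ * c) = 0 := by
    apply mul_left_cancel₀ pt'
    linear_combination ft'
  obtain ⟨e2, e1⟩ := cubic_eq_of_three_roots h.t_ne_zero h.t_ne_one g0 g1 gt
  obtain ⟨e2', -⟩ := cubic_eq_of_three_roots h.t'_ne_zero h.t'_ne_one g0 g1 gt'
  -- The roots 0, 1, t and the roots 0, 1, t' give two values for the coefficient of x², and t ≠ t'.
  have hκ : κ = 0 := by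
    apply mul_left_cancel₀ (sub_ne_zero.2 h.t_ne_t')
    linear_combination e2' - e2
  rw [hκ] at e1 e2 g0
  -- The cubic is now identically zero, and its value at x = c is 3P(c)c'.
  have hc : c' = 0 := by
    apply mul_left_cancel₀ (mul_ne_zero (three_ne_zero) h.at_c)
    linear_combination g0 + c * e1 + c ^ 2 * e2
  refine ⟨?_, ?_, hc⟩
  · rw [hc] at e1 e2
    linear_combination e1 / 2 + c * e2 / 2
  · rw [hc] at e2
    linear_combination e2 / 2

/-- The prefactor of the Hamiltonian. -/
theorem CoverRelations.prefactor (h : CoverRelations a₀ a₁ c k t t' q r) :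
    -((t - q) * (t - r) / (t * (t - 1) * (t - t'))) = -(t - c) / (t ^ 2 + a₁ * t + a₀) := by
  have h1 := h.at_t.2.1
  have h2 := h.t_ne_zero
  have h3 := sub_ne_zero.2 h.t_ne_one
  have h4 := sub_ne_zero.2 h.t_ne_t'
  rw [neg_div, neg_inj, div_eq_div_iff (by positivity) h1]
  linear_combination -h.deriv_mul t

/-- Only t moves, so the cubic of `field` still has the roots 0, 1, t'. Its value at t fixes the
leading coefficient. -/
theorem CoverVariation.field_eq (h : CoverRelations a₀ a₁ c k t t' q r)
    (v : CoverVariation a₀ a₁ c k t t' q r a₀' a₁' c' k' 1 0 q' r') :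
    -(k' / k) = -(t - c) / (t ^ 2 + a₁ * t + a₀) ∧
    2 * a₁' + 3 * c' - k' / k * (a₁ - c) = k' / k * (1 + t') ∧
    2 * a₀' - 2 * a₁' * c + 3 * a₁ * c' - k' / k * (a₀ - a₁ * c) = -(k' / k) * t' ∧
    -2 * a₀' * c + 3 * a₀ * c' + k' / k * a₀ * c = 0 := by
  have f0 := v.field h 0
  have f1 := v.field h 1
  have ft := v.field h t
  have ft' := v.field h t'
  have p0 := h.at_zero.2.1
  have p1 := h.at_one.2.1
  have pt := h.at_t.2.1
  have pt' := h.swap_times.at_t.2.1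
  set κ := k' / k
  have g0 : -2 * a₀' * c + 3 * a₀ * c' + κ * a₀ * c = 0 := by
    apply mul_left_cancel₀ p0
    linear_combination f0
  have g1 : -κ + (2 * a₁' + 3 * c' - κ * (a₁ - c))
      + (2 * a₀' - 2 * a₁' * c + 3 * a₁ * c' - κ * (a₀ - a₁ * c))
      + (-2 * a₀' * c + 3 * a₀ * c' + κ * a₀ * c) = 0 := by
    apply mul_left_cancel₀ p1
    linear_combination f1
  have gt' : -κ * t' ^ 3 + (2 * a₁' + 3 * c' - κ * (a₁ - c)) * t' ^ 2
      + (2 * a₀' - 2 * a₁' * c + 3 * a₁ * c' - κ * (a₀ - a₁ * c)) * t'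
      + (-2 * a₀' * c + 3 * a₀ * c' + κ * a₀ * c) = 0 := by
    apply mul_left_cancel₀ pt'
    linear_combination ft'
  obtain ⟨e2, e1⟩ := cubic_eq_of_three_roots h.t'_ne_zero h.t'_ne_one g0 g1 gt'
  refine ⟨?_, by linear_combination e2, e1, g0⟩
  have h2 := h.t_ne_zero
  have h3 := sub_ne_zero.2 h.t_ne_one
  have h4 := sub_ne_zero.2 h.t_ne_t'
  rw [eq_div_iff pt]
  apply mul_left_cancel₀ (mul_ne_zero (mul_ne_zero h2 h3) h4)
  linear_combination ft - (t ^ 2 + a₁ * t + a₀) * (t ^ 2 * e2 + t * e1 + g0)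

/-- The motion of the triple pole. -/
theorem CoverVariation.pole_eq (h : CoverRelations a₀ a₁ c k t t' q r)
    (v : CoverVariation a₀ a₁ c k t t' q r a₀' a₁' c' k' 1 0 q' r') :
    c' = -(t - c) / (t ^ 2 + a₁ * t + a₀) * ((q - c) * (r - c) / (9 * (t - c))) := by
  obtain ⟨e3, e2, e1, e0⟩ := v.field_eq h
  rw [← e3]
  set κ := k' / k
  have hc := h.at_c
  have htc := h.at_t.1
  have hf := h.fibre c
  rw [h.critical_at_c]
  -- The cubic at x = c, where only the term in c' survives. The fibre identity at c then supplies
  -- P(c)².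
  have e : 3 * (c ^ 2 + a₁ * c + a₀) * c' = -κ * (c * (c - 1) * (c - t')) := by
    linear_combination e0 + c * e1 + c ^ 2 * e2
  have e' : c * (c - 1) * (c - t') * (t - c) = -(c ^ 2 + a₁ * c + a₀) ^ 2 := by
    linear_combination -hf
  apply mul_left_cancel₀ (mul_ne_zero (mul_ne_zero three_ne_zero hc) htc)
  field_simp
  linear_combination 3 * (t - c) * e - 3 * κ * e'

/-- The point q is critical for φ, so the logarithmic derivative of φ - 1 vanishes there. -/
theorem CoverRelations.sum_inv (h : CoverRelations a₀ a₁ c k t t' q r) :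
    1 / q + 1 / (q - 1) + 1 / (q - t) + 1 / (q - t') = 3 / (q - c) := by
  have h0 := h.at_zero.2.2.1
  have h1 : q - 1 ≠ 0 := by rw [← neg_sub]; exact neg_ne_zero.2 h.at_one.2.2.1
  have ht : q - t ≠ 0 := by rw [← neg_sub]; exact neg_ne_zero.2 h.at_t.2.2.1
  have ht' : q - t' ≠ 0 := by rw [← neg_sub]; exact neg_ne_zero.2 h.swap_times.at_t.2.2.1
  have hc := h.q_sub_c
  have := h.deriv_mul q
  rw [sub_self, zero_mul, mul_zero] at this
  field_simp
  linear_combination this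

/-- The motion of a free critical point. -/
theorem CoverVariation.critical_eq (h : CoverRelations a₀ a₁ c k t t' q r)
    (v : CoverVariation a₀ a₁ c k t t' q r a₀' a₁' c' k' 1 0 q' r') :
    q' = -(t - c) / (t ^ 2 + a₁ * t + a₀) * (q * (q - 1) * (q - t') / (q - r)
      * (1 / (q - t) - 1 / (2 * (q - c)))) := by
  obtain ⟨e3, e2, e1, e0⟩ := v.field_eq h
  rw [← e3]
  set κ := k' / k
  have h0 := h.at_zero.2.2.1
  have h1 : q - 1 ≠ 0 := by rw [← neg_sub]; exact neg_ne_zero.2 h.at_one.2.2.1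
  have ht : q - t ≠ 0 := by rw [← neg_sub]; exact neg_ne_zero.2 h.at_t.2.2.1
  have ht' : q - t' ≠ 0 := by rw [← neg_sub]; exact neg_ne_zero.2 h.swap_times.at_t.2.2.1
  have hc := h.q_sub_c
  have hr := sub_ne_zero.2 h.q_ne_r
  have hs := h.sum_inv
  have hD : 2 * (2 * q + a₁) * (q - c) = 3 * (q ^ 2 + a₁ * q + a₀) := by
    have := h.critical q
    linear_combination -this
  have hq' : (q - r) * q' = (4 * c' + a₁') * q + 2 * (a₁' * c + a₁ * c') + 3 * a₀' := by
    linear_combination q * v.sum - v.prod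
  -- This is the combination 5N - 2(x-c)N' of the cubic N of `field_eq` and its derivative, taken at
  -- x = q. The relation `hD` between P'(q) and P(q) removes what is left.
  have hB : 2 * (q - c) * ((q - r) * q') = 5 * (-κ * (q * (q - 1) * (q - t')))
      - 2 * (q - c) * (-κ * ((q - 1) * (q - t') + q * (q - t') + q * (q - 1))) := by
    rw [hq']
    linear_combination (5 * q ^ 2 - 4 * q * (q - c)) * e2 + (5 * q - 2 * (q - c)) * e1 + 5 * e0
      + (5 * c' - κ * (q - c)) * hD
  have hsum : (q - 1) * (q - t') + q * (q - t') + q * (q - 1)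
      = q * (q - 1) * (q - t') * (3 / (q - c) - 1 / (q - t)) := by
    rw [← hs]
    field_simp
    ring
  rw [hsum] at hB
  apply mul_left_cancel₀ (mul_ne_zero (mul_ne_zero two_ne_zero hc) hr)
  rw [mul_assoc, hB]
  field_simp
  ring

end Variation

/-! ### Identities at a free critical point. -/

namespace CoverRelations

variable {a₀ a₁ c k t t' q r : ℂ}

theorem q_sub (h : CoverRelations a₀ a₁ c k t t' q r) :
    q ≠ 0 ∧ q - 1 ≠ 0 ∧ q - t ≠ 0 ∧ q - t' ≠ 0 ∧ q - r ≠ 0 := by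
  refine ⟨h.at_zero.2.2.1, ?_, ?_, ?_, sub_ne_zero.2 h.q_ne_r⟩
  · rw [← neg_sub]; exact neg_ne_zero.2 h.at_one.2.2.1
  · rw [← neg_sub]; exact neg_ne_zero.2 h.at_t.2.2.1
  · rw [← neg_sub]; exact neg_ne_zero.2 h.swap_times.at_t.2.2.1

/-- With Z the fibre polynomial, differentiate Z'(x-c) - 3Z = P(x-q)(x-r) at q; the right side
contributes P(q)(q-r). The sum of inverse squares follows from its square and the second elementary
symmetric function. -/
theorem sum_inv_sq (h : CoverRelations a₀ a₁ c k t t' q r) :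
    1 / q ^ 2 + 1 / (q - 1) ^ 2 + 1 / (q - t) ^ 2 + 1 / (q - t') ^ 2
      = 3 / (q - c) ^ 2 - (q ^ 2 + a₁ * q + a₀) * (q - r)
          / ((q - c) * (q * (q - 1) * (q - t) * (q - t'))) := by
  obtain ⟨h0, h1, ht, ht', hr⟩ := h.q_sub
  have hc := h.q_sub_c
  have hs := h.sum_inv
  have e2 : 2 * ((q - t) * (q - t') + (q - 1) * (q - t') + (q - 1) * (q - t)
      + q * (q - t') + q * (q - t) + q * (q - 1)) * (q - c)
      - 2 * ((q - 1) * (q - t) * (q - t') + q * (q - t) * (q - t') + q * (q - 1) * (q - t')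
      + q * (q - 1) * (q - t)) = (q ^ 2 + a₁ * q + a₀) * (q - r) := by
    have hD := h.critical q
    rw [sub_self, zero_mul] at hD
    have hf := h.fibre_deriv q
    linear_combination (6 * q * (q - c)) * h.cubic + 2 * (q - c) * h.quadratic - 2 * hf
      + (q ^ 2 + a₁ * q + a₀) * h.sum - (2 * q + a₁) * hD
  have hs2 : 1 / q ^ 2 + 1 / (q - 1) ^ 2 + 1 / (q - t) ^ 2 + 1 / (q - t') ^ 2
      = (1 / q + 1 / (q - 1) + 1 / (q - t) + 1 / (q - t')) ^ 2
        - 2 * ((q - t) * (q - t') + (q - 1) * (q - t') + (q - 1) * (q - t)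
      + q * (q - t') + q * (q - t) + q * (q - 1)) / (q * (q - 1) * (q - t) * (q - t')) := by
    field_simp
    ring
  have hz : ((q - 1) * (q - t) * (q - t') + q * (q - t) * (q - t') + q * (q - 1) * (q - t')
      + q * (q - 1) * (q - t)) = 3 / (q - c) * (q * (q - 1) * (q - t) * (q - t')) := by
    rw [← hs]
    field_simp
  have e3 : 2 * ((q - t) * (q - t') + (q - 1) * (q - t') + (q - 1) * (q - t)
      + q * (q - t') + q * (q - t) + q * (q - 1)) = (q ^ 2 + a₁ * q + a₀) * (q - r) / (q - c)
      + 6 / (q - c) ^ 2 * (q * (q - 1) * (q - t) * (q - t')) := by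
    apply mul_right_cancel₀ hc
    rw [hz] at e2
    rw [eq_add_of_sub_eq e2]
    field_simp
    ring
  rw [hs2, hs, e3]
  field_simp
  ring

/-- The Lagrange coefficient of the Hamiltonian at `q`, in the coordinate centred at `c`. -/
theorem lagrange (h : CoverRelations a₀ a₁ c k t t' q r) :
    q * (q - 1) * (q - t') / (q - r)
      = ((q ^ 2 + a₁ * q + a₀) ^ 2
          - (t ^ 2 + a₁ * t + a₀) ^ 2 / (t - c) ^ 3 * (q - c) ^ 3) / ((q - t) * (q - r)) := by
  obtain ⟨h0, h1, ht, ht', hr⟩ := h.q_sub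
  rw [← h.k_eq, div_eq_div_iff hr (by positivity)]
  linear_combination (q - r) * h.fibre q

/-- The coefficient of `p_k` in the Hamiltonian. -/
theorem momentum_coeff (h : CoverRelations a₀ a₁ c k t t' q r) (θ : ℂ) :
    θ / q + θ / (q - 1) + ((θ - 1) / (q - t) + θ / (q - t'))
      = 3 * θ / (q - c) - 1 / (q - t) := by
  linear_combination θ * h.sum_inv

/-- For θ = (4μ+1)/6 the constant κ equals 4μ(4μ-1)/9. At the momentum μ/(q-c) everything except the
κ term then depends only on q - c and t - c. -/
theorem bracket (h : CoverRelations a₀ a₁ c k t t' q r) {θ μ : ℂ} (hθ : θ = (4 * μ + 1) / 6) :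
    (μ / (q - c)) ^ 2 - (θ / q + θ / (q - 1) + ((θ - 1) / (q - t) + θ / (q - t'))) * (μ / (q - c))
      + ((4 * θ - 1) ^ 2 - (1 / 3) ^ 2) / 4 / (q * (q - 1))
      = -(μ ^ 2 + μ / 2) / (q - c) ^ 2 + μ / ((q - c) * ((q - c) - (t - c)))
        + 4 * μ * (4 * μ - 1) / 9 / (q * (q - 1)) := by
  obtain ⟨h0, h1, ht, ht', hr⟩ := h.q_sub
  have hc := h.q_sub_c
  rw [h.momentum_coeff, hθ, sub_sub_sub_cancel_right]
  field_simp
  ring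

end CoverRelations

/-- Collects the terms of ∂H/∂q that carry κ; their poles at q = r cancel. -/
theorem kappa_terms {q r t t' : ℂ} (hq : q ≠ 0) (hq1 : q - 1 ≠ 0) (hqt : q - t ≠ 0)
    (hqt' : q - t' ≠ 0) (hqr : q - r ≠ 0) :
    1 / (q - t) * ((q - t') / (q - r) + (r - t') / (r - q))
      + (q - t') / (q - r) * (1 / q + 1 / (q - 1) + 1 / (q - t') - 1 / (q - r))
      + (r - t') / (r - q) / (r - q) - (q - t') / (q - r) * (1 / q + 1 / (q - 1))
      = 1 / (q - t) := by
  have h6 : r - q = -(q - r) := by ring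
  rw [h6]
  field_simp
  ring

/-- In the coordinate x - c a cover is determined by the positions Q, R, T of q, r, t: `centred`
gives P, and `k_eq` gives k. Once the Lagrange coefficients are written this way, the second
Hamilton equation is an identity of rational functions in Q, R, T, μ. -/
theorem centred_force {Q R T μ : ℂ} (hQ : Q ≠ 0) (hR : R ≠ 0) (hT : T ≠ 0) (hqt : Q - T ≠ 0)
    (hrt : R - T ≠ 0) (hqr : Q - R ≠ 0) {P : ℂ → ℂ}
    (hP : ∀ x, P x = x ^ 2 + (Q + R) * x - Q * R / 3) {M₁ M₂ : ℂ}
    (hM₁ : M₁ = (P Q ^ 2 - P T ^ 2 / T ^ 3 * Q ^ 3) / ((Q - T) * (Q - R)))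
    (hM₂ : M₂ = (P R ^ 2 - P T ^ 2 / T ^ 3 * R ^ 3) / ((R - T) * (R - Q))) :
    1 / (Q - T) * (M₁ * (-(μ ^ 2 + μ / 2) / Q ^ 2 + μ / (Q * (Q - T)))
        + M₂ * (-(μ ^ 2 + μ / 2) / R ^ 2 + μ / (R * (R - T))))
      + M₁ * (-(μ ^ 2 + μ / 2) / Q ^ 2 + μ / (Q * (Q - T))) * (3 / Q - 1 / (Q - T) - 1 / (Q - R))
      + M₂ * (-(μ ^ 2 + μ / 2) / R ^ 2 + μ / (R * (R - T))) / (R - Q)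
      + ((4 * μ + 1) / 6 * (3 * M₁ / Q ^ 2 - P Q / (Q * (Q - T))) - M₁ / (Q - T) ^ 2) * (μ / Q)
      + 4 * μ * (4 * μ - 1) / 9 / (Q - T)
      = μ / Q ^ 2 * (M₁ * (1 / (Q - T) - 1 / (2 * Q)) - Q * R / (9 * T)) := by
  have h6 : R - Q = -(Q - R) := by ring
  rw [h6] at hM₂ ⊢
  subst hM₁ hM₂
  simp only [hP]
  field_simp
  ring

/-- The same reduction to Q, R, T, μ, for the value of the Hamiltonian in place of its derivative.
-/
theorem centred_value {Q R T μ : ℂ} (hQ : Q ≠ 0) (hR : R ≠ 0) (hT : T ≠ 0) (hqt : Q - T ≠ 0)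
    (hrt : R - T ≠ 0) (hqr : Q - R ≠ 0) {P : ℂ → ℂ} (hPT : P T ≠ 0)
    (hP : ∀ x, P x = x ^ 2 + (Q + R) * x - Q * R / 3) {M₁ M₂ : ℂ}
    (hM₁ : M₁ = (P Q ^ 2 - P T ^ 2 / T ^ 3 * Q ^ 3) / ((Q - T) * (Q - R)))
    (hM₂ : M₂ = (P R ^ 2 - P T ^ 2 / T ^ 3 * R ^ 3) / ((R - T) * (R - Q))) :
    -T / P T * (M₁ * (-(μ ^ 2 + μ / 2) / Q ^ 2 + μ / (Q * (Q - T)))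
        + M₂ * (-(μ ^ 2 + μ / 2) / R ^ 2 + μ / (R * (R - T))) + 4 * μ * (4 * μ - 1) / 9)
      = -(μ / T * ((μ - 1) * ((T - Q) * (T - R)) / (9 * P T) - (5 - 4 * μ) / 6)) := by
  have h6 : R - Q = -(Q - R) := by ring
  rw [h6] at hM₂
  have h7 : (Q - T) * (R - T) = (T - Q) * (T - R) := by ring
  subst hM₁ hM₂
  field_simp
  simp only [hP]
  ring

/-! ### Hamilton's equations for the momenta μ/(q-c) and μ/(r-c). -/

section Equations

variable {a₀ a₁ c k t t' q r a₀' a₁' c' k' q' r' θ μ : ℂ}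

/-- The first Hamilton equation. -/
theorem CoverVariation.velocity (h : CoverRelations a₀ a₁ c k t t' q r)
    (v : CoverVariation a₀ a₁ c k t t' q r a₀' a₁' c' k' 1 0 q' r') (hθ : θ = (4 * μ + 1) / 6) :
    deriv (fun m => hamiltonian θ t t' q r m (μ / (r - c))) (μ / (q - c)) = q' := by
  rw [(hasDerivAt_hamiltonian_momentum θ t t' q r _ _).deriv, h.prefactor, v.critical_eq h,
    h.momentum_coeff, hθ]
  have hc := h.q_sub_c
  obtain ⟨h0, h1, ht, ht', hr⟩ := h.q_sub
  congr 2
  field_simp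
  ring

/-- The second Hamilton equation. -/
theorem CoverVariation.force (h : CoverRelations a₀ a₁ c k t t' q r)
    (v : CoverVariation a₀ a₁ c k t t' q r a₀' a₁' c' k' 1 0 q' r') (hθ : θ = (4 * μ + 1) / 6) :
    deriv (fun l => hamiltonian θ t t' l r (μ / (q - c)) (μ / (r - c))) q
      = μ / (q - c) ^ 2 * (q' - c') := by
  obtain ⟨h0, h1, ht, ht', hr⟩ := h.q_sub
  obtain ⟨g0, g1, gt, gt', gr⟩ := h.swap_critical.q_sub
  have hc := h.q_sub_c
  have gc := h.swap_critical.q_sub_c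
  have htc := h.at_t.1
  rw [(hasDerivAt_hamiltonian_position h0 h1 ht ht' hr).deriv, h.prefactor, v.critical_eq h,
    v.pole_eq h, h.bracket hθ, h.swap_critical.bracket hθ]
  set M₁ := q * (q - 1) * (q - t') / (q - r) with hM₁
  set M₂ := r * (r - 1) * (r - t') / (r - q) with hM₂
  have core := centred_force (μ := μ) hc gc htc (by simpa using ht) (by simpa using gt)
    (by simpa using hr) (P := fun x => x ^ 2 + ((q - c) + (r - c)) * x - (q - c) * (r - c) / 3)
    (fun _ => rfl) (M₁ := M₁) (M₂ := M₂)
    (by rw [hM₁, h.lagrange]; simp only [← h.centred]; simp)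
    (by rw [hM₂, h.swap_critical.lagrange]; simp only [← h.centred]; simp)
  simp only [← h.centred, sub_sub_sub_cancel_right] at core
  simp only [sub_sub_sub_cancel_right]
  have hk := kappa_terms h0 h1 ht ht' hr
  set w₁ := -(μ ^ 2 + μ / 2) / (q - c) ^ 2 + μ / ((q - c) * (q - t))
  set w₂ := -(μ ^ 2 + μ / 2) / (r - c) ^ 2 + μ / ((r - c) * (r - t))
  set K := 4 * μ * (4 * μ - 1) / 9 with hK
  have hκ : ((4 * θ - 1) ^ 2 - (1 / 3) ^ 2) / 4 = K := by rw [hθ, hK]; ring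
  have e1 : M₁ * (K / (q * (q - 1))) = K * ((q - t') / (q - r)) := by
    rw [hM₁]; field_simp
  have e2 : M₂ * (K / (r * (r - 1))) = K * ((r - t') / (r - q)) := by
    rw [hM₂]; field_simp
  have e3 : 1 / q + 1 / (q - 1) + 1 / (q - t') - 1 / (q - r)
      = 3 / (q - c) - 1 / (q - t) - 1 / (q - r) := by
    linear_combination h.sum_inv
  have e4 : M₁ * (θ / q ^ 2 + θ / (q - 1) ^ 2 + (θ - 1) / (q - t) ^ 2 + θ / (q - t') ^ 2)
      = (4 * μ + 1) / 6 * (3 * M₁ / (q - c) ^ 2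
          - (q ^ 2 + a₁ * q + a₀) / ((q - c) * (q - t))) - M₁ / (q - t) ^ 2 := by
    have e5 : θ / q ^ 2 + θ / (q - 1) ^ 2 + (θ - 1) / (q - t) ^ 2 + θ / (q - t') ^ 2
        = θ * (3 / (q - c) ^ 2 - (q ^ 2 + a₁ * q + a₀) * (q - r)
          / ((q - c) * (q * (q - 1) * (q - t) * (q - t')))) - 1 / (q - t) ^ 2 := by
      rw [← h.sum_inv_sq]
      ring
    rw [e5, hθ, hM₁]
    field_simp
  rw [hκ]
  -- The κ terms, the logarithmic derivative and the sum of inverse squares are exchanged for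
  -- centred expressions one at a time, after which only `core` remains.
  refine Eq.trans (congrArg _ (Eq.trans ?_ core)) (by ring)
  linear_combination (1 / (q - t) + (1 / q + 1 / (q - 1) + 1 / (q - t') - 1 / (q - r))
      - (1 / q + 1 / (q - 1))) * e1 + (1 / (q - t) + 1 / (r - q)) * e2 + M₁ * w₁ * e3
    + μ / (q - c) * e4 + K * hk

/-- The value of the Hamiltonian. -/
theorem CoverRelations.hamiltonian_eq (h : CoverRelations a₀ a₁ c k t t' q r)
    (hθ : θ = (4 * μ + 1) / 6) :
    hamiltonian θ t t' q r (μ / (q - c)) (μ / (r - c))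
      = -(μ / (t - c) * ((μ - 1) * ((t - q) * (t - r)) / (9 * (t ^ 2 + a₁ * t + a₀))
          - (5 - 4 * μ) / 6)) := by
  obtain ⟨h0, h1, ht, ht', hr⟩ := h.q_sub
  obtain ⟨g0, g1, gt, gt', gr⟩ := h.swap_critical.q_sub
  have hc := h.q_sub_c
  have gc := h.swap_critical.q_sub_c
  have htc := h.at_t.1
  unfold hamiltonian
  rw [h.prefactor, h.bracket hθ, h.swap_critical.bracket hθ]
  set M₁ := q * (q - 1) * (q - t') / (q - r) with hM₁
  set M₂ := r * (r - 1) * (r - t') / (r - q) with hM₂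
  have core := centred_value (μ := μ) hc gc htc (by simpa using ht) (by simpa using gt)
    (by simpa using hr) (P := fun x => x ^ 2 + ((q - c) + (r - c)) * x - (q - c) * (r - c) / 3)
    (by simp only [← h.centred]; exact h.at_t.2.1)
    (fun _ => rfl) (M₁ := M₁) (M₂ := M₂)
    (by rw [hM₁, h.lagrange]; simp only [← h.centred]; simp)
    (by rw [hM₂, h.swap_critical.lagrange]; simp only [← h.centred]; simp)
  simp only [← h.centred, sub_sub_sub_cancel_right] at core ⊢
  rw [← core]
  congr 1
  -- After cancellation this is (q-t')/(q-r) + (r-t')/(r-q) = 1.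
  have : M₁ * (4 * μ * (4 * μ - 1) / 9 / (q * (q - 1)))
      + M₂ * (4 * μ * (4 * μ - 1) / 9 / (r * (r - 1))) = 4 * μ * (4 * μ - 1) / 9 := by
    rw [hM₁, hM₂]
    have h6 : r - q = -(q - r) := by ring
    rw [h6]
    field_simp
    ring
  linear_combination this

end Equations

/-! ### The Fuchsian equation as a pull-back of the hypergeometric equation. -/

section Potential

variable {a₀ a₁ c k t t' q r : ℂ}

/-- The logarithmic derivative of `φ`. -/
def logDerivCover (a₀ a₁ c w : ℂ) : ℂ :=
  2 * (2 * w + a₁) / (w ^ 2 + a₁ * w + a₀) - 3 / (w - c)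

/-- The logarithmic derivative of `φ - 1`. -/
def logDerivCoverSubOne (c t t' w : ℂ) : ℂ :=
  1 / w + 1 / (w - 1) + 1 / (w - t) + 1 / (w - t') - 3 / (w - c)

/-- The logarithmic derivative of the logarithmic derivative of `φ`. -/
def logDerivSecond (a₀ a₁ c q r w : ℂ) : ℂ :=
  1 / (w - q) + 1 / (w - r) - (2 * w + a₁) / (w ^ 2 + a₁ * w + a₀) - 1 / (w - c)

theorem hasDerivAt_quadratic (a₀ a₁ w : ℂ) :
    HasDerivAt (fun x => x ^ 2 + a₁ * x + a₀) (2 * w + a₁) w := by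
  have := ((hasDerivAt_pow 2 w).add ((hasDerivAt_id w).const_mul a₁)).add_const a₀
  refine this.congr_deriv ?_
  norm_num

theorem hasDerivAt_linear (a₁ w : ℂ) : HasDerivAt (fun x => 2 * x + a₁) 2 w := by
  have := ((hasDerivAt_id w).const_mul 2).add_const a₁
  refine this.congr_deriv ?_
  norm_num

theorem hasDerivAt_coverMap (a₀ a₁ c : ℂ) {w : ℂ} (hP : w ^ 2 + a₁ * w + a₀ ≠ 0) (hw : w - c ≠ 0) :
    HasDerivAt (coverMap a₀ a₁ c) (coverMap a₀ a₁ c w * logDerivCover a₀ a₁ c w) w := by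
  have := (((hasDerivAt_quadratic a₀ a₁ w).pow 2).div
    (((hasDerivAt_id w).sub_const c).pow 3) (pow_ne_zero 3 hw)).const_mul (-(c ^ 3 / a₀ ^ 2))
  refine this.congr_deriv ?_
  simp only [coverMap, logDerivCover, id, Pi.pow_apply]
  generalize w ^ 2 + a₁ * w + a₀ = P at hP ⊢
  field_simp
  norm_num
  ring

/-- The logarithmic derivative of φ equals (w-q)(w-r)/(P(w)(w-c)), and `logDerivSecond` is the
logarithmic derivative of that quotient. -/
theorem hasDerivAt_logDerivCover (h : CoverRelations a₀ a₁ c k t t' q r) {w : ℂ}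
    (hP : w ^ 2 + a₁ * w + a₀ ≠ 0) (hc : w - c ≠ 0) (hq : w - q ≠ 0) (hr : w - r ≠ 0) :
    HasDerivAt (logDerivCover a₀ a₁ c)
      (logDerivCover a₀ a₁ c w * logDerivSecond a₀ a₁ c q r w) w := by
  have := (((hasDerivAt_linear a₁ w).const_mul 2).div (hasDerivAt_quadratic a₀ a₁ w) hP).sub
    (hasDerivAt_const_div_sub 3 c w hc)
  refine this.congr_deriv ?_
  have hD := h.critical w
  have hU : logDerivCover a₀ a₁ c w
      = (w - q) * (w - r) / ((w ^ 2 + a₁ * w + a₀) * (w - c)) := by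
    rw [hD, logDerivCover]
    generalize w ^ 2 + a₁ * w + a₀ = P at hP ⊢
    field_simp
  have hD' : (w - q) + (w - r) = 4 * (w - c) - (2 * w + a₁) := by
    linear_combination -h.sum
  have hUL : logDerivCover a₀ a₁ c w * logDerivSecond a₀ a₁ c q r w
      = ((w - q) + (w - r)) / ((w ^ 2 + a₁ * w + a₀) * (w - c))
        - (w - q) * (w - r) * (2 * w + a₁) / ((w ^ 2 + a₁ * w + a₀) ^ 2 * (w - c))
        - (w - q) * (w - r) / ((w ^ 2 + a₁ * w + a₀) * (w - c) ^ 2) := by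
    rw [hU, logDerivSecond]
    generalize w ^ 2 + a₁ * w + a₀ = P at hP ⊢
    field_simp
    ring
  rw [hUL, hD, hD']
  generalize w ^ 2 + a₁ * w + a₀ = P at hP ⊢
  field_simp
  ring

theorem hasDerivAt_logDerivSecond {w : ℂ}
    (hP : w ^ 2 + a₁ * w + a₀ ≠ 0) (hc : w - c ≠ 0) (hq : w - q ≠ 0) (hr : w - r ≠ 0) :
    HasDerivAt (logDerivSecond a₀ a₁ c q r)
      (-1 / (w - q) ^ 2 + -1 / (w - r) ^ 2
        - (2 * (w ^ 2 + a₁ * w + a₀) - (2 * w + a₁) * (2 * w + a₁)) / (w ^ 2 + a₁ * w + a₀) ^ 2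
        - -1 / (w - c) ^ 2) w :=
  (((hasDerivAt_const_div_sub 1 q w hq).add (hasDerivAt_const_div_sub 1 r w hr)).sub
    ((hasDerivAt_linear a₁ w).div (hasDerivAt_quadratic a₀ a₁ w) hP)).sub
    (hasDerivAt_const_div_sub 1 c w hc)

theorem CoverRelations.k_eq_div (h : CoverRelations a₀ a₁ c k t t' q r) : k = a₀ ^ 2 / c ^ 3 := by
  rw [eq_div_iff (pow_ne_zero 3 h.at_zero.1), h.constant]

theorem CoverRelations.coverMap_sub_one (h : CoverRelations a₀ a₁ c k t t' q r) {w : ℂ}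
    (hc : w - c ≠ 0) :
    coverMap a₀ a₁ c w - 1 = -(w * (w - 1) * (w - t) * (w - t')) / (k * (w - c) ^ 3) := by
  have h0 := h.at_zero.1
  have h1 := h.at_zero.2.1
  rw [h.fibre, coverMap, h.k_eq_div]
  field_simp
  ring

/-- Both sides are φ', computed once from φ and once from φ - 1. -/
theorem CoverRelations.deriv_coverMap (h : CoverRelations a₀ a₁ c k t t' q r) {w : ℂ}
    (hP : w ^ 2 + a₁ * w + a₀ ≠ 0) (hc : w - c ≠ 0)
    (h0 : w ≠ 0) (h1 : w - 1 ≠ 0) (ht : w - t ≠ 0) (ht' : w - t' ≠ 0) :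
    coverMap a₀ a₁ c w * logDerivCover a₀ a₁ c w
      = (coverMap a₀ a₁ c w - 1) * logDerivCoverSubOne c t t' w := by
  have hk := h.k_ne_zero
  have g0 := h.at_zero.1
  have g1 := h.at_zero.2.1
  have e : coverMap a₀ a₁ c w * logDerivCover a₀ a₁ c w
      = -(w ^ 2 + a₁ * w + a₀) * ((w - q) * (w - r)) / (k * (w - c) ^ 4) := by
    rw [h.critical, coverMap, logDerivCover, h.k_eq_div]
    generalize w ^ 2 + a₁ * w + a₀ = P at hP ⊢
    field_simp
  rw [e, h.coverMap_sub_one hc, logDerivCoverSubOne, neg_mul, ← h.deriv_mul]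
  field_simp

/-- The coefficient `f` of the Fuchsian equation, in terms of logarithmic derivatives. -/
theorem fuchsF_eq {θ μ w : ℂ}
    (hθ : θ = (4 * μ + 1) / 6) (T Q : Fin 2 → ℂ) (hT : T = ![t, t']) (hQ : Q = ![q, r]) :
    fuchsF θ θ ![θ, θ] T Q w
      = (1 - θ) * logDerivCoverSubOne c t t' w - logDerivCover a₀ a₁ c w / 2
        - logDerivSecond a₀ a₁ c q r w - 2 * μ / (w - c) := by
  subst hT hQ
  simp only [fuchsF, logDerivCoverSubOne, logDerivCover, logDerivSecond, Fin.sum_univ_two,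
    Matrix.cons_val_zero, Matrix.cons_val_one]
  -- The total residue at c on the right is 3θ - 1/2 - 2μ, which this value of θ makes zero.
  rw [hθ]
  ring

/-- Lagrange interpolation of a cubic at `0, 1, t, t'`. -/
theorem lagrange_cubic {t t' w : ℂ} (b₀ b₁ b₂ b₃ : ℂ) (h0 : w ≠ 0) (h1 : w - 1 ≠ 0)
    (ht : w - t ≠ 0) (ht' : w - t' ≠ 0) (t0 : t ≠ 0) (t1 : t - 1 ≠ 0) (t0' : t' ≠ 0)
    (t1' : t' - 1 ≠ 0) (tt : t - t' ≠ 0) :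
    b₀ / (-(t * t')) / w + (b₃ + b₂ + b₁ + b₀) / ((1 - t) * (1 - t')) / (w - 1)
      + (b₃ * t ^ 3 + b₂ * t ^ 2 + b₁ * t + b₀) / (t * (t - 1) * (t - t')) / (w - t)
      + (b₃ * t' ^ 3 + b₂ * t' ^ 2 + b₁ * t' + b₀) / (t' * (t' - 1) * (t' - t)) / (w - t')
      = (b₃ * w ^ 3 + b₂ * w ^ 2 + b₁ * w + b₀) / (w * (w - 1) * (w - t) * (w - t')) := by
  have e1 : 1 - t = -(t - 1) := by ring
  have e2 : 1 - t' = -(t' - 1) := by ring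
  have e3 : t' - t = -(t - t') := by ring
  rw [e1, e2, e3]
  field_simp
  ring

/-- The coefficient `g` of the Fuchsian equation, in terms of logarithmic derivatives. -/
theorem fuchsG_eq (h : CoverRelations a₀ a₁ c k t t' q r) {θ μ : ℂ} (hθ : θ = (4 * μ + 1) / 6) :
    ∃ a b : ℂ, ∀ w, w ^ 2 + a₁ * w + a₀ ≠ 0 → w - c ≠ 0 → w ≠ 0 → w - 1 ≠ 0 → w - t ≠ 0 →
      w - t' ≠ 0 → w - q ≠ 0 → w - r ≠ 0 →
      a / w + b / (w - 1)
        - (hamiltonian θ t t' q r (μ / (q - c)) (μ / (r - c)) / (w - t)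
          + hamiltonian θ t' t q r (μ / (q - c)) (μ / (r - c)) / (w - t'))
        + (μ / (q - c) / (w - q) + μ / (r - c) / (w - r))
      = μ * (μ - 1) / 9 * (logDerivCover a₀ a₁ c w * logDerivCoverSubOne c t t' w)
        - μ / (w - c) * ((1 - θ) * logDerivCoverSubOne c t t' w - logDerivCover a₀ a₁ c w / 2
        - logDerivSecond a₀ a₁ c q r w - 2 * μ / (w - c)) - μ * (μ - 1) / (w - c) ^ 2 := by
  have hDZ : ∀ x, x * (x - 1) * (x - t) * (x - t') = 0 →
      ((x - 1) * (x - t) * (x - t') + x * (x - t) * (x - t') + x * (x - 1) * (x - t')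
        + x * (x - 1) * (x - t)) * (x - c) = (x ^ 2 + a₁ * x + a₀) * ((x - q) * (x - r)) := by
    intro x hx
    have := h.deriv_mul x
    rw [hx] at this
    linear_combination this
  -- The residues at 0 and 1 are given by the expression that `hamiltonian_eq` yields for -H at t
  -- and t', so that all four points of the fibre are treated alike.
  refine ⟨μ / (0 - c) * ((μ - 1) * ((0 - q) * (0 - r)) / (9 * (0 ^ 2 + a₁ * 0 + a₀))
    - (5 - 4 * μ) / 6), μ / (1 - c) * ((μ - 1) * ((1 - q) * (1 - r)) / (9 * (1 ^ 2 + a₁ * 1 + a₀))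
    - (5 - 4 * μ) / 6), fun w hP hc h0 h1 ht ht' hq hr => ?_⟩
  rw [h.hamiltonian_eq hθ, h.swap_times.hamiltonian_eq hθ]
  obtain ⟨c0, p0, -, -⟩ := h.at_zero
  obtain ⟨c1, p1, -, -⟩ := h.at_one
  obtain ⟨ct, pt, -, -⟩ := h.at_t
  obtain ⟨ct', pt', -, -⟩ := h.swap_times.at_t
  have t0 := h.t_ne_zero
  have t0' := h.t'_ne_zero
  have t1 := sub_ne_zero.2 h.t_ne_one
  have t1' := sub_ne_zero.2 h.t'_ne_one
  have tt := sub_ne_zero.2 h.t_ne_t'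
  have tt' := sub_ne_zero.2 h.t_ne_t'.symm
  have s1 := sub_ne_zero.2 h.t_ne_one.symm
  have s1' := sub_ne_zero.2 h.t'_ne_one.symm
  have qc := h.q_sub_c
  have rc := h.swap_critical.q_sub_c
  set γ := c ^ 2 + a₁ * c + a₀ with hγ
  have γ0 : γ ≠ 0 := h.at_c
  set β := 2 * c + a₁ with hβ
  have hPβ : ∀ x, x ^ 2 + a₁ * x + a₀ = (x - c) ^ 2 + β * (x - c) + γ := by
    intro x; rw [hβ, hγ]; ring
  have hDβ : ∀ x, (x - q) * (x - r) = (x - c) ^ 2 - β * (x - c) - 3 * γ := by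
    intro x; rw [h.critical, hβ, hγ]; ring
  -- With ξ = x - c one has P = ξ² + βξ + γ and (x-q)(x-r) = ξ² - βξ - 3γ. The cubic y₃ξ³ + y₂ξ² +
  -- y₁ξ + y₀ is what remains of the product of the two logarithmic derivatives over the fibre
  -- polynomial once the polar part 9/ξ² - 12(β/γ)/ξ at c is removed.
  obtain ⟨y₃, hy₃⟩ : ∃ y, y = 12 * (β / γ) := ⟨_, rfl⟩
  obtain ⟨y₂, hy₂⟩ : ∃ y, y = 12 * (β / γ) * (2 * β + k) - 8 := ⟨_, rfl⟩
  obtain ⟨y₁, hy₁⟩ : ∃ y, y = 12 * (β / γ) * (β ^ 2 + 2 * γ) - 20 * β - 9 * k := ⟨_, rfl⟩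
  obtain ⟨y₀, hy₀⟩ : ∃ y, y = 16 * β ^ 2 - 24 * γ := ⟨_, rfl⟩
  have hβγ : β / γ * γ = β := div_mul_cancel₀ _ γ0
  have hY : ∀ x, (y₃ * x ^ 3 + (y₂ - 3 * c * y₃) * x ^ 2 + (y₁ - 2 * c * y₂ + 3 * c ^ 2 * y₃) * x
      + (y₀ - c * y₁ + c ^ 2 * y₂ - c ^ 3 * y₃)) * (x - c) ^ 2
      = ((x - q) * (x - r)) ^ 2 - 9 * (x * (x - 1) * (x - t) * (x - t'))
        + 12 * (β / γ) * (x - c) * (x * (x - 1) * (x - t) * (x - t')) := by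
    intro x
    rw [h.fibre, hPβ, hDβ, hy₃, hy₂, hy₁, hy₀]
    linear_combination (-24 * β * (x - c) ^ 2 - 12 * γ * (x - c)) * hβγ
  have hres : ∀ x, x * (x - 1) * (x - t) * (x - t') = 0 → x - c ≠ 0 → x ^ 2 + a₁ * x + a₀ ≠ 0 →
      ∀ z', (x - 1) * (x - t) * (x - t') + x * (x - t) * (x - t') + x * (x - 1) * (x - t')
        + x * (x - 1) * (x - t) = z' → z' ≠ 0 →
      (y₃ * x ^ 3 + (y₂ - 3 * c * y₃) * x ^ 2 + (y₁ - 2 * c * y₂ + 3 * c ^ 2 * y₃) * x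
      + (y₀ - c * y₁ + c ^ 2 * y₂ - c ^ 3 * y₃)) / z'
      = (x - q) * (x - r) / ((x ^ 2 + a₁ * x + a₀) * (x - c)) := by
    intro x hx xc xP z' hz' z0
    have e1 := hY x
    have e2 := hDZ x hx
    rw [hx, mul_zero, mul_zero, sub_zero, add_zero] at e1
    rw [hz'] at e2
    rw [div_eq_div_iff z0 (mul_ne_zero xP xc)]
    apply mul_right_cancel₀ xc
    linear_combination (x ^ 2 + a₁ * x + a₀) * e1 - (x - q) * (x - r) * e2
  have hL := lagrange_cubic (y₀ - c * y₁ + c ^ 2 * y₂ - c ^ 3 * y₃)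
    (y₁ - 2 * c * y₂ + 3 * c ^ 2 * y₃) (y₂ - 3 * c * y₃) y₃ h0 h1 ht ht' t0 t1 t0' t1' tt
  have r0 := hres 0 (by ring) (by simpa using c0) (by simpa using p0) (-(t * t')) (by ring)
    (by simp [t0, t0'])
  have r1 := hres 1 (by ring) c1 (by simpa using p1) ((1 - t) * (1 - t')) (by ring)
    (mul_ne_zero s1 s1')
  have rt := hres t (by ring) ct pt (t * (t - 1) * (t - t')) (by ring)
    (mul_ne_zero (mul_ne_zero t0 t1) tt)
  have rt' := hres t' (by ring) ct' pt' (t' * (t' - 1) * (t' - t)) (by ring)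
    (mul_ne_zero (mul_ne_zero t0' t1') tt')
  have hYw := hY w
  have hU : logDerivCover a₀ a₁ c w = (w - q) * (w - r) / ((w ^ 2 + a₁ * w + a₀) * (w - c)) := by
    rw [h.critical, logDerivCover]
    generalize w ^ 2 + a₁ * w + a₀ = P at hP ⊢
    field_simp
  have hW : logDerivCoverSubOne c t t' w = (w ^ 2 + a₁ * w + a₀) * ((w - q) * (w - r))
      / (w * (w - 1) * (w - t) * (w - t') * (w - c)) := by
    rw [← h.deriv_mul, logDerivCoverSubOne]
    field_simp
  have hUW : logDerivCover a₀ a₁ c w * logDerivCoverSubOne c t t' w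
      = (y₃ * w ^ 3 + (y₂ - 3 * c * y₃) * w ^ 2 + (y₁ - 2 * c * y₂ + 3 * c ^ 2 * y₃) * w
      + (y₀ - c * y₁ + c ^ 2 * y₂ - c ^ 3 * y₃)) / (w * (w - 1) * (w - t) * (w - t'))
        + 9 / (w - c) ^ 2 - 12 * (β / γ) / (w - c) := by
    have e : ((w - q) * (w - r)) ^ 2 = (y₃ * w ^ 3 + (y₂ - 3 * c * y₃) * w ^ 2
        + (y₁ - 2 * c * y₂ + 3 * c ^ 2 * y₃) * w
        + (y₀ - c * y₁ + c ^ 2 * y₂ - c ^ 3 * y₃)) * (w - c) ^ 2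
        + 9 * (w * (w - 1) * (w - t) * (w - t'))
        - 12 * (β / γ) * (w - c) * (w * (w - 1) * (w - t) * (w - t')) := by
      linear_combination -hYw
    have e' : logDerivCover a₀ a₁ c w * logDerivCoverSubOne c t t' w
        = ((w - q) * (w - r)) ^ 2 / ((w - c) ^ 2 * (w * (w - 1) * (w - t) * (w - t'))) := by
      rw [hU, hW]
      generalize w ^ 2 + a₁ * w + a₀ = P at hP ⊢
      field_simp
    rw [e', e]
    generalize β / γ = B
    field_simp
  have hpf : ∀ a b : ℂ, a - c ≠ 0 → w - a ≠ 0 →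
      b / (a - c) / (w - a) = b / (w - c) * (1 / (a - c) + 1 / (w - a)) := by
    intro a b ha hb
    field_simp
    ring
  -- Minus the logarithmic derivative of P² + k(x-c)³ at c, which is 2P'(c)/P(c).
  have hS0 : 1 / (0 - c) + 1 / (1 - c) + 1 / (t - c) + 1 / (t' - c) = -2 * (β / γ) := by
    have e1 := h.fibre c
    have e2 := h.fibre_deriv c
    rw [← hγ, ← hβ, sub_self] at e2
    rw [← hγ, sub_self] at e1
    have e3 : 1 / (0 - c) + 1 / (1 - c) + 1 / (t - c) + 1 / (t' - c)
        = -((c - 1) * (c - t) * (c - t') + c * (c - t) * (c - t') + c * (c - 1) * (c - t')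
          + c * (c - 1) * (c - t)) / (c * (c - 1) * (c - t) * (c - t')) := by
      rw [← neg_sub t c, ← neg_sub t' c, ← neg_sub 1 c, zero_sub]
      field_simp
    rw [e3, e1, e2]
    field_simp
    ring
  -- The numbers q - c and r - c are the roots of ξ² - βξ - 3γ.
  have hS1 : 1 / (q - c) + 1 / (r - c) = -(β / γ) / 3 := by
    have e1 := h.critical_at_c
    have e2 := h.sum
    rw [div_add_div _ _ qc rc, e1, ← hγ]
    field_simp
    linear_combination -e2
  have hf : (1 - θ) * logDerivCoverSubOne c t t' w - logDerivCover a₀ a₁ c w / 2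
      - logDerivSecond a₀ a₁ c q r w - 2 * μ / (w - c)
      = (1 - θ) * (1 / w + 1 / (w - 1) + 1 / (w - t) + 1 / (w - t'))
        - (1 / (w - q) + 1 / (w - r)) := by
    simp only [logDerivCoverSubOne, logDerivCover, logDerivSecond]
    rw [hθ]
    ring
  have r0' : (y₀ - c * y₁ + c ^ 2 * y₂ - c ^ 3 * y₃) / (-(t * t'))
      = (0 - q) * (0 - r) / ((0 ^ 2 + a₁ * 0 + a₀) * (0 - c)) := by
    refine Eq.trans (congrArg (· / _) ?_) r0
    ring
  have r1' : (y₃ + (y₂ - 3 * c * y₃) + (y₁ - 2 * c * y₂ + 3 * c ^ 2 * y₃)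
      + (y₀ - c * y₁ + c ^ 2 * y₂ - c ^ 3 * y₃)) / ((1 - t) * (1 - t'))
      = (1 - q) * (1 - r) / ((1 ^ 2 + a₁ * 1 + a₀) * (1 - c)) := by
    refine Eq.trans (congrArg (· / _) ?_) r1
    ring
  rw [hf, hUW, ← hL, r0', r1', rt, rt']
  have k0 := hpf 0 1 (by simpa using c0) (by simpa using h0)
  have k1 := hpf 1 1 c1 h1
  have kt := hpf t 1 ct ht
  have kt' := hpf t' 1 ct' ht'
  have kq := hpf q 1 qc hq
  have kr := hpf r 1 rc hr
  rw [sub_zero] at k0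
  rw [hθ]
  -- All partial fractions are in place. The denominators can now be treated as independent
  -- quantities tied only by `hS0`, `hS1` and the splittings `k0`, …, `kr`.
  clear hW hU hUW hf r0' r1' rt rt' r0 r1 hL hres hY hYw hDZ hpf c0 p0 c1 p1 ct pt ct' pt' hP h0 h1 ht
    ht' hq hr hc qc rc s1 s1'
  generalize 0 ^ 2 + a₁ * 0 + a₀ = P₀
  generalize 1 ^ 2 + a₁ * 1 + a₀ = P₁
  generalize t ^ 2 + a₁ * t + a₀ = P₂
  generalize t' ^ 2 + a₁ * t' + a₀ = P₃
  generalize (0 - q) * (0 - r) = D₀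
  generalize (1 - q) * (1 - r) = D₁
  generalize (t - q) * (t - r) = D₂
  generalize (t' - q) * (t' - r) = D₃
  generalize 0 - c = C₀ at hS0 k0 ⊢
  generalize 1 - c = C₁ at hS0 k1 ⊢
  generalize t - c = C₂ at hS0 kt ⊢
  generalize t' - c = C₃ at hS0 kt' ⊢
  generalize q - c = C₄ at hS1 kq ⊢
  generalize r - c = C₅ at hS1 kr ⊢
  generalize w - c = d at k0 k1 kt kt' kq kr ⊢
  generalize w - 1 = d₁ at k1 ⊢
  generalize w - t = d₂ at kt ⊢
  generalize w - t' = d₃ at kt' ⊢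
  generalize w - q = d₄ at kq ⊢
  generalize w - r = d₅ at kr ⊢
  linear_combination -μ * (5 - 4 * μ) / 6 * (k0 + k1 + kt + kt') + μ * (kq + kr)
    - μ * (5 - 4 * μ) / 6 / d * hS0 + μ / d * hS1

/-- The normal form attached to a cover is equivalent to the pull-back of a hypergeometric
equation. -/
theorem potential_fuchs (h : CoverRelations a₀ a₁ c k t t' q r) {θ μ : ℂ}
    (hθ : θ = (4 * μ + 1) / 6) (T Q p : Fin 2 → ℂ) (hT : T = ![t, t']) (hQ : Q = ![q, r])
    (hp : p = ![μ / (q - c), μ / (r - c)]) :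
    ∃ a b : ℂ, ∀ z : ℂ, z ≠ 0 → z ≠ 1 → (∀ i, z ≠ T i) → (∀ i, z ≠ Q i) → z ≠ c →
      z ^ 2 + a₁ * z + a₀ ≠ 0 →
      potential (fuchsF θ θ ![θ, θ] T Q)
        (fuchsG a b T Q (fun j => garnierH θ θ (1 / 3) ![θ, θ] j T Q p) p) z
      = pullbackPotential (coverMap a₀ a₁ c) (hypergeometricPotential (1 / 2) θ (1 / 3)) z := by
  obtain ⟨a, b, hab⟩ := fuchsG_eq h hθ
  refine ⟨a, b, fun z z0 z1 zT zQ zc zP => ?_⟩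
  have zt : z ≠ t := by simpa [hT] using zT 0
  have zt' : z ≠ t' := by simpa [hT] using zT 1
  have zq : z ≠ q := by simpa [hQ] using zQ 0
  have zr : z ≠ r := by simpa [hQ] using zQ 1
  have hg : fuchsG a b T Q (fun j => garnierH θ θ (1 / 3) ![θ, θ] j T Q p) p z = _ :=
    Eq.trans (by
      simp only [fuchsG, garnierH_fin_two θ _ 0, Fin.sum_univ_two]
      simp [hT, hQ, hp]) (hab z zP (sub_ne_zero.2 zc) z0 (sub_ne_zero.2 z1) (sub_ne_zero.2 zt)
        (sub_ne_zero.2 zt') (sub_ne_zero.2 zq) (sub_ne_zero.2 zr))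
  have ev : ∀ᶠ w in nhds z, w ^ 2 + a₁ * w + a₀ ≠ 0 ∧ w - c ≠ 0 ∧ w ≠ 0 ∧ w - 1 ≠ 0 ∧ w - t ≠ 0 ∧
      w - t' ≠ 0 ∧ w - q ≠ 0 ∧ w - r ≠ 0 := by
    have e : ∀ x, z ≠ x → ∀ᶠ w in nhds z, w - x ≠ 0 := fun x hx =>
      (eventually_ne_nhds hx).mono fun w hw => sub_ne_zero.2 hw
    have eP : ∀ᶠ w in nhds z, w ^ 2 + a₁ * w + a₀ ≠ 0 :=
      (hasDerivAt_quadratic a₀ a₁ z).continuousAt.eventually_ne zP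
    filter_upwards [eP, e c zc, eventually_ne_nhds z0, e 1 z1, e t zt, e t' zt', e q zq, e r zr]
      with w h1 h2 h3 h4 h5 h6 h7 h8
    exact ⟨h1, h2, h3, h4, h5, h6, h7, h8⟩
  set φ := coverMap a₀ a₁ c
  set U := logDerivCover a₀ a₁ c
  set L := logDerivSecond a₀ a₁ c q r
  set W := logDerivCoverSubOne c t t'
  have d1 : deriv φ =ᶠ[nhds z] fun w => φ w * U w := by
    filter_upwards [ev] with w hw
    exact (hasDerivAt_coverMap a₀ a₁ c hw.1 hw.2.1).deriv
  have hd2 : ∀ᶠ w in nhds z, HasDerivAt (fun w => φ w * U w) (φ w * U w * (U w + L w)) w := by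
    filter_upwards [ev] with w hw
    exact ((hasDerivAt_coverMap a₀ a₁ c hw.1 hw.2.1).mul (hasDerivAt_logDerivCover h hw.1 hw.2.1
      hw.2.2.2.2.2.2.1 hw.2.2.2.2.2.2.2)).congr_deriv (by ring)
  have d2 : deriv (deriv φ) =ᶠ[nhds z] fun w => φ w * U w * (U w + L w) := by
    filter_upwards [d1.eventuallyEq_nhds, hd2] with w hw hw2
    rw [hw.deriv_eq, hw2.deriv]
  obtain ⟨cP, cc, c0, c1, ct, ct', cq, cr⟩ := ev.self_of_nhds
  have hU := hasDerivAt_logDerivCover h cP cc cq cr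
  -- The value of L' is not needed: it enters both potentials as L'/2.
  obtain ⟨L', hL'⟩ : ∃ L', HasDerivAt L L' z :=
    ⟨_, hasDerivAt_logDerivSecond (a₀ := a₀) (a₁ := a₁) cP cc cq cr⟩
  have d3 : deriv (deriv (deriv φ)) z
      = φ z * U z * (U z + L z) * (U z + L z) + φ z * U z * (U z * L z + L') := by
    rw [d2.deriv_eq]
    exact (hd2.self_of_nhds.mul (hU.add hL')).deriv
  have hW : ∀ᶠ w in nhds z, φ w * U w = (φ w - 1) * W w := by
    filter_upwards [ev] with w hw
    exact h.deriv_coverMap hw.1 hw.2.1 hw.2.2.1 hw.2.2.2.1 hw.2.2.2.2.1 hw.2.2.2.2.2.1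
  have φ1 : φ z - 1 ≠ 0 := by
    rw [h.coverMap_sub_one cc]
    have := h.k_ne_zero
    exact div_ne_zero (neg_ne_zero.2 (by simp [c0, c1, ct, ct'])) (by simp [cc, this])
  have φ0 : φ z ≠ 0 := by
    have := h.at_zero
    change -(c ^ 3 / a₀ ^ 2) * ((z ^ 2 + a₁ * z + a₀) ^ 2 / (z - c) ^ 3) ≠ 0
    simp [this.1, this.2.1, cP, cc]
  have U0 : U z ≠ 0 := by
    have : U z = (z - q) * (z - r) / ((z ^ 2 + a₁ * z + a₀) * (z - c)) := by
      change logDerivCover a₀ a₁ c z = _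
      rw [h.critical, logDerivCover]
      generalize z ^ 2 + a₁ * z + a₀ = P at cP ⊢
      field_simp
    rw [this]
    exact div_ne_zero (mul_ne_zero cq cr) (mul_ne_zero cP cc)
  obtain ⟨W', hW'⟩ : ∃ W', HasDerivAt W W' z :=
    ⟨_, ((((hasDerivAt_const_div 1 z c0).add (hasDerivAt_const_div_sub 1 1 z c1)).add
      (hasDerivAt_const_div_sub 1 t z ct)).add (hasDerivAt_const_div_sub 1 t' z ct')).sub
      (hasDerivAt_const_div_sub 3 c z cc)⟩
  have eW : φ z * U z = (φ z - 1) * W z := hW.self_of_nhds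
  -- Differentiate φU = (φ-1)W; both sides are φ'.
  have eW' : W' = W z * (U z + L z) - W z ^ 2 := by
    have hφ := hasDerivAt_coverMap a₀ a₁ c cP cc
    have e1 := hd2.self_of_nhds.unique
      (((hφ.sub_const 1).mul hW').congr_of_eventuallyEq hW)
    have e1 : φ z * U z * (U z + L z) = φ z * U z * W z + (φ z - 1) * W' := e1
    apply mul_left_cancel₀ φ1
    linear_combination -e1 + (U z + L z - W z) * eW
  have hf : HasDerivAt (fuchsF θ θ ![θ, θ] T Q)
      ((1 - θ) * W' - U z * L z / 2 - L' - -(2 * μ) / (z - c) ^ 2) z := by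
    have := (((hW'.const_mul (1 - θ)).sub (hU.div_const 2)).sub hL').sub
      (hasDerivAt_const_div_sub (2 * μ) c z cc)
    refine this.congr_of_eventuallyEq (Filter.Eventually.of_forall fun w => ?_)
    exact fuchsF_eq hθ T Q hT hQ
  -- Writing φ' as φU or as (φ-1)W turns each term of the hypergeometric potential into a multiple
  -- of U², W² or UW.
  have eR : φ z * U z * (φ z * U z) * hypergeometricPotential (1 / 2) θ (1 / 3) (φ z)
      = 3 / 16 * U z ^ 2 + (1 - θ ^ 2) / 4 * W z ^ 2
        + ((1 / 2) ^ 2 + θ ^ 2 - (1 / 3) ^ 2 - 1) / 4 * (U z * W z) := by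
    have e1 : φ z * U z * (φ z * U z) * ((1 - (1 / 2) ^ 2) / (4 * φ z ^ 2)) = 3 / 16 * U z ^ 2 := by
      field_simp
      norm_num
    have e2 : φ z * U z * (φ z * U z) * ((1 - θ ^ 2) / (4 * (φ z - 1) ^ 2))
        = (1 - θ ^ 2) / 4 * W z ^ 2 := by
      rw [eW]
      field_simp
    have e3 : φ z * U z * (φ z * U z) * (((1 / 2) ^ 2 + θ ^ 2 - (1 / 3) ^ 2 - 1)
        / (4 * (φ z * (φ z - 1))))
        = ((1 / 2) ^ 2 + θ ^ 2 - (1 / 3) ^ 2 - 1) / 4 * (U z * W z) := by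
      have : φ z * U z * (φ z * U z) = φ z * U z * ((φ z - 1) * W z) := by rw [← eW]
      rw [this]
      field_simp
    rw [hypergeometricPotential, mul_add, mul_add, e1, e2, e3]
  have φU : φ z * U z ≠ 0 := mul_ne_zero φ0 U0
  rw [potential, hf.deriv, hg, fuchsF_eq (a₀ := a₀) (a₁ := a₁) hθ T Q hT hQ, pullbackPotential,
    schwarzian, d3, d2.self_of_nhds, d1.self_of_nhds, sq (φ z * U z), eR]
  have s1 : (φ z * U z * (U z + L z) * (U z + L z) + φ z * U z * (U z * L z + L')) / (φ z * U z)
      = (U z + L z) * (U z + L z) + (U z * L z + L') := by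
    rw [mul_assoc (φ z * U z), ← mul_add, mul_div_cancel_left₀ _ φU]
  rw [s1, mul_div_cancel_left₀ _ φU, eW', hθ]
  change μ * (μ - 1) / 9 * (U z * W z) - _ - _ - _ - ((1 - _) * W z - U z / 2 - L z - _) ^ 2 / 4 = _
  clear_value φ U L W
  generalize z - c = d
  ring

end Potential

/-! ### The parametrization by `(u, v)`

The factors that occur in the formulas for `t₁, t₂, q₁, q₂` in terms of `(u, v)`. -/

section Factors

variable {R : Type*} [CommRing R]

/-- `A₊`. -/
def factorAp (α u v : R) : R := u * v + u + α * v - α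

/-- `A₋`. -/
def factorAm (α u v : R) : R := u * v - u + α * v + α

/-- `B₊`. -/
def factorBp (α u v : R) : R := α * v - 2 * v + α - 2 + 7 * u * v + u - 4 * α * u

/-- `B₋`. -/
def factorBm (α u v : R) : R := α * v - 2 * v + 2 - α + 7 * u * v - u + 4 * α * u

/-- `C₊`. -/
def factorCp (α u v : R) : R := 2 * v + α * v + 2 + α + 7 * u * v + u + 4 * α * u

/-- `C₋`. -/
def factorCm (α u v : R) : R := 2 * v + α * v - 2 - α + 7 * u * v - u - 4 * α * u

/-- `M`. -/
def factorM (α u v : R) : R :=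
  u ^ 2 * v ^ 2 - u ^ 2 - 2 * α * u * v ^ 2 - 2 * α * u + v ^ 2 - 1

end Factors

section Parametrization

variable {F : Type*} [Field F] {α u v : F}

/-- The denominators of the formulas in `(u, v)` do not vanish at this point. -/
structure RegularPoint (α u v : F) : Prop where
  vp : v + 1 ≠ 0
  vm : v - 1 ≠ 0
  up : u + 1 ≠ 0
  um : u - 1 ≠ 0
  Ap : factorAp α u v ≠ 0
  Am : factorAm α u v ≠ 0
  Bp : factorBp α u v ≠ 0
  Bm : factorBm α u v ≠ 0
  Cp : factorCp α u v ≠ 0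
  Cm : factorCm α u v ≠ 0
  M : factorM α u v ≠ 0

theorem paramW_mul (hn : 1 - v ^ 2 ≠ 0) : paramW α v * (1 - v ^ 2) = 2 * α * (1 + v ^ 2) :=
  div_mul_cancel₀ _ hn

section

variable {w : F} (hα : α ^ 2 = -3) (hn : 1 - v ^ 2 ≠ 0) (hw : w * (1 - v ^ 2) = 2 * α * (1 + v ^ 2))

include hα hw

/-- The substitution v ↦ -v sends A₊ to -A₋, and likewise B₊ to -B₋ and C₊ to -C₋. Each product is
therefore even in v and can be expressed through w. -/
theorem factorA_mul :
    factorAp α u v * factorAm α u v = -((u ^ 2 - 3 - u * w) * (1 - v ^ 2)) := by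
  rw [factorAp, factorAm]
  linear_combination (v ^ 2 - 1) * hα - u * hw

theorem factorB_mul : factorBp α u v * factorBm α u v
    = (4 * α - 1) * (1 - v ^ 2) * (u ^ 2 - 4 * u + 1 - 2 * u ^ 2 * w + u * w) := by
  rw [factorBp, factorBm]
  linear_combination (v ^ 2 - 1 + (16 * u ^ 2 - 8 * u) * v ^ 2) * hα - (4 * α - 1) * (u - 2 * u ^ 2) * hw

theorem factorC_mul : factorCp α u v * factorCm α u v
    = -(4 * α + 1) * (1 - v ^ 2) * (2 * u ^ 2 * w + 4 * u + u ^ 2 + u * w + 1) := by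
  rw [factorCp, factorCm]
  linear_combination (v ^ 2 - 1 + (16 * u ^ 2 + 8 * u) * v ^ 2) * hα
    + (4 * α + 1) * (2 * u ^ 2 + u) * hw

omit hα in
theorem factorM_eq : factorM α u v = -((1 - v ^ 2) * (u ^ 2 + u * w + 1)) := by
  rw [factorM]
  linear_combination u * hw

end

section

variable (u) (w : F) {s t : F}
  (he : u ^ 2 - 3 - u * w ≠ 0) (hs : s = -(3 * u ^ 2 + w * u - 1) / (u ^ 2 - 3 - u * w))

include he hs

theorem s_sub_one : s - 1 = 4 * (1 - u ^ 2) / (u ^ 2 - 3 - u * w) := by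
  rw [hs, eq_div_iff he, sub_mul, div_mul_cancel₀ _ he]
  ring

theorem s_add_one : s + 1 = -2 * (u ^ 2 + u * w + 1) / (u ^ 2 - 3 - u * w) := by
  rw [hs, eq_div_iff he, add_mul, div_mul_cancel₀ _ he]
  ring

theorem s_add_three : s + 3 = -4 * (u * w + 2) / (u ^ 2 - 3 - u * w) := by
  rw [hs, eq_div_iff he, add_mul, div_mul_cancel₀ _ he]
  ring

variable [CharZero F] (hu : 1 - u ^ 2 ≠ 0)
  (ht : t = -(4 * u * (w * u + 2)) / ((u ^ 2 - 3 - u * w) * (s - 1)))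

include ht hu

theorem s_sub_one_mul_t : (s - 1) * t = -4 * u * (u * w + 2) / (u ^ 2 - 3 - u * w) := by
  have h4 : (4 : F) ≠ 0 := by norm_num
  rw [ht, s_sub_one u w he hs, mul_div_cancel₀ _ he]
  field_simp

theorem t_eq : t = -u * (u * w + 2) / (1 - u ^ 2) := by
  have h4 : (4 : F) ≠ 0 := by norm_num
  rw [ht, s_sub_one u w he hs, mul_div_cancel₀ _ he]
  field_simp

/-- These are the factors out of which `tOne`, `tTwo`, `critProd` and the denominator of `critSum`
are built. Each of them becomes a product in u and w. -/
theorem linearForms :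
    s * t - t - 1 - s = 2 * (u ^ 2 - 4 * u + 1 - 2 * u ^ 2 * w + u * w) / (u ^ 2 - 3 - u * w) ∧
    s * t - t + s + 1 = -2 * (2 * u ^ 2 * w + 4 * u + u ^ 2 + u * w + 1) / (u ^ 2 - 3 - u * w) ∧
    s * t - t - 1 - 3 * s = 4 * u * (u - 1) * (2 - w) / (u ^ 2 - 3 - u * w) ∧
    s * t - t + 1 + 3 * s = -4 * u * (u + 1) * (2 + w) / (u ^ 2 - 3 - u * w) := by
  have h1 := s_sub_one_mul_t u w he hs hu ht
  have h2 := hs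
  rw [eq_div_iff he] at h1 h2
  refine ⟨?_, ?_, ?_, ?_⟩ <;> rw [eq_div_iff he]
  · linear_combination h1 - h2
  · linear_combination h1 + h2
  · linear_combination h1 - 3 * h2
  · linear_combination h1 + 3 * h2

theorem critNum : t ^ 2 * s ^ 3 + 3 * s ^ 3 - 4 * t ^ 2 * s ^ 2 + 4 * s ^ 2 + 5 * t ^ 2 * s + 7 * s
    + 2 - 2 * t ^ 2 = -(32 * u * (1 - u ^ 2) * (2 * w - 10 * u + 3 / 2 * u * w ^ 2 - 12 * u ^ 2 * w
      + 1 / 2 * u ^ 2 * w ^ 3 - 2 * u ^ 3 - 5 / 2 * u ^ 3 * w ^ 2)) / (u ^ 2 - 3 - u * w) ^ 3 := by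
  have h1 := s_sub_one_mul_t u w he hs hu ht
  have : t ^ 2 * s ^ 3 + 3 * s ^ 3 - 4 * t ^ 2 * s ^ 2 + 4 * s ^ 2 + 5 * t ^ 2 * s + 7 * s
    + 2 - 2 * t ^ 2 = ((s - 1) * t) ^ 2 * (s - 2) + 3 * s ^ 3 + 4 * s ^ 2 + 7 * s + 2 := by ring
  rw [this, h1, hs]
  field_simp
  ring

theorem tOne_eq (hu1 : u + 1 ≠ 0) : tOne s t = (u ^ 2 * w + 2 * u + u ^ 2 - 1) * u * (2 - w)
      * (u ^ 2 - 3 - u * w) ^ 2 / (2 * (u + 1) * (u ^ 2 - 4 * u + 1 - 2 * u ^ 2 * w + u * w) ^ 2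
        * (u ^ 2 + u * w + 1)) := by
  obtain ⟨h1, h2, h3, h4⟩ := linearForms u w he hs hu ht
  have : t + 1 = -(u ^ 2 * w + 2 * u + u ^ 2 - 1) / (1 - u ^ 2) := by
    rw [t_eq u w he hs hu ht, div_add_one hu]
    ring
  rw [tOne, h1, h3, this, s_add_one u w he hs]
  have : 1 - u ^ 2 = -((u - 1) * (u + 1)) := by ring
  rw [this] at hu ⊢
  have hu' : u - 1 ≠ 0 := fun h => hu (by rw [h]; ring)
  field_simp
  ring

theorem tTwo_eq (hu1 : u - 1 ≠ 0) : tTwo s t = -((u ^ 2 * w + 2 * u - u ^ 2 + 1) * u * (2 + w)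
      * (u ^ 2 - 3 - u * w) ^ 2) / (2 * (u - 1) * (2 * u ^ 2 * w + 4 * u + u ^ 2 + u * w + 1) ^ 2
        * (u ^ 2 + u * w + 1)) := by
  obtain ⟨h1, h2, h3, h4⟩ := linearForms u w he hs hu ht
  have : -1 + t = -(u ^ 2 * w + 2 * u - u ^ 2 + 1) / (1 - u ^ 2) := by
    rw [t_eq u w he hs hu ht, neg_add_eq_sub, div_sub_one hu]
    ring
  rw [tTwo, h2, h4, this, s_add_one u w he hs]
  have : 1 - u ^ 2 = -((u - 1) * (u + 1)) := by ring
  rw [this] at hu ⊢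
  have hu' : u + 1 ≠ 0 := fun h => hu (by rw [h]; ring)
  field_simp
  ring

theorem critSum_eq :
    critSum s t = -(u * (2 * w - 10 * u + 3 / 2 * u * w ^ 2 - 12 * u ^ 2 * w
      + 1 / 2 * u ^ 2 * w ^ 3 - 2 * u ^ 3 - 5 / 2 * u ^ 3 * w ^ 2) * (u ^ 2 - 3 - u * w))
      / ((u ^ 2 + u * w + 1) * (u ^ 2 - 4 * u + 1 - 2 * u ^ 2 * w + u * w)
        * (2 * u ^ 2 * w + 4 * u + u ^ 2 + u * w + 1)) := by
  obtain ⟨h1, h2, h3, h4⟩ := linearForms u w he hs hu ht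
  rw [critSum, critNum u w he hs hu ht, h1, h2, s_add_one u w he hs, s_sub_one u w he hs]
  generalize (2 * w - 10 * u + 3 / 2 * u * w ^ 2 - 12 * u ^ 2 * w
      + 1 / 2 * u ^ 2 * w ^ 3 - 2 * u ^ 3 - 5 / 2 * u ^ 3 * w ^ 2) = N
  field_simp
  ring

theorem critProd_eq :
    critProd s t = u ^ 2 * ((2 - w) * (2 + w)) * (u ^ 2 - 3 - u * w) ^ 3
      / (4 * (u ^ 2 + u * w + 1) ^ 2 * (u ^ 2 - 4 * u + 1 - 2 * u ^ 2 * w + u * w)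
        * (2 * u ^ 2 * w + 4 * u + u ^ 2 + u * w + 1)) := by
  obtain ⟨h1, h2, h3, h4⟩ := linearForms u w he hs hu ht
  rw [critProd, h1, h2, h3, h4, s_add_one u w he hs, s_sub_one u w he hs]
  field_simp
  ring

end

namespace RegularPoint

theorem one_sub_v_sq (h : RegularPoint α u v) : 1 - v ^ 2 ≠ 0 := by
  have : 1 - v ^ 2 = -((v + 1) * (v - 1)) := by ring
  rw [this]
  exact neg_ne_zero.2 (mul_ne_zero h.vp h.vm)

theorem one_sub_u_sq (h : RegularPoint α u v) : 1 - u ^ 2 ≠ 0 := by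
  have : 1 - u ^ 2 = -((u + 1) * (u - 1)) := by ring
  rw [this]
  exact neg_ne_zero.2 (mul_ne_zero h.up h.um)

variable (h : RegularPoint α u v) (hα : α ^ 2 = -3)
include h hα

theorem denom_ne_zero : u ^ 2 - 3 - u * paramW α v ≠ 0 := fun e =>
  mul_ne_zero h.Ap h.Am <| by
    rw [factorA_mul hα (paramW_mul h.one_sub_v_sq), e, zero_mul, neg_zero]

theorem B_ne_zero : u ^ 2 - 4 * u + 1 - 2 * u ^ 2 * paramW α v + u * paramW α v ≠ 0 := fun e =>
  mul_ne_zero h.Bp h.Bm <| by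
    rw [factorB_mul hα (paramW_mul h.one_sub_v_sq), e, mul_zero]

theorem C_ne_zero : 2 * u ^ 2 * paramW α v + 4 * u + u ^ 2 + u * paramW α v + 1 ≠ 0 := fun e =>
  mul_ne_zero h.Cp h.Cm <| by
    rw [factorC_mul hα (paramW_mul h.one_sub_v_sq), e, mul_zero]

omit hα in
theorem M_ne_zero : u ^ 2 + u * paramW α v + 1 ≠ 0 := fun e =>
  h.M <| by rw [factorM_eq (paramW_mul h.one_sub_v_sq), e, mul_zero, neg_zero]

omit h

variable [CharZero F]

/-- Since α² = -3, (4α - 1)(4α + 1) = -49. -/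
theorem four_mul_sub_one : 4 * α - 1 ≠ 0 := fun e => by
  have h49 : (49 : F) ≠ 0 := by norm_num
  exact h49 (by linear_combination (-4 * α - 1) * e + 16 * hα)

theorem four_mul_add_one : 4 * α + 1 ≠ 0 := fun e => by
  have h49 : (49 : F) ≠ 0 := by norm_num
  exact h49 (by linear_combination (1 - 4 * α) * e + 16 * hα)

include h

theorem solT1_eq : solT1 α u v = tOne (paramS α u v) (paramT α u v) := by
  have hw := paramW_mul (α := α) h.one_sub_v_sq
  have he := h.denom_ne_zero hα
  have hY := h.B_ne_zero hα
  have hm := h.M_ne_zero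
  have hβ := four_mul_sub_one hα
  have hn := h.one_sub_v_sq
  rw [tOne_eq (s := paramS α u v) (t := paramT α u v) u (paramW α v) he rfl h.one_sub_u_sq rfl h.up]
  have hE := factorA_mul (u := u) hα hw
  have hB := factorB_mul (u := u) hα hw
  have hM := factorM_eq (u := u) hw
  generalize paramW α v = w at *
  have hV : (2 * v - 1 + α) * (2 * v + 1 - α) = -((1 - α) / 2 * ((1 - v ^ 2) * (2 - w))) := by
    linear_combination v ^ 2 * hα - (1 - α) / 2 * hw
  have hT : -4 * α * u ^ 2 + 2 * u * v ^ 2 - 2 * u - v ^ 2 + 1 + 13 * u ^ 2 * v ^ 2 + 11 * u ^ 2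
        + 4 * α * u * v ^ 2 - 4 * α * u - 2 * α * v ^ 2 + 2 * α
      = -((2 * α + 1) * ((1 - v ^ 2) * (u ^ 2 * w + 2 * u + u ^ 2 - 1))) := by
    linear_combination 4 * u ^ 2 * (1 + v ^ 2) * hα + (2 * α + 1) * u ^ 2 * hw
  -- The constant 353 + 9α over 52 compensates the scalars 2α + 1, (1 - α)/2 and (4α - 1)² that
  -- split off from the two numerator factors and from (B₊B₋)².
  have hκ : (353 + 9 * α) * (2 * α + 1) * (1 - α) = -52 * (4 * α - 1) ^ 2 := by
    linear_combination (135 - 18 * α) * hα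
  have e1 : solT1 α u v = -(1 / 52) * (353 + 9 * α)
    * (-4 * α * u ^ 2 + 2 * u * v ^ 2 - 2 * u - v ^ 2 + 1 + 13 * u ^ 2 * v ^ 2 + 11 * u ^ 2
        + 4 * α * u * v ^ 2 - 4 * α * u - 2 * α * v ^ 2 + 2 * α) * u
    * ((2 * v - 1 + α) * (2 * v + 1 - α)) * (factorAp α u v * factorAm α u v) ^ 2
    / ((u + 1) * factorM α u v * -(1 - v ^ 2) * (factorBp α u v * factorBm α u v) ^ 2) := by
    simp only [solT1, factorAp, factorAm, factorBp, factorBm, factorM]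
    congr 1 <;> ring
  rw [e1, hV, hT, hE, hB, hM]
  have hu := h.up
  clear e1 hV hT hE hB hM hw hα h
  generalize u ^ 2 - 4 * u + 1 - 2 * u ^ 2 * w + u * w = Y at *
  generalize u ^ 2 - 3 - u * w = e at *
  generalize u ^ 2 + u * w + 1 = m at *
  generalize u ^ 2 * w + 2 * u + u ^ 2 - 1 = T at *
  generalize 1 - v ^ 2 = n at *
  generalize 2 - w = z at *
  generalize 4 * α - 1 = β at *
  field_simp
  linear_combination -(T * u * z) * hκ

theorem solT2_eq : solT2 α u v = tTwo (paramS α u v) (paramT α u v) := by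
  have hw := paramW_mul (α := α) h.one_sub_v_sq
  have he := h.denom_ne_zero hα
  have hY := h.C_ne_zero hα
  have hm := h.M_ne_zero
  have hβ := four_mul_add_one hα
  have hn := h.one_sub_v_sq
  rw [tTwo_eq (s := paramS α u v) (t := paramT α u v) u (paramW α v) he rfl h.one_sub_u_sq rfl h.um]
  have hE := factorA_mul (u := u) hα hw
  have hB := factorC_mul (u := u) hα hw
  have hM := factorM_eq (u := u) hw
  generalize paramW α v = w at *
  have hV : (2 * v - 1 - α) * (2 * v + 1 + α) = -((1 + α) / 2 * ((1 - v ^ 2) * (2 + w))) := by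
    linear_combination v ^ 2 * hα + (1 + α) / 2 * hw
  have hT : -v ^ 2 + 1 + 13 * u ^ 2 * v ^ 2 + 11 * u ^ 2 + 4 * α * u ^ 2 - 2 * u * v ^ 2 + 2 * u
        + 2 * α * v ^ 2 - 2 * α + 4 * α * u * v ^ 2 - 4 * α * u
      = (1 - 2 * α) * ((1 - v ^ 2) * (u ^ 2 * w + 2 * u - u ^ 2 + 1)) := by
    linear_combination 4 * u ^ 2 * (1 + v ^ 2) * hα - (1 - 2 * α) * u ^ 2 * hw
  have hκ : (353 - 9 * α) * (1 - 2 * α) * (1 + α) = -52 * (4 * α + 1) ^ 2 := by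
    linear_combination (135 + 18 * α) * hα
  have e1 : solT2 α u v = 1 / 52 * (9 * α - 353)
    * (-v ^ 2 + 1 + 13 * u ^ 2 * v ^ 2 + 11 * u ^ 2 + 4 * α * u ^ 2 - 2 * u * v ^ 2 + 2 * u
        + 2 * α * v ^ 2 - 2 * α + 4 * α * u * v ^ 2 - 4 * α * u) * u
    * ((2 * v - 1 - α) * (2 * v + 1 + α)) * (factorAp α u v * factorAm α u v) ^ 2
    / ((u - 1) * factorM α u v * -(1 - v ^ 2) * (factorCp α u v * factorCm α u v) ^ 2) := by
    simp only [solT2, factorAp, factorAm, factorCp, factorCm, factorM]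
    congr 1 <;> ring
  rw [e1, hV, hT, hE, hB, hM]
  have hu := h.um
  clear e1 hV hT hE hB hM hw hα h
  generalize 2 * u ^ 2 * w + 4 * u + u ^ 2 + u * w + 1 = Y at *
  generalize u ^ 2 - 3 - u * w = e at *
  generalize u ^ 2 + u * w + 1 = m at *
  generalize u ^ 2 * w + 2 * u - u ^ 2 + 1 = T at *
  generalize 1 - v ^ 2 = n at *
  generalize 2 + w = z at *
  generalize 4 * α + 1 = β at *
  field_simp
  linear_combination T * u * z * hκ

omit h

/-- This is the numerator of q₁ + q₂ over a common denominator. Its two terms are exchanged by v ↦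
-v, so the sum is a power of 1 - v² times a polynomial in u and w. -/
theorem critical_bracket {w : F} (hw : w * (1 - v ^ 2) = 2 * α * (1 + v ^ 2)) :
    factorAp α u v * ((2 * v + 1 - α) * (2 * v + 1 + α)) * factorCp α u v * factorBp α u v * (v - 1)
      + factorAm α u v * ((2 * v - 1 + α) * (2 * v - 1 - α)) * factorBm α u v * factorCm α u v
        * (v + 1)
    = -14 * (1 - v ^ 2) ^ 3 * (2 * w - 10 * u + 3 / 2 * u * w ^ 2 - 12 * u ^ 2 * w
      + 1 / 2 * u ^ 2 * w ^ 3 - 2 * u ^ 3 - 5 / 2 * u ^ 3 * w ^ 2) := by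
  -- Each power of w is paired with a power of 1 - v², so that w can be eliminated without division.
  have e : -14 * (1 - v ^ 2) ^ 3 * (2 * w - 10 * u + 3 / 2 * u * w ^ 2 - 12 * u ^ 2 * w
      + 1 / 2 * u ^ 2 * w ^ 3 - 2 * u ^ 3 - 5 / 2 * u ^ 3 * w ^ 2)
      = -14 * (2 * (w * (1 - v ^ 2)) * (1 - v ^ 2) ^ 2 - 10 * u * (1 - v ^ 2) ^ 3
        + 3 / 2 * u * (w * (1 - v ^ 2)) ^ 2 * (1 - v ^ 2)
        - 12 * u ^ 2 * (w * (1 - v ^ 2)) * (1 - v ^ 2) ^ 2 + 1 / 2 * u ^ 2 * (w * (1 - v ^ 2)) ^ 3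
        - 2 * u ^ 3 * (1 - v ^ 2) ^ 3 - 5 / 2 * u ^ 3 * (w * (1 - v ^ 2)) ^ 2 * (1 - v ^ 2)) := by
    ring
  rw [e, hw]
  simp only [factorAp, factorAm, factorBp, factorBm, factorCp, factorCm]
  linear_combination (16 * α - 2 * α ^ 3 - 24 * v ^ 2 * α + 4 * v ^ 2 * α ^ 3 - 2 * v ^ 4 * α ^ 3 + 8 * v ^ 6
      * α - 44 * u + 30 * u * α ^ 2 + 172 * u * v ^ 2 - 164 * u * v ^ 4 - 30 * u * v ^ 4 * α ^ 2
      + 36 * u * v ^ 6 - 102 * u ^ 2 * α + 32 * u ^ 2 * α ^ 3 + 180 * u ^ 2 * v ^ 2 * α + 32 * u ^ 2 * v ^ 2 * α ^ 3 - 86 * u ^ 2 * v ^ 4 * α + 56 * u ^ 2 * v ^ 6 * α - 10 * u ^ 3 - 32 *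
      u ^ 3 * α ^ 2 - 44 * u ^ 3 * v ^ 2 + 32 * u ^ 3 * v ^ 2 * α ^ 2 - 86 * u ^ 3 * v ^ 4 + 140
      * u ^ 3 * v ^ 6) * hα

include h

theorem solQ_add :
    solQ1 α u v + solQ2 α u v = critSum (paramS α u v) (paramT α u v) := by
  have hw := paramW_mul (α := α) h.one_sub_v_sq
  have he := h.denom_ne_zero hα
  have hY := h.B_ne_zero hα
  have hY' := h.C_ne_zero hα
  have hm := h.M_ne_zero
  have hβ := four_mul_sub_one hα
  have hβ' := four_mul_add_one hα
  have hn := h.one_sub_v_sq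
  rw [critSum_eq (s := paramS α u v) (t := paramT α u v) u (paramW α v) he rfl h.one_sub_u_sq rfl]
  have hE := factorA_mul (u := u) hα hw
  have hB := factorB_mul (u := u) hα hw
  have hC := factorC_mul (u := u) hα hw
  have hM := factorM_eq (u := u) hw
  have hbr := critical_bracket (u := u) hα hw
  generalize paramW α v = w at *
  have e1 : solQ1 α u v + solQ2 α u v = -(7 / 2) * u * (factorAp α u v * factorAm α u v)
      * (factorAp α u v * ((2 * v + 1 - α) * (2 * v + 1 + α)) * factorCp α u v * factorBp α u v
        * (v - 1) + factorAm α u v * ((2 * v - 1 + α) * (2 * v - 1 - α)) * factorBm α u v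
        * factorCm α u v * (v + 1))
      / (factorM α u v * (factorBp α u v * factorBm α u v) * (factorCp α u v * factorCm α u v)
        * -(1 - v ^ 2)) := by
    have f1 : solQ1 α u v = -(7 / 2) * factorAm α u v * u * (2 * v + 1 - α) * (2 * v + 1 + α)
        * factorAp α u v ^ 2 / (factorM α u v * factorBm α u v * factorCm α u v * (v + 1)) := rfl
    have f2 : solQ2 α u v = -(7 / 2) * factorAp α u v * u * (2 * v - 1 + α) * (2 * v - 1 - α)
        * factorAm α u v ^ 2 / (factorM α u v * factorCp α u v * factorBp α u v * (v - 1)) := rfl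
    have : -(1 - v ^ 2) = (v + 1) * (v - 1) := by ring
    rw [f1, f2, this]
    obtain ⟨g1, g2, -, -, -, -, g3, g4, g5, g6, g7⟩ := h
    clear hE hB hC hM hbr f1 f2
    generalize factorAp α u v = A at *
    generalize factorAm α u v = A' at *
    generalize factorBp α u v = B at *
    generalize factorBm α u v = B' at *
    generalize factorCp α u v = C at *
    generalize factorCm α u v = C' at *
    generalize factorM α u v = M at *
    generalize v + 1 = x at *
    generalize v - 1 = y at *
    field_simp
    ring
  rw [e1, hbr, hE, hB, hC, hM]
  have hκ : (4 * α - 1) * (4 * α + 1) = -49 := by linear_combination 16 * hα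
  clear e1 hE hB hC hM hbr hw hα h
  generalize 2 * w - 10 * u + 3 / 2 * u * w ^ 2 - 12 * u ^ 2 * w
      + 1 / 2 * u ^ 2 * w ^ 3 - 2 * u ^ 3 - 5 / 2 * u ^ 3 * w ^ 2 = N
  generalize u ^ 2 - 4 * u + 1 - 2 * u ^ 2 * w + u * w = Y at *
  generalize 2 * u ^ 2 * w + 4 * u + u ^ 2 + u * w + 1 = Y' at *
  generalize u ^ 2 - 3 - u * w = e at *
  generalize u ^ 2 + u * w + 1 = m at *
  generalize 1 - v ^ 2 = n at *
  generalize 4 * α - 1 = β at *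
  generalize 4 * α + 1 = β' at *
  field_simp
  linear_combination 2 * u * N * hκ

theorem solQ_mul :
    solQ1 α u v * solQ2 α u v = critProd (paramS α u v) (paramT α u v) := by
  have hw := paramW_mul (α := α) h.one_sub_v_sq
  have he := h.denom_ne_zero hα
  have hY := h.B_ne_zero hα
  have hY' := h.C_ne_zero hα
  have hm := h.M_ne_zero
  have hβ := four_mul_sub_one hα
  have hβ' := four_mul_add_one hα
  have hn := h.one_sub_v_sq
  rw [critProd_eq (s := paramS α u v) (t := paramT α u v) u (paramW α v) he rfl h.one_sub_u_sq rfl]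
  have hE := factorA_mul (u := u) hα hw
  have hB := factorB_mul (u := u) hα hw
  have hC := factorC_mul (u := u) hα hw
  have hM := factorM_eq (u := u) hw
  generalize paramW α v = w at *
  have hV : (2 * v - 1 + α) * (2 * v + 1 - α) = -((1 - α) / 2 * ((1 - v ^ 2) * (2 - w))) := by
    linear_combination v ^ 2 * hα - (1 - α) / 2 * hw
  have hV' : (2 * v - 1 - α) * (2 * v + 1 + α) = -((1 + α) / 2 * ((1 - v ^ 2) * (2 + w))) := by
    linear_combination v ^ 2 * hα + (1 + α) / 2 * hw
  have e1 : solQ1 α u v * solQ2 α u v = 49 / 4 * u ^ 2 * (factorAp α u v * factorAm α u v) ^ 3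
      * ((2 * v - 1 + α) * (2 * v + 1 - α)) * ((2 * v - 1 - α) * (2 * v + 1 + α))
      / (factorM α u v ^ 2 * (factorBp α u v * factorBm α u v) * (factorCp α u v * factorCm α u v)
        * -(1 - v ^ 2)) := by
    simp only [solQ1, solQ2, factorAp, factorAm, factorBp, factorBm, factorCp, factorCm, factorM]
    rw [div_mul_div_comm]
    congr 1 <;> ring
  rw [e1, hE, hB, hC, hM, hV, hV']
  have hκ : (4 * α - 1) * (4 * α + 1) = -49 := by linear_combination 16 * hα
  have hκ' : (1 - α) * (1 + α) = 4 := by linear_combination -hα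
  clear e1 hE hB hC hM hV hV' hw hα h
  generalize u ^ 2 - 4 * u + 1 - 2 * u ^ 2 * w + u * w = Y at *
  generalize 2 * u ^ 2 * w + 4 * u + u ^ 2 + u * w + 1 = Y' at *
  generalize u ^ 2 - 3 - u * w = e at *
  generalize u ^ 2 + u * w + 1 = m at *
  generalize 1 - v ^ 2 = n at *
  generalize 4 * α - 1 = β at *
  generalize 4 * α + 1 = β' at *
  generalize 2 - w = z at *
  generalize 2 + w = z' at *
  generalize 1 - α = δ at *
  generalize 1 + α = δ' at *
  field_simp
  linear_combination -49 * u ^ 2 * z * z' * hκ' - 4 * u ^ 2 * z * z' * hκ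

end RegularPoint

end Parametrization

/-! ### The relations of the family in terms of `(s, t)` -/

section FamilyRelations

variable {F : Type*} [Field F] {s t : F}

/-- The denominators of the formulas in `(s, t)` do not vanish at this point. -/
structure RegularParameter (s t : F) : Prop where
  sm : s - 1 ≠ 0
  sp : s + 1 ≠ 0
  y : s * t - t - 1 - s ≠ 0
  y' : s * t - t + s + 1 ≠ 0

namespace RegularParameter

variable (h : RegularParameter s t)
include h

theorem one_sub_sq : 1 - s ^ 2 ≠ 0 := by
  have : 1 - s ^ 2 = -((s - 1) * (s + 1)) := by ring
  rw [this]
  exact neg_ne_zero.2 (mul_ne_zero h.sm h.sp)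

theorem discr : (s - 1) ^ 2 * t ^ 2 - (s + 1) ^ 2 ≠ 0 := by
  have : (s - 1) ^ 2 * t ^ 2 - (s + 1) ^ 2
    = (s * t - t - 1 - s) * (s * t - t + s + 1) := by ring
  rw [this]
  exact mul_ne_zero h.y h.y'

omit h in
theorem coeffA0_eq : coeffA0 s t
    = (t ^ 2 - 1) / ((s + 1) * ((s * t - t - 1 - s) * (s * t - t + s + 1))) := by
  rw [coeffA0]
  congr 2
  ring

theorem ratio : coeffA0 s t ^ 2 / poleC s ^ 3 = coeffA0 s t ^ 2 * (1 - s ^ 2) ^ 3 := by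
  have := h.one_sub_sq
  rw [poleC]
  field_simp

theorem cubic : -(1 + tOne s t + tTwo s t)
    = 2 * coeffA1 s t + coeffA0 s t ^ 2 / poleC s ^ 3 := by
  rw [h.ratio, coeffA1, coeffA0_eq, tOne, tTwo]
  obtain ⟨h1, h2, h3, h4⟩ := h
  -- The two linear factors stay opaque while denominators are cleared, and are expanded only for
  -- the final polynomial identity.
  generalize hy : s * t - t - 1 - s = y at *
  generalize hy' : s * t - t + s + 1 = y' at *
  field_simp
  rw [← hy, ← hy']
  ring

theorem quadratic : tOne s t + tTwo s t + tOne s t * tTwo s t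
    = coeffA1 s t ^ 2 + 2 * coeffA0 s t - 3 * (coeffA0 s t ^ 2 / poleC s ^ 3) * poleC s := by
  have := h.one_sub_sq
  rw [h.ratio, coeffA1, coeffA0_eq, tOne, tTwo, poleC]
  obtain ⟨h1, h2, h3, h4⟩ := h
  generalize hy : s * t - t - 1 - s = y at *
  generalize hy' : s * t - t + s + 1 = y' at *
  field_simp
  rw [← hy, ← hy']
  ring

theorem linear : -(tOne s t * tTwo s t)
    = 2 * coeffA0 s t * coeffA1 s t + 3 * (coeffA0 s t ^ 2 / poleC s ^ 3) * poleC s ^ 2 := by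
  have := h.one_sub_sq
  rw [h.ratio, coeffA1, coeffA0_eq, tOne, tTwo, poleC]
  obtain ⟨h1, h2, h3, h4⟩ := h
  generalize hy : s * t - t - 1 - s = y at *
  generalize hy' : s * t - t + s + 1 = y' at *
  field_simp
  rw [← hy, ← hy']
  ring

theorem constant : coeffA0 s t ^ 2 = coeffA0 s t ^ 2 / poleC s ^ 3 * poleC s ^ 3 :=
  (div_mul_cancel₀ _ (pow_ne_zero 3 (one_div_ne_zero h.one_sub_sq))).symm

theorem critSum_eq_coeff : critSum s t = 4 * poleC s + coeffA1 s t := by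
  have h0 : poleC s = -1 / ((s - 1) * (s + 1)) := by
    rw [poleC, ← neg_div_neg_eq]
    congr 1
    ring
  rw [h0, coeffA1, coeffA0_eq, critSum]
  obtain ⟨h1, h2, h3, h4⟩ := h
  generalize hy : s * t - t - 1 - s = y at *
  generalize hy' : s * t - t + s + 1 = y' at *
  field_simp
  rw [← hy, ← hy']
  ring

theorem critProd_eq_coeff :
    critProd s t = -(2 * coeffA1 s t * poleC s) - 3 * coeffA0 s t := by
  have h0 : poleC s = -1 / ((s - 1) * (s + 1)) := by
    rw [poleC, ← neg_div_neg_eq]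
    congr 1
    ring
  rw [h0, coeffA1, coeffA0_eq, critProd]
  obtain ⟨h1, h2, h3, h4⟩ := h
  generalize hy : s * t - t - 1 - s = y at *
  generalize hy' : s * t - t + s + 1 = y' at *
  field_simp
  rw [← hy, ← hy']
  ring

end RegularParameter

end FamilyRelations

theorem Admissible.regularParameter {s t : ℂ} (h : Admissible s t) : RegularParameter s t := by
  obtain ⟨h1, h2, -⟩ := h
  refine ⟨fun e => h1 ?_, fun e => h1 ?_, fun e => h2 ?_, fun e => h2 ?_⟩
  · linear_combination (s + 1) * e
  · linear_combination (s - 1) * e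
  · linear_combination (s * t - t + s + 1) * e
  · linear_combination (s * t - t - 1 - s) * e

theorem Admissible.coverEquations {s t q r : ℂ} (h : Admissible s t) (hs : q + r = critSum s t)
    (hp : q * r = critProd s t) :
    CoverEquations (coeffA0 s t) (coeffA1 s t) (poleC s) (coeffA0 s t ^ 2 / poleC s ^ 3)
      (tOne s t) (tTwo s t) q r where
  cubic := h.regularParameter.cubic
  quadratic := h.regularParameter.quadratic
  linear := h.regularParameter.linear
  constant := h.regularParameter.constant
  sum := hs.trans h.regularParameter.critSum_eq_coeff
  prod := hp.trans h.regularParameter.critProd_eq_coeff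
  t_ne_zero := h.2.2.1
  t_ne_one := h.2.2.2.1
  t'_ne_zero := h.2.2.2.2.1
  t'_ne_one := h.2.2.2.2.2.1
  t_ne_t' := h.2.2.2.2.2.2.1

/-! ### Normalized covers -/

/-- The condition `φ(1) = 1`. -/
theorem value_one_iff_existsUnique (a₀ a₁ c : ℂ) (h0 : a₀ ≠ 0) (hc : c ≠ 0) (hc1 : c ≠ 1) :
    a₀ ^ 2 / c ^ 3 + (1 + a₁ + a₀) ^ 2 / (1 - c) ^ 3 = 0 ↔
      ∃! s : ℂ, a₁ = a₀ * (s ^ 3 - 1) - 1 ∧ c = 1 / (1 - s ^ 2) := by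
  have h1c : 1 - c ≠ 0 := sub_ne_zero.2 hc1.symm
  have hd : (c - 1) / c ≠ 0 := div_ne_zero (sub_ne_zero.2 hc1) hc
  constructor
  · intro h
    rw [div_add_div _ _ (pow_ne_zero 3 hc) (pow_ne_zero 3 h1c), div_eq_zero_iff] at h
    replace h := h.resolve_right (mul_ne_zero (pow_ne_zero 3 hc) (pow_ne_zero 3 h1c))
    -- The constraint reads r² = d³, a cuspidal cubic. Its parameter is s = r/d, with d = s² and r =
    -- s³.
    obtain ⟨r, hr⟩ : ∃ r, r = (1 + a₁ + a₀) / a₀ := ⟨_, rfl⟩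
    obtain ⟨d, hd'⟩ : ∃ d, d = (c - 1) / c := ⟨_, rfl⟩
    rw [← hd'] at hd
    have hrd : r ^ 2 = d ^ 3 := by
      rw [hr, hd', div_pow, div_pow, div_eq_div_iff (pow_ne_zero 2 h0) (pow_ne_zero 3 hc)]
      linear_combination h
    have hcd : c * (1 - d) = 1 := by rw [hd']; field_simp; ring
    have hra : a₀ * r = 1 + a₁ + a₀ := by rw [hr]; field_simp
    have hs2 : (r / d) ^ 2 = d := by
      rw [div_pow, hrd]; field_simp
    have hs3 : (r / d) ^ 3 = r := by
      rw [pow_succ, hs2]; field_simp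
    refine ⟨r / d, ⟨?_, ?_⟩, ?_⟩
    · rw [hs3]; linear_combination -hra
    · rw [hs2]; exact eq_one_div_of_mul_eq_one_left hcd
    · rintro s ⟨e1, e2⟩
      have n0 : 1 - s ^ 2 ≠ 0 := fun e => hc (by rw [e2, e, div_zero])
      have f2 : s ^ 2 = d := by
        have : c * (1 - s ^ 2) = 1 := by rw [e2]; field_simp
        apply mul_left_cancel₀ hc
        linear_combination hcd - this
      have f3 : s ^ 3 = r := by
        apply mul_left_cancel₀ h0
        linear_combination -e1 - hra
      rw [eq_div_iff hd, ← f2, ← f3]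
      ring
  · rintro ⟨s, ⟨e1, e2⟩, -⟩
    have n0 : 1 - s ^ 2 ≠ 0 := fun e => hc (by rw [e2, e, div_zero])
    have e3 : 1 - c = -s ^ 2 / (1 - s ^ 2) := by rw [e2]; field_simp; ring
    have s0 : s ≠ 0 := by
      rintro rfl
      apply h1c
      rw [e3]; simp
    rw [e3, e1, e2]
    field_simp
    ring

/-- A quotient of coprime polynomials with monic denominator is in lowest terms. -/
theorem num_denom_of_isCoprime {K : Type*} [Field K] {x : RatFunc K} {p q : K[X]}
    (hpq : IsCoprime p q) (hq : q.Monic) (hx : x = algebraMap K[X] (RatFunc K) p / algebraMap K[X] (RatFunc K) q) :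
    x.num = p ∧ x.denom = q := by
  have e := (RatFunc.num_mul_eq_mul_denom_iff hq.ne_zero).2 hx
  have d1 : x.denom ∣ q := by rw [hx]; exact RatFunc.denom_div_dvd p q
  have d2 : q ∣ x.denom := hpq.symm.dvd_of_dvd_mul_left (e ▸ dvd_mul_left _ _)
  have e2 : x.denom = q := eq_of_monic_of_associated x.monic_denom hq (associated_of_dvd_dvd d1 d2)
  rw [e2] at e
  exact ⟨mul_right_cancel₀ hq.ne_zero e, e2⟩

/-! ### The cover as a fraction in lowest terms. -/

section Quadratic

/-- The monic quadratic polynomial with coefficients `a₁, a₀`. -/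
def monicQuadratic (a₁ a₀ : ℂ) : ℂ[X] := X ^ 2 + C a₁ * X + C a₀

variable (a₀ a₁ c : ℂ)

theorem monicQuadratic_monic : (monicQuadratic a₁ a₀).Monic := by
  rw [monicQuadratic]; monicity!

theorem eval_monicQuadratic (x : ℂ) : (monicQuadratic a₁ a₀).eval x = x ^ 2 + a₁ * x + a₀ := by
  simp [monicQuadratic]

theorem natDegree_monicQuadratic : (monicQuadratic a₁ a₀).natDegree = 2 := by
  rw [monicQuadratic]; compute_degree!

theorem monicQuadratic_eq (x y : ℂ) :
    monicQuadratic (-(x + y)) (x * y) = (X - C x) * (X - C y) := by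
  simp only [monicQuadratic, map_neg, map_add, map_mul]
  ring

theorem roots_pair (x y : ℂ) : ((X - C x) * (X - C y)).roots = {x, y} := by
  rw [roots_mul (mul_ne_zero (X_sub_C_ne_zero x) (X_sub_C_ne_zero y)), roots_X_sub_C, roots_X_sub_C]
  rfl

/-- Over `ℂ`, a monic polynomial with four roots. -/
theorem exists_monicQuadratic_eq :
    ∃ x y, monicQuadratic a₁ a₀ = (X - C x) * (X - C y) ∧ x + y = -a₁ ∧ x * y = a₀ := by
  have h := (IsAlgClosed.splits (monicQuadratic a₁ a₀))
  have hc : (monicQuadratic a₁ a₀).roots.card = 2 := by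
    rw [← natDegree_monicQuadratic a₀ a₁, h.natDegree_eq_card_roots]
  obtain ⟨x, y, hxy⟩ := Multiset.card_eq_two.1 hc
  have e := h.eq_prod_roots_of_monic (monicQuadratic_monic a₀ a₁)
  rw [hxy] at e
  have e : monicQuadratic a₁ a₀ = (X - C x) * (X - C y) := by simpa using e
  refine ⟨x, y, e, ?_, ?_⟩
  · have h0 := congrArg (eval 0) e
    have h1 := congrArg (eval 1) e
    simp [eval_monicQuadratic] at h0 h1
    linear_combination h1 - h0
  · have h0 := congrArg (eval 0) e
    simp [eval_monicQuadratic] at h0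
    exact h0.symm

/-- The numerator of the cover. -/
def coverNum : ℂ[X] := C (-(c ^ 3 / a₀ ^ 2)) * monicQuadratic a₁ a₀ ^ 2

variable {a₀ a₁ c}

theorem coverRat_eq : coverRat a₀ a₁ c = algebraMap ℂ[X] (RatFunc ℂ) (coverNum a₀ a₁ c)
    / algebraMap ℂ[X] (RatFunc ℂ) ((X - C c) ^ 3) := by
  simp only [coverRat, coverMap, coverNum, monicQuadratic, map_mul, map_pow, map_add, map_sub,
    RatFunc.algebraMap_X, RatFunc.algebraMap_C, map_neg, map_div₀]
  ring

theorem isCoprime_cover (hc : c ^ 2 + a₁ * c + a₀ ≠ 0) (h0 : a₀ ≠ 0) (hc0 : c ≠ 0) :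
    IsCoprime (coverNum a₀ a₁ c) ((X - C c) ^ 3) := by
  have h1 : IsCoprime (monicQuadratic a₁ a₀) (X - C c) := by
    refine ((irreducible_X_sub_C c).coprime_iff_not_dvd.2 ?_).symm
    rw [dvd_iff_isRoot, IsRoot, eval_monicQuadratic]
    exact hc
  have hu : IsUnit (C (-(c ^ 3 / a₀ ^ 2))) :=
    isUnit_C.2 (IsUnit.mk0 _ (by simp [h0, hc0]))
  rw [coverNum, isCoprime_mul_unit_left_left hu]
  exact h1.pow

theorem num_coverRat (hc : c ^ 2 + a₁ * c + a₀ ≠ 0) (h0 : a₀ ≠ 0) (hc0 : c ≠ 0) :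
    (coverRat a₀ a₁ c).num = coverNum a₀ a₁ c ∧ (coverRat a₀ a₁ c).denom = (X - C c) ^ 3 :=
  num_denom_of_isCoprime (isCoprime_cover hc h0 hc0) ((monic_X_sub_C c).pow 3) coverRat_eq

/-- The critical polynomial of a cover. -/
theorem critical_cover (κ : ℂ) (P : ℂ[X]) :
    derivative (C κ * P ^ 2) * (X - C c) ^ 3 - C κ * P ^ 2 * derivative ((X - C c) ^ 3)
      = C κ * (P * (X - C c) ^ 2 * (2 * derivative P * (X - C c) - 3 * P)) := by
  simp only [derivative_mul, derivative_C, derivative_pow, derivative_sub, derivative_X]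
  norm_num [C_ofNat]
  ring

theorem critical_quadratic {q r : ℂ} (hs : q + r = 4 * c + a₁) (hp : q * r = -(2 * a₁ * c) - 3 * a₀) :
    2 * derivative (monicQuadratic a₁ a₀) * (X - C c) - 3 * monicQuadratic a₁ a₀
      = (X - C q) * (X - C r) := by
  have hs' := congrArg C hs
  have hp' := congrArg C hp
  simp only [map_add, map_mul, map_sub, map_neg, C_ofNat] at hs' hp'
  simp only [monicQuadratic, derivative_add, derivative_pow, derivative_X, derivative_mul,
    derivative_C]
  norm_num [C_ofNat]
  linear_combination X * hs' - hp'

end Quadratic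

/-- The equations of a cover with distinct zeros describe a normalized cover. -/
theorem CoverEquations.isNormalizedCover {a₀ a₁ c k t t' q r : ℂ}
    (h : CoverEquations a₀ a₁ c k t t' q r) (hsq : a₁ ^ 2 ≠ 4 * a₀) :
    IsNormalizedCover (coverRat a₀ a₁ c) t t' q r := by
  obtain ⟨c0, p0, -, -⟩ := h.at_zero
  obtain ⟨hn, hd⟩ := num_coverRat h.at_c p0 c0
  have hκ : -(c ^ 3 / a₀ ^ 2) ≠ 0 := by simp [p0, c0]
  have hκk : -(c ^ 3 / a₀ ^ 2) * k = -1 := by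
    have := h.constant
    field_simp
    linear_combination this
  obtain ⟨x, y, hxy, hs, hp⟩ := exists_monicQuadratic_eq a₀ a₁
  have hne : x ≠ y := by
    rintro rfl
    apply hsq
    rw [← hp]
    linear_combination (a₁ - 2 * x) * hs
  have hPx : ∀ z, z ^ 2 + a₁ * z + a₀ = (z - x) * (z - y) := fun z => by
    linear_combination z * hs - hp
  have hP0 : monicQuadratic a₁ a₀ ≠ 0 := (monicQuadratic_monic a₀ a₁).ne_zero
  have hroots : (monicQuadratic a₁ a₀).roots = {x, y} := by rw [hxy, roots_pair]
  have hnum : ∀ z, (coverNum a₀ a₁ c).IsRoot z ↔ z ^ 2 + a₁ * z + a₀ = 0 := fun z => by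
    rw [IsRoot, coverNum, eval_mul, eval_C, eval_pow, eval_monicQuadratic]
    simp only [mul_eq_zero, hκ, false_or, pow_eq_zero_iff two_ne_zero]
  have hden : ∀ z, ((X - C c) ^ 3 : ℂ[X]).IsRoot z ↔ z - c = 0 := fun z => by
    simp [IsRoot]
  have hfib : coverNum a₀ a₁ c - (X - C c) ^ 3
      = C (-(c ^ 3 / a₀ ^ 2)) * ((X - C 0) * (X - C 1) * ((X - C t) * (X - C t'))) := by
    refine Polynomial.funext fun z => ?_
    simp only [coverNum, eval_sub, eval_mul, eval_C, eval_pow, eval_monicQuadratic, eval_X]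
    linear_combination -(-(c ^ 3 / a₀ ^ 2)) * h.fibre z - (z - c) ^ 3 * hκk
  have hfr : (coverNum a₀ a₁ c - (X - C c) ^ 3).roots = {0, 1, t, t'} := by
    rw [hfib, roots_C_mul _ hκ, roots_mul, roots_pair, roots_pair]
    · rfl
    · exact mul_ne_zero (mul_ne_zero (X_sub_C_ne_zero _) (X_sub_C_ne_zero _))
        (mul_ne_zero (X_sub_C_ne_zero _) (X_sub_C_ne_zero _))
  have hcr := h.critical
  refine ⟨?_, ?_, ⟨c, ?_⟩, ?_, ?_, ?_, ?_⟩
  · rw [hn, coverNum, natDegree_C_mul hκ, natDegree_pow, natDegree_monicQuadratic]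
  · rw [hd, natDegree_pow, natDegree_X_sub_C]
  · rw [hd, rootMultiplicity_X_sub_C_pow]
  · intro z hz
    rw [hn] at hz ⊢
    have hz' := (hnum z).1 hz
    rw [hPx] at hz'
    rw [← count_roots, coverNum, roots_C_mul _ hκ, roots_pow, hroots]
    rcases mul_eq_zero.1 hz' with e | e
    · rw [sub_eq_zero.1 e]; simp [hne]
    · rw [sub_eq_zero.1 e]; simp [hne.symm]
  · rw [hn, hd, hfr]
  · rw [hn, hd, hfr]
    simp [h.t_ne_zero.symm, h.t'_ne_zero.symm, h.t_ne_one.symm, h.t'_ne_one.symm, h.t_ne_t']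
  · rw [hn, hd]
    have hne1 : C (-(c ^ 3 / a₀ ^ 2)) * (monicQuadratic a₁ a₀ * (X - C c) ^ 2
        * ((X - C q) * (X - C r))) ≠ 0 :=
      mul_ne_zero (C_ne_zero.2 hκ) (mul_ne_zero (mul_ne_zero hP0 (pow_ne_zero 2 (X_sub_C_ne_zero c)))
        (mul_ne_zero (X_sub_C_ne_zero q) (X_sub_C_ne_zero r)))
    -- At a root z of 2P'(x-c) - 3P, z = c would give P(c) = 0. A zero of P at z would give P'(z) =
    -- 0 too, hence a double root of P and a₁² = 4a₀.
    have hq : ∀ z, (z - q) * (z - r) = 0 →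
        ¬ (coverNum a₀ a₁ c).IsRoot z ∧ ¬ ((X - C c) ^ 3 : ℂ[X]).IsRoot z := by
      intro z hz
      have e := hcr z
      rw [hz] at e
      rw [hnum, hden]
      have hzc : z - c ≠ 0 := by
        intro h0
        apply h.at_c
        rw [← sub_eq_zero.1 h0]
        linear_combination (2 * (2 * z + a₁) * h0 + e) / 3
      refine ⟨fun h0 => ?_, hzc⟩
      rw [h0] at e
      have e1 : 2 * z + a₁ = 0 := by
        apply mul_right_cancel₀ hzc
        linear_combination -e / 2
      apply hsq
      linear_combination (2 * z + a₁) * e1 - 4 * h0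
    rw [coverNum, critical_cover, critical_quadratic h.sum h.prod, roots_C_mul _ hκ,
      roots_mul (right_ne_zero_of_mul hne1),
      roots_mul (left_ne_zero_of_mul (right_ne_zero_of_mul hne1)), roots_pair, hroots, roots_pow,
      roots_X_sub_C, ← coverNum, Multiset.filter_add, Multiset.filter_add]
    have e1 : Multiset.filter (fun z => ¬ (coverNum a₀ a₁ c).IsRoot z ∧
        ¬ ((X - C c) ^ 3 : ℂ[X]).IsRoot z) {x, y} = 0 := by
      rw [Multiset.filter_eq_nil]
      intro z hz hh
      apply hh.1
      rw [hnum, hPx]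
      simp only [Multiset.insert_eq_cons, Multiset.mem_cons, Multiset.mem_singleton] at hz
      rcases hz with rfl | rfl <;> simp
    have e2 : Multiset.filter (fun z => ¬ (coverNum a₀ a₁ c).IsRoot z ∧
        ¬ ((X - C c) ^ 3 : ℂ[X]).IsRoot z) (2 • {c}) = 0 := by
      rw [Multiset.filter_eq_nil]
      intro z hz hh
      apply hh.2
      rw [hden]
      rw [Multiset.mem_nsmul_of_ne_zero (by norm_num), Multiset.mem_singleton] at hz
      simp [hz]
    have e3 : Multiset.filter (fun z => ¬ (coverNum a₀ a₁ c).IsRoot z ∧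
        ¬ ((X - C c) ^ 3 : ℂ[X]).IsRoot z) {q, r} = {q, r} := by
      rw [Multiset.filter_eq_self]
      intro z hz
      apply hq
      simp only [Multiset.insert_eq_cons, Multiset.mem_cons, Multiset.mem_singleton] at hz
      rcases hz with rfl | rfl <;> simp
    convert congrArg₂ (· + ·) (congrArg₂ (· + ·) e1 e2) e3 using 2
    simp

/-- The two double zeros make the numerator κP², and the triple pole makes the denominator (x-c)³.
The fibre over 1 then gives the quartic identity with k = -1/κ. For the critical points the converse
`isNormalizedCover` is applied to the roots of 2P'(x-c) - 3P, and the two descriptions of the same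
multiset are compared. -/
theorem IsNormalizedCover.exists_coverEquations {φ : RatFunc ℂ} {τ₁ τ₂ ξ₁ ξ₂ : ℂ}
    (h : IsNormalizedCover φ τ₁ τ₂ ξ₁ ξ₂) :
    ∃ a₀ a₁ c k, CoverEquations a₀ a₁ c k τ₁ τ₂ ξ₁ ξ₂ ∧ a₁ ^ 2 ≠ 4 * a₀ ∧
      φ = coverRat a₀ a₁ c := by
  classical
  obtain ⟨c, hc⟩ := h.fibre_infty
  have hD : φ.denom = (X - C c) ^ 3 := by
    refine (eq_of_monic_of_dvd_of_natDegree_le ((monic_X_sub_C c).pow 3) φ.monic_denom ?_ ?_)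
    · rw [← hc]; exact pow_rootMultiplicity_dvd _ _
    · rw [h.natDegree_denom, natDegree_pow, natDegree_X_sub_C]
  have hN0 : φ.num ≠ 0 := fun e => by simpa [e] using h.natDegree_num
  obtain ⟨κ, hκ⟩ : ∃ κ, κ = φ.num.leadingCoeff := ⟨_, rfl⟩
  have hκ0 : κ ≠ 0 := by rw [hκ]; exact leadingCoeff_ne_zero.2 hN0
  have hcard : φ.num.roots.card = 4 := by
    rw [← (IsAlgClosed.splits φ.num).natDegree_eq_card_roots, h.natDegree_num]
  -- All roots of the numerator are double, so the four roots counted with multiplicity are two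
  -- points taken twice.
  have hdd : φ.num.roots = 2 • φ.num.roots.dedup := by
    ext z
    rw [Multiset.count_nsmul, Multiset.count_dedup]
    split_ifs with hz
    · rw [count_roots, h.fibre_zero z (isRoot_of_mem_roots hz)]
    · rw [Multiset.count_eq_zero_of_notMem hz]
  have hcard2 : φ.num.roots.dedup.card = 2 := by
    have := hcard
    rw [hdd, Multiset.card_nsmul] at this
    omega
  obtain ⟨x, y, hxy⟩ := Multiset.card_eq_two.1 hcard2
  have hne : x ≠ y := by
    have := Multiset.nodup_dedup φ.num.roots
    rw [hxy] at this
    simpa using this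
  have hN : φ.num = C κ * monicQuadratic (-(x + y)) (x * y) ^ 2 := by
    have e := (IsAlgClosed.splits φ.num).eq_prod_roots
    rw [hdd, hxy, ← hκ] at e
    rw [e, monicQuadratic_eq]
    congr 1
    simp only [two_nsmul, Multiset.map_add, Multiset.prod_add]
    simp
    ring
  have hdeg : φ.denom.natDegree < φ.num.natDegree := by
    rw [h.natDegree_num, h.natDegree_denom]; norm_num
  have hNDlc : (φ.num - φ.denom).leadingCoeff = κ := by
    rw [hκ, leadingCoeff_sub_of_degree_lt (degree_lt_degree hdeg)]
  have hZ : φ.num - φ.denom = C κ * ((X - C 0) * ((X - C 1) * ((X - C τ₁) * (X - C τ₂)))) := by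
    have e := (IsAlgClosed.splits (φ.num - φ.denom)).eq_prod_roots
    rw [hNDlc, h.fibre_one] at e
    rw [e]
    simp
  have hnd := h.fibre_one_nodup
  rw [h.fibre_one] at hnd
  simp only [Multiset.insert_eq_cons, Multiset.nodup_cons, Multiset.mem_cons,
    Multiset.mem_singleton, Multiset.nodup_singleton, not_or, and_true] at hnd
  obtain ⟨⟨-, n1, n2⟩, ⟨n3, n4⟩, n5⟩ := hnd
  obtain ⟨a₁, ha₁⟩ : ∃ a, a = -(x + y) := ⟨_, rfl⟩
  obtain ⟨a₀, ha₀⟩ : ∃ a, a = x * y := ⟨_, rfl⟩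
  rw [← ha₀, ← ha₁] at hN
  obtain ⟨k, hk⟩ : ∃ k, k = -1 / κ := ⟨_, rfl⟩
  have hκk : κ * k = -1 := by rw [hk]; field_simp
  have H : ∀ z, z * (z - 1) * (z - τ₁) * (z - τ₂)
      = (z ^ 2 + a₁ * z + a₀) ^ 2 + k * (z - c) ^ 3 := by
    intro z
    have e := congrArg (eval z) hZ
    rw [hN, hD] at e
    simp only [eval_sub, eval_mul, eval_C, eval_pow, eval_monicQuadratic, eval_X] at e
    apply mul_left_cancel₀ hκ0
    linear_combination -e - (z - c) ^ 3 * hκk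
  obtain ⟨q, r, -, hs, hp⟩ := exists_monicQuadratic_eq (-(2 * a₁ * c) - 3 * a₀) (-(4 * c + a₁))
  have hE : ∀ {q r : ℂ}, q + r = 4 * c + a₁ → q * r = -(2 * a₁ * c) - 3 * a₀ →
      CoverEquations a₀ a₁ c k τ₁ τ₂ q r := by
    intro q r hs hp
    -- Both sides are monic quartics, so the values at -1, 0, 1, 2 recover the four lower
    -- coefficients.
    have H0 := H 0
    have H1 := H 1
    have H2 := H (-1)
    have H3 := H 2
    exact
      { cubic := by linear_combination (H3 - 3 * H1 - H2 + 3 * H0) / 6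
        quadratic := by linear_combination (H1 + H2) / 2 - H0
        linear := by linear_combination (H1 - H2) / 2 - (H3 - 3 * H1 - H2 + 3 * H0) / 6
        constant := by linear_combination -H0
        sum := hs
        prod := hp
        t_ne_zero := Ne.symm n1
        t_ne_one := Ne.symm n3
        t'_ne_zero := Ne.symm n2
        t'_ne_one := Ne.symm n4
        t_ne_t' := n5 }
  have E := hE (by linear_combination hs) hp
  obtain ⟨c0, p0, -, -⟩ := E.at_zero
  have hφ : φ = coverRat a₀ a₁ c := by
    conv_lhs => rw [← RatFunc.num_div_denom φ, hN, hD]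
    rw [coverRat_eq, coverNum]
    congr 5
    have := E.constant
    field_simp
    linear_combination κ * this + c ^ 3 * hκk
  have hsq : a₁ ^ 2 ≠ 4 * a₀ := by
    intro e
    apply hne
    have : (x - y) ^ 2 = 0 := by
      rw [ha₁, ha₀] at e
      linear_combination e
    exact sub_eq_zero.1 (pow_eq_zero_iff two_ne_zero |>.1 this)
  -- Sum and product of the multiset of critical points are all that the equations require of ξ₁,
  -- ξ₂.
  have hcrit := (E.isNormalizedCover hsq).critical
  rw [← hφ, h.critical] at hcrit
  have e1 := congrArg Multiset.sum hcrit
  have e2 := congrArg Multiset.prod hcrit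
  simp only [Multiset.insert_eq_cons, Multiset.sum_cons, Multiset.sum_singleton,
    Multiset.prod_cons, Multiset.prod_singleton] at e1 e2
  exact ⟨a₀, a₁, c, k, hE (by linear_combination e1 + hs) (by linear_combination e2 + hp), hsq, hφ⟩

/-- The coefficients are determined by the cover. -/
theorem coverRat_injective {a₀ a₁ c k t t' q r b₀ b₁ d k' u u' q' r' : ℂ}
    (h : CoverEquations a₀ a₁ c k t t' q r) (h' : CoverEquations b₀ b₁ d k' u u' q' r')
    (e : coverRat a₀ a₁ c = coverRat b₀ b₁ d) : a₀ = b₀ ∧ a₁ = b₁ ∧ c = d := by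
  obtain ⟨c0, p0, -, -⟩ := h.at_zero
  obtain ⟨d0, p0', -, -⟩ := h'.at_zero
  obtain ⟨hn, hd⟩ := num_coverRat h.at_c p0 c0
  obtain ⟨hn', hd'⟩ := num_coverRat h'.at_c p0' d0
  rw [← e, hn, coverNum, coverNum] at hn'
  rw [← e, hd] at hd'
  have hκ := congrArg leadingCoeff hn'
  simp only [leadingCoeff_mul, leadingCoeff_C, leadingCoeff_pow,
    (monicQuadratic_monic _ _).leadingCoeff, one_pow, mul_one] at hκ
  rw [hκ] at hn'
  have hκ0 : -(d ^ 3 / b₀ ^ 2) ≠ 0 := by simp [p0', d0]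
  have H : ∀ z, (z ^ 2 + a₁ * z + a₀) ^ 2 = (z ^ 2 + b₁ * z + b₀) ^ 2 := by
    intro z
    have := congrArg (eval z) hn'
    simp only [eval_mul, eval_C, eval_pow, eval_monicQuadratic] at this
    exact mul_left_cancel₀ hκ0 this
  -- The third difference over -1, 0, 1, 2 isolates the coefficient 2a₁ of x³, because the leading
  -- terms agree.
  have h1 : a₁ = b₁ := by
    linear_combination (H 2 - 3 * H 1 - H (-1) + 3 * H 0) / 12
  subst h1
  refine ⟨?_, rfl, ?_⟩
  · linear_combination ((H 1 + H (-1)) / 2 - H 0) / 2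
  · have := congrArg (eval c) hd'
    have : (c - d) ^ 3 = 0 := by simpa using this.symm
    exact sub_eq_zero.1 (pow_eq_zero_iff three_ne_zero |>.1 this)

section Parameter

variable {F : Type*} [Field F] (s t : F)

theorem coeffA0_neg : coeffA0 s (-t) = coeffA0 s t := by rw [coeffA0, coeffA0, neg_sq]

/-- The sign change t ↦ -t leaves the cover fixed and relabels its fibre. This is the ambiguity in
the square root that defines t. -/
theorem tOne_neg : tOne s (-t) = tTwo s t := by
  rw [tOne, tTwo]
  congr 1
  · ring
  · ring

theorem tTwo_neg : tTwo s (-t) = tOne s t := by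
  rw [← tOne_neg, neg_neg]

end Parameter

/-- The discriminant of the two free points of the fibre over `1`. -/
theorem CoverEquations.discr {a₀ a₁ c k t t' q r s : ℂ} (h : CoverEquations a₀ a₁ c k t t' q r)
    (h1 : a₁ = a₀ * (s ^ 3 - 1) - 1) (h2 : c = 1 / (1 - s ^ 2)) :
    (t - t') ^ 2 = (a₀ * (s + 1) * (s - 1) ^ 2 - 1) ^ 3 * (a₀ * (s + 1) ^ 3 - 1) := by
  obtain ⟨c0, -, -, -⟩ := h.at_zero
  have n0 : 1 - s ^ 2 ≠ 0 := fun e => c0 (by rw [h2, e, div_zero])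
  have hc : c * (1 - s ^ 2) = 1 := by rw [h2]; field_simp
  have hk : k = a₀ ^ 2 * (1 - s ^ 2) ^ 3 := by
    rw [h.constant, mul_assoc, ← mul_pow, hc]
    ring
  have e1 : t + t' = -1 - 2 * a₁ - k := by linear_combination -h.cubic
  have e2 : t * t' = -(2 * a₀ * a₁) - 3 * a₀ ^ 2 * (1 - s ^ 2) := by
    have : k * c ^ 2 = a₀ ^ 2 * (1 - s ^ 2) := by
      rw [hk]
      linear_combination a₀ ^ 2 * (1 - s ^ 2) * (c * (1 - s ^ 2) + 1) * hc
    linear_combination -h.linear - 3 * this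
  have : (t - t') ^ 2 = (t + t') ^ 2 - 4 * (t * t') := by ring
  rw [this, e1, e2, hk, h1]
  ring

/-- The condition φ(1) = 1 gives s. With b = a₀(s+1)(s-1)² - 1, nonzero because τ₁ ≠ τ₂, take t with
t²b = a₀(s+1)³ - 1. By `discr` the discriminant of τ₁, τ₂ becomes the square b⁴t², and solving the
equation of t for a₀ gives `coeffA0`. -/
theorem CoverEquations.exists_parameter {a₀ a₁ c k τ₁ τ₂ q r : ℂ}
    (h : CoverEquations a₀ a₁ c k τ₁ τ₂ q r) (hsq : a₁ ^ 2 ≠ 4 * a₀) :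
    ∃ s t, Admissible s t ∧ a₀ = coeffA0 s t ∧ a₁ = coeffA1 s t ∧ c = poleC s ∧
      τ₁ = tOne s t ∧ τ₂ = tTwo s t := by
  obtain ⟨c0, p0, -, -⟩ := h.at_zero
  obtain ⟨c1, -, -, -⟩ := h.at_one
  have hk : k = a₀ ^ 2 / c ^ 3 := by rw [h.constant]; field_simp
  have hv : a₀ ^ 2 / c ^ 3 + (1 + a₁ + a₀) ^ 2 / (1 - c) ^ 3 = 0 := by
    have := h.fibre 1
    rw [← hk]
    field_simp
    linear_combination -this
  obtain ⟨s, ⟨h1, h2⟩, -⟩ := (value_one_iff_existsUnique a₀ a₁ c p0 c0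
    (sub_ne_zero.1 c1).symm).1 hv
  have n0 : 1 - s ^ 2 ≠ 0 := fun e => c0 (by rw [h2, e, div_zero])
  have s0 : s ≠ 0 := by
    rintro rfl
    apply c1
    rw [h2]; norm_num
  have hd := h.discr h1 h2
  have hb : a₀ * (s + 1) * (s - 1) ^ 2 - 1 ≠ 0 := by
    intro e
    rw [e] at hd
    exact sub_ne_zero.2 h.t_ne_t' (pow_eq_zero_iff two_ne_zero |>.1 (by linear_combination hd))
  have sp : s + 1 ≠ 0 := fun e => n0 (by linear_combination (1 - s) * e)
  have sm : s - 1 ≠ 0 := fun e => n0 (by linear_combination -(1 + s) * e)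
  obtain ⟨b, hb'⟩ : ∃ b, b = a₀ * (s + 1) * (s - 1) ^ 2 - 1 := ⟨_, rfl⟩
  rw [← hb'] at hb
  have key : ∀ t, t ^ 2 * b = a₀ * (s + 1) ^ 3 - 1 → RegularParameter s t ∧ a₀ = coeffA0 s t := by
    intro t ht
    have e1 : ((s - 1) ^ 2 * t ^ 2 - (s + 1) ^ 2) * b = 4 * s := by
      linear_combination (s - 1) ^ 2 * ht - (s + 1) ^ 2 * hb'
    have e2 : (t ^ 2 - 1) * b = 4 * s * (a₀ * (s + 1)) := by linear_combination ht - hb'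
    have e3 : (s - 1) ^ 2 * t ^ 2 - (s + 1) ^ 2 ≠ 0 := by
      intro e
      rw [e, zero_mul] at e1
      simp [s0] at e1
    refine ⟨⟨sm, sp, fun e => e3 ?_, fun e => e3 ?_⟩, ?_⟩
    · linear_combination (s * t - t + s + 1) * e
    · linear_combination (s * t - t - 1 - s) * e
    · rw [coeffA0, eq_div_iff (mul_ne_zero sp e3)]
      apply mul_right_cancel₀ hb
      linear_combination a₀ * (s + 1) * e1 - e2
  have adm : ∀ t, t ^ 2 * b = a₀ * (s + 1) ^ 3 - 1 → τ₁ = tOne s t → τ₂ = tTwo s t →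
      ∃ s t, Admissible s t ∧ a₀ = coeffA0 s t ∧ a₁ = coeffA1 s t ∧ c = poleC s ∧
      τ₁ = tOne s t ∧ τ₂ = tTwo s t := by
    intro t ht e1 e2
    obtain ⟨k1, k2⟩ := key t ht
    have k3 : a₁ = coeffA1 s t := by rw [coeffA1, ← k2, h1]
    refine ⟨s, t, ⟨?_, ?_, ?_⟩, k2, k3, h2, e1, e2⟩
    · exact fun e => n0 (by rw [e, sub_self])
    · exact sub_ne_zero.1 k1.discr
    · rw [← e1, ← e2, ← k2, ← k3]
      exact ⟨h.t_ne_zero, h.t_ne_one, h.t'_ne_zero, h.t'_ne_one, h.t_ne_t', hsq⟩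
  obtain ⟨t, ht⟩ := IsAlgClosed.exists_pow_nat_eq ((a₀ * (s + 1) ^ 3 - 1) / b) two_pos
  rw [eq_div_iff hb] at ht
  obtain ⟨k1, k2⟩ := key t ht
  have k3 : a₁ = coeffA1 s t := by rw [coeffA1, ← k2, h1]
  have k4 : c = poleC s := h2
  have f1 := k1.cubic
  have f2 := k1.linear
  rw [← k2, ← k3, ← k4, ← hk] at f1 f2
  -- The pairs τ₁, τ₂ and `tOne s t`, `tTwo s t` have equal sums and products. If the order is
  -- wrong, -t is used instead.
  have : (τ₁ - tOne s t) * (τ₁ - tTwo s t) = 0 := by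
    linear_combination τ₁ * (f1 - h.cubic) - (f2 - h.linear)
  rcases mul_eq_zero.1 this with e | e
  · exact adm t ht (sub_eq_zero.1 e) (by linear_combination f1 - h.cubic - e)
  · refine adm (-t) (by rw [neg_sq]; exact ht) ?_ ?_
    · rw [tOne_neg]; exact sub_eq_zero.1 e
    · rw [tTwo_neg]; linear_combination f1 - h.cubic - e

/-- The covers of the prescribed type are exactly those of the family. -/
theorem isNormalizedCover_iff (φ : RatFunc ℂ) (τ₁ τ₂ ξ₁ ξ₂ : ℂ) :
    IsNormalizedCover φ τ₁ τ₂ ξ₁ ξ₂ ↔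
      ∃! x : ℂ × ℂ, Admissible x.1 x.2 ∧
        φ = coverRat (coeffA0 x.1 x.2) (coeffA1 x.1 x.2) (poleC x.1) ∧
        τ₁ = tOne x.1 x.2 ∧ τ₂ = tTwo x.1 x.2 ∧
        ξ₁ + ξ₂ = critSum x.1 x.2 ∧ ξ₁ * ξ₂ = critProd x.1 x.2 := by
  constructor
  · intro h
    obtain ⟨a₀, a₁, c, k, E, hsq, hφ⟩ := h.exists_coverEquations
    obtain ⟨s, t, had, e0, e1, e2, e3, e4⟩ := E.exists_parameter hsq
    refine ⟨(s, t), ⟨had, ?_, e3, e4, ?_, ?_⟩, ?_⟩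
    · rw [hφ, e0, e1, e2]
    · rw [had.regularParameter.critSum_eq_coeff, ← e1, ← e2, E.sum]
    · rw [had.regularParameter.critProd_eq_coeff, ← e0, ← e1, ← e2, E.prod]
    · rintro ⟨s', t'⟩ ⟨had', hφ', e3', e4', e5', e6'⟩
      dsimp only at had' hφ' e3' e4' e5' e6'
      have E' := had'.coverEquations e5' e6'
      obtain ⟨b0, b1, b2⟩ := coverRat_injective E E' (hφ.symm.trans hφ')
      obtain ⟨c0, p0, -, -⟩ := E.at_zero
      obtain ⟨c1, -, -, -⟩ := E.at_one
      have n0 := had.regularParameter.one_sub_sq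
      have n0' := had'.regularParameter.one_sub_sq
      have s0 : s ≠ 0 := by
        rintro rfl
        apply c1
        rw [e2, poleC]; norm_num
      -- The pole c fixes s², and a₀ and a₁ fix s³; s ≠ 0 because c ≠ 1.
      have q2 : s ^ 2 = s' ^ 2 := by
        have := e2.symm.trans b2
        rw [poleC, poleC, div_eq_div_iff n0 n0'] at this
        linear_combination this
      have q3 : s ^ 3 = s' ^ 3 := by
        have := e1.symm.trans b1
        rw [coeffA1, coeffA1, ← e0, ← b0] at this
        apply mul_left_cancel₀ p0
        linear_combination this
      have hs : s' = s := by
        apply mul_right_cancel₀ (pow_ne_zero 2 s0)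
        linear_combination s' * q2 - q3
      subst hs
      have hd := E.discr (s := s') (by rw [e1, coeffA1, ← e0]) e2
      have hb : a₀ * (s' + 1) * (s' - 1) ^ 2 - 1 ≠ 0 := by
        intro e
        rw [e] at hd
        exact sub_ne_zero.2 E.t_ne_t' (pow_eq_zero_iff two_ne_zero |>.1 (by linear_combination hd))
      have g : ∀ t, RegularParameter s' t → a₀ = coeffA0 s' t →
          t ^ 2 * (a₀ * (s' + 1) * (s' - 1) ^ 2 - 1) = a₀ * (s' + 1) ^ 3 - 1 := by
        intro t hr e
        rw [coeffA0, eq_div_iff (mul_ne_zero hr.sp hr.discr)] at e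
        linear_combination e
      have ht : (t' - t) * (t' + t) = 0 := by
        apply mul_right_cancel₀ hb
        linear_combination g t' had'.regularParameter b0 - g t had.regularParameter e0
      -- The opposite sign of t exchanges the two labelled points, which would make τ₁ and τ₂ equal.
      rcases mul_eq_zero.1 ht with e | e
      · rw [sub_eq_zero.1 e]
      · exfalso
        apply E.t_ne_t'
        rw [e3', eq_neg_of_add_eq_zero_left e, tOne_neg, ← e4]
  · rintro ⟨⟨s, t⟩, ⟨had, hφ, e3, e4, e5, e6⟩, -⟩
    dsimp only at had hφ e3 e4 e5 e6
    rw [hφ, e3, e4]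
    exact (had.coverEquations e5 e6).isNormalizedCover had.2.2.2.2.2.2.2

/-! ### Rational functions that are regular at a base point -/

section Generic

variable {σ : Type*} {x₀ : σ → ℂ}

/-- The statement holds off a hypersurface that does not contain `x₀`. -/
def Generically (x₀ : σ → ℂ) (P : (σ → ℂ) → Prop) : Prop :=
  ∃ d : MvPolynomial σ ℂ, MvPolynomial.eval x₀ d ≠ 0 ∧ ∀ x, MvPolynomial.eval x d ≠ 0 → P x

/-- The function is given by a rational function that is regular at `x₀`. -/
def RatAt (x₀ : σ → ℂ) (f : (σ → ℂ) → ℂ) : Prop :=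
  ∃ n : MvPolynomial σ ℂ, ∃ d : MvPolynomial σ ℂ, MvPolynomial.eval x₀ d ≠ 0 ∧
    ∀ x, MvPolynomial.eval x d ≠ 0 → f x = MvPolynomial.eval x n / MvPolynomial.eval x d

namespace Generically

variable {P Q : (σ → ℂ) → Prop}

theorem and (hP : Generically x₀ P) (hQ : Generically x₀ Q) :
    Generically x₀ fun x => P x ∧ Q x := by
  obtain ⟨d, hd, h⟩ := hP
  obtain ⟨e, he, h'⟩ := hQ
  refine ⟨d * e, by simp [hd, he], fun x hx => ?_⟩
  rw [map_mul] at hx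
  exact ⟨h x (left_ne_zero_of_mul hx), h' x (right_ne_zero_of_mul hx)⟩

theorem mono (hP : Generically x₀ P) (h : ∀ x, P x → Q x) : Generically x₀ Q := by
  obtain ⟨d, hd, h'⟩ := hP
  exact ⟨d, hd, fun x hx => h x (h' x hx)⟩

end Generically

namespace RatAt

variable {f g : (σ → ℂ) → ℂ}

theorem const (c : ℂ) : RatAt x₀ fun _ => c := ⟨MvPolynomial.C c, 1, by simp, by simp⟩

theorem coord (i : σ) : RatAt x₀ fun x => x i := ⟨MvPolynomial.X i, 1, by simp, by simp⟩

theorem add (hf : RatAt x₀ f) (hg : RatAt x₀ g) : RatAt x₀ fun x => f x + g x := by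
  obtain ⟨n, d, hd, h⟩ := hf
  obtain ⟨m, e, he, h'⟩ := hg
  refine ⟨n * e + d * m, d * e, by simp [hd, he], fun x hx => ?_⟩
  rw [map_mul] at hx
  simp only [map_add, map_mul, h x (left_ne_zero_of_mul hx), h' x (right_ne_zero_of_mul hx)]
  rw [div_add_div _ _ (left_ne_zero_of_mul hx) (right_ne_zero_of_mul hx)]

theorem mul (hf : RatAt x₀ f) (hg : RatAt x₀ g) : RatAt x₀ fun x => f x * g x := by
  obtain ⟨n, d, hd, h⟩ := hf
  obtain ⟨m, e, he, h'⟩ := hg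
  refine ⟨n * m, d * e, by simp [hd, he], fun x hx => ?_⟩
  rw [map_mul] at hx
  simp only [map_mul, h x (left_ne_zero_of_mul hx), h' x (right_ne_zero_of_mul hx)]
  rw [div_mul_div_comm]

theorem neg (hf : RatAt x₀ f) : RatAt x₀ fun x => -f x := by
  simpa using (const (x₀ := x₀) (-1)).mul hf

theorem sub (hf : RatAt x₀ f) (hg : RatAt x₀ g) : RatAt x₀ fun x => f x - g x := by
  simpa [sub_eq_add_neg] using hf.add hg.neg

theorem pow (hf : RatAt x₀ f) (n : ℕ) : RatAt x₀ fun x => f x ^ n := by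
  induction n with
  | zero => simpa using const (x₀ := x₀) 1
  | succ n ih => simpa [pow_succ] using ih.mul hf

theorem congr (hf : RatAt x₀ f) (h : Generically x₀ fun x => g x = f x) : RatAt x₀ g := by
  obtain ⟨n, d, hd, h1⟩ := hf
  obtain ⟨e, he, h2⟩ := h
  refine ⟨n * e, d * e, by simp [hd, he], fun x hx => ?_⟩
  rw [map_mul] at hx
  rw [h2 x (right_ne_zero_of_mul hx), h1 x (left_ne_zero_of_mul hx), map_mul, map_mul,
    mul_div_mul_right _ _ (right_ne_zero_of_mul hx)]

theorem inv (hf : RatAt x₀ f) (h0 : f x₀ ≠ 0) : RatAt x₀ fun x => (f x)⁻¹ := by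
  obtain ⟨n, d, hd, h⟩ := hf
  have hn : MvPolynomial.eval x₀ n ≠ 0 := fun e => h0 (by rw [h x₀ hd, e, zero_div])
  refine ⟨d ^ 2, n * d, by simp [hd, hn], fun x hx => ?_⟩
  rw [map_mul] at hx
  change (f x)⁻¹ = _
  rw [h x (right_ne_zero_of_mul hx), inv_div, map_pow, map_mul, sq,
    mul_div_mul_right _ _ (right_ne_zero_of_mul hx)]

theorem div (hf : RatAt x₀ f) (hg : RatAt x₀ g) (h0 : g x₀ ≠ 0) : RatAt x₀ fun x => f x / g x := by
  simpa [div_eq_mul_inv] using hf.mul (hg.inv h0)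

theorem ne_zero (hf : RatAt x₀ f) (h0 : f x₀ ≠ 0) : Generically x₀ fun x => f x ≠ 0 := by
  obtain ⟨n, d, hd, h⟩ := hf
  have hn : MvPolynomial.eval x₀ n ≠ 0 := fun e => h0 (by rw [h x₀ hd, e, zero_div])
  refine ⟨n * d, by simp [hd, hn], fun x hx => ?_⟩
  rw [map_mul] at hx
  rw [h x (right_ne_zero_of_mul hx)]
  exact div_ne_zero (left_ne_zero_of_mul hx) (right_ne_zero_of_mul hx)

theorem contDiffAt [Fintype σ] (hf : RatAt x₀ f) : Generically x₀ fun x => ContDiffAt ℂ 1 f x := by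
  obtain ⟨n, d, hd, h⟩ := hf
  have hp : ∀ p : MvPolynomial σ ℂ, ContDiff ℂ 1 fun x => MvPolynomial.eval x p := fun p =>
    contDiff_iff_contDiffAt.2 fun x => ((AnalyticOnNhd.eval_mvPolynomial p) x trivial).contDiffAt
  refine ⟨d, hd, fun x hx => ?_⟩
  refine ((hp n).contDiffAt.div (hp d).contDiffAt hx).congr_of_eventuallyEq ?_
  filter_upwards [(hp d).continuous.continuousAt.eventually_ne hx] with y hy using h y hy

end RatAt

end Generic

/-! ### Generic points of the parameter plane -/

section GoodPoint

variable (α : ℂ)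

/-- The parameter `s` as a function of `(u, v)`. -/
def planeS (x : Fin 2 → ℂ) : ℂ := paramS α (x 0) (x 1)

/-- The parameter `t` as a function of `(u, v)`. -/
def planeT (x : Fin 2 → ℂ) : ℂ := paramT α (x 0) (x 1)

/-- The parameter `w` as a function of `(u, v)`. -/
def planeW (x : Fin 2 → ℂ) : ℂ := paramW α (x 1)

/-- The coefficient `a₀` as a function of `(u, v)`. -/
def planeA0 (x : Fin 2 → ℂ) : ℂ := coeffA0 (planeS α x) (planeT α x)

/-- The coefficient `a₁` as a function of `(u, v)`. -/
def planeA1 (x : Fin 2 → ℂ) : ℂ := coeffA1 (planeS α x) (planeT α x)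

/-- The pole `c` as a function of `(u, v)`. -/
def planeC (x : Fin 2 → ℂ) : ℂ := poleC (planeS α x)

/-- The points `(u, v)` at which the construction is not degenerate. -/
structure GoodPoint (x : Fin 2 → ℂ) : Prop where
  regular : RegularPoint α (x 0) (x 1)
  v_ne_zero : x 1 ≠ 0
  t_ne_zero : planeT α x ≠ 0
  admissible : Admissible (planeS α x) (planeT α x)
  critical : solQ α x 0 ≠ solQ α x 1
  contDiffAt_T : ∀ i, ContDiffAt ℂ 1 (fun y => solT α y i) x
  contDiffAt_Q : ∀ i, ContDiffAt ℂ 1 (fun y => solQ α y i) x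
  contDiffAt_W : ContDiffAt ℂ 1 (planeW α) x
  contDiffAt_S : ContDiffAt ℂ 1 (planeS α) x
  contDiffAt_t : ContDiffAt ℂ 1 (planeT α) x
  contDiffAt_A0 : ContDiffAt ℂ 1 (planeA0 α) x
  contDiffAt_A1 : ContDiffAt ℂ 1 (planeA1 α) x
  contDiffAt_C : ContDiffAt ℂ 1 (planeC α) x
  contDiffAt_K : ContDiffAt ℂ 1 (fun y => planeA0 α y ^ 2 / planeC α y ^ 3) x

variable {α} (hα : α ^ 2 = -3)

/-- A point at which nothing degenerates. -/
def basePoint : Fin 2 → ℂ := ![2, Complex.I]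

/-- At the base point v² = -1, so w = 0. There s and t are rational numbers that do not depend on α,
and the nondegeneracy conditions in (s, t) can be checked numerically. -/
theorem planeW_basePoint : planeW α basePoint = 0 := by
  simp [planeW, paramW, basePoint]

theorem planeS_basePoint : planeS α basePoint = -11 := by
  have : paramW α Complex.I = 0 := planeW_basePoint
  simp [planeS, paramS, basePoint, this]
  norm_num

theorem planeT_basePoint : planeT α basePoint = 4 / 3 := by
  have : paramW α Complex.I = 0 := planeW_basePoint
  have h : paramS α 2 Complex.I = -11 := planeS_basePoint
  simp [planeT, paramT, basePoint, this, h]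
  norm_num

include hα in
theorem regularPoint_basePoint : RegularPoint α (basePoint 0) (basePoint 1) := by
  have hI : Complex.I ^ 2 = -1 := Complex.I_sq
  have hn : (1 : ℂ) - Complex.I ^ 2 ≠ 0 := by rw [hI]; norm_num
  have hw : (0 : ℂ) * (1 - Complex.I ^ 2) = 2 * α * (1 + Complex.I ^ 2) := by rw [hI]; ring
  have hA := factorA_mul (u := 2) hα hw
  have hB := factorB_mul (u := 2) hα hw
  have hC := factorC_mul (u := 2) hα hw
  have hM := factorM_eq (u := 2) hw
  have b1 := RegularPoint.four_mul_sub_one hα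
  have b2 := RegularPoint.four_mul_add_one hα
  have hA0 : factorAp α 2 Complex.I * factorAm α 2 Complex.I ≠ 0 := by
    rw [hA, hI]; norm_num
  have hB0 : factorBp α 2 Complex.I * factorBm α 2 Complex.I ≠ 0 := by
    rw [hB, hI]; simp only [mul_zero, sub_zero, add_zero]; norm_num [b1]
  have hC0 : factorCp α 2 Complex.I * factorCm α 2 Complex.I ≠ 0 := by
    rw [hC, hI]; simp only [mul_zero, add_zero, zero_add]; norm_num [b2]
    intro h; exact b2 (by linear_combination -h)
  have hM0 : factorM α 2 Complex.I ≠ 0 := by rw [hM, hI]; norm_num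
  have hv : (Complex.I + 1) * (Complex.I - 1) ≠ 0 := by
    have : (Complex.I + 1) * (Complex.I - 1) = -2 := by linear_combination hI
    rw [this]; norm_num
  simp only [basePoint, Matrix.cons_val_zero, Matrix.cons_val_one]
  exact ⟨left_ne_zero_of_mul hv, right_ne_zero_of_mul hv, by norm_num, by norm_num,
    left_ne_zero_of_mul hA0, right_ne_zero_of_mul hA0, left_ne_zero_of_mul hB0,
    right_ne_zero_of_mul hB0, left_ne_zero_of_mul hC0, right_ne_zero_of_mul hC0, hM0⟩

include hα in
theorem generically_regularPoint :
    Generically basePoint fun x => RegularPoint α (x 0) (x 1) := by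
  have h := regularPoint_basePoint hα
  have key : ∀ f : MvPolynomial (Fin 2) ℂ, MvPolynomial.eval basePoint f ≠ 0 →
      Generically basePoint fun x => MvPolynomial.eval x f ≠ 0 := fun f hf => ⟨f, hf, fun x hx => hx⟩
  have hX : ∀ x : Fin 2 → ℂ, MvPolynomial.eval x (MvPolynomial.C α) = α ∧ MvPolynomial.eval x (MvPolynomial.X 0 : MvPolynomial (Fin 2) ℂ) = x 0 ∧
    MvPolynomial.eval x (MvPolynomial.X 1 : MvPolynomial (Fin 2) ℂ) = x 1 := fun x => by simp
  have k1 := key (MvPolynomial.X 1 + 1) (by simpa using h.vp)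
  have k2 := key (MvPolynomial.X 1 - 1) (by simpa using h.vm)
  have k3 := key (MvPolynomial.X 0 + 1) (by simpa using h.up)
  have k4 := key (MvPolynomial.X 0 - 1) (by simpa using h.um)
  have k5 := key (factorAp (MvPolynomial.C α) (MvPolynomial.X 0) (MvPolynomial.X 1)) (by simpa [factorAp] using h.Ap)
  have k6 := key (factorAm (MvPolynomial.C α) (MvPolynomial.X 0) (MvPolynomial.X 1)) (by simpa [factorAm] using h.Am)
  have k7 := key (factorBp (MvPolynomial.C α) (MvPolynomial.X 0) (MvPolynomial.X 1)) (by simpa [factorBp] using h.Bp)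
  have k8 := key (factorBm (MvPolynomial.C α) (MvPolynomial.X 0) (MvPolynomial.X 1)) (by simpa [factorBm] using h.Bm)
  have k9 := key (factorCp (MvPolynomial.C α) (MvPolynomial.X 0) (MvPolynomial.X 1)) (by simpa [factorCp] using h.Cp)
  have k10 := key (factorCm (MvPolynomial.C α) (MvPolynomial.X 0) (MvPolynomial.X 1)) (by simpa [factorCm] using h.Cm)
  have k11 := key (factorM (MvPolynomial.C α) (MvPolynomial.X 0) (MvPolynomial.X 1)) (by simpa [factorM] using h.M)
  refine ((((((((((k1.and k2).and k3).and k4).and k5).and k6).and k7).and k8).and k9).and k10).and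
    k11).mono fun x hx => ?_
  obtain ⟨⟨⟨⟨⟨⟨⟨⟨⟨⟨h1, h2⟩, h3⟩, h4⟩, h5⟩, h6⟩, h7⟩, h8⟩, h9⟩, h10⟩, h11⟩ := hx
  exact ⟨by simpa using h1, by simpa using h2, by simpa using h3, by simpa using h4,
    by simpa [factorAp] using h5, by simpa [factorAm] using h6, by simpa [factorBp] using h7,
    by simpa [factorBm] using h8, by simpa [factorCp] using h9, by simpa [factorCm] using h10,
    by simpa [factorM] using h11⟩

theorem ratAt_W : RatAt basePoint (planeW α) := by
  have hv := RatAt.coord (x₀ := basePoint) 1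
  refine (((RatAt.const (2 * α)).mul ((RatAt.const 1).add (hv.pow 2))).div
    ((RatAt.const 1).sub (hv.pow 2)) ?_)
  simp [basePoint]

theorem ratAt_S : RatAt basePoint (planeS α) := by
  have hu := RatAt.coord (x₀ := basePoint) 0
  have hw := ratAt_W (α := α)
  refine ((((RatAt.const 3).mul (hu.pow 2)).add (hw.mul hu)).sub (RatAt.const 1)).neg.div
    (((hu.pow 2).sub (RatAt.const 3)).sub (hu.mul hw)) ?_
  rw [show paramW α (basePoint 1) = 0 from planeW_basePoint]
  simp [basePoint]
  norm_num

theorem ratAt_t : RatAt basePoint (planeT α) := by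
  have hu := RatAt.coord (x₀ := basePoint) 0
  have hw := ratAt_W (α := α)
  refine (((RatAt.const 4).mul hu).mul ((hw.mul hu).add (RatAt.const 2))).neg.div
    ((((hu.pow 2).sub (RatAt.const 3)).sub (hu.mul hw)).mul (ratAt_S.sub (RatAt.const 1))) ?_
  rw [show paramW α (basePoint 1) = 0 from planeW_basePoint,
    show paramS α (basePoint 0) (basePoint 1) = -11 from planeS_basePoint]
  simp [basePoint]
  norm_num

theorem ratAt_A0 : RatAt basePoint (planeA0 α) := by
  have hs := ratAt_S (α := α)
  have ht := ratAt_t (α := α)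
  have c1 := RatAt.const (x₀ := basePoint) 1
  refine ((ht.pow 2).sub c1).div ((hs.add c1).mul ((((hs.sub c1).pow 2).mul (ht.pow 2)).sub
    ((hs.add c1).pow 2))) ?_
  rw [planeS_basePoint, planeT_basePoint]
  norm_num

theorem ratAt_A1 : RatAt basePoint (planeA1 α) :=
  ((ratAt_A0.mul ((ratAt_S.pow 3).sub (RatAt.const 1))).sub (RatAt.const 1))

theorem ratAt_C : RatAt basePoint (planeC α) := by
  refine (RatAt.const 1).div ((RatAt.const 1).sub (ratAt_S.pow 2)) ?_
  rw [planeS_basePoint]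
  norm_num

theorem ratAt_K : RatAt basePoint fun y => planeA0 α y ^ 2 / planeC α y ^ 3 := by
  refine (ratAt_A0.pow 2).div (ratAt_C.pow 3) ?_
  rw [planeC, planeS_basePoint, poleC]
  norm_num

theorem ratAt_tOne : RatAt basePoint fun y => tOne (planeS α y) (planeT α y) := by
  have hs := ratAt_S (α := α)
  have ht := ratAt_t (α := α)
  have c1 := RatAt.const (x₀ := basePoint) 1
  refine ((ht.add c1).mul ((((hs.mul ht).sub ht).sub c1).sub ((RatAt.const 3).mul hs))).neg.div
    ((((((hs.mul ht).sub ht).sub c1).sub hs).pow 2).mul (hs.add c1)) ?_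
  rw [planeS_basePoint, planeT_basePoint]
  norm_num

theorem ratAt_tTwo : RatAt basePoint fun y => tTwo (planeS α y) (planeT α y) := by
  have hs := ratAt_S (α := α)
  have ht := ratAt_t (α := α)
  have c1 := RatAt.const (x₀ := basePoint) 1
  refine (((RatAt.const (-1)).add ht).mul ((((hs.mul ht).sub ht).add c1).add
    ((RatAt.const 3).mul hs))).neg.div
    ((((((hs.mul ht).sub ht).add hs).add c1).pow 2).mul (hs.add c1)) ?_
  rw [planeS_basePoint, planeT_basePoint]
  norm_num

include hα in
theorem ratAt_solT (i : Fin 2) : RatAt basePoint fun y => solT α y i := by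
  fin_cases i
  · exact ratAt_tOne.congr ((generically_regularPoint hα).mono fun x hx => hx.solT1_eq hα)
  · exact ratAt_tTwo.congr ((generically_regularPoint hα).mono fun x hx => hx.solT2_eq hα)

-- The sum and the product of q₁, q₂ are rational in s and t, but q₁ itself is not, so the explicit
-- quotients are used. Their denominators are products of factors from `RegularPoint`.
include hα in
theorem ratAt_solQ (i : Fin 2) : RatAt basePoint fun y => solQ α y i := by
  obtain ⟨h1, h2, -, -, -, -, h3, h4, h5, h6, h7⟩ := regularPoint_basePoint hα
  have key : ∀ (n d : MvPolynomial (Fin 2) ℂ) (g : (Fin 2 → ℂ) → ℂ), MvPolynomial.eval basePoint d ≠ 0 →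
      (∀ x, g x = MvPolynomial.eval x n / MvPolynomial.eval x d) → RatAt basePoint g := fun n d g hd hg =>
    ⟨n, d, hd, fun x _ => hg x⟩
  fin_cases i
  · refine key (MvPolynomial.C (-(7 / 2)) * factorAm (MvPolynomial.C α) (MvPolynomial.X 0) (MvPolynomial.X 1) * MvPolynomial.X 0 * (2 * MvPolynomial.X 1 + 1 - MvPolynomial.C α)
      * (2 * MvPolynomial.X 1 + 1 + MvPolynomial.C α) * factorAp (MvPolynomial.C α) (MvPolynomial.X 0) (MvPolynomial.X 1) ^ 2)
      (factorM (MvPolynomial.C α) (MvPolynomial.X 0) (MvPolynomial.X 1) * factorBm (MvPolynomial.C α) (MvPolynomial.X 0) (MvPolynomial.X 1) * factorCm (MvPolynomial.C α) (MvPolynomial.X 0) (MvPolynomial.X 1)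
        * (MvPolynomial.X 1 + 1)) _ ?_ ?_
    · simpa [factorM, factorBm, factorCm] using ⟨⟨⟨h7, h4⟩, h6⟩, h1⟩
    · intro x
      simp [solQ, solQ1, factorM, factorBm, factorCm, factorAp, factorAm]
  · refine key (MvPolynomial.C (-(7 / 2)) * factorAp (MvPolynomial.C α) (MvPolynomial.X 0) (MvPolynomial.X 1) * MvPolynomial.X 0 * (2 * MvPolynomial.X 1 - 1 + MvPolynomial.C α)
      * (2 * MvPolynomial.X 1 - 1 - MvPolynomial.C α) * factorAm (MvPolynomial.C α) (MvPolynomial.X 0) (MvPolynomial.X 1) ^ 2)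
      (factorM (MvPolynomial.C α) (MvPolynomial.X 0) (MvPolynomial.X 1) * factorCp (MvPolynomial.C α) (MvPolynomial.X 0) (MvPolynomial.X 1) * factorBp (MvPolynomial.C α) (MvPolynomial.X 0) (MvPolynomial.X 1)
        * (MvPolynomial.X 1 - 1)) _ ?_ ?_
    · simpa [factorM, factorBp, factorCp] using ⟨⟨⟨h7, h5⟩, h3⟩, h2⟩
    · intro x
      simp [solQ, solQ2, factorM, factorBp, factorCp, factorAp, factorAm]

theorem generically_admissible :
    Generically basePoint fun x => Admissible (planeS α x) (planeT α x) := by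
  have hs := ratAt_S (α := α)
  have ht := ratAt_t (α := α)
  have c1 := RatAt.const (x₀ := basePoint) 1
  have k1 := ((hs.pow 2).sub c1).ne_zero (by rw [planeS_basePoint]; norm_num)
  have k2 := ((((hs.sub c1).pow 2).mul (ht.pow 2)).sub ((hs.add c1).pow 2)).ne_zero
    (by rw [planeS_basePoint, planeT_basePoint]; norm_num)
  have f1 := ratAt_tOne (α := α)
  have f2 := ratAt_tTwo (α := α)
  have k3 := f1.ne_zero (by rw [planeS_basePoint, planeT_basePoint, tOne]; norm_num)
  have k4 := (f1.sub c1).ne_zero (by rw [planeS_basePoint, planeT_basePoint, tOne]; norm_num)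
  have k5 := f2.ne_zero (by rw [planeS_basePoint, planeT_basePoint, tTwo]; norm_num)
  have k6 := (f2.sub c1).ne_zero (by rw [planeS_basePoint, planeT_basePoint, tTwo]; norm_num)
  have k7 := (f1.sub f2).ne_zero
    (by rw [planeS_basePoint, planeT_basePoint, tOne, tTwo]; norm_num)
  have k8 := ((ratAt_A1.pow 2).sub ((RatAt.const 4).mul (ratAt_A0 (α := α)))).ne_zero
    (by rw [planeA1, planeA0, planeS_basePoint, planeT_basePoint, coeffA1, coeffA0]; norm_num)
  refine (((((((k1.and k2).and k3).and k4).and k5).and k6).and k7).and k8).mono fun x hx => ?_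
  obtain ⟨⟨⟨⟨⟨⟨⟨h1, h2⟩, h3⟩, h4⟩, h5⟩, h6⟩, h7⟩, h8⟩ := hx
  exact ⟨sub_ne_zero.1 h1, sub_ne_zero.1 h2, h3, sub_ne_zero.1 h4, h5, sub_ne_zero.1 h6,
    sub_ne_zero.1 h7, sub_ne_zero.1 h8⟩

include hα in
theorem generically_goodPoint : Generically basePoint (GoodPoint α) := by
  have hv := (RatAt.coord (x₀ := basePoint) 1).ne_zero (by simp [basePoint])
  have ht := (ratAt_t (α := α)).ne_zero (by rw [planeT_basePoint]; norm_num)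
  have hQ := ((ratAt_solQ hα 0).sub (ratAt_solQ hα 1)).ne_zero (by
    have h := regularPoint_basePoint hα
    have e1 := h.solQ_add hα
    have e2 := h.solQ_mul hα
    have hS : paramS α (basePoint 0) (basePoint 1) = -11 := planeS_basePoint
    have hT : paramT α (basePoint 0) (basePoint 1) = 4 / 3 := planeT_basePoint
    rw [hS, hT] at e1 e2
    intro e
    have e3 : solQ1 α (basePoint 0) (basePoint 1) - solQ2 α (basePoint 0) (basePoint 1) = 0 := e
    -- The discriminant (q₁ - q₂)² is symmetric, hence a computable number at the base point.
    have e4 : critSum (-11 : ℂ) (4 / 3) ^ 2 - 4 * critProd (-11 : ℂ) (4 / 3) = 0 := by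
      rw [← e1, ← e2]
      linear_combination (solQ1 α (basePoint 0) (basePoint 1)
        - solQ2 α (basePoint 0) (basePoint 1)) * e3
    rw [critSum, critProd] at e4
    norm_num at e4)
  refine ((((((((((((((generically_regularPoint hα).and hv).and ht).and
    (generically_admissible (α := α))).and hQ).and (ratAt_solT hα 0).contDiffAt).and
    (ratAt_solT hα 1).contDiffAt).and (ratAt_solQ hα 0).contDiffAt).and
    (ratAt_solQ hα 1).contDiffAt).and (ratAt_W (α := α)).contDiffAt).and (ratAt_S (α := α)).contDiffAt).and
    (ratAt_t (α := α)).contDiffAt).and ((ratAt_A0 (α := α)).contDiffAt.and (ratAt_A1 (α := α)).contDiffAt)).and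
    ((ratAt_C (α := α)).contDiffAt.and (ratAt_K (α := α)).contDiffAt)).mono fun x hx => ?_
  obtain ⟨⟨⟨⟨⟨⟨⟨⟨⟨⟨⟨⟨⟨h1, h2⟩, h3⟩, h4⟩, h5⟩, h6⟩, h7⟩, h8⟩, h9⟩, h10⟩, h11⟩, h12⟩, h13, h14⟩,
    h15, h16⟩ := hx
  exact ⟨h1, h2, h3, h4, sub_ne_zero.1 h5, Fin.forall_fin_two.2 ⟨h6, h7⟩,
    Fin.forall_fin_two.2 ⟨h8, h9⟩, h10, h11, h12, h13, h14, h15, h16⟩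

end GoodPoint

/-! ### Local inverses and the Garnier system -/

/-- Differentiates the six relations along a curve of covers. It serves both for lines in the (u, v)
plane and for the motion of a single time. -/
theorem CoverVariation.of_hasDerivAt {a₀ a₁ c k t t' q r : ℂ → ℂ}
    {a₀' a₁' c' k' τ τ' q' r' z : ℂ} (h0 : HasDerivAt a₀ a₀' z) (h1 : HasDerivAt a₁ a₁' z)
    (hc : HasDerivAt c c' z) (hk : HasDerivAt k k' z) (ht : HasDerivAt t τ z)
    (ht' : HasDerivAt t' τ' z) (hq : HasDerivAt q q' z) (hr : HasDerivAt r r' z)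
    (h : ∀ᶠ w in nhds z, CoverEquations (a₀ w) (a₁ w) (c w) (k w) (t w) (t' w) (q w) (r w)) :
    CoverVariation (a₀ z) (a₁ z) (c z) (k z) (t z) (t' z) (q z) (r z) a₀' a₁' c' k' τ τ' q' r' := by
  have key : ∀ {f g : ℂ → ℂ} {f' g' : ℂ}, HasDerivAt f f' z → HasDerivAt g g' z →
      (∀ᶠ w in nhds z, f w = g w) → f' = g' := fun hf hg e =>
    hf.unique (hg.congr_of_eventuallyEq e)
  refine ⟨?_, ?_, ?_, ?_, ?_, ?_⟩
  · have := key (((hasDerivAt_const z (1 : ℂ)).add ht).add ht').neg ((h1.const_mul 2).add hk)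
      (h.mono fun w hw => hw.cubic)
    linear_combination this
  · have := key ((ht.add ht').add (ht.mul ht')) (((h1.pow 2).add (h0.const_mul 2)).sub
      ((hk.const_mul 3).mul hc)) (h.mono fun w hw => hw.quadratic)
    push_cast at this
    linear_combination this
  · have := key (ht.mul ht').neg (((h0.const_mul 2).mul h1).add ((hk.const_mul 3).mul (hc.pow 2)))
      (h.mono fun w hw => hw.linear)
    simp only [Pi.pow_apply] at this
    push_cast at this
    linear_combination this
  · have := key (h0.pow 2) (hk.mul (hc.pow 3)) (h.mono fun w hw => hw.constant)
    simp only [Pi.pow_apply] at this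
    push_cast at this
    linear_combination this
  · exact key (hq.add hr) ((hc.const_mul 4).add h1) (h.mono fun w hw => hw.sum)
  · have := key (hq.mul hr) ((((h1.const_mul 2).mul hc).neg).sub (h0.const_mul 3))
      (h.mono fun w hw => hw.prod)
    linear_combination this

section Local

variable {α : ℂ} (hα : α ^ 2 = -3)

include hα in
theorem GoodPoint.coverRelations {x : Fin 2 → ℂ} (h : GoodPoint α x) :
    CoverRelations (planeA0 α x) (planeA1 α x) (planeC α x) (planeA0 α x ^ 2 / planeC α x ^ 3)
      (solT α x 0) (solT α x 1) (solQ α x 0) (solQ α x 1) := by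
  have hr := h.regular
  have e := h.admissible.coverEquations (hr.solQ_add hα) (hr.solQ_mul hα)
  rw [planeS, planeT, ← hr.solT1_eq hα, ← hr.solT2_eq hα] at e
  exact ⟨e, h.critical⟩

/-- The derivative of `(u, v) ↦ (t₁, t₂)` is injective at a good point. -/
theorem GoodPoint.injective_deriv {U : Set (Fin 2 → ℂ)} (hU : IsOpen U)
    (hgood : ∀ x ∈ U, GoodPoint α x) {x : Fin 2 → ℂ} (hx : x ∈ U) (hα : α ^ 2 = -3)
    {T' : (Fin 2 → ℂ) →L[ℂ] (Fin 2 → ℂ)} (hT : HasFDerivAt (solT α) T' x) (η : Fin 2 → ℂ)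
    (hη : T' η = 0) : η = 0 := by
  have g := hgood x hx
  have hline : HasDerivAt (fun z : ℂ => x + z • η) η 0 := by
    simpa using ((hasDerivAt_id (0 : ℂ)).smul_const η).const_add x
  have hx0 : x + (0 : ℂ) • η = x := by simp
  have comp : ∀ {f : (Fin 2 → ℂ) → ℂ}, ContDiffAt ℂ 1 f x →
      HasDerivAt (fun z : ℂ => f (x + z • η)) (fderiv ℂ f x η) 0 := by
    intro f hf
    have := (hf.differentiableAt one_ne_zero).hasFDerivAt
    rw [← hx0] at this
    simpa only [hx0, Function.comp_def] using this.comp_hasDerivAt (0 : ℂ) hline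
  have hT0 : ∀ i, HasDerivAt (fun z : ℂ => solT α (x + z • η) i) 0 0 := by
    intro i
    have := (hasFDerivAt_pi'.1 hT i)
    rw [← hx0] at this
    have := this.comp_hasDerivAt (0 : ℂ) hline
    simpa [hη, Function.comp_def] using this
  have hev : ∀ᶠ z : ℂ in nhds 0, x + z • η ∈ U :=
    hline.continuousAt.eventually (by simpa only [hx0] using hU.eventually_mem hx)
  have hvar := CoverVariation.of_hasDerivAt (comp g.contDiffAt_A0) (comp g.contDiffAt_A1)
    (comp g.contDiffAt_C) (comp g.contDiffAt_K) (hT0 0) (hT0 1) (comp (g.contDiffAt_Q 0))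
    (comp (g.contDiffAt_Q 1))
    (hev.mono fun z hz => ((hgood _ hz).coverRelations hα).toCoverEquations)
  simp only [hx0] at hvar
  have hrel := g.coverRelations hα
  -- Along the line x + zη both t₁ and t₂ are stationary at z = 0, so rigidity makes the
  -- coefficients of the cover stationary.
  obtain ⟨d0, d1, dc⟩ := hvar.rigid hrel
  have D0 := comp g.contDiffAt_A0
  have Dc := comp g.contDiffAt_C
  have Ds := comp g.contDiffAt_S
  have Dt := comp g.contDiffAt_t
  have Dw := comp g.contDiffAt_W
  rw [d0] at D0
  rw [dc] at Dc
  have Du : HasDerivAt (fun z : ℂ => (x + z • η) 0) (η 0) 0 := (hasDerivAt_pi.1 hline) 0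
  have Dv : HasDerivAt (fun z : ℂ => (x + z • η) 1) (η 1) 0 := (hasDerivAt_pi.1 hline) 1
  have key : ∀ {f g : ℂ → ℂ} {f' g' : ℂ}, HasDerivAt f f' 0 → HasDerivAt g g' 0 →
      (∀ᶠ w in nhds 0, f w = g w) → f' = g' := fun hf hg e =>
    hf.unique (hg.congr_of_eventuallyEq e)
  have hreg := g.regular
  have hp := g.admissible.regularParameter
  have c0 := hrel.at_zero.1
  have c1 := hrel.at_one.1
  -- From here the vanishing of derivatives passes from c to s, then to t, u, w and finally v. Each
  -- step differentiates a polynomial relation in which the next derivative has a nonzero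
  -- coefficient.
  have E1 : ∀ y ∈ U, planeC α y * (1 - planeS α y ^ 2) = 1 := fun y hy =>
    one_div_mul_cancel ((hgood y hy).admissible.regularParameter.one_sub_sq)
  have s0 : planeS α x ≠ 0 := by
    intro e
    have := E1 x hx
    rw [e] at this
    apply c1
    linear_combination -this
  have F1 := key (Dc.mul ((hasDerivAt_const (0 : ℂ) (1 : ℂ)).sub (Ds.pow 2)))
    (hasDerivAt_const (0 : ℂ) (1 : ℂ)) (hev.mono fun z hz => E1 _ hz)
  simp only [zero_smul, add_zero, Pi.pow_apply, Pi.sub_apply] at F1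
  have ds : fderiv ℂ (planeS α) x η = 0 := by
    apply mul_left_cancel₀ (mul_ne_zero (mul_ne_zero two_ne_zero c0) s0)
    push_cast at F1
    linear_combination -F1
  rw [ds] at Ds
  have E2 : ∀ y ∈ U, planeT α y ^ 2 * (planeA0 α y * (planeS α y + 1) * (planeS α y - 1) ^ 2 - 1)
      = planeA0 α y * (planeS α y + 1) ^ 3 - 1 := by
    intro y hy
    have hp := (hgood y hy).admissible.regularParameter
    have e : planeA0 α y = _ := rfl
    rw [planeA0, coeffA0, eq_div_iff (mul_ne_zero hp.sp hp.discr), ← coeffA0] at e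
    rw [planeA0]
    linear_combination e
  have F2 := key ((Dt.pow 2).mul (((D0.mul (Ds.add_const 1)).mul
      ((Ds.sub_const 1).pow 2)).sub_const 1)) ((D0.mul ((Ds.add_const 1).pow 3)).sub_const 1)
    (hev.mono fun z hz => E2 _ hz)
  simp only [zero_smul, add_zero, Pi.pow_apply, Pi.mul_apply] at F2
  have hb : planeA0 α x * (planeS α x + 1) * (planeS α x - 1) ^ 2 - 1 ≠ 0 := by
    intro e
    have := hrel.discr (s := planeS α x) rfl rfl
    rw [e] at this
    exact sub_ne_zero.2 hrel.t_ne_t' (pow_eq_zero_iff two_ne_zero |>.1 (by linear_combination this))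
  have dt : fderiv ℂ (planeT α) x η = 0 := by
    apply mul_left_cancel₀ (mul_ne_zero (mul_ne_zero two_ne_zero g.t_ne_zero) hb)
    push_cast at F2
    linear_combination F2
  rw [dt] at Dt
  have he : ∀ y ∈ U, y 0 ^ 2 - 3 - y 0 * planeW α y ≠ 0 := fun y hy =>
    (hgood y hy).regular.denom_ne_zero hα
  have E3 : ∀ y ∈ U, y 0 * (planeS α y + 3) = planeT α y * (planeS α y - 1) := by
    intro y hy
    have e1 := s_add_three (s := planeS α y) (y 0) (planeW α y) (he y hy) rfl
    have e2 := s_sub_one_mul_t (s := planeS α y) (t := planeT α y) (y 0) (planeW α y) (he y hy) rfl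
      (hgood y hy).regular.one_sub_u_sq rfl
    rw [e1, mul_comm (planeT α y), e2]
    ring
  have F3 := key (Du.mul (Ds.add_const 3)) (Dt.mul (Ds.sub_const 1)) (hev.mono fun z hz => E3 _ hz)
  simp only [zero_smul, Pi.zero_apply, add_zero, Pi.add_apply] at F3
  have s3 : planeS α x + 3 ≠ 0 := by
    intro e
    have := E3 x hx
    rw [e, mul_zero] at this
    exact mul_ne_zero g.t_ne_zero hp.sm this.symm
  have u0 : x 0 ≠ 0 := by
    intro e
    have := E3 x hx
    rw [e, zero_mul] at this
    exact mul_ne_zero g.t_ne_zero hp.sm this.symm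
  have du : η 0 = 0 := by
    apply mul_right_cancel₀ s3
    linear_combination F3
  rw [du] at Du
  have E4 : ∀ y ∈ U, planeS α y * (y 0 ^ 2 - 3 - y 0 * planeW α y)
      = -(3 * y 0 ^ 2 + planeW α y * y 0 - 1) := fun y hy => div_mul_cancel₀ _ (he y hy)
  have F4 := key (Ds.mul (((Du.pow 2).sub_const 3).sub (Du.mul Dw)))
    ((((Du.pow 2).const_mul 3).add (Dw.mul Du)).sub_const 1).neg (hev.mono fun z hz => E4 _ hz)
  simp only [zero_smul, Pi.zero_apply, add_zero, Pi.pow_apply, Pi.add_apply] at F4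
  have dw : fderiv ℂ (planeW α) x η = 0 := by
    apply mul_left_cancel₀ (mul_ne_zero u0 hp.sm)
    push_cast at F4
    linear_combination -F4
  rw [dw] at Dw
  have E5 : ∀ y ∈ U, planeW α y * (1 - y 1 ^ 2) = 2 * α * (1 + y 1 ^ 2) := fun y hy =>
    paramW_mul (hgood y hy).regular.one_sub_v_sq
  have F5 := key (Dw.mul ((Dv.pow 2).const_sub 1)) (((Dv.pow 2).const_add 1).const_mul (2 * α))
    (hev.mono fun z hz => E5 _ hz)
  simp only [zero_smul, Pi.zero_apply, add_zero, Pi.pow_apply, Pi.add_apply] at F5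
  have a0 : α ≠ 0 := by rintro rfl; norm_num at hα
  have hw : planeW α x + 2 * α ≠ 0 := by
    intro e
    have := E5 x hx
    exact mul_ne_zero (by norm_num : (4 : ℂ) ≠ 0) a0 (by linear_combination (1 - x 1 ^ 2) * e - this)
  have dv : η 1 = 0 := by
    apply mul_left_cancel₀ (mul_ne_zero (mul_ne_zero two_ne_zero g.v_ne_zero) hw)
    push_cast at F5
    linear_combination -F5
  funext i
  fin_cases i
  · exact du
  · exact dv

/-- The inverse function theorem, using injectivity of the derivative in dimension two. The target
is cut down to the points whose preimage stays in U; there the derivative is invertible everywhere,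
so the inverse is holomorphic on all of V. -/
theorem exists_localInverse {U : Set (Fin 2 → ℂ)} (hU : IsOpen U)
    (hgood : ∀ x ∈ U, GoodPoint α x) {x : Fin 2 → ℂ} (hx : x ∈ U) (hα : α ^ 2 = -3) :
    ∃ (V : Set (Fin 2 → ℂ)) (G : (Fin 2 → ℂ) → Fin 2 → ℂ), IsOpen V ∧ solT α x ∈ V ∧
      G (solT α x) = x ∧ DifferentiableOn ℂ G V ∧ ∀ τ ∈ V, G τ ∈ U ∧ solT α (G τ) = τ := by
  have hcd : ∀ y ∈ U, ContDiffAt ℂ 1 (solT α) y := fun y hy =>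
    contDiffAt_pi.2 (hgood y hy).contDiffAt_T
  have hequiv : ∀ y ∈ U, ∃ E : (Fin 2 → ℂ) ≃L[ℂ] (Fin 2 → ℂ),
      HasStrictFDerivAt (solT α) (E : (Fin 2 → ℂ) →L[ℂ] (Fin 2 → ℂ)) y := by
    intro y hy
    have hs := (hcd y hy).hasStrictFDerivAt one_ne_zero
    have hinj : Function.Injective (fderiv ℂ (solT α) y : (Fin 2 → ℂ) →ₗ[ℂ] (Fin 2 → ℂ)) := by
      rw [← LinearMap.ker_eq_bot, LinearMap.ker_eq_bot']
      exact fun η hη => GoodPoint.injective_deriv hU hgood hy hα hs.hasFDerivAt η hη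
    refine ⟨(LinearEquiv.ofInjectiveEndo _ hinj).toContinuousLinearEquiv, ?_⟩
    have e : ((LinearEquiv.ofInjectiveEndo _ hinj).toContinuousLinearEquiv :
        (Fin 2 → ℂ) →L[ℂ] (Fin 2 → ℂ)) = fderiv ℂ (solT α) y := ContinuousLinearMap.ext fun _ => rfl
    rw [e]
    exact hs
  obtain ⟨E, hE⟩ := hequiv x hx
  let e := hE.toOpenPartialHomeomorph (solT α)
  have he : ∀ y, e y = solT α y := fun y => rfl
  have hxe : x ∈ e.source := hE.mem_toOpenPartialHomeomorph_source
  refine ⟨e.target ∩ e.symm ⁻¹' U, e.symm, e.symm.isOpen_inter_preimage hU,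
    ⟨e.map_source hxe, ?_⟩, e.left_inv hxe, ?_, fun τ hτ => ⟨hτ.2, e.right_inv hτ.1⟩⟩
  · change e.symm (e x) ∈ U
    rwa [e.left_inv hxe]
  · intro τ hτ
    obtain ⟨E', hE'⟩ := hequiv _ hτ.2
    exact (e.hasFDerivAt_symm hτ.1 hE'.hasFDerivAt).differentiableAt.differentiableWithinAt

theorem CoverRelations.reindex {a₀ a₁ c k : ℂ} {t q : Fin 2 → ℂ}
    (h : CoverRelations a₀ a₁ c k (t 0) (t 1) (q 0) (q 1)) (i j : Fin 2) :
    CoverRelations a₀ a₁ c k (t i) (t (1 - i)) (q j) (q (1 - j)) := by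
  fin_cases i <;> fin_cases j
  · exact h
  · exact h.swap_critical
  · exact h.swap_times
  · exact h.swap_times.swap_critical

/-- Along a branch G the covers satisfy `CoverRelations` with prescribed times, so moving τ j alone
gives a `CoverVariation` with speeds 1 and 0. Then `velocity` and `force` are the two Hamilton
equations for p = μ/(q - c). -/
theorem isGarnierSolution {U V : Set (Fin 2 → ℂ)}
    (hgood : ∀ x ∈ U, GoodPoint α x) {G : (Fin 2 → ℂ) → Fin 2 → ℂ} (hV : IsOpen V)
    (hG : DifferentiableOn ℂ G V) (hGV : ∀ τ ∈ V, G τ ∈ U ∧ solT α (G τ) = τ) (hα : α ^ 2 = -3)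
    {θ μ : ℂ} (hθ : θ = (4 * μ + 1) / 6) (p : (Fin 2 → ℂ) → Fin 2 → ℂ)
    (hp : ∀ x ∈ U, ∀ k, p x k = μ / (solQ α x k - planeC α x)) :
    IsGarnierSolution θ θ (1 / 3) ![θ, θ] V (fun τ => solQ α (G τ)) (fun τ => p (G τ)) := by
  have hrel : ∀ τ ∈ V, ∀ j k, CoverRelations (planeA0 α (G τ)) (planeA1 α (G τ)) (planeC α (G τ))
      (planeA0 α (G τ) ^ 2 / planeC α (G τ) ^ 3) (τ j) (τ (1 - j)) (solQ α (G τ) k)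
      (solQ α (G τ) (1 - k)) := by
    intro τ hτ j k
    have := ((hgood _ (hGV τ hτ).1).coverRelations hα).reindex j k
    rwa [(hGV τ hτ).2] at this
  have hdiff : ∀ {f : (Fin 2 → ℂ) → ℂ} {τ : Fin 2 → ℂ}, τ ∈ V → ContDiffAt ℂ 1 f (G τ) →
      DifferentiableAt ℂ (fun σ => f (G σ)) τ := fun {f τ} hτ hf =>
    DifferentiableAt.comp τ (hf.differentiableAt one_ne_zero)
      ((hG τ hτ).differentiableAt (hV.mem_nhds hτ))
  have hqc : ∀ τ ∈ V, ∀ k, solQ α (G τ) k - planeC α (G τ) ≠ 0 := fun τ hτ k =>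
    (hrel τ hτ 0 k).q_sub_c
  have hdq : ∀ τ ∈ V, ∀ k, DifferentiableAt ℂ (fun σ => solQ α (G σ) k) τ := fun τ hτ k =>
    hdiff hτ ((hgood _ (hGV τ hτ).1).contDiffAt_Q k)
  have hdc : ∀ τ ∈ V, DifferentiableAt ℂ (fun σ => planeC α (G σ)) τ := fun τ hτ =>
    hdiff hτ (hgood _ (hGV τ hτ).1).contDiffAt_C
  have hpe : ∀ τ ∈ V, ∀ k, (fun σ => p (G σ) k) =ᶠ[nhds τ]
      fun σ => μ / (solQ α (G σ) k - planeC α (G σ)) := fun τ hτ k => by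
    filter_upwards [hV.mem_nhds hτ] with σ hσ using hp _ (hGV σ hσ).1 k
  have hcurve : ∀ (τ : Fin 2 → ℂ) j, HasDerivAt (fun z => Function.update τ j z) (Pi.single j 1)
      (τ j) := fun τ j => hasDerivAt_update τ j (τ j)
  have hdcurve : ∀ {f : (Fin 2 → ℂ) → ℂ} {τ : Fin 2 → ℂ} (j : Fin 2), DifferentiableAt ℂ f τ →
      HasDerivAt (fun z => f (Function.update τ j z)) (fderiv ℂ f τ (Pi.single j 1)) (τ j) := by
    intro f τ j hf
    have h1 := hf.hasFDerivAt
    rw [← Function.update_eq_self j τ] at h1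
    have := h1.comp_hasDerivAt (τ j) (hcurve τ j)
    simpa only [Function.update_eq_self, Function.comp_def] using this
  have hk : ∀ k : Fin 2, 1 - k ≠ k := by decide
  have hev : ∀ τ ∈ V, ∀ j, ∀ᶠ z in nhds (τ j), Function.update τ j z ∈ V := fun τ hτ j =>
    (hcurve τ j).continuousAt.eventually
      (by simpa only [Function.update_eq_self] using hV.eventually_mem hτ)
  have hvar : ∀ τ ∈ V, ∀ j k, ∃ a₀' a₁' k' r', CoverVariation (planeA0 α (G τ)) (planeA1 α (G τ))
      (planeC α (G τ)) (planeA0 α (G τ) ^ 2 / planeC α (G τ) ^ 3) (τ j) (τ (1 - j))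
      (solQ α (G τ) k) (solQ α (G τ) (1 - k)) a₀' a₁'
      (fderiv ℂ (fun σ => planeC α (G σ)) τ (Pi.single j 1)) k' 1 0
      (fderiv ℂ (fun σ => solQ α (G σ) k) τ (Pi.single j 1)) r' := by
    intro τ hτ j k
    have g := hgood _ (hGV τ hτ).1
    have h1 := hdcurve j (hdiff hτ g.contDiffAt_A0)
    have h2 := hdcurve j (hdiff hτ g.contDiffAt_A1)
    have h3 := hdcurve j (hdiff hτ g.contDiffAt_C)
    have h4 := hdcurve j (hdiff hτ g.contDiffAt_K)
    have h5 := hdcurve j (hdq τ hτ k)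
    have h6 := hdcurve j (hdq τ hτ (1 - k))
    have t1 : HasDerivAt (fun z => Function.update τ j z j) 1 (τ j) := by
      simpa only [Function.update_self] using hasDerivAt_id' (τ j)
    have t2 : HasDerivAt (fun z => Function.update τ j z (1 - j)) 0 (τ j) := by
      simpa [hk j] using hasDerivAt_const (τ j) (τ (1 - j))
    have := CoverVariation.of_hasDerivAt h1 h2 h3 h4 t1 t2 h5 h6
      ((hev τ hτ j).mono fun z hz => (hrel _ hz j k).toCoverEquations)
    simp only [Function.update_eq_self] at this
    exact ⟨_, _, _, _, this⟩
  refine ⟨hV, fun τ hτ => ⟨?_, ?_⟩, fun τ hτ => ⟨?_, fun k => ?_⟩, ?_, ?_, ?_, ?_⟩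
  · have h := (hrel τ hτ 0 0).t_ne_t'
    intro i j hij
    fin_cases i <;> fin_cases j <;> first | rfl | exact absurd hij h | exact absurd hij.symm h
  · exact fun i => ⟨(hrel τ hτ i 0).t_ne_zero, (hrel τ hτ i 0).t_ne_one⟩
  · have h := (hrel τ hτ 0 0).q_ne_r
    intro i j hij
    fin_cases i <;> fin_cases j <;> first | rfl | exact absurd hij h | exact absurd hij.symm h
  · refine ⟨(hrel τ hτ 0 k).at_zero.2.2.1, ?_, fun i => ?_⟩
    · exact (sub_ne_zero.1 (hrel τ hτ 0 k).at_one.2.2.1).symm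
    · exact (sub_ne_zero.1 (hrel τ hτ i k).at_t.2.2.1).symm
  · exact fun τ hτ => (differentiableAt_pi.2 (hdq τ hτ)).differentiableWithinAt
  · refine fun τ hτ => (differentiableAt_pi.2 fun k => ?_).differentiableWithinAt
    have hs : DifferentiableAt ℂ (fun σ => solQ α (G σ) k - planeC α (G σ)) τ :=
      (hdq τ hτ k).fun_sub (hdc τ hτ)
    have h : DifferentiableAt ℂ (fun σ => μ / (solQ α (G σ) k - planeC α (G σ))) τ :=
      by
      simp only [div_eq_mul_inv]
      exact (hs.fun_inv (hqc τ hτ k)).const_mul μ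
    exact h.congr_of_eventuallyEq (hpe τ hτ k)
  · intro τ hτ j k
    obtain ⟨a₀', a₁', k', r', hv⟩ := hvar τ hτ j k
    have e := hv.velocity (hrel τ hτ j k) hθ
    convert hdcurve j (hdq τ hτ k) using 1
    rw [← e]
    simp only [garnierH_fin_two θ j k, Function.update_self, Function.update_of_ne (hk k),
      hp _ (hGV τ hτ).1]
  · intro τ hτ j k
    obtain ⟨a₀', a₁', k', r', hv⟩ := hvar τ hτ j k
    have e := hv.force (hrel τ hτ j k) hθ
    have hd := (hasDerivAt_const (τ j) μ).fun_div
      ((hdcurve j (hdq τ hτ k)).fun_sub (hdcurve j (hdc τ hτ)))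
      (by simpa only [Function.update_eq_self] using hqc τ hτ k)
    have hd' := hd.congr_of_eventuallyEq (f₁ := fun z => p (G (Function.update τ j z)) k)
      ((hev τ hτ j).mono fun z hz => hp _ (hGV _ hz).1 k)
    refine hd'.congr_deriv ?_
    simp only [garnierH_fin_two θ j k, Function.update_self, Function.update_of_ne (hk k),
      hp _ (hGV τ hτ).1, e, Function.update_eq_self]
    ring

end Local

/-- The family gives a complete algebraic solution of the Garnier system of rank `2`. -/
theorem exists_algebraic_solution (α : ℂ) (hα : α ^ 2 = -3) :
    ∃ h : MvPolynomial (Fin 2) ℂ, h ≠ 0 ∧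
      (∀ x : Fin 2 → ℂ, MvPolynomial.eval x h ≠ 0 →
        let s := paramS α (x 0) (x 1)
        let t := paramT α (x 0) (x 1)
        IsNormalizedCover (coverRat (coeffA0 s t) (coeffA1 s t) (poleC s))
          (solT α x 0) (solT α x 1) (solQ α x 0) (solQ α x 1) ∧
        solQ α x 0 ≠ solQ α x 1) ∧
      ∀ θ : ℂ, ∃ n : Fin 2 → MvPolynomial (Fin 2) ℂ,
        let p : (Fin 2 → ℂ) → Fin 2 → ℂ :=
          fun x k => MvPolynomial.eval x (n k) / MvPolynomial.eval x h
        ∀ x : Fin 2 → ℂ, MvPolynomial.eval x h ≠ 0 →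
          (let s := paramS α (x 0) (x 1)
           let t := paramT α (x 0) (x 1)
           let a₀ := coeffA0 s t
           let a₁ := coeffA1 s t
           let c := poleC s
           ∃ a b : ℂ, ∀ z : ℂ, z ≠ 0 → z ≠ 1 → (∀ i, z ≠ solT α x i) → (∀ i, z ≠ solQ α x i) →
             z ≠ c → z ^ 2 + a₁ * z + a₀ ≠ 0 →
             potential (fuchsF θ θ ![θ, θ] (solT α x) (solQ α x))
               (fuchsG a b (solT α x) (solQ α x)
                 (fun j => garnierH θ θ (1 / 3) ![θ, θ] j (solT α x) (solQ α x) (p x)) (p x)) z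
             = pullbackPotential (coverMap a₀ a₁ c)
                 (hypergeometricPotential (1 / 2) θ (1 / 3)) z) ∧
          ∃ (V : Set (Fin 2 → ℂ)) (G : (Fin 2 → ℂ) → Fin 2 → ℂ),
            solT α x ∈ V ∧ G (solT α x) = x ∧ DifferentiableOn ℂ G V ∧
            (∀ τ ∈ V, MvPolynomial.eval (G τ) h ≠ 0 ∧ solT α (G τ) = τ) ∧
            IsGarnierSolution θ θ (1 / 3) ![θ, θ] V
              (fun τ => solQ α (G τ)) (fun τ => p (G τ)) := by
  obtain ⟨d, hd, hgood⟩ := generically_goodPoint hα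
  have hbase := (hgood _ hd).coverRelations hα
  -- The functions 1/(q₁ - c) and 1/(q₂ - c) are written as fractions with denominators d₀ and d₁.
  -- With h = d·d₀·d₁ the momenta are fractions over h for every θ, since θ enters only through the
  -- factor μ.
  obtain ⟨n₀, d₀, hd₀, h₀⟩ := ((ratAt_solQ hα 0).sub (ratAt_C (α := α))).inv hbase.q_sub_c
  obtain ⟨n₁, d₁, hd₁, h₁⟩ := ((ratAt_solQ hα 1).sub (ratAt_C (α := α))).inv
    hbase.swap_critical.q_sub_c
  refine ⟨d * d₀ * d₁, fun e => ?_, fun x hx => ?_, fun θ => ?_⟩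
  · have := congrArg (MvPolynomial.eval basePoint) e
    simp [hd, hd₀, hd₁] at this
  · rw [map_mul, map_mul] at hx
    have g := hgood x (left_ne_zero_of_mul (left_ne_zero_of_mul hx))
    exact ⟨(g.coverRelations hα).isNormalizedCover g.admissible.2.2.2.2.2.2.2, g.critical⟩
  obtain ⟨μ, hμ⟩ : ∃ μ, θ = (4 * μ + 1) / 6 := ⟨(6 * θ - 1) / 4, by ring⟩
  refine ⟨![MvPolynomial.C μ * n₀ * d * d₁, MvPolynomial.C μ * n₁ * d * d₀], ?_⟩
  intro p
  have hp : ∀ x, MvPolynomial.eval x (d * d₀ * d₁) ≠ 0 → ∀ k,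
      p x k = μ / (solQ α x k - planeC α x) := by
    intro x hx k
    have hx' := hx
    rw [map_mul, map_mul] at hx'
    have x0 := right_ne_zero_of_mul (left_ne_zero_of_mul hx')
    have x1 := right_ne_zero_of_mul hx'
    have x2 := left_ne_zero_of_mul (left_ne_zero_of_mul hx')
    fin_cases k
    · simp only [p, Fin.zero_eta, Matrix.cons_val_zero, map_mul, MvPolynomial.eval_C]
      have e : (solQ α x 0 - planeC α x)⁻¹ = _ := h₀ x x0
      rw [div_eq_mul_inv μ, e]
      field_simp
    · simp only [p, Fin.mk_one, Matrix.cons_val_one, Matrix.cons_val_fin_one, map_mul, MvPolynomial.eval_C]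
      have e : (solQ α x 1 - planeC α x)⁻¹ = _ := h₁ x x1
      rw [div_eq_mul_inv μ, e]
      field_simp
  have hU : IsOpen {x | MvPolynomial.eval x (d * d₀ * d₁) ≠ 0} :=
    isOpen_ne_fun (MvPolynomial.continuous_eval _) continuous_const
  have hgoodU : ∀ x ∈ {x | MvPolynomial.eval x (d * d₀ * d₁) ≠ 0}, GoodPoint α x := by
    intro x hx
    rw [Set.mem_ofPred_eq, map_mul, map_mul] at hx
    exact hgood x (left_ne_zero_of_mul (left_ne_zero_of_mul hx))
  intro x hx
  refine ⟨?_, ?_⟩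
  · refine potential_fuchs ((hgoodU x hx).coverRelations hα) hμ (solT α x) (solQ α x) (p x) ?_ ?_ ?_
    · rfl
    · rfl
    · funext k
      rw [hp x hx k]
      fin_cases k <;> rfl
  · obtain ⟨V, G, hV, hxV, hGx, hG, hGV⟩ := exists_localInverse hU hgoodU hx hα
    exact ⟨V, G, hxV, hGx, hG, hGV, isGarnierSolution hgoodU hV hG hGV hα hμ p hp⟩

/-! ### The double cover of the parameter plane -/

theorem FunctionField2.adjoin_coord (k : Type*) [Field k] :
    IntermediateField.adjoin k {coord k 0, coord k 1} = ⊤ := by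
  rw [eq_top_iff]
  rintro x -
  have hp : ∀ p : MvPolynomial (Fin 2) k, algebraMap (MvPolynomial (Fin 2) k) (FunctionField2 k) p ∈
      IntermediateField.adjoin k {coord k 0, coord k 1} := by
    intro p
    induction p using MvPolynomial.induction_on with
    | C a =>
      have : algebraMap (MvPolynomial (Fin 2) k) (FunctionField2 k) (MvPolynomial.C a) = algebraMap k _ a := by
        rw [IsScalarTower.algebraMap_apply k (MvPolynomial (Fin 2) k)]; rfl
      rw [this]
      exact IntermediateField.algebraMap_mem _ a
    | add p q hp hq => rw [map_add]; exact add_mem hp hq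
    | mul_X p i hp =>
      rw [map_mul]
      refine mul_mem hp (IntermediateField.subset_adjoin _ _ ?_)
      fin_cases i
      · exact Or.inl rfl
      · exact Or.inr rfl
  obtain ⟨p, q, -, rfl⟩ := IsFractionRing.div_surjective (A := MvPolynomial (Fin 2) k) x
  exact div_mem (hp p) (hp q)

/-- Used throughout to show that a concrete function is not zero, by evaluating it at one point. -/
theorem FunctionField2.algebraMap_ne_zero {k : Type*} [Field k] (x : Fin 2 → k)
    {p : MvPolynomial (Fin 2) k} (hp : MvPolynomial.eval x p ≠ 0) :
    algebraMap _ (FunctionField2 k) p ≠ 0 := by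
  rw [Ne, FaithfulSMul.algebraMap_eq_zero_iff]
  rintro rfl
  exact hp (map_zero _)

theorem IntermediateField.finrank_eq_two_of_sq_mem {k L : Type*} [Field k] [Field L] [Algebra k L]
    (E : IntermediateField k L) {v : L} (hv : v ^ 2 ∈ E) (hvE : v ∉ E)
    (htop : IntermediateField.adjoin E {v} = ⊤) : Module.finrank E L = 2 := by
  have hm : (X ^ 2 - C (⟨v ^ 2, hv⟩ : E)).Monic := monic_X_pow_sub_C _ two_ne_zero
  have h0 : aeval v (X ^ 2 - C (⟨v ^ 2, hv⟩ : E)) = 0 := by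
    simp [IntermediateField.algebraMap_apply]
  have hint : IsIntegral E v := ⟨_, hm, by rwa [← aeval_def]⟩
  rw [← IntermediateField.finrank_top', ← htop, IntermediateField.adjoin.finrank hint]
  refine le_antisymm ?_ ((minpoly.two_le_natDegree_iff hint).2 ?_)
  · refine (natDegree_le_of_dvd (minpoly.dvd E v h0) hm.ne_zero).trans ?_
    rw [natDegree_X_pow_sub_C]
  · rintro ⟨y, rfl⟩
    exact hvE y.2

theorem IntermediateField.adjoin_eq_top_of_mem {k L : Type*} [Field k] [Field L] [Algebra k L]
    (E : IntermediateField k L) {u v : L} (h : IntermediateField.adjoin k {u, v} = ⊤) (hu : u ∈ E) :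
    IntermediateField.adjoin E {v} = ⊤ := by
  rw [← IntermediateField.restrictScalars_eq_top_iff (K := k), eq_top_iff, ← h,
    IntermediateField.adjoin_le_iff]
  rintro x (rfl | rfl)
  · have h1 := IntermediateField.algebraMap_mem (IntermediateField.adjoin E {v}) (⟨x, hu⟩ : E)
    rw [IntermediateField.algebraMap_apply] at h1
    exact (IntermediateField.mem_restrictScalars k).2 h1
  · exact (IntermediateField.mem_restrictScalars k).2
      (IntermediateField.subset_adjoin E {x} (Set.mem_singleton x))

theorem IntermediateField.eq_top_of_finrank_eq_two {k L : Type*} [Field k] [Field L] [Algebra k L]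
    {E F : IntermediateField k L} (h : Module.finrank E L = 2) (hEF : E ≤ F) {x : L} (hx : x ∈ F)
    (hxE : x ∉ E) : F = ⊤ := by
  have := IntermediateField.isSimpleOrder_of_finrank_prime E L (h ▸ Nat.prime_two)
  rcases eq_bot_or_eq_top (IntermediateField.extendScalars hEF) with hb | hb
  · have : x ∈ (⊥ : IntermediateField E L) := hb ▸ hx
    obtain ⟨y, rfl⟩ := IntermediateField.mem_bot.1 this
    exact absurd y.2 hxE
  · rw [eq_top_iff]
    intro y _
    have : y ∈ IntermediateField.extendScalars hEF := hb ▸ IntermediateField.mem_top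
    exact this

/-- The automorphism `v ↦ -v` of `k(u,v)`. -/
def flipV (k : Type*) [Field k] : FunctionField2 k →ₐ[k] FunctionField2 k :=
  (IsFractionRing.fieldEquivOfAlgEquiv k (FunctionField2 k) (FunctionField2 k)
    (AlgEquiv.ofAlgHom (MvPolynomial.aeval ![MvPolynomial.X 0, -MvPolynomial.X 1])
      (MvPolynomial.aeval ![MvPolynomial.X 0, -MvPolynomial.X 1])
      (by ext i; fin_cases i <;> simp) (by ext i; fin_cases i <;> simp) :
      MvPolynomial (Fin 2) k ≃ₐ[k] MvPolynomial (Fin 2) k)).toAlgHom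

theorem flip_coord_zero (k : Type*) [Field k] : flipV k (coord k 0) = coord k 0 := by
  have := IsFractionRing.fieldEquivOfAlgEquiv_algebraMap k (FunctionField2 k) (FunctionField2 k)
    (AlgEquiv.ofAlgHom (MvPolynomial.aeval ![MvPolynomial.X 0, -MvPolynomial.X 1])
      (MvPolynomial.aeval ![MvPolynomial.X 0, -MvPolynomial.X 1])
      (by ext i; fin_cases i <;> simp) (by ext i; fin_cases i <;> simp) :
      MvPolynomial (Fin 2) k ≃ₐ[k] MvPolynomial (Fin 2) k) (MvPolynomial.X 0)
  refine this.trans ?_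
  simp [coord]

theorem flip_coord_one (k : Type*) [Field k] : flipV k (coord k 1) = -coord k 1 := by
  have := IsFractionRing.fieldEquivOfAlgEquiv_algebraMap k (FunctionField2 k) (FunctionField2 k)
    (AlgEquiv.ofAlgHom (MvPolynomial.aeval ![MvPolynomial.X 0, -MvPolynomial.X 1])
      (MvPolynomial.aeval ![MvPolynomial.X 0, -MvPolynomial.X 1])
      (by ext i; fin_cases i <;> simp) (by ext i; fin_cases i <;> simp) :
      MvPolynomial (Fin 2) k ≃ₐ[k] MvPolynomial (Fin 2) k) (MvPolynomial.X 1)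
  refine this.trans ?_
  simp [coord]

section

variable {F : Type*} [Field F] (α u v : F)

theorem paramW_neg : paramW α (-v) = paramW α v := by
  rw [paramW, paramW, neg_sq]

theorem paramS_neg : paramS α u (-v) = paramS α u v := by
  rw [paramS, paramS, paramW_neg]

theorem paramT_neg : paramT α u (-v) = paramT α u v := by
  rw [paramT, paramT, paramW_neg, paramS_neg]

theorem solQ1_neg : solQ1 α u (-v) = solQ2 α u v := by
  rw [solQ1, solQ2, ← neg_div_neg_eq]
  congr 1 <;> ring

theorem map_paramS {F' : Type*} [Field F'] (f : F →+* F') :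
    f (paramS α u v) = paramS (f α) (f u) (f v) := by
  simp only [paramS, paramW, map_neg, map_div₀, map_mul, map_add, map_sub, map_pow, map_one,
    map_ofNat]

theorem map_paramT {F' : Type*} [Field F'] (f : F →+* F') :
    f (paramT α u v) = paramT (f α) (f u) (f v) := by
  simp only [paramT, map_paramS, paramW, map_neg, map_div₀, map_mul, map_add, map_sub, map_pow, map_one,
    map_ofNat]

theorem map_solQ1 {F' : Type*} [Field F'] (f : F →+* F') :
    f (solQ1 α u v) = solQ1 (f α) (f u) (f v) := by
  simp only [solQ1, map_neg, map_div₀, map_mul, map_add, map_sub, map_pow, map_one, map_ofNat]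

end

section

variable {k : Type*} [Field k] [CharZero k] {β : k} (hβ : β ^ 2 = -3)

-- At (u, v) = (0, 2) every factor is a nonzero rational number or a nonzero rational multiple of β,
-- β - 2 or β + 2, and (β - 2)(β + 2) = -7.
include hβ in
theorem regularPoint_coord : RegularPoint (algebraMap k (FunctionField2 k) β) (coord k 0)
    (coord k 1) := by
  have h0 : β ≠ 0 := by rintro rfl; norm_num at hβ
  have h1 : β - 2 ≠ 0 := fun e => by
    have h7 : (7 : k) ≠ 0 := by norm_num
    exact h7 (by linear_combination hβ - (β + 2) * e)
  have h2 : β + 2 ≠ 0 := fun e => by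
    have h7 : (7 : k) ≠ 0 := by norm_num
    exact h7 (by linear_combination hβ - (β - 2) * e)
  have h3 : (3 : k) ≠ 0 := by norm_num
  have key : ∀ (p : MvPolynomial (Fin 2) k) (x : FunctionField2 k), MvPolynomial.eval ![0, 2] p ≠ 0 →
      algebraMap _ _ p = x → x ≠ 0 := fun p x hp e =>
    e ▸ FunctionField2.algebraMap_ne_zero ![0, 2] hp
  have hC : algebraMap k (FunctionField2 k) β = algebraMap _ _ (MvPolynomial.C (σ := Fin 2) β) := by
    rw [IsScalarTower.algebraMap_apply k (MvPolynomial (Fin 2) k)]; rfl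
  rw [hC, coord, coord]
  constructor
  · exact key (MvPolynomial.X 1 + 1) _
      (by simp; norm_num)
      (by simp)
  · exact key (MvPolynomial.X 1 - 1) _
      (by simp; norm_num)
      (by simp)
  · exact key (MvPolynomial.X 0 + 1) _
      (by simp)
      (by simp)
  · exact key (MvPolynomial.X 0 - 1) _
      (by simp)
      (by simp)
  · exact key (factorAp (MvPolynomial.C β) (MvPolynomial.X 0) (MvPolynomial.X 1)) _
      (by rw [show MvPolynomial.eval _ _ = β by simp [factorAp]; ring]; exact h0)
      (by simp only [factorAp, map_add, map_sub, map_mul, map_pow, map_one, map_ofNat])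
  · exact key (factorAm (MvPolynomial.C β) (MvPolynomial.X 0) (MvPolynomial.X 1)) _
      (by rw [show MvPolynomial.eval _ _ = 3 * β by simp [factorAm]; ring]; exact mul_ne_zero h3 h0)
      (by simp only [factorAm, map_add, map_sub, map_mul, map_pow, map_one, map_ofNat])
  · exact key (factorBp (MvPolynomial.C β) (MvPolynomial.X 0) (MvPolynomial.X 1)) _
      (by rw [show MvPolynomial.eval _ _ = 3 * (β - 2) by simp [factorBp]; ring]; exact mul_ne_zero h3 h1)
      (by simp only [factorBp, map_add, map_sub, map_mul, map_pow, map_one, map_ofNat])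
  · exact key (factorBm (MvPolynomial.C β) (MvPolynomial.X 0) (MvPolynomial.X 1)) _
      (by rw [show MvPolynomial.eval _ _ = β - 2 by simp [factorBm]; ring]; exact h1)
      (by simp only [factorBm, map_add, map_sub, map_mul, map_pow, map_one, map_ofNat])
  · exact key (factorCp (MvPolynomial.C β) (MvPolynomial.X 0) (MvPolynomial.X 1)) _
      (by rw [show MvPolynomial.eval _ _ = 3 * (β + 2) by simp [factorCp]; ring]; exact mul_ne_zero h3 h2)
      (by simp only [factorCp, map_add, map_sub, map_mul, map_pow, map_one, map_ofNat])
  · exact key (factorCm (MvPolynomial.C β) (MvPolynomial.X 0) (MvPolynomial.X 1)) _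
      (by rw [show MvPolynomial.eval _ _ = β + 2 by simp [factorCm]; ring]; exact h2)
      (by simp only [factorCm, map_add, map_sub, map_mul, map_pow, map_one, map_ofNat])
  · exact key (factorM (MvPolynomial.C β) (MvPolynomial.X 0) (MvPolynomial.X 1)) _
      (by simp [factorM]; norm_num)
      (by simp only [factorM, map_add, map_sub, map_mul, map_pow, map_one, map_ofNat])

-- After cross multiplication and removal of the common factors, equality would make a polynomial
-- vanish whose value at (u, v) = (0, 2) is 144β(β - 2)(β + 2).
include hβ in
theorem solQ1_ne_solQ2 : solQ1 (algebraMap k (FunctionField2 k) β) (coord k 0) (coord k 1)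
    ≠ solQ2 (algebraMap k (FunctionField2 k) β) (coord k 0) (coord k 1) := by
  have h := regularPoint_coord hβ
  set γ := algebraMap k (FunctionField2 k) β with hγ
  set u := coord k 0 with hu
  set v := coord k 1 with hv
  obtain ⟨d1, d2, -, -, hAp, hAm, hBp, hBm, hCp, hCm, hM⟩ := h
  have h0 : β ≠ 0 := by rintro rfl; norm_num at hβ
  have h2 : β - 2 ≠ 0 := fun e => by
    have h7 : (7 : k) ≠ 0 := by norm_num
    exact h7 (by linear_combination hβ - (β + 2) * e)
  have h2' : β + 2 ≠ 0 := fun e => by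
    have h7 : (7 : k) ≠ 0 := by norm_num
    exact h7 (by linear_combination hβ - (β - 2) * e)
  have hC : γ = algebraMap _ _ (MvPolynomial.C (σ := Fin 2) β) := by
    rw [hγ, IsScalarTower.algebraMap_apply k (MvPolynomial (Fin 2) k)]; rfl
  have hu0 : u ≠ 0 := by
    simpa [hu, coord] using FunctionField2.algebraMap_ne_zero ![(1 : k), 0]
      (p := MvPolynomial.X 0) (by simp)
  have hD : factorAp γ u v * (2 * v + 1 - γ) * (2 * v + 1 + γ) * factorCp γ u v * factorBp γ u v * (v - 1)
      - factorAm γ u v * (2 * v - 1 + γ) * (2 * v - 1 - γ) * factorBm γ u v * factorCm γ u v * (v + 1)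
      ≠ 0 := by
    have key := FunctionField2.algebraMap_ne_zero ![(0 : k), 2]
      (p := let U := MvPolynomial.X 0; let V := MvPolynomial.X 1; let G := MvPolynomial.C β
        factorAp G U V * (2 * V + 1 - G) * (2 * V + 1 + G) * factorCp G U V * factorBp G U V * (V - 1)
        - factorAm G U V * (2 * V - 1 + G) * (2 * V - 1 - G) * factorBm G U V * factorCm G U V * (V + 1))
      (by
        have e : ∀ x : k, x = 144 * (β * (β - 2) * (β + 2)) → x ≠ 0 := by
          rintro x rfl
          exact mul_ne_zero (by norm_num) (mul_ne_zero (mul_ne_zero h0 h2) h2')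
        apply e
        simp [factorAp, factorAm, factorBp, factorBm, factorCp, factorCm]
        ring)
    simpa only [factorAp, factorAm, factorBp, factorBm, factorCp, factorCm, hC, hu, hv, coord,
      map_add, map_sub, map_mul, map_pow, map_one, map_ofNat] using key
  intro e
  apply hD
  have e1 : solQ1 γ u v = -(7 / 2) * factorAm γ u v * u * (2 * v + 1 - γ) * (2 * v + 1 + γ)
      * factorAp γ u v ^ 2 / (factorM γ u v * factorBm γ u v * factorCm γ u v * (v + 1)) := rfl
  have e2 : solQ2 γ u v = -(7 / 2) * factorAp γ u v * u * (2 * v - 1 + γ) * (2 * v - 1 - γ)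
      * factorAm γ u v ^ 2 / (factorM γ u v * factorCp γ u v * factorBp γ u v * (v - 1)) := rfl
  rw [e1, e2, div_eq_div_iff (mul_ne_zero (mul_ne_zero (mul_ne_zero hM hBm) hCm) d1)
    (mul_ne_zero (mul_ne_zero (mul_ne_zero hM hCp) hBp) d2)] at e
  have h7 : (7 / 2 : FunctionField2 k) ≠ 0 := by norm_num
  refine (mul_eq_zero.1 ?_).resolve_left (mul_ne_zero h7 (mul_ne_zero (mul_ne_zero (mul_ne_zero hAp hAm) hM) hu0))
  linear_combination -e

-- One recovers u = (s-1)t/(s+3), then w from t and u, then v² = (w-2γ)/(w+2γ). The automorphism v ↦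
-- -v fixes s and t. It moves v, and it sends q₁ to q₂ ≠ q₁, so neither v nor q₁ lies in k(s,t).
include hβ in
theorem paramField_facts :
    let γ := algebraMap k (FunctionField2 k) β
    let u := coord k 0
    let v := coord k 1
    let E := IntermediateField.adjoin k {paramS γ u v, paramT γ u v}
    u ∈ E ∧ v ^ 2 ∈ E ∧ v ∉ E ∧ solQ1 γ u v ∉ E := by
  intro γ u v E
  have h : RegularPoint γ u v := regularPoint_coord hβ
  have hγ : γ ^ 2 = -3 := by
    rw [← map_pow, hβ, map_neg, map_ofNat]
  have hC : γ = algebraMap _ _ (MvPolynomial.C (σ := Fin 2) β) := by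
    rw [show γ = algebraMap k _ β from rfl, IsScalarTower.algebraMap_apply k (MvPolynomial (Fin 2) k)]; rfl
  have hn := h.one_sub_v_sq
  have hw := paramW_mul (α := γ) hn
  have he := h.denom_ne_zero hγ
  have hu1 := h.one_sub_u_sq
  have hγ0 : γ ≠ 0 := by
    intro e; rw [e] at hγ; norm_num at hγ
  set w := paramW γ v with hwdef
  set s := paramS γ u v with hs
  set t := paramT γ u v with ht
  have hs' : s = -(3 * u ^ 2 + w * u - 1) / (u ^ 2 - 3 - u * w) := rfl
  have ht' : t = -(4 * u * (w * u + 2)) / ((u ^ 2 - 3 - u * w) * (s - 1)) := rfl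
  have hsE : s ∈ E := IntermediateField.subset_adjoin _ _ (Or.inl rfl)
  have htE : t ∈ E := IntermediateField.subset_adjoin _ _ (Or.inr rfl)
  have hu0 : u ≠ 0 := by
    simpa [u, coord] using FunctionField2.algebraMap_ne_zero ![(1 : k), 0]
      (p := MvPolynomial.X 0) (by simp)
  have huw : u * w + 2 ≠ 0 := by
    have key := FunctionField2.algebraMap_ne_zero ![(0 : k), 2]
      (p := MvPolynomial.X 0 * (2 * MvPolynomial.C β * (1 + MvPolynomial.X 1 ^ 2))
        + 2 * (1 - MvPolynomial.X 1 ^ 2)) (by simp; norm_num)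
    intro e
    apply key
    simp only [map_add, map_mul, map_sub, map_pow, map_one, map_ofNat, ← hC]
    change u * (2 * γ * (1 + v ^ 2)) + 2 * (1 - v ^ 2) = 0
    linear_combination (1 - v ^ 2) * e - u * hw
  have hs3 := s_add_three u w he hs'
  have hst := s_sub_one_mul_t u w he hs' hu1 ht'
  have h4 : (4 : FunctionField2 k) ≠ 0 := by norm_num
  have hs30 : s + 3 ≠ 0 := by
    rw [hs3]
    exact div_ne_zero (mul_ne_zero (neg_ne_zero.2 h4) huw) he
  have huE : u ∈ E := by
    have : u = (s - 1) * t / (s + 3) := by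
      rw [eq_div_iff hs30, hst, hs3]; ring
    rw [this]
    exact div_mem (mul_mem (sub_mem hsE (one_mem _)) htE) (add_mem hsE (ofNat_mem _ 3))
  have hwE : w ∈ E := by
    have : w = (t * (u ^ 2 - 1) / u - 2) / u := by
      have := t_eq u w he hs' hu1 ht'
      have h2 : u ^ 2 - 1 ≠ 0 := fun e => hu1 (by linear_combination -e)
      rw [this, eq_div_iff hu0, eq_sub_iff_add_eq, eq_div_iff hu0, div_mul_eq_mul_div, eq_div_iff hu1]
      ring
    rw [this]
    exact div_mem (sub_mem (div_mem (mul_mem htE (sub_mem (pow_mem huE 2) (one_mem _))) huE)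
      (ofNat_mem _ 2)) huE
  have hγE : γ ∈ E := IntermediateField.algebraMap_mem _ β
  have hvE : v ^ 2 ∈ E := by
    have h0 : w + 2 * γ ≠ 0 := by
      intro e
      exact mul_ne_zero h4 hγ0 (by linear_combination (1 - v ^ 2) * e - hw)
    have : v ^ 2 = (w - 2 * γ) / (w + 2 * γ) := by
      rw [eq_div_iff h0]; linear_combination -hw
    rw [this]
    exact div_mem (sub_mem hwE (mul_mem (ofNat_mem _ 2) hγE))
      (add_mem hwE (mul_mem (ofNat_mem _ 2) hγE))
  have hfix : ∀ x ∈ E, flipV k x = x := by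
    intro x hx
    induction hx using IntermediateField.adjoin_induction with
    | mem x hx =>
      have h0 : (flipV k : FunctionField2 k →+* FunctionField2 k) u = u := flip_coord_zero k
      have h1 : (flipV k : FunctionField2 k →+* FunctionField2 k) v = -v := flip_coord_one k
      have h2 : (flipV k : FunctionField2 k →+* FunctionField2 k) γ = γ := (flipV k).commutes β
      rcases hx with rfl | rfl
      · exact (map_paramS γ u v (flipV k : FunctionField2 k →+* FunctionField2 k)).trans (by
          rw [h0, h1, h2, paramS_neg])
      · exact (map_paramT γ u v (flipV k : FunctionField2 k →+* FunctionField2 k)).trans (by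
          rw [h0, h1, h2, paramT_neg])
    | algebraMap x => exact (flipV k).commutes x
    | add x y _ _ hx hy => rw [map_add, hx, hy]
    | inv x _ hx => rw [map_inv₀, hx]
    | mul x y _ _ hx hy => rw [map_mul, hx, hy]
  refine ⟨huE, hvE, fun hv => ?_, fun hq => ?_⟩
  · have h1 := hfix v hv
    rw [show flipV k v = -v from flip_coord_one k, neg_eq_self] at h1
    have : v ≠ 0 := by
      simpa [v, coord] using FunctionField2.algebraMap_ne_zero ![(0 : k), 1]
        (p := MvPolynomial.X 1) (by simp)
    exact this h1
  · have h1 := hfix _ hq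
    refine solQ1_ne_solQ2 hβ ?_
    rw [← solQ1_neg]
    have h0 : (flipV k : FunctionField2 k →+* FunctionField2 k) u = u := flip_coord_zero k
    have h1' : (flipV k : FunctionField2 k →+* FunctionField2 k) v = -v := flip_coord_one k
    have h2 : (flipV k : FunctionField2 k →+* FunctionField2 k) γ = γ := (flipV k).commutes β
    have h3 := map_solQ1 γ u v (flipV k : FunctionField2 k →+* FunctionField2 k)
    rw [h0, h1', h2] at h3
    exact h1.symm.trans h3

include hβ in
theorem finrank_paramField :
    let γ := algebraMap k (FunctionField2 k) β
    let u := coord k 0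
    let v := coord k 1
    let s := paramS γ u v
    let t := paramT γ u v
    Module.finrank (IntermediateField.adjoin k {s, t}) (FunctionField2 k) = 2 ∧
    IntermediateField.adjoin k {s, t, solQ1 γ u v} = ⊤ := by
  intro γ u v s t
  obtain ⟨hu, hv2, hv, hq⟩ := paramField_facts hβ
  have hfin : Module.finrank (IntermediateField.adjoin k {s, t}) (FunctionField2 k) = 2 := by
    exact IntermediateField.finrank_eq_two_of_sq_mem _ hv2 hv
      (IntermediateField.adjoin_eq_top_of_mem _ (FunctionField2.adjoin_coord k) hu)
  refine ⟨hfin, IntermediateField.eq_top_of_finrank_eq_two hfin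
    (IntermediateField.adjoin.mono _ _ _ ?_)
    (IntermediateField.subset_adjoin k {s, t, solQ1 γ u v} (Or.inr (Or.inr rfl))) hq⟩
  rintro x (rfl | rfl)
  · exact Or.inl rfl
  · exact Or.inr (Or.inl rfl)

end

theorem plane_doubleCover (α : ℂ) (hα : α ^ 2 = -3) :
    let k := IntermediateField.adjoin ℚ {α}
    let γ : FunctionField2 k := algebraMap k (FunctionField2 k)
      (IntermediateField.AdjoinSimple.gen ℚ α)
    let u := coord k 0
    let v := coord k 1
    let s := paramS γ u v
    let t := paramT γ u v
    solT1 γ u v = tOne s t ∧ solT2 γ u v = tTwo s t ∧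
    solQ1 γ u v + solQ2 γ u v = critSum s t ∧ solQ1 γ u v * solQ2 γ u v = critProd s t ∧
    Module.finrank (IntermediateField.adjoin k {s, t}) (FunctionField2 k) = 2 ∧
    IntermediateField.adjoin k {s, t, solQ1 γ u v} = ⊤ := by
  intro k γ u v s t
  have hβ : (IntermediateField.AdjoinSimple.gen ℚ α) ^ 2 = -3 := by
    apply Subtype.ext
    exact hα
  have hγ : γ ^ 2 = -3 := by
    rw [← map_pow, hβ, map_neg, map_ofNat]
  have h : RegularPoint γ u v := regularPoint_coord hβ
  exact ⟨h.solT1_eq hγ, h.solT2_eq hγ, h.solQ_add hγ, h.solQ_mul hγ, finrank_paramField hβ⟩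

/-! ### The degree of the map to `(t₁, t₂)` -/

section FieldTheory

theorem algebraicIndependent_coord (k : Type*) [Field k] :
    AlgebraicIndependent k ![coord k 0, coord k 1] := by
  have h := (MvPolynomial.algebraicIndependent_X (Fin 2) k).map'
    (f := IsScalarTower.toAlgHom k (MvPolynomial (Fin 2) k) (FunctionField2 k))
    (IsFractionRing.injective _ _)
  convert h using 1
  ext i
  fin_cases i <;> rfl

-- The transcendence degree is two, so a pair over which the field is algebraic is a transcendence
-- basis.
open IntermediateField.algebraAdjoinAdjoin in
theorem algebraicIndependent_of_isAlgebraic {k : Type*} [Field k] (a b : FunctionField2 k)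
    [Algebra.IsAlgebraic (IntermediateField.adjoin k {a, b}) (FunctionField2 k)] :
    AlgebraicIndependent k ![a, b] := by
  have h1 : Algebra.IsAlgebraic (Algebra.adjoin k {a, b}) (FunctionField2 k) :=
    Algebra.IsAlgebraic.trans (Algebra.adjoin k {a, b}) (IntermediateField.adjoin k {a, b})
      (FunctionField2 k)
  have h2 : Algebra.IsAlgebraic (Algebra.adjoin k (Set.range ![a, b])) (FunctionField2 k) := by
    rw [Matrix.range_cons_cons_empty]
    exact h1
  exact (Algebra.IsAlgebraic.isTranscendenceBasis_of_lift_le_trdeg_of_finite k ![a, b]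
    (algebraicIndependent_coord k).lift_cardinalMk_le_trdeg).1

open IntermediateField.algebraAdjoinAdjoin in
theorem AlgebraicIndependent.transcendental_adjoin_pair {k L : Type*} [Field k] [Field L]
    [Algebra k L] {a b : L} (h : AlgebraicIndependent k ![a, b]) :
    Transcendental (IntermediateField.adjoin k {a}) b := by
  have h1 := h.transcendental_adjoin (s := {0}) (i := 1) (by simp)
  rw [Set.image_singleton] at h1
  intro h2
  exact h1 ((IsFractionRing.isAlgebraic_iff (Algebra.adjoin k {a}) (IntermediateField.adjoin k {a})
    L).2 h2)

theorem RatFunc.natDegree_num_div_of_isCoprime {K : Type*} [Field K] {p q : K[X]}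
    (hpq : IsCoprime p q) (hp : p ≠ 0) (hq : q ≠ 0) :
    (algebraMap K[X] (RatFunc K) p / algebraMap K[X] (RatFunc K) q).num.natDegree = p.natDegree ∧
    (algebraMap K[X] (RatFunc K) p / algebraMap K[X] (RatFunc K) q).denom.natDegree
      = q.natDegree := by
  set f := algebraMap K[X] (RatFunc K) p / algebraMap K[X] (RatFunc K) q with hf
  have h1 : f.num * q = p * f.denom := by
    rw [RatFunc.num_mul_eq_mul_denom_iff hq]
  have hf0 : f ≠ 0 := div_ne_zero (RatFunc.algebraMap_ne_zero hp) (RatFunc.algebraMap_ne_zero hq)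
  have h2 : p ∣ f.num := hpq.dvd_of_dvd_mul_right ⟨f.denom, h1⟩
  have h3 : q ∣ f.denom := hpq.symm.dvd_of_dvd_mul_left ⟨f.num, by rw [← h1, mul_comm]⟩
  exact ⟨le_antisymm (natDegree_le_of_dvd (RatFunc.num_div_dvd p hq) hp)
      (natDegree_le_of_dvd h2 (RatFunc.num_ne_zero hf0)),
    le_antisymm (natDegree_le_of_dvd (RatFunc.denom_div_dvd p q) hq)
      (natDegree_le_of_dvd h3 f.denom_ne_zero)⟩

/-- Since z is transcendental and generates L, the field L is a copy of K(X), where the degree over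
the subfield of a reduced fraction is the larger of the degrees of its numerator and denominator. -/
theorem IntermediateField.finrank_adjoin_div {K L : Type*} [Field K] [Field L] [Algebra K L]
    {z : L} (hz : Transcendental K z) (htop : IntermediateField.adjoin K {z} = ⊤) {p q : K[X]}
    (hpq : IsCoprime p q) (hp : p ≠ 0) (hq : q ≠ 0) :
    Module.finrank (IntermediateField.adjoin K {aeval z p / aeval z q}) L
      = max p.natDegree q.natDegree := by
  let e : RatFunc K ≃ₐ[K] L := (RatFunc.algEquivOfTranscendental z hz).trans
    ((IntermediateField.equivOfEq htop).trans IntermediateField.topEquiv)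
  have he : ∀ g : K[X], e (algebraMap _ _ g) = aeval z g := by
    intro g
    change ((IntermediateField.equivOfEq htop) (RatFunc.algEquivOfTranscendental z hz
      (algebraMap _ _ g)) : L) = _
    rw [RatFunc.algEquivOfTranscendental_algebraMap]
    change (((aeval (IntermediateField.AdjoinSimple.gen K z)) g : IntermediateField.adjoin K {z}) : L) = _
    exact (aeval_algHom_apply (IntermediateField.adjoin K {z}).val
      (IntermediateField.AdjoinSimple.gen K z) g).symm
  obtain ⟨h1, h2⟩ := RatFunc.natDegree_num_div_of_isCoprime hpq hp hq
  rw [← h1, ← h2, ← RatFunc.finrank_eq_max_natDegree]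
  set f := algebraMap K[X] (RatFunc K) p / algebraMap K[X] (RatFunc K) q with hf
  have hef : e f = aeval z p / aeval z q := by rw [hf, map_div₀, he, he]
  have hmap : (IntermediateField.adjoin K {f}).map e.toAlgHom
      = IntermediateField.adjoin K {aeval z p / aeval z q} := by
    rw [IntermediateField.adjoin_map, Set.image_singleton, ← hef]
    rfl
  rw [← hmap]
  exact (Algebra.finrank_eq_of_equiv_equiv
    (IntermediateField.intermediateFieldMap e (IntermediateField.adjoin K {f})).toRingEquiv
    e.toRingEquiv (by ext; rfl)).symm

end FieldTheory

/-! ### The fibres of t₁ as rational curves. -/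

/-- The coordinate that generates `ℂ(s,t)` over `ℂ(t₁)`. -/
def fibreCoord {F : Type*} [Field F] (s t : F) : F :=
  (2 * s / (s * t - t - 1 - s) - 1) / (s - 1)

section FibreCoord

variable {F : Type*} [Field F] [CharZero F] {s t : F} (h : RegularParameter s t)

include h

-- With x = 2s/(st-t-1-s) this is the conic x² - 1 = t₁(s² - 1) in the plane (s, x). Its rational
-- point (1, 1) is the base point for `fibreCoord`.
omit [CharZero F] in
theorem RegularParameter.tOne_eq : tOne s t
    = ((2 * s / (s * t - t - 1 - s)) ^ 2 - 1) / (s ^ 2 - 1) := by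
  have h1 := h.sm
  have h2 := h.sp
  have h3 := h.y
  have h4 : s ^ 2 - 1 ≠ 0 := by
    rw [show s ^ 2 - 1 = (s - 1) * (s + 1) by ring]; exact mul_ne_zero h1 h2
  rw [tOne, div_pow, div_sub_one (pow_ne_zero 2 h3), div_div, div_eq_div_iff
    (mul_ne_zero (pow_ne_zero 2 h3) h2) (mul_ne_zero (pow_ne_zero 2 h3) h4)]
  ring

omit [CharZero F] in
theorem RegularParameter.tTwo_eq : tTwo s t
    = ((2 * s / (s * t - t + s + 1)) ^ 2 - 1) / (s ^ 2 - 1) := by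
  have h1 := h.sm
  have h2 := h.sp
  have h3 := h.y'
  have h4 : s ^ 2 - 1 ≠ 0 := by
    rw [show s ^ 2 - 1 = (s - 1) * (s + 1) by ring]; exact mul_ne_zero h1 h2
  rw [tTwo, div_pow, div_sub_one (pow_ne_zero 2 h3), div_div, div_eq_div_iff
    (mul_ne_zero (pow_ne_zero 2 h3) h2) (mul_ne_zero (pow_ne_zero 2 h3) h4)]
  ring

variable (h0 : tOne s t ≠ 0) (h1 : tOne s t ≠ 1)

include h0 h1

/-- Here z is the slope of the line from (1, 1) to (s, x) on the conic x² - 1 = T(s² - 1). The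
second intersection gives s = (z² - 2z + T)/(z² - T) and x = (-z² + 2Tz - T)/(z² - T). Both t and t₂
follow from these. -/
theorem RegularParameter.fibreCoord_spec :
    let T := tOne s t
    let z := fibreCoord s t
    z ^ 2 - T ≠ 0 ∧ T - z ≠ 0 ∧ z ^ 2 - 2 * z + T = s * (z ^ 2 - T) ∧
    (s - 1) * t * (-z ^ 2 + 2 * T * z - T)
      = 2 * (z ^ 2 - 2 * z + T) + (s + 1) * (-z ^ 2 + 2 * T * z - T) ∧
    -z ^ 2 + 2 * T * z - T ≠ 0 ∧
    z ^ 4 - 4 * T * z ^ 3 + 6 * T * z ^ 2 - 4 * T * z + T ^ 2 ≠ 0 ∧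
    tTwo s t = (T - 1) * (z ^ 2 - T) ^ 3 * (z ^ 3 - 3 * T * z ^ 2 + 3 * T * z - T ^ 2)
      / ((z ^ 4 - 4 * T * z ^ 3 + 6 * T * z ^ 2 - 4 * T * z + T ^ 2) ^ 2 * (T - z)) := by
  intro T z
  have hm := h.sm
  have hp := h.sp
  have hy := h.y
  have hy' := h.y'
  have hm2 : s ^ 2 - 1 ≠ 0 := by
    rw [show s ^ 2 - 1 = (s - 1) * (s + 1) by ring]; exact mul_ne_zero hm hp
  have h2 : (2 : F) ≠ 0 := by norm_num
  have hT2 := h.tTwo_eq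
  have hT : T = _ := h.tOne_eq
  have hz : z = (2 * s / (s * t - t - 1 - s) - 1) / (s - 1) := rfl
  obtain ⟨x, hx⟩ : ∃ x, x = 2 * s / (s * t - t - 1 - s) := ⟨_, rfl⟩
  rw [← hx] at hT hz
  rw [eq_div_iff hm2] at hT
  rw [eq_div_iff hm] at hz
  rw [eq_div_iff hy] at hx
  have hx1 : x - 1 ≠ 0 := fun e => h0 (by
    refine (mul_eq_zero.1 (?_ : T * (s ^ 2 - 1) = 0)).resolve_right hm2
    linear_combination hT + (x + 1) * e)
  have hxs : x - s ≠ 0 := fun e => h1 (by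
    refine sub_eq_zero.1 ((mul_eq_zero.1 (?_ : (T - 1) * (s ^ 2 - 1) = 0)).resolve_right hm2)
    linear_combination hT + (x + s) * e)
  have hs0 : s ≠ 0 := by
    rintro rfl
    rw [mul_zero] at hx
    have hx0 := (mul_eq_zero.1 hx).resolve_right hy
    exact hxs (by rw [hx0]; ring)
  have hx0 : x ≠ 0 := by
    rintro rfl
    rw [zero_mul] at hx
    exact mul_ne_zero h2 hs0 hx.symm
  have hD : (s - 1) ^ 2 * (s + 1) ≠ 0 := mul_ne_zero (pow_ne_zero 2 hm) hp
  have hT' : T = (x ^ 2 - 1) / ((s - 1) * (s + 1)) := by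
    rw [eq_div_iff (mul_ne_zero hm hp)]; linear_combination hT
  have hz' : z = (x - 1) / (s - 1) := by rw [eq_div_iff hm, hz]
  have d : z ^ 2 - T = 2 * (x - 1) * (x - s) / ((s - 1) ^ 2 * (s + 1)) := by
    rw [hT', hz']; field_simp; ring
  have n1 : z ^ 2 - 2 * z + T = 2 * s * (x - 1) * (x - s) / ((s - 1) ^ 2 * (s + 1)) := by
    rw [hT', hz']; field_simp; ring
  have n2 : -z ^ 2 + 2 * T * z - T = 2 * x * (x - 1) * (x - s) / ((s - 1) ^ 2 * (s + 1)) := by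
    rw [hT', hz']; field_simp; ring
  have w : T - z = (x - 1) * (x - s) / ((s - 1) * (s + 1)) := by
    rw [hT', hz']; field_simp; ring
  have hyy : s * t - t + s + 1 = 2 * (s + s * x + x) / x := by
    rw [eq_div_iff hx0]; linear_combination hx
  have hsx : s + s * x + x ≠ 0 := fun e => hy' (by rw [hyy, e, mul_zero, zero_div])
  have he : z ^ 4 - 4 * T * z ^ 3 + 6 * T * z ^ 2 - 4 * T * z + T ^ 2
      = -(4 * (x - 1) ^ 2 * (x - s) ^ 2 * (s + s * x + x)) / ((s - 1) ^ 2 * (s + 1)) ^ 2 := by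
    rw [hT', hz']; field_simp; ring
  have hg : z ^ 3 - 3 * T * z ^ 2 + 3 * T * z - T ^ 2
      = -(2 * (x - 1) ^ 2 * (x - s) * (2 * s * x + s + x)) / ((s - 1) ^ 3 * (s + 1) ^ 2) := by
    rw [hT', hz']; field_simp; ring
  have hT1 : T - 1 = (x - s) * (x + s) / ((s - 1) * (s + 1)) := by
    rw [hT']; field_simp; ring
  refine ⟨?_, ?_, ?_, ?_, ?_, ?_, ?_⟩
  · rw [d]; exact div_ne_zero (mul_ne_zero (mul_ne_zero h2 hx1) hxs) hD
  · rw [w]; exact div_ne_zero (mul_ne_zero hx1 hxs) (mul_ne_zero hm hp)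
  · rw [n1, d]; ring
  · rw [n1, n2]
    field_simp
    linear_combination hx
  · rw [n2]; exact div_ne_zero (mul_ne_zero (mul_ne_zero (mul_ne_zero h2 hx0) hx1) hxs) hD
  · rw [he]
    exact div_ne_zero (neg_ne_zero.2 (mul_ne_zero (mul_ne_zero (mul_ne_zero (by norm_num)
      (pow_ne_zero 2 hx1)) (pow_ne_zero 2 hxs)) hsx)) (pow_ne_zero 2 hD)
  · have hL : tTwo s t = -((x + s) * (2 * s * x + s + x))
        / ((s - 1) * (s + 1) * (s + s * x + x) ^ 2) := by
      have e1 : 2 * s / (s * t - t + s + 1) = s * x / (s + s * x + x) := by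
        rw [hyy, div_div_eq_mul_div, div_eq_div_iff (mul_ne_zero h2 hsx) hsx]
        ring
      rw [hT2, e1, div_pow, div_sub_one (pow_ne_zero 2 hsx), div_div, div_eq_div_iff
        (mul_ne_zero (pow_ne_zero 2 hsx) hm2)
        (mul_ne_zero (mul_ne_zero hm hp) (pow_ne_zero 2 hsx))]
      ring
    rw [he, w, d, hg, hT1, hL]
    clear * - hsx hm hp hx1 hxs h2
    generalize s + s * x + x = k at *
    generalize 2 * s * x + s + x = m at *
    generalize x - s = a at *
    generalize x - 1 = b at *
    generalize s - 1 = c at *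
    generalize s + 1 = d at *
    have h4 : (4 : F) ≠ 0 := by norm_num
    field_simp
    ring

end FibreCoord

section Fibration

variable {K : Type*} [Field K] [CharZero K] {T : K}

theorem natDegree_fibration (T : K) :
    let p : K[X] := C (T - 1) * (X ^ 2 - C T) ^ 3 * (X ^ 3 - C (3 * T) * X ^ 2 + C (3 * T) * X - C (T ^ 2))
    let q : K[X] := (X ^ 4 - C (4 * T) * X ^ 3 + C (6 * T) * X ^ 2 - C (4 * T) * X + C (T ^ 2)) ^ 2
      * (C T - X)
    T ≠ 1 → p.natDegree = 9 ∧ q.natDegree = 9 := by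
  intro p q hT
  have hT' := sub_ne_zero.2 hT
  have h1 : (X ^ 2 - C T : K[X]).natDegree = 2 := by compute_degree!
  have h2 : (X ^ 3 - C (3 * T) * X ^ 2 + C (3 * T) * X - C (T ^ 2) : K[X]).natDegree = 3 := by
    compute_degree!
  have h3 : (X ^ 4 - C (4 * T) * X ^ 3 + C (6 * T) * X ^ 2 - C (4 * T) * X + C (T ^ 2)
      : K[X]).natDegree = 4 := by compute_degree!
  have h4 : (C T - X : K[X]).natDegree = 1 := by compute_degree!
  have n : ∀ {f : K[X]} {m : ℕ}, f.natDegree = m + 1 → f ≠ 0 := by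
    rintro f m h rfl
    simp at h
  constructor
  · rw [natDegree_mul (mul_ne_zero (C_ne_zero.2 hT') (pow_ne_zero _ (n h1))) (n h2),
      natDegree_C_mul hT', natDegree_pow, h1, h2]
  · rw [natDegree_mul (pow_ne_zero _ (n h3)) (n h4), natDegree_pow, h3, h4]

theorem isCoprime_fibration (h0 : T ≠ 0) (h1 : T ≠ 1) :
    IsCoprime (C (T - 1) * (X ^ 2 - C T) ^ 3 * (X ^ 3 - C (3 * T) * X ^ 2 + C (3 * T) * X - C (T ^ 2)) : K[X])
      ((X ^ 4 - C (4 * T) * X ^ 3 + C (6 * T) * X ^ 2 - C (4 * T) * X + C (T ^ 2)) ^ 2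
      * (C T - X)) := by
  have h1' : T - 1 ≠ 0 := sub_ne_zero.2 h1
  have h2 : (2 : K) ≠ 0 := by norm_num
  have key : ∀ (f : K[X]) (a : K), f.eval a ≠ 0 → IsCoprime f (X - C a) := fun f a h =>
    ((irreducible_X_sub_C a).coprime_iff_not_dvd.2 (by rwa [dvd_iff_isRoot])).symm
  have hu : ∀ (f : K[X]) (a : K), a ≠ 0 → IsCoprime f (C a) := fun f a ha =>
    ⟨0, C a⁻¹, by rw [zero_mul, zero_add, ← C_mul, inv_mul_cancel₀ ha, C_1]⟩
  -- In terms of the slope, s = n₁/d and x = n₂/d. The identities `e1` and `e2` express the quartic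
  -- e and the cubic g through d, n₁, n₂, which reduces coprimality to resultants with linear
  -- factors.
  set d : K[X] := X ^ 2 - C T with hd
  set n₁ : K[X] := X ^ 2 - 2 * X + C T with hn₁
  set n₂ : K[X] := -X ^ 2 + 2 * C T * X - C T with hn₂
  set g : K[X] := X ^ 3 - C (3 * T) * X ^ 2 + C (3 * T) * X - C (T ^ 2) with hg
  set e : K[X] := X ^ 4 - C (4 * T) * X ^ 3 + C (6 * T) * X ^ 2 - C (4 * T) * X + C (T ^ 2) with he
  have cs : ∀ n : ℕ, ∀ [n.AtLeastTwo], (C (OfNat.ofNat n : K) : K[X]) = OfNat.ofNat n := fun n _ => map_ofNat C n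
  have e1 : -e = 2 * C T * (X - C 1) * n₁ + d * n₂ := by
    rw [he, hn₁, hn₂, hd]; simp only [map_mul, map_pow, map_one, cs]; ring
  have e2 : -(2 * (X - C 1) * g) + e = n₁ * n₂ := by
    rw [he, hn₁, hn₂, hg]; simp only [map_mul, map_pow, map_one, cs]; ring
  have c1 : IsCoprime d (X - C T) := key _ _ (by
    rw [hd]; simpa [show T ^ 2 - T = T * (T - 1) by ring] using ⟨h0, h1'⟩)
  have c2 : IsCoprime d (X - C 1) := key _ _ (by
    rw [hd]; simpa [sub_eq_zero] using Ne.symm h1)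
  have c3 : IsCoprime d n₁ := by
    have : n₁ = -(C 2 * (X - C T)) + d * 1 := by rw [hn₁, hd]; simp only [cs]; ring
    rw [this]
    exact (((hu d 2 h2).mul_right c1).neg_right).add_mul_left_right 1
  have c4 : IsCoprime d (-e) := by
    rw [e1, ← cs 2, ← C_mul]
    exact ((((hu d _ (mul_ne_zero h2 h0)).mul_right c2).mul_right c3)).add_mul_left_right _
  have c5 : IsCoprime n₁ n₂ := by
    have : n₂ = C (2 * (T - 1)) * (X - C 0) + n₁ * (-1) := by
      rw [hn₁, hn₂]; simp only [map_mul, map_sub, map_one, map_zero, cs]; ring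
    rw [this]
    exact ((hu _ _ (mul_ne_zero h2 h1')).mul_right (key _ _ (by rw [hn₁]; simpa using h0))).add_mul_left_right _
  have c6 : IsCoprime n₁ (-e) := by
    rw [e1, add_comm, mul_comm _ n₁]
    exact (c3.symm.mul_right c5).add_mul_left_right _
  have c7 : IsCoprime n₂ (-e) := by
    rw [e1, ← cs 2, ← C_mul, mul_comm d]
    refine (((hu n₂ _ (mul_ne_zero h2 h0)).mul_right (key _ _ ?_)).mul_right c5.symm).add_mul_left_right _
    rw [hn₂]
    simp
    intro e; exact h1' (by linear_combination e)
  have c8 : IsCoprime g e := by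
    have h8 : IsCoprime (n₁ * n₂) e := by
      have := (c6.mul_left c7).neg_right; rwa [neg_neg] at this
    rw [← e2] at h8
    have h9 : IsCoprime (-(2 * (X - C 1) * g)) e := by
      have := h8.symm.add_mul_left_right (-1)
      have h' : -(2 * (X - C 1) * g) + e + e * -1 = -(2 * (X - C 1) * g) := by ring
      rw [h'] at this
      exact this.symm
    have h10 := h9.neg_left
    rw [neg_neg] at h10
    exact h10.of_mul_left_right
  have c9 : IsCoprime g (X - C T) := key _ _ (by
    have : g.eval T = -2 * (T ^ 2 * (T - 1)) := by rw [hg]; simp; ring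
    rw [this]
    exact mul_ne_zero (neg_ne_zero.2 h2) (mul_ne_zero (pow_ne_zero 2 h0) h1'))
  have c4' : IsCoprime d e := by have := c4.neg_right; rwa [neg_neg] at this
  have e3 : (C T - X : K[X]) = -(X - C T) := by ring
  rw [e3]
  exact (((hu _ _ h1').symm.mul_left (((c4'.pow_right (n := 2)).mul_right c1.neg_right).pow_left (m := 3))).mul_left
    ((c8.pow_right (n := 2)).mul_right c9.neg_right))

end Fibration

section Plane

variable {k : Type*} [Field k] [CharZero k]

theorem regularParameter_coord :
    RegularParameter (coord k 0) (coord k 1) := by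
  have key : ∀ (p : MvPolynomial (Fin 2) k) (x : FunctionField2 k), MvPolynomial.eval ![2, 2] p ≠ 0 →
      algebraMap _ _ p = x → x ≠ 0 := fun p x hp e =>
    e ▸ FunctionField2.algebraMap_ne_zero ![2, 2] hp
  rw [coord, coord]
  constructor
  · exact key (MvPolynomial.X 0 - 1) _ (by simp; norm_num) (by simp only [map_sub, map_one])
  · exact key (MvPolynomial.X 0 + 1) _ (by simp; norm_num) (by simp only [map_add, map_one])
  · exact key (MvPolynomial.X 0 * MvPolynomial.X 1 - MvPolynomial.X 1 - 1 - MvPolynomial.X 0) _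
      (by simp; norm_num) (by simp only [map_sub, map_mul, map_one])
  · exact key (MvPolynomial.X 0 * MvPolynomial.X 1 - MvPolynomial.X 1 + MvPolynomial.X 0 + 1) _
      (by simp; norm_num) (by simp only [map_sub, map_add, map_mul, map_one])

theorem tOne_coord_ne : tOne (coord k 0) (coord k 1) ≠ 0 ∧ tOne (coord k 0) (coord k 1) ≠ 1 := by
  have key : ∀ (p : MvPolynomial (Fin 2) k) (x : FunctionField2 k), MvPolynomial.eval ![2, 2] p ≠ 0 →
      algebraMap _ _ p = x → x ≠ 0 := fun p x hp e =>
    e ▸ FunctionField2.algebraMap_ne_zero ![2, 2] hp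
  have h : RegularParameter (coord k 0) (coord k 1) := regularParameter_coord
  have hy := h.y
  have hp := h.sp
  constructor
  · refine div_ne_zero (neg_ne_zero.2 ?_) (mul_ne_zero (pow_ne_zero 2 hy) hp)
    rw [coord, coord]
    exact key ((MvPolynomial.X 1 + 1) * (MvPolynomial.X 0 * MvPolynomial.X 1 - MvPolynomial.X 1 - 1
      - 3 * MvPolynomial.X 0)) _ (by simp; norm_num)
      (by simp only [map_sub, map_mul, map_one, map_add, map_ofNat])
  · intro e
    rw [tOne, div_eq_one_iff_eq (mul_ne_zero (pow_ne_zero 2 hy) hp), ← sub_eq_zero] at e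
    revert e
    rw [coord, coord]
    exact key (-((MvPolynomial.X 1 + 1) * (MvPolynomial.X 0 * MvPolynomial.X 1 - MvPolynomial.X 1 - 1
      - 3 * MvPolynomial.X 0)) - (MvPolynomial.X 0 * MvPolynomial.X 1 - MvPolynomial.X 1 - 1
      - MvPolynomial.X 0) ^ 2 * (MvPolynomial.X 0 + 1)) _ (by simp; norm_num)
      (by simp only [map_sub, map_mul, map_one, map_add, map_ofNat, map_neg, map_pow])

theorem adjoin_tOne_fibreCoord : IntermediateField.adjoin k
    {tOne (coord k 0) (coord k 1), fibreCoord (coord k 0) (coord k 1)} = ⊤ := by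
  obtain ⟨hd, -, h1, h2, h3, -⟩ := (regularParameter_coord (k := k)).fibreCoord_spec tOne_coord_ne.1
    tOne_coord_ne.2
  rw [eq_top_iff, ← FunctionField2.adjoin_coord k, IntermediateField.adjoin_le_iff]
  set s := coord k 0
  set t := coord k 1
  set T := tOne s t
  set z := fibreCoord s t
  set E := IntermediateField.adjoin k {T, z}
  have hT : T ∈ E := IntermediateField.subset_adjoin _ _ (Or.inl rfl)
  have hz : z ∈ E := IntermediateField.subset_adjoin _ _ (Or.inr rfl)
  have hs : s ∈ E := by
    rw [eq_div_of_mul_eq hd h1.symm]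
    exact div_mem (add_mem (sub_mem (pow_mem hz 2) (mul_mem (ofNat_mem _ 2) hz)) hT)
      (sub_mem (pow_mem hz 2) hT)
  have hn : -z ^ 2 + 2 * T * z - T ∈ E :=
    sub_mem (add_mem (neg_mem (pow_mem hz 2)) (mul_mem (mul_mem (ofNat_mem _ 2) hT) hz)) hT
  have ht : t = (2 * (z ^ 2 - 2 * z + T) + (s + 1) * (-z ^ 2 + 2 * T * z - T))
      / ((s - 1) * (-z ^ 2 + 2 * T * z - T)) := by
    rw [eq_div_iff (mul_ne_zero (regularParameter_coord (k := k)).sm h3), ← h2]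
    ring
  rintro x (rfl | rfl)
  · exact hs
  · rw [ht]
    exact div_mem (add_mem (mul_mem (ofNat_mem _ 2) (add_mem (sub_mem (pow_mem hz 2)
      (mul_mem (ofNat_mem _ 2) hz)) hT)) (mul_mem (add_mem hs (one_mem _)) hn))
      (mul_mem (sub_mem hs (one_mem _)) hn)

end Plane

theorem IntermediateField.finrank_adjoin_pair {k L : Type*} [Field k] [Field L] [Algebra k L]
    (a b : L) : Module.finrank (IntermediateField.adjoin k {a, b}) L
      = Module.finrank (IntermediateField.adjoin (IntermediateField.adjoin k {a}) {b}) L := by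
  have e : IntermediateField.adjoin k {a, b} = (IntermediateField.adjoin
      (IntermediateField.adjoin k {a}) {b}).restrictScalars k := by
    rw [IntermediateField.adjoin_adjoin_left, Set.singleton_union]
  rw [e]
  rfl

theorem finrank_fibration {k L : Type*} [Field k] [CharZero k] [Field L] [Algebra k L] {T z T₂ : L}
    (h0 : T ≠ 0) (h1 : T ≠ 1) (hz : Transcendental (IntermediateField.adjoin k {T}) z)
    (htop : IntermediateField.adjoin (IntermediateField.adjoin k {T}) {z} = ⊤)
    (h2 : T₂ = (T - 1) * (z ^ 2 - T) ^ 3 * (z ^ 3 - 3 * T * z ^ 2 + 3 * T * z - T ^ 2)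
      / ((z ^ 4 - 4 * T * z ^ 3 + 6 * T * z ^ 2 - 4 * T * z + T ^ 2) ^ 2 * (T - z))) :
    Module.finrank (IntermediateField.adjoin k {T, T₂}) L = 9 := by
  let T' : IntermediateField.adjoin k {T} := IntermediateField.AdjoinSimple.gen k T
  have h0' : T' ≠ 0 := fun e => h0 (congrArg Subtype.val e)
  have h1' : T' ≠ 1 := fun e => h1 (congrArg Subtype.val e)
  have hT' : algebraMap (IntermediateField.adjoin k {T}) L T' = T := rfl
  have hc := isCoprime_fibration h0' h1'
  obtain ⟨d1, d2⟩ := natDegree_fibration T' h1'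
  have n : ∀ {f : (IntermediateField.adjoin k {T})[X]}, f.natDegree = 9 → f ≠ 0 := by
    rintro f h rfl
    simp at h
  have key := IntermediateField.finrank_adjoin_div hz htop hc (n d1) (n d2)
  rw [d1, d2, max_self] at key
  have e : T₂ = aeval z (C (T' - 1) * (X ^ 2 - C T') ^ 3
      * (X ^ 3 - C (3 * T') * X ^ 2 + C (3 * T') * X - C (T' ^ 2)))
      / aeval z ((X ^ 4 - C (4 * T') * X ^ 3 + C (6 * T') * X ^ 2 - C (4 * T') * X + C (T' ^ 2)) ^ 2
        * (C T' - X)) := by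
    rw [h2]
    simp only [map_mul, map_sub, map_add, map_pow, aeval_X, aeval_C, hT', map_one, map_ofNat]
  rw [IntermediateField.finrank_adjoin_pair, e, key]

theorem FunctionField2.transcendental_of_adjoin_eq_top {k : Type*} [Field k] {a b : FunctionField2 k}
    (h : IntermediateField.adjoin k {a, b} = ⊤) : Transcendental (IntermediateField.adjoin k {a}) b := by
  have : Algebra.IsAlgebraic (IntermediateField.adjoin k {a, b}) (FunctionField2 k) :=
    ⟨fun x => isAlgebraic_algebraMap
      (⟨x, h ▸ IntermediateField.mem_top⟩ : IntermediateField.adjoin k {a, b})⟩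
  exact (algebraicIndependent_of_isAlgebraic a b).transcendental_adjoin_pair

theorem finrank_adjoin_tOne_tTwo {k : Type*} [Field k] [CharZero k] :
    Module.finrank (IntermediateField.adjoin k
      {tOne (coord k 0) (coord k 1), tTwo (coord k 0) (coord k 1)}) (FunctionField2 k) = 9 := by
  have h := (regularParameter_coord (k := k)).fibreCoord_spec tOne_coord_ne.1
    tOne_coord_ne.2
  have htop := adjoin_tOne_fibreCoord (k := k)
  obtain ⟨h0, h1⟩ := tOne_coord_ne (k := k)
  dsimp only at h
  generalize tOne (coord k 0) (coord k 1) = T at *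
  generalize fibreCoord (coord k 0) (coord k 1) = z at *
  exact finrank_fibration h0 h1
    (FunctionField2.transcendental_of_adjoin_eq_top htop)
    (IntermediateField.adjoin_eq_top_of_mem _ htop (IntermediateField.subset_adjoin _ _ rfl))
    h.2.2.2.2.2.2

/-! ### Valuations at which the points `0, 1, ∞, t₁, t₂` stay apart -/

/-- The quadrics satisfy m₀ + m₁ = 2bc, m₀ + m₂ = 2c, m₀ + m₃ = 2b, and all four add up to zero. The
cases are distinguished by which of them vanish. -/
theorem eq_zero_of_differences_eq_zero {κ : Type*} [Field κ] (h2 : (2 : κ) ≠ 0) {b c : κ}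
    (h01 : (b + c) * (c - b - b * c) ^ 2 * (b - c - b * c) ^ 2 = 0)
    (h02 : (1 + c) * (b * c - b - c) ^ 2 * (b - c - b * c) ^ 2 = 0)
    (h03 : (1 + b) * (b * c - b - c) ^ 2 * (c - b - b * c) ^ 2 = 0)
    (h12 : (1 - b) * (b * c + b + c) ^ 2 * (b - c - b * c) ^ 2 = 0)
    (h13 : (1 - c) * (b * c + b + c) ^ 2 * (c - b - b * c) ^ 2 = 0)
    (h23 : (b - c) * (b * c + b + c) ^ 2 * (b * c - b - c) ^ 2 = 0) : b = 0 ∧ c = 0 := by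
  have cancel : ∀ x : κ, 2 * x = 0 → x = 0 := fun x h => (mul_eq_zero.1 h).resolve_left h2
  obtain ⟨m0, e0⟩ : ∃ m, m = b * c + b + c := ⟨_, rfl⟩
  obtain ⟨m1, e1⟩ : ∃ m, m = b * c - b - c := ⟨_, rfl⟩
  obtain ⟨m2, e2⟩ : ∃ m, m = c - b - b * c := ⟨_, rfl⟩
  obtain ⟨m3, e3⟩ : ∃ m, m = b - c - b * c := ⟨_, rfl⟩
  rw [← e2, ← e3] at h01
  rw [← e1, ← e3] at h02
  rw [← e1, ← e2] at h03
  rw [← e0, ← e3] at h12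
  rw [← e0, ← e2] at h13
  rw [← e0, ← e1] at h23
  simp only [mul_eq_zero, pow_eq_zero_iff two_ne_zero] at h01 h02 h03 h12 h13 h23
  have one : (1 : κ) ≠ 0 := one_ne_zero
  by_cases z0 : m0 = 0
  · by_cases z1 : m1 = 0
    · have hbc : b * c = 0 := cancel _ (by linear_combination z0 + z1 - e0 - e1)
      by_cases z2 : m2 = 0
      · have hc : c = 0 := cancel _ (by linear_combination z0 + z2 - e0 - e2)
        exact ⟨by linear_combination z0 - e0 - hbc - hc, hc⟩
      · by_cases z3 : m3 = 0
        · have hb : b = 0 := cancel _ (by linear_combination z0 + z3 - e0 - e3)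
          exact ⟨hb, by linear_combination z0 - e0 - hbc - hb⟩
        · have hs : b + c = 0 := h01.resolve_right z3 |>.resolve_right z2
          have hb : b = 0 := pow_eq_zero_iff two_ne_zero |>.1 (by linear_combination b * hs - hbc)
          exact ⟨hb, by linear_combination hs - hb⟩
    · have hb : b = 0 := by
        rcases h02 with (h | h) | h
        · exact absurd (by linear_combination (b + 1) * h + e0 - z0 : (1 : κ) = 0) one
        · exact absurd h z1
        · exact cancel _ (by linear_combination z0 + h - e0 - e3)
      have hc : c = 0 := by linear_combination z0 - e0 - (c + 1) * hb
      exact ⟨hb, hc⟩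
  · have hm3 : m3 = 0 := by
      rcases h12 with (h | h) | h
      · have hb : b = 1 := by linear_combination -h
        subst hb
        have z1 : m1 ≠ 0 := fun z => one (by linear_combination e1 - z)
        have hc : c = 1 := by
          rcases h23 with (h | h) | h
          · linear_combination -h
          · exact absurd h z0
          · exact absurd h z1
        subst hc
        rcases h01 with (h | h) | h
        · exact absurd (by linear_combination h) h2
        · exact absurd (by linear_combination e2 - h) one
        · exact h
      · exact absurd h z0
      · exact h
    have hm2 : m2 = 0 := by
      rcases h13 with (h | h) | h
      · exact absurd (by linear_combination e3 - hm3 + (b + 1) * h : (1 : κ) = 0) one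
      · exact absurd h z0
      · exact h
    have z1 : m1 ≠ 0 := fun z => z0 (by linear_combination e0 + e1 + e2 + e3 - z - hm2 - hm3)
    have hbc : b - c = 0 := h23.resolve_right z1 |>.resolve_right z0
    have hb : b = 0 := pow_eq_zero_iff two_ne_zero |>.1 (by
      linear_combination (1 + b) * hbc + e3 - hm3)
    exact ⟨hb, by linear_combination hb - hbc⟩

section Valuation

variable {L : Type*} [Field L]

theorem Valuation.eq_one_of_mul_eq_one {Γ : Type*} [LinearOrderedCommGroupWithZero Γ]
    (v : Valuation L Γ) {x y : L} (hx : v x ≤ 1) (hy : v y ≤ 1) (h : v (x * y) = 1) :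
    v x = 1 ∧ v y = 1 := by
  rw [map_mul] at h
  refine ⟨le_antisymm hx ?_, le_antisymm hy ?_⟩
  · calc (1 : Γ) = v x * v y := h.symm
      _ ≤ v x * 1 := by gcongr
      _ = v x := mul_one _
  · calc (1 : Γ) = v x * v y := h.symm
      _ ≤ 1 * v y := by gcongr
      _ = v y := one_mul _

theorem Valuation.factors_eq_one {Γ : Type*} [LinearOrderedCommGroupWithZero Γ]
    (v : Valuation L Γ) {x y z : L} (hx : v x ≤ 1) (hy : v y ≤ 1) (hz : v z ≤ 1)
    (h : v (x * y ^ 2 * z ^ 2) = 1) : v x = 1 ∧ v y = 1 ∧ v z = 1 := by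
  have hy2 : v (y ^ 2) ≤ 1 := by rw [map_pow]; exact pow_le_one' hy 2
  have hz2 : v (z ^ 2) ≤ 1 := by rw [map_pow]; exact pow_le_one' hz 2
  obtain ⟨h1, h2⟩ := v.eq_one_of_mul_eq_one (by rw [map_mul]; exact mul_le_one' hx hy2) hz2 h
  obtain ⟨h3, h4⟩ := v.eq_one_of_mul_eq_one hx hy2 h1
  rw [pow_two] at h2 h4
  exact ⟨h3, (v.eq_one_of_mul_eq_one hy hy h4).1, (v.eq_one_of_mul_eq_one hz hz h2).1⟩

/-- If the six differences have the same absolute value, they are units. -/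
theorem ValuationSubring.differences_eq_one (V : ValuationSubring L) (h2 : V.valuation 2 = 1)
    {b c : L} (hb : V.valuation b ≤ 1) (hc : V.valuation c ≤ 1) {δ : V.ValueGroup} (hδ : δ ≠ 0)
    (h01 : V.valuation ((b + c) * (c - b - b * c) ^ 2 * (b - c - b * c) ^ 2) = δ)
    (h02 : V.valuation ((1 + c) * (b * c - b - c) ^ 2 * (b - c - b * c) ^ 2) = δ)
    (h03 : V.valuation ((1 + b) * (b * c - b - c) ^ 2 * (c - b - b * c) ^ 2) = δ)
    (h12 : V.valuation ((1 - b) * (b * c + b + c) ^ 2 * (b - c - b * c) ^ 2) = δ)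
    (h13 : V.valuation ((1 - c) * (b * c + b + c) ^ 2 * (c - b - b * c) ^ 2) = δ)
    (h23 : V.valuation ((b - c) * (b * c + b + c) ^ 2 * (b * c - b - c) ^ 2) = δ) : δ = 1 := by
  rw [V.valuation_le_one_iff] at hb hc
  by_cases hlt : V.valuation b < 1 ∧ V.valuation c < 1
  -- With b and c both in the maximal ideal, 1 ± b and 1 ± c are units. The six equalities then
  -- force v(b+c)v(b-c) = 1, although both values are below 1.
  · exfalso
    obtain ⟨lb, lc⟩ := hlt
    have p1 : V.valuation (1 + c) = 1 := V.valuation.map_one_add_of_lt lc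
    have p2 : V.valuation (1 + b) = 1 := V.valuation.map_one_add_of_lt lb
    have p3 : V.valuation (1 - c) = 1 := V.valuation.map_one_sub_of_lt lc
    have p4 : V.valuation (1 - b) = 1 := V.valuation.map_one_sub_of_lt lb
    have q1 : V.valuation (b + c) < 1 := V.valuation.map_add_lt lb lc
    have q2 : V.valuation (b - c) < 1 := V.valuation.map_sub_lt lb lc
    simp only [map_mul, map_pow, p1, p2, p3, p4, one_mul] at h01 h02 h03 h12 h13 h23
    generalize V.valuation (b + c) = β at *
    generalize V.valuation (b - c) = γ at *
    generalize V.valuation (b * c + b + c) ^ 2 = a₀ at *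
    generalize V.valuation (b * c - b - c) ^ 2 = a₁ at *
    generalize V.valuation (c - b - b * c) ^ 2 = a₂ at *
    generalize V.valuation (b - c - b * c) ^ 2 = a₃ at *
    have n1 : a₁ ≠ 0 := by rintro rfl; exact hδ (by rw [← h02, zero_mul])
    have n3 : a₃ ≠ 0 := by rintro rfl; exact hδ (by rw [← h02, mul_zero])
    have e1 : a₃ = a₂ := mul_left_cancel₀ n1 (h02.trans h03.symm)
    have e2 : a₀ = a₁ := mul_right_cancel₀ n3 (h12.trans h02.symm)
    subst e1 e2
    have e3 : β * a₃ = a₀ := mul_right_cancel₀ n3 (h01.trans h02.symm)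
    have e4 : γ * a₀ = a₃ := mul_right_cancel₀ n1 ((h23.trans h02.symm).trans (mul_comm _ _))
    have e5 : β * γ = 1 := mul_right_cancel₀ n1 (by rw [mul_assoc, e4, e3, one_mul])
    exact (mul_lt_one_of_nonneg_of_lt_one_left zero_le q1 q2.le).ne e5
  -- If δ < 1, all six expressions vanish in the residue field, which puts b and c in the maximal
  -- ideal.
  · by_contra hne
    apply hlt
    have hle : δ ≤ 1 := by
      rw [← h01, V.valuation_le_one_iff]
      exact MulMemClass.mul_mem (MulMemClass.mul_mem (AddMemClass.add_mem hb hc) (_root_.pow_mem (_root_.sub_mem (_root_.sub_mem hc hb) (MulMemClass.mul_mem hb hc)) 2))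
        (_root_.pow_mem (_root_.sub_mem (_root_.sub_mem hb hc) (MulMemClass.mul_mem hb hc)) 2)
    have hl := lt_of_le_of_ne hle hne
    let b' : V := ⟨b, hb⟩
    let c' : V := ⟨c, hc⟩
    have key : ∀ x : V, V.valuation x < 1 → IsLocalRing.residue V x = 0 := fun x hx =>
      (IsLocalRing.residue_eq_zero_iff x).2 ((V.valuation_lt_one_iff x).2 hx)
    have key' : ∀ x : V, IsLocalRing.residue V x = 0 → V.valuation x < 1 := fun x hx =>
      (V.valuation_lt_one_iff x).1 ((IsLocalRing.residue_eq_zero_iff x).1 hx)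
    have two : (2 : IsLocalRing.ResidueField V) ≠ 0 := by
      intro e
      have := key' 2 (by rw [map_ofNat]; exact e)
      rw [show ((2 : V) : L) = 2 from rfl, h2] at this
      exact lt_irrefl _ this
    have r01 := key ((b' + c') * (c' - b' - b' * c') ^ 2 * (b' - c' - b' * c') ^ 2) (h01.trans_lt hl)
    have r02 := key ((1 + c') * (b' * c' - b' - c') ^ 2 * (b' - c' - b' * c') ^ 2) (h02.trans_lt hl)
    have r03 := key ((1 + b') * (b' * c' - b' - c') ^ 2 * (c' - b' - b' * c') ^ 2) (h03.trans_lt hl)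
    have r12 := key ((1 - b') * (b' * c' + b' + c') ^ 2 * (b' - c' - b' * c') ^ 2) (h12.trans_lt hl)
    have r13 := key ((1 - c') * (b' * c' + b' + c') ^ 2 * (c' - b' - b' * c') ^ 2) (h13.trans_lt hl)
    have r23 := key ((b' - c') * (b' * c' + b' + c') ^ 2 * (b' * c' - b' - c') ^ 2) (h23.trans_lt hl)
    simp only [map_mul, map_add, map_sub, map_pow, map_one] at r01 r02 r03 r12 r13 r23
    obtain ⟨z1, z2⟩ := eq_zero_of_differences_eq_zero two r01 r02 r03 r12 r13 r23
    exact ⟨key' b' z1, key' c' z2⟩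

/-- The six differences of `0, ∞, 1, t₁, t₂` up to a common factor, in homogeneous coordinates. -/
structure EqualDifferences {Γ : Type*} [LinearOrderedCommGroupWithZero Γ] (v : Valuation L Γ) (x y z : L)
    (δ : Γ) : Prop where
  ne_zero : δ ≠ 0
  h01 : v ((y + z) * (x * z - x * y - y * z) ^ 2 * (x * y - x * z - y * z) ^ 2) = δ
  h02 : v ((x + z) * (y * z - x * y - x * z) ^ 2 * (x * y - x * z - y * z) ^ 2) = δ
  h03 : v ((x + y) * (y * z - x * y - x * z) ^ 2 * (x * z - x * y - y * z) ^ 2) = δ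
  h12 : v ((x - y) * (y * z + x * y + x * z) ^ 2 * (x * y - x * z - y * z) ^ 2) = δ
  h13 : v ((x - z) * (y * z + x * y + x * z) ^ 2 * (x * z - x * y - y * z) ^ 2) = δ
  h23 : v ((y - z) * (y * z + x * y + x * z) ^ 2 * (y * z - x * y - x * z) ^ 2) = δ

/-- A permutation of the coordinates permutes the four quadrics, and hence the six expressions up to
sign. The coordinate of largest value can therefore be moved to the first place. -/
theorem EqualDifferences.swap {Γ : Type*} [LinearOrderedCommGroupWithZero Γ] {v : Valuation L Γ} {x y z : L}
    {δ : Γ} (h : EqualDifferences v x y z δ) : EqualDifferences v y x z δ := by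
  refine ⟨h.ne_zero, ?_, ?_, ?_, ?_, ?_, ?_⟩
  · rw [← h.h02]; ring_nf
  · rw [← h.h01]; ring_nf
  · rw [← h.h03]; ring_nf
  · rw [← h.h12, ← v.map_neg]; ring_nf
  · rw [← h.h23]; ring_nf
  · rw [← h.h13]; ring_nf

theorem EqualDifferences.rotate {Γ : Type*} [LinearOrderedCommGroupWithZero Γ] {v : Valuation L Γ} {x y z : L}
    {δ : Γ} (h : EqualDifferences v x y z δ) : EqualDifferences v z x y δ := by
  refine ⟨h.ne_zero, ?_, ?_, ?_, ?_, ?_, ?_⟩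
  · rw [← h.h03]; ring_nf
  · rw [← h.h01]; ring_nf
  · rw [← h.h02]; ring_nf
  · rw [← h.h13, ← v.map_neg]; ring_nf
  · rw [← h.h23, ← v.map_neg]; ring_nf
  · rw [← h.h12]; ring_nf

/-- The six forms are homogeneous of degree 9, so division by x⁹ passes to the affine coordinates
y/x and z/x, which are integral. -/
theorem EqualDifferences.eq_pow {V : ValuationSubring L} (h2 : V.valuation 2 = 1) {x y z : L}
    {δ : V.ValueGroup} (h : EqualDifferences V.valuation x y z δ) (hx : x ≠ 0)
    (hy : V.valuation y ≤ V.valuation x) (hz : V.valuation z ≤ V.valuation x) :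
    δ = V.valuation x ^ 9 := by
  have hvx : V.valuation x ≠ 0 := (V.valuation.ne_zero_iff).2 hx
  have hle : ∀ w : L, V.valuation w ≤ V.valuation x → V.valuation (w / x) ≤ 1 := fun w hw => by
    rw [map_div₀]; exact div_le_one_of_le₀ hw zero_le
  have key : ∀ p q : L, V.valuation p = δ → p = x ^ 9 * q → V.valuation q = δ / V.valuation x ^ 9 := by
    rintro p q rfl rfl
    rw [map_mul, map_pow, mul_div_cancel_left₀ _ (pow_ne_zero 9 hvx)]
  have h1 := V.differences_eq_one h2 (hle y hy) (hle z hz)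
    (δ := δ / V.valuation x ^ 9) (div_ne_zero h.ne_zero (pow_ne_zero 9 hvx))
    (key _ _ h.h01 (by field_simp)) (key _ _ h.h02 (by field_simp)) (key _ _ h.h03 (by field_simp))
    (key _ _ h.h12 (by field_simp)) (key _ _ h.h13 (by field_simp)) (key _ _ h.h23 (by field_simp))
  rwa [div_eq_one_iff_eq (pow_ne_zero 9 hvx)] at h1

theorem EqualDifferences.exists_eq_pow {V : ValuationSubring L} (h2 : V.valuation 2 = 1) {x y z : L}
    {δ : V.ValueGroup} (h : EqualDifferences V.valuation x y z δ) :
    ∃ m : L, m ≠ 0 ∧ V.valuation x ≤ V.valuation m ∧ V.valuation y ≤ V.valuation m ∧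
      V.valuation z ≤ V.valuation m ∧ δ = V.valuation m ^ 9 := by
  have hne : ∀ {x y z : L}, EqualDifferences V.valuation x y z δ → V.valuation y ≤ V.valuation x →
      V.valuation z ≤ V.valuation x → x ≠ 0 := by
    rintro x y z h hy hz rfl
    rw [map_zero, le_zero_iff, V.valuation.zero_iff] at hy hz
    subst hy hz
    exact h.ne_zero (by rw [← h.h01]; simp)
  rcases le_total (V.valuation x) (V.valuation y) with hxy | hxy
  · rcases le_total (V.valuation y) (V.valuation z) with hyz | hyz
    · have := hne h.rotate (hxy.trans hyz) hyz
      exact ⟨z, this, hxy.trans hyz, hyz, le_rfl, h.rotate.eq_pow h2 this (hxy.trans hyz) hyz⟩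
    · have := hne h.swap hxy hyz
      exact ⟨y, this, hxy, le_rfl, hyz, h.swap.eq_pow h2 this hxy hyz⟩
  · rcases le_total (V.valuation x) (V.valuation z) with hxz | hxz
    · have := hne h.rotate hxz (hxy.trans hxz)
      exact ⟨z, this, hxz, hxy.trans hxz, le_rfl, h.rotate.eq_pow h2 this hxz (hxy.trans hxz)⟩
    · have := hne h hxy hxz
      exact ⟨x, this, le_rfl, hxy, hxz, h.eq_pow h2 this hxy hxz⟩

/-- In affine coordinates `(r, t)`, all factors of the differences are units. -/
theorem EqualDifferences.units {V : ValuationSubring L} (h2 : V.valuation 2 = 1) {r t : L}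
    {δ : V.ValueGroup} (h : EqualDifferences V.valuation r (1 - t) (1 + t) δ) :
    V.valuation r ≤ 1 ∧ V.valuation t ≤ 1 ∧ V.valuation t = 1 ∧ V.valuation (1 + t + r) = 1 ∧
    V.valuation (1 - t + r) = 1 ∧ V.valuation (1 - t - r) = 1 ∧ V.valuation (1 + t - r) = 1 ∧
    V.valuation (1 - t ^ 2 + 2 * r) = 1 ∧ V.valuation (1 - t ^ 2 - 2 * r) = 1 ∧
    V.valuation (2 * r * t - 1 + t ^ 2) = 1 ∧ V.valuation (-2 * r * t - 1 + t ^ 2) = 1 := by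
  obtain ⟨m, hm0, hx, hy, hz, hδ⟩ := h.exists_eq_pow h2
  have hvm : V.valuation m ≠ 0 := (V.valuation.ne_zero_iff).2 hm0
  have add : ∀ {a b : L}, V.valuation a ≤ 1 → V.valuation b ≤ 1 → V.valuation (a + b) ≤ 1 :=
    fun ha hb => V.valuation.map_add_le ha hb
  have sub : ∀ {a b : L}, V.valuation a ≤ 1 → V.valuation b ≤ 1 → V.valuation (a - b) ≤ 1 :=
    fun ha hb => V.valuation.map_sub_le ha hb
  have mul : ∀ {a b : L}, V.valuation a ≤ 1 → V.valuation b ≤ 1 → V.valuation (a * b) ≤ 1 :=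
    fun ha hb => by rw [map_mul]; exact mul_le_one' ha hb
  have hle : ∀ w : L, V.valuation w ≤ V.valuation m → V.valuation (w / m) ≤ 1 := fun w hw => by
    rw [map_div₀]; exact div_le_one_of_le₀ hw zero_le
  obtain ⟨x, ex⟩ : ∃ x, x = r / m := ⟨_, rfl⟩
  obtain ⟨y, ey⟩ : ∃ y, y = (1 - t) / m := ⟨_, rfl⟩
  obtain ⟨z, ez⟩ : ∃ z, z = (1 + t) / m := ⟨_, rfl⟩
  have hx1 : V.valuation x ≤ 1 := ex ▸ hle _ hx
  have hy1 : V.valuation y ≤ 1 := ey ▸ hle _ hy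
  have hz1 : V.valuation z ≤ 1 := ez ▸ hle _ hz
  have key : ∀ p q : L, V.valuation p = δ → p = m ^ 9 * q → V.valuation q = 1 := by
    rintro p q hp rfl
    rw [map_mul, map_pow, ← hδ] at hp
    exact mul_left_cancel₀ h.ne_zero (by rw [hp, mul_one])
  have rx : r = m * x := by rw [ex, mul_div_cancel₀ _ hm0]
  have ry : 1 - t = m * y := by rw [ey, mul_div_cancel₀ _ hm0]
  have rz : 1 + t = m * z := by rw [ez, mul_div_cancel₀ _ hm0]
  have k01 := V.valuation.factors_eq_one (add hy1 hz1) (sub (sub (mul hx1 hz1) (mul hx1 hy1)) (mul hy1 hz1))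
    (sub (sub (mul hx1 hy1) (mul hx1 hz1)) (mul hy1 hz1)) (key _ _ h.h01 (by rw [rx, ry, rz]; ring))
  have k02 := V.valuation.factors_eq_one (add hx1 hz1) (sub (sub (mul hy1 hz1) (mul hx1 hy1)) (mul hx1 hz1))
    (sub (sub (mul hx1 hy1) (mul hx1 hz1)) (mul hy1 hz1)) (key _ _ h.h02 (by rw [rx, ry, rz]; ring))
  have k03 := V.valuation.factors_eq_one (add hx1 hy1) (sub (sub (mul hy1 hz1) (mul hx1 hy1)) (mul hx1 hz1))
    (sub (sub (mul hx1 hz1) (mul hx1 hy1)) (mul hy1 hz1)) (key _ _ h.h03 (by rw [rx, ry, rz]; ring))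
  have k12 := V.valuation.factors_eq_one (sub hx1 hy1) (add (add (mul hy1 hz1) (mul hx1 hy1)) (mul hx1 hz1))
    (sub (sub (mul hx1 hy1) (mul hx1 hz1)) (mul hy1 hz1)) (key _ _ h.h12 (by rw [rx, ry, rz]; ring))
  have k13 := V.valuation.factors_eq_one (sub hx1 hz1) (add (add (mul hy1 hz1) (mul hx1 hy1)) (mul hx1 hz1))
    (sub (sub (mul hx1 hz1) (mul hx1 hy1)) (mul hy1 hz1)) (key _ _ h.h13 (by rw [rx, ry, rz]; ring))
  have k23 := V.valuation.factors_eq_one (sub hy1 hz1) (add (add (mul hy1 hz1) (mul hx1 hy1)) (mul hx1 hz1))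
    (sub (sub (mul hy1 hz1) (mul hx1 hy1)) (mul hx1 hz1)) (key _ _ h.h23 (by rw [rx, ry, rz]; ring))
  -- The rescaled y + z is a unit, and m(y + z) = (1 - t) + (1 + t) = 2, so the common scale m is a
  -- unit.
  have hm1 : V.valuation m = 1 := by
    have : (2 : L) = m * (y + z) := by rw [mul_add, ← ry, ← rz]; ring
    rw [this, map_mul, k01.1, mul_one] at h2
    exact h2
  rw [hm1] at hx hy hz
  have e1 : ∀ p q : L, V.valuation q = 1 → p = m * q → V.valuation p = 1 := by
    rintro p q hq rfl; rw [map_mul, hm1, hq, mul_one]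
  have e2 : ∀ p q : L, V.valuation q = 1 → p = m ^ 2 * q → V.valuation p = 1 := by
    rintro p q hq rfl; rw [map_mul, map_pow, hm1, hq, one_pow, mul_one]
  have ht : V.valuation t = 1 := by
    have : V.valuation (-2 * t) = 1 := e1 _ (y - z) k23.1 (by rw [mul_sub, ← ry, ← rz]; ring)
    rwa [map_mul, V.valuation.map_neg, h2, one_mul] at this
  refine ⟨hx, ht.le, ht, e1 _ _ k02.1 (by rw [mul_add, ← rx, ← rz]; ring),
    e1 _ _ k03.1 (by rw [mul_add, ← rx, ← ry]; ring), ?_, ?_,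
    e2 _ _ k12.2.1 ?_, e2 _ _ k02.2.1 ?_, e2 _ _ k01.2.1 ?_, e2 _ _ k01.2.2 ?_⟩
  · rw [← V.valuation.map_neg]; exact e1 _ _ k12.1 (by rw [mul_sub, ← rx, ← ry]; ring)
  · rw [← V.valuation.map_neg]; exact e1 _ _ k13.1 (by rw [mul_sub, ← rx, ← rz]; ring)
  · linear_combination (1 + t + r) * ry + (m * y + r) * rz + (m * y + m * z) * rx
  · linear_combination (1 + t - r) * ry + (m * y - r) * rz - (m * y + m * z) * rx
  · linear_combination -(1 + t + r) * ry + (r - m * y) * rz + (m * z - m * y) * rx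
  · linear_combination (r - (1 + t)) * ry - (r + m * y) * rz + (m * y - m * z) * rx

end Valuation

/-! ### Integral elements and localization -/

section Integral

variable {L : Type*} [Field L]

/-- The subring `R[1/g]` of a field. -/
def Subring.away (R : Subring L) (g : L) (hg : g ∈ R) : Subring L where
  carrier := {x | ∃ n : ℕ, g ^ n * x ∈ R}
  mul_mem' := by
    rintro x y ⟨m, hx⟩ ⟨n, hy⟩
    exact ⟨m + n, by rw [pow_add, mul_mul_mul_comm]; exact R.mul_mem hx hy⟩
  one_mem' := ⟨0, by simp⟩
  add_mem' := by
    rintro x y ⟨m, hx⟩ ⟨n, hy⟩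
    refine ⟨m + n, ?_⟩
    rw [show g ^ (m + n) * (x + y) = g ^ n * (g ^ m * x) + g ^ m * (g ^ n * y) by ring]
    exact R.add_mem (R.mul_mem (R.pow_mem hg n) hx) (R.mul_mem (R.pow_mem hg m) hy)
  zero_mem' := ⟨0, by simp⟩
  neg_mem' := by
    rintro x ⟨m, hx⟩
    exact ⟨m, by rw [mul_neg]; exact R.neg_mem hx⟩

theorem Subring.le_away (R : Subring L) (g : L) (hg : g ∈ R) : R ≤ R.away g hg :=
  fun x hx => ⟨0, by simpa using hx⟩

theorem IsIntegral.exists_pow_mul {R : Subring L} {g : L} {hg : g ∈ R} (hg0 : g ≠ 0) {x : L}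
    (hx : IsIntegral (R.away g hg) x) : ∃ n : ℕ, IsIntegral R (g ^ n * x) := by
  letI : Algebra R (R.away g hg) := (Subring.inclusion (R.le_away g hg)).toAlgebra
  have : IsScalarTower R (R.away g hg) L := IsScalarTower.of_algebraMap_eq fun _ => rfl
  have : IsLocalization (Submonoid.powers (⟨g, hg⟩ : R)) (R.away g hg) := by
    refine ⟨⟨?_, ?_, ?_⟩⟩
    · rintro ⟨_, n, rfl⟩
      refine IsUnit.of_mul_eq_one (⟨(g ^ n)⁻¹, n, by
        rw [mul_inv_cancel₀ (pow_ne_zero n hg0)]; exact R.one_mem⟩ : R.away g hg) ?_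
      exact Subtype.ext (mul_inv_cancel₀ (pow_ne_zero n hg0))
    · rintro ⟨y, n, hy⟩
      exact ⟨⟨⟨_, hy⟩, ⟨_, n, rfl⟩⟩, Subtype.ext (mul_comm _ _)⟩
    · intro a b h
      have h' : (a : L) = b := congrArg (fun z : R.away g hg => (z : L)) h
      exact ⟨1, by rw [Subtype.ext h']⟩
  obtain ⟨⟨_, n, rfl⟩, h⟩ := IsIntegral.exists_multiple_integral_of_isLocalization
    (Submonoid.powers (⟨g, hg⟩ : R)) x hx
  exact ⟨n, h⟩

/-- The integral closure of R[1/g] in the field is the intersection of the valuation rings that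
contain it. A power of g then clears the denominators of an integral equation. -/
theorem Subring.exists_isIntegral_pow_mul {R : Subring L} {g : L} (hg : g ∈ R) (hg0 : g ≠ 0) {x : L}
    (hx : ∀ V : ValuationSubring L, R ≤ V.toSubring → g⁻¹ ∈ V → x ∈ V) :
    ∃ n : ℕ, IsIntegral R (g ^ n * x) := by
  have h : x ∈ ⨅ V : {V : ValuationSubring L // ((R.away g hg : Subring L) : Set L) ⊆ V.toSubring},
      V.1.toSubring := by
    rw [Subring.mem_iInf]
    rintro ⟨V, hV⟩
    refine hx V (fun y hy => hV (R.le_away g hg hy)) (hV ⟨1, ?_⟩)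
    rw [pow_one, mul_inv_cancel₀ hg0]
    exact R.one_mem
  rw [iInf_valuationSubring_superset] at h
  have h' : IsIntegral (Subring.closure ((R.away g hg : Subring L) : Set L)) x := h
  rw [Subring.closure_eq] at h'
  exact h'.exists_pow_mul hg0

end Integral

section Localization

variable {L : Type*} [Field L] [Algebra ℂ L] (A : Subalgebra ℂ L)
  (Q : Ideal (integralClosure A L)) [Q.IsPrime]

/-- The local ring of a point of the normalization, as a subring of the function field. -/
def localToField : Localization.AtPrime Q →+* L :=
  IsLocalization.lift (M := Q.primeCompl) (g := algebraMap (integralClosure A L) L) fun q => by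
    refine IsUnit.mk0 _ fun h => q.2 ?_
    rw [show (q : integralClosure A L) = 0 from Subtype.ext h]
    exact Q.zero_mem

theorem localToField_algebraMap (x : integralClosure A L) :
    localToField A Q (algebraMap _ _ x) = x :=
  IsLocalization.lift_eq _ x

theorem localToField_injective : Function.Injective (localToField A Q) := by
  refine (injective_iff_map_eq_zero _).2 fun y hy => ?_
  obtain ⟨⟨x, q⟩, h⟩ := IsLocalization.surj Q.primeCompl y
  have h1 := congrArg (localToField A Q) h
  rw [map_mul, hy, zero_mul, localToField_algebraMap] at h1
  have hx : x = 0 := Subtype.ext h1.symm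
  rw [hx, map_zero] at h
  exact (IsLocalization.map_units _ q).mul_left_eq_zero.1 h

theorem exists_localToField_eq {x g : L} {n : ℕ} (hg : g ∈ A)
    (hgQ : algebraMap A (integralClosure A L) ⟨g, hg⟩ ∉ Q) (hx : IsIntegral A (g ^ n * x)) :
    ∃ y, localToField A Q y = x := by
  let q : Q.primeCompl := ⟨algebraMap A (integralClosure A L) ⟨g, hg⟩ ^ n,
    fun h => hgQ (Ideal.IsPrime.mem_of_pow_mem ‹_› n h)⟩
  refine ⟨IsLocalization.mk' _ (⟨_, hx⟩ : integralClosure A L) q, ?_⟩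
  have h := congrArg (localToField A Q) (IsLocalization.mk'_spec (Localization.AtPrime Q)
    (⟨_, hx⟩ : integralClosure A L) q)
  rw [map_mul, localToField_algebraMap, localToField_algebraMap] at h
  have hg0 : g ^ n ≠ 0 := by
    intro e
    apply q.2
    rw [show (q : integralClosure A L) = 0 from Subtype.ext e]
    exact Q.zero_mem
  have hq : ((q : integralClosure A L) : L) = g ^ n := rfl
  rw [hq, mul_comm] at h
  exact mul_left_cancel₀ hg0 h

end Localization

/-! ### Derivations and the Jacobian of (t₁, t₂). -/

section Derivation

variable {L : Type*} [Field L]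

theorem Derivation.smul_eq_zero_of_isUnit {B M : Type*} [CommRing B] [AddCommGroup M] [Module B M]
    {b : B} (hb : IsUnit b) {m : M} (h : b • m = 0) : m = 0 := by
  obtain ⟨u, rfl⟩ := hb
  rw [← one_smul B m, ← u.inv_mul, mul_smul, h, smul_zero]

/-- The differentials of `t₁, t₂` span those of the coordinates `r, t`. -/
theorem Derivation.eq_zero_of_differences {R B M : Type*} [CommRing R] [CommRing B] [Algebra R B]
    [AddCommGroup M] [Module B M] [Module R M] (D : Derivation R B M) {r t T₁ T₂ : B}
    (u0 : IsUnit (1 - t ^ 2 + 2 * r)) (u1 : IsUnit (1 - t ^ 2 - 2 * r)) (h6 : IsUnit (6 : B))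
    (h1 : T₁ * (2 * (2 * r * t - 1 + t ^ 2) ^ 2) = (1 - t ^ 2 - 2 * r) ^ 2 * (1 + t + r))
    (h2 : T₂ * (2 * (-2 * r * t - 1 + t ^ 2) ^ 2) = (1 - t ^ 2 - 2 * r) ^ 2 * (1 - t + r))
    (d1 : D T₁ = 0) (d2 : D T₂ = 0) : D r = 0 ∧ D t = 0 := by
  have hD : ∀ n : ℕ, ∀ [n.AtLeastTwo], D (OfNat.ofNat n : B) = 0 := fun n _ => D.map_natCast n
  obtain ⟨m1, e1⟩ : ∃ m, m = 1 - t ^ 2 - 2 * r := ⟨_, rfl⟩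
  obtain ⟨m2, e2⟩ : ∃ m, m = 2 * r * t - 1 + t ^ 2 := ⟨_, rfl⟩
  obtain ⟨m3, e3⟩ : ∃ m, m = -2 * r * t - 1 + t ^ 2 := ⟨_, rfl⟩
  have D1 : D m1 = -(2 * t) • D t - (2 : B) • D r := by
    rw [e1]; simp only [map_sub, Derivation.leibniz, Derivation.leibniz_pow, hD, Derivation.map_one_eq_zero]
    module
  have D2 : D m2 = (2 * r + 2 * t) • D t + (2 * t) • D r := by
    rw [e2]; simp only [map_sub, map_add, Derivation.leibniz, Derivation.leibniz_pow, hD, Derivation.map_one_eq_zero]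
    module
  have D3 : D m3 = (-2 * r + 2 * t) • D t - (2 * t) • D r := by
    rw [e3]; simp only [map_sub, map_add, map_neg, Derivation.leibniz, Derivation.leibniz_pow, hD, Derivation.map_one_eq_zero]
    module
  rw [← e1, ← e2] at h1
  rw [← e1, ← e3] at h2
  rw [← e1] at u1
  have k1 := congrArg D h1
  have k2 := congrArg D h2
  simp only [map_add, map_sub, Derivation.leibniz, Derivation.leibniz_pow, hD, d1, d2, D1, D2, D3,
    Derivation.map_one_eq_zero, smul_add, smul_zero, add_zero, zero_add, Nat.add_one_sub_one, pow_one] at k1 k2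
  -- The first relation differentiated and multiplied by m₂, with T₁ eliminated by the relation
  -- itself. What is left is divisible by the unit m₁.
  have f1 : m1 • ((2 * m1 * (1 + t + r) * (2 * t) + 2 * m2 * (1 + t + r) * 2 - m1 * m2) • D r
      + (2 * m1 * (1 + t + r) * (2 * r + 2 * t) + 2 * m2 * (1 + t + r) * (2 * t) - m1 * m2) • D t)
      = 0 := by
    linear_combination (norm := module) m2 • k1 - (2 : B) • congrArg (fun z => z • ((2 * r + 2 * t) • D t + (2 * t) • D r)) h1
  have f2 : m1 • ((2 * m1 * (1 - t + r) * (-(2 * t)) + 2 * m3 * (1 - t + r) * 2 - m1 * m3) • D r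
      + (2 * m1 * (1 - t + r) * (-2 * r + 2 * t) + 2 * m3 * (1 - t + r) * (2 * t) + m1 * m3) • D t)
      = 0 := by
    linear_combination (norm := module) m3 • k2 - (2 : B) • congrArg (fun z => z • ((-2 * r + 2 * t) • D t - (2 * t) • D r)) h2
  have g1 := Derivation.smul_eq_zero_of_isUnit u1 f1
  have g2 := Derivation.smul_eq_zero_of_isUnit u1 f2
  -- The Jacobian determinant of the two linear equations in D r and D t is a product of units.
  have hdet : (6 * (1 - t ^ 2 + 2 * r) ^ 3 * m1)
      = (2 * m1 * (1 + t + r) * (2 * t) + 2 * m2 * (1 + t + r) * 2 - m1 * m2)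
        * (2 * m1 * (1 - t + r) * (-2 * r + 2 * t) + 2 * m3 * (1 - t + r) * (2 * t) + m1 * m3)
        - (2 * m1 * (1 + t + r) * (2 * r + 2 * t) + 2 * m2 * (1 + t + r) * (2 * t) - m1 * m2)
        * (2 * m1 * (1 - t + r) * (-(2 * t)) + 2 * m3 * (1 - t + r) * 2 - m1 * m3) := by
    rw [e1, e2, e3]; ring
  have hu : IsUnit (6 * (1 - t ^ 2 + 2 * r) ^ 3 * m1) := (h6.mul (u0.pow 3)).mul u1
  generalize 2 * m1 * (1 + t + r) * (2 * t) + 2 * m2 * (1 + t + r) * 2 - m1 * m2 = a at *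
  generalize 2 * m1 * (1 + t + r) * (2 * r + 2 * t) + 2 * m2 * (1 + t + r) * (2 * t) - m1 * m2 = b at *
  generalize 2 * m1 * (1 - t + r) * (-(2 * t)) + 2 * m3 * (1 - t + r) * 2 - m1 * m3 = c at *
  generalize 2 * m1 * (1 - t + r) * (-2 * r + 2 * t) + 2 * m3 * (1 - t + r) * (2 * t) + m1 * m3 = d at *
  rw [hdet] at hu
  constructor
  · refine Derivation.smul_eq_zero_of_isUnit hu ?_
    linear_combination (norm := module) d • g1 - b • g2
  · refine Derivation.smul_eq_zero_of_isUnit hu ?_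
    linear_combination (norm := module) a • g2 - c • g1

end Derivation

/-! ### Points at which the normalization is unramified -/

/-- The elements of L that come from B with vanishing differential form an algebra K containing A.
It contains T₁ and T₂, then r and t by the Jacobian, then Δ⁻¹. By `hgen` every element of B is a
quotient of such elements, so all differentials vanish. -/
theorem formallyUnramified_of_differences {L : Type*} [Field L] [Algebra ℂ L] (A : Subalgebra ℂ L)
    {B : Type*} [CommRing B] [Algebra A B] (ι : B →+* L) (hι : Function.Injective ι)
    (hA : ∀ a : A, ι (algebraMap A B a) = a) {r t T₁ T₂ Δ : L}
    (hr : ∃ y, ι y = r) (ht : ∃ y, ι y = t)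
    (n0 : 1 - t ^ 2 + 2 * r ≠ 0) (n1 : 1 - t ^ 2 - 2 * r ≠ 0)
    (h0 : ∃ y, ι y = (1 - t ^ 2 + 2 * r)⁻¹) (h1 : ∃ y, ι y = (1 - t ^ 2 - 2 * r)⁻¹)
    (e1 : T₁ * (2 * (2 * r * t - 1 + t ^ 2) ^ 2) = (1 - t ^ 2 - 2 * r) ^ 2 * (1 + t + r))
    (e2 : T₂ * (2 * (-2 * r * t - 1 + t ^ 2) ^ 2) = (1 - t ^ 2 - 2 * r) ^ 2 * (1 - t + r))
    (a1 : T₁ ∈ A ∨ T₁⁻¹ ∈ A) (a2 : T₂ ∈ A ∨ T₂⁻¹ ∈ A) (z1 : T₁ ≠ 0) (z2 : T₂ ≠ 0)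
    (r1 : ∃ y, ι y = T₁) (r2 : ∃ y, ι y = T₂)
    (hΔ : Δ ∈ Algebra.adjoin ℂ {r, t}) (hΔ0 : Δ ≠ 0) (rΔ : ∃ y, ι y = Δ⁻¹)
    (hgen : ∀ y : B, ∃ x q : B, IsUnit q ∧ y * q = x ∧
      (∃ n : ℕ, Δ ^ n * ι x ∈ Algebra.adjoin ℂ {r, t}) ∧
      (∃ n : ℕ, Δ ^ n * ι q ∈ Algebra.adjoin ℂ {r, t})) :
    Algebra.FormallyUnramified A B := by
  let D := KaehlerDifferential.D A B
  have hAD : ∀ a : A, D (algebraMap A B a) = 0 := fun a => D.map_algebraMap a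
  let K : Subalgebra ℂ L :=
    { carrier := {x | ∃ y, ι y = x ∧ D y = 0}
      mul_mem' := by
        rintro _ _ ⟨x, rfl, hx⟩ ⟨y, rfl, hy⟩
        exact ⟨x * y, map_mul _ _ _, by rw [D.leibniz, hx, hy, smul_zero, smul_zero, add_zero]⟩
      add_mem' := by
        rintro _ _ ⟨x, rfl, hx⟩ ⟨y, rfl, hy⟩
        exact ⟨x + y, map_add _ _ _, by rw [map_add, hx, hy, add_zero]⟩
      algebraMap_mem' := fun c => ⟨algebraMap A B (algebraMap ℂ A c), hA _, hAD _⟩ }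
  have hKA : ∀ x ∈ A, x ∈ K := fun x hx => ⟨algebraMap A B ⟨x, hx⟩, hA _, hAD _⟩
  have hKinv : ∀ x : L, x ≠ 0 → x ∈ K → (∃ y, ι y = x⁻¹) → x⁻¹ ∈ K := by
    rintro _ h0 ⟨x, rfl, hx⟩ ⟨y, hy⟩
    have hxy : y * x = 1 := hι (by rw [map_mul, hy, inv_mul_cancel₀ h0, map_one])
    exact ⟨y, hy, by rw [D.leibniz_of_mul_eq_one hxy, hx, smul_zero]⟩
  have hT : ∀ T : L, T ≠ 0 → (T ∈ A ∨ T⁻¹ ∈ A) → (∃ y, ι y = T) → T ∈ K := by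
    rintro T hT0 (h | h) hy
    · exact hKA T h
    · rw [← inv_inv T]
      exact hKinv _ (inv_ne_zero hT0) (hKA _ h) (by rwa [inv_inv])
  obtain ⟨θ₁, hθ₁, dθ₁⟩ := hT T₁ z1 a1 r1
  obtain ⟨θ₂, hθ₂, dθ₂⟩ := hT T₂ z2 a2 r2
  obtain ⟨ρ, hρ⟩ := hr
  obtain ⟨τ, hτ⟩ := ht
  have unit : ∀ {x : B}, ι x ≠ 0 → (∃ y, ι y = (ι x)⁻¹) → IsUnit x := by
    rintro x h0 ⟨y, hy⟩
    exact IsUnit.of_mul_eq_one y (hι (by rw [map_mul, hy, mul_inv_cancel₀ h0, map_one]))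
  have i0 : ι (1 - τ ^ 2 + 2 * ρ) = 1 - t ^ 2 + 2 * r := by
    simp only [map_add, map_sub, map_mul, map_pow, map_one, map_ofNat, hρ, hτ]
  have i1 : ι (1 - τ ^ 2 - 2 * ρ) = 1 - t ^ 2 - 2 * r := by
    simp only [map_sub, map_mul, map_pow, map_one, map_ofNat, hρ, hτ]
  have i6 : ι 6 = 6 := map_ofNat ι 6
  have : CharZero L := charZero_of_injective_algebraMap (algebraMap ℂ L).injective
  obtain ⟨dρ, dτ⟩ := D.eq_zero_of_differences (r := ρ) (t := τ)
    (unit (i0 ▸ n0) (i0 ▸ h0)) (unit (i1 ▸ n1) (i1 ▸ h1))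
    (unit (by rw [i6]; norm_num) (by
      obtain ⟨y, hy, -⟩ := K.algebraMap_mem (6⁻¹ : ℂ)
      exact ⟨y, by rw [hy, i6, map_inv₀, map_ofNat]⟩))
    (T₁ := θ₁) (T₂ := θ₂)
    (hι (by simpa only [map_add, map_sub, map_mul, map_pow, map_one, map_ofNat, hρ, hτ, hθ₁] using e1))
    (hι (by simpa only [map_add, map_sub, map_neg, map_mul, map_pow, map_one, map_ofNat, hρ, hτ, hθ₂]
      using e2)) dθ₁ dθ₂
  have hadj : Algebra.adjoin ℂ {r, t} ≤ K := by
    rw [Algebra.adjoin_le_iff]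
    rintro x (rfl | rfl)
    · exact ⟨ρ, hρ, dρ⟩
    · exact ⟨τ, hτ, dτ⟩
  have hΔK := hKinv Δ hΔ0 (hadj hΔ) rΔ
  have hker : ∀ x : B, (∃ n : ℕ, Δ ^ n * ι x ∈ Algebra.adjoin ℂ {r, t}) → D x = 0 := by
    rintro x ⟨n, hn⟩
    have : ι x ∈ K := by
      have h := K.mul_mem (K.pow_mem hΔK n) (hadj hn)
      rwa [inv_pow, inv_mul_cancel_left₀ (pow_ne_zero n hΔ0)] at h
    obtain ⟨y, hy, hDy⟩ := this
    rwa [← hι hy]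
  have hall : ∀ y, D y = 0 := by
    intro y
    obtain ⟨x, q, hq, hyq, hx, hq'⟩ := hgen y
    have h := congrArg D hyq
    rw [D.leibniz, hker x hx, hker q hq', smul_zero, zero_add] at h
    exact Derivation.smul_eq_zero_of_isUnit hq h
  refine ⟨?_⟩
  rw [← Submodule.subsingleton_iff B, ← subsingleton_iff_bot_eq_top, ← KaehlerDifferential.span_range_derivation A B, eq_comm,
    Submodule.span_eq_bot]
  rintro _ ⟨y, rfl⟩
  exact hall y

/-! ### The chart (r, t). -/

/-- The second coordinate of the chart `(r, t)`. -/
def coordR {F : Type*} [Field F] (s t : F) : F :=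
  (s - 1) * (1 - t ^ 2) / (2 * (s + 1))

section Relations

variable {F : Type*} [Field F] [CharZero F] {s t : F} (h : RegularParameter s t)

include h

/-- Up to the common factor (1 - t²)/(s + 1), the four quadrics in (r, 1 - t, 1 + t) are 2s, 2,
st-t-1-s and -(st-t+s+1), four forms with sum zero. The choice of r undoes a quadratic
transformation of the plane. -/
theorem RegularParameter.coordR_forms :
    1 - t ^ 2 + 2 * coordR s t = 2 * s * (1 - t ^ 2) / (s + 1) ∧
    1 - t ^ 2 - 2 * coordR s t = 2 * (1 - t ^ 2) / (s + 1) ∧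
    2 * coordR s t * t - 1 + t ^ 2 = (1 - t ^ 2) * (s * t - t - 1 - s) / (s + 1) ∧
    -2 * coordR s t * t - 1 + t ^ 2 = -((1 - t ^ 2) * (s * t - t + s + 1)) / (s + 1) := by
  have hp := h.sp
  have h2 : (2 : F) ≠ 0 := by norm_num
  rw [coordR]
  refine ⟨?_, ?_, ?_, ?_⟩ <;> · field_simp; ring

theorem RegularParameter.coordR_relations :
    let r := coordR s t
    let T₁ := tOne s t
    let T₂ := tTwo s t
    T₁ * (2 * (2 * r * t - 1 + t ^ 2) ^ 2) = (1 - t ^ 2 - 2 * r) ^ 2 * (1 + t + r) ∧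
    T₂ * (2 * (-2 * r * t - 1 + t ^ 2) ^ 2) = (1 - t ^ 2 - 2 * r) ^ 2 * (1 - t + r) ∧
    (T₁ - 1) * (2 * (2 * r * t - 1 + t ^ 2) ^ 2) = -((1 - t ^ 2 + 2 * r) ^ 2 * (1 - t - r)) ∧
    (T₂ - 1) * (2 * (-2 * r * t - 1 + t ^ 2) ^ 2) = -((1 - t ^ 2 + 2 * r) ^ 2 * (1 + t - r)) ∧
    (T₁ - T₂) * ((2 * r * t - 1 + t ^ 2) * (-2 * r * t - 1 + t ^ 2)) ^ 2
      = t * (1 - t ^ 2 + 2 * r) ^ 2 * (1 - t ^ 2 - 2 * r) ^ 2 := by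
  intro r T₁ T₂
  obtain ⟨f0, f1, f2, f3⟩ := h.coordR_forms
  have hp := h.sp
  have hy := h.y
  have hy' := h.y'
  have h2 : (2 : F) ≠ 0 := by norm_num
  have c1 : T₁ * (2 * (2 * r * t - 1 + t ^ 2) ^ 2) = (1 - t ^ 2 - 2 * r) ^ 2 * (1 + t + r) := by
    rw [f1, f2, show r = _ from coordR.eq_def s t, show T₁ = _ from tOne.eq_def s t]
    generalize s * t - t - 1 - s = y at *
    field_simp
    ring
  have c2 : T₂ * (2 * (-2 * r * t - 1 + t ^ 2) ^ 2) = (1 - t ^ 2 - 2 * r) ^ 2 * (1 - t + r) := by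
    rw [f1, f3, show r = _ from coordR.eq_def s t, show T₂ = _ from tTwo.eq_def s t]
    generalize s * t - t + s + 1 = y at *
    field_simp
    ring
  refine ⟨c1, c2, by linear_combination c1, by linear_combination c2, ?_⟩
  have h4 : (2 : F) * ((T₁ - T₂) * ((2 * r * t - 1 + t ^ 2) * (-2 * r * t - 1 + t ^ 2)) ^ 2)
      = 2 * (t * (1 - t ^ 2 + 2 * r) ^ 2 * (1 - t ^ 2 - 2 * r) ^ 2) := by
    linear_combination (-2 * r * t - 1 + t ^ 2) ^ 2 * c1 - (2 * r * t - 1 + t ^ 2) ^ 2 * c2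
  exact mul_left_cancel₀ h2 h4

end Relations

/-- The five functions whose zeros and poles form the branch locus are units at `V`. -/
def UnitsAt {L : Type*} [Field L] (V : ValuationSubring L) (T₁ T₂ : L) : Prop :=
  V.valuation T₁ = 1 ∧ V.valuation T₂ = 1 ∧ V.valuation (T₁ - 1) = 1 ∧ V.valuation (T₂ - 1) = 1 ∧
    V.valuation (T₁ - T₂) = 1

/-- Up to sign each of the six forms is one fixed quantity multiplied by 1, t₁, t₂, t₁ - 1, t₂ - 1
or t₁ - t₂, all of value 1. -/
theorem UnitsAt.equalDifferences {L : Type*} [Field L] [CharZero L] {V : ValuationSubring L} {s t : L}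
    (h : RegularParameter s t) (hT : UnitsAt V (tOne s t) (tTwo s t)) (ht : 1 - t ^ 2 ≠ 0) :
    ∃ δ, EqualDifferences V.valuation (coordR s t) (1 - t) (1 + t) δ := by
  obtain ⟨v1, v2, v3, v4, v5⟩ := hT
  obtain ⟨c1, c2, c3, c4, c5⟩ := h.coordR_relations
  obtain ⟨-, -, f2, f3⟩ := h.coordR_forms
  generalize coordR s t = r at *
  have h2 : (2 : L) ≠ 0 := by norm_num
  have n2 : 2 * r * t - 1 + t ^ 2 ≠ 0 := by
    rw [f2]; exact div_ne_zero (mul_ne_zero ht h.y) h.sp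
  have n3 : -2 * r * t - 1 + t ^ 2 ≠ 0 := by
    rw [f3]; exact div_ne_zero (neg_ne_zero.2 (mul_ne_zero ht h.y')) h.sp
  refine ⟨V.valuation (2 * (2 * r * t - 1 + t ^ 2) ^ 2 * (-2 * r * t - 1 + t ^ 2) ^ 2),
    (V.valuation.ne_zero_iff).2 (mul_ne_zero (mul_ne_zero h2 (pow_ne_zero 2 n2)) (pow_ne_zero 2 n3)),
    ?_, ?_, ?_, ?_, ?_, ?_⟩
  · congr 1; ring
  · rw [← one_mul (V.valuation (2 * _ * _)), ← v1, ← map_mul]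
    congr 1; linear_combination -(-2 * r * t - 1 + t ^ 2) ^ 2 * c1
  · rw [← one_mul (V.valuation (2 * _ * _)), ← v2, ← map_mul]
    congr 1; linear_combination -(2 * r * t - 1 + t ^ 2) ^ 2 * c2
  · rw [← one_mul (V.valuation (2 * _ * _)), ← v3, ← map_mul]
    congr 1; linear_combination -(-2 * r * t - 1 + t ^ 2) ^ 2 * c3
  · rw [← one_mul (V.valuation (2 * _ * _)), ← v4, ← map_mul]
    congr 1; linear_combination -(2 * r * t - 1 + t ^ 2) ^ 2 * c4
  · rw [← one_mul (V.valuation (2 * _ * _)), ← v5, ← map_mul, ← V.valuation.map_neg]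
    congr 1; linear_combination -2 * c5

/-- The product of the factors of the differences of `0, 1, ∞, t₁, t₂` in the chart `(r, t)`. -/
def diffFactor {F : Type*} [Field F] (r t : F) : F :=
  t * (1 + t + r) * (1 - t + r) * (1 - t - r) * (1 + t - r) * (1 - t ^ 2 + 2 * r)
    * (1 - t ^ 2 - 2 * r) * (2 * r * t - 1 + t ^ 2) * (-2 * r * t - 1 + t ^ 2)

section Chart

variable {L : Type*} [Field L] [Algebra ℂ L] {s t : L}

/-- The parameter is regular and `0, 1, t₁, t₂` are distinct. -/
structure GenericParameter {F : Type*} [Field F] (s t : F) : Prop extends RegularParameter s t where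
  one_zero : tOne s t ≠ 0
  one_one : tOne s t ≠ 1
  two_zero : tTwo s t ≠ 0
  two_one : tTwo s t ≠ 1
  one_two : tOne s t ≠ tTwo s t

theorem GenericParameter.one_sub_t_sq {F : Type*} [Field F] {s t : F} (h : GenericParameter s t) :
    1 - t ^ 2 ≠ 0 := by
  intro e
  have : (t + 1) * (-1 + t) = 0 := by linear_combination -e
  rcases mul_eq_zero.1 this with e | e
  · exact h.one_zero (by rw [tOne, e]; simp)
  · exact h.two_zero (by rw [tTwo, e]; simp)

theorem GenericParameter.factor_ne_zero {F : Type*} [Field F] [CharZero F] {s t : F}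
    (h : GenericParameter s t) : diffFactor (coordR s t) t ≠ 0 := by
  have hp := h.toRegularParameter
  obtain ⟨c1, c2, c3, c4, c5⟩ := hp.coordR_relations
  obtain ⟨f0, f1, f2, f3⟩ := hp.coordR_forms
  have ht := h.one_sub_t_sq
  have h2 : (2 : F) ≠ 0 := by norm_num
  have n2 : 2 * coordR s t * t - 1 + t ^ 2 ≠ 0 := by
    rw [f2]; exact div_ne_zero (mul_ne_zero ht hp.y) hp.sp
  have n3 : -2 * coordR s t * t - 1 + t ^ 2 ≠ 0 := by
    rw [f3]; exact div_ne_zero (neg_ne_zero.2 (mul_ne_zero ht hp.y')) hp.sp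
  have k1 := mul_ne_zero h.one_zero (mul_ne_zero h2 (pow_ne_zero 2 n2))
  have k2 := mul_ne_zero h.two_zero (mul_ne_zero h2 (pow_ne_zero 2 n3))
  have k3 := mul_ne_zero (sub_ne_zero.2 h.one_one) (mul_ne_zero h2 (pow_ne_zero 2 n2))
  have k4 := mul_ne_zero (sub_ne_zero.2 h.two_one) (mul_ne_zero h2 (pow_ne_zero 2 n3))
  have k5 := mul_ne_zero (sub_ne_zero.2 h.one_two) (pow_ne_zero 2 (mul_ne_zero n2 n3))
  rw [c1] at k1
  rw [c2] at k2
  rw [c3] at k3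
  rw [c4] at k4
  rw [c5] at k5
  simp only [ne_eq, mul_eq_zero, neg_eq_zero, pow_eq_zero_iff two_ne_zero, not_or] at k1 k2 k3 k4 k5
  exact mul_ne_zero (mul_ne_zero (mul_ne_zero (mul_ne_zero (mul_ne_zero (mul_ne_zero (mul_ne_zero
    (mul_ne_zero k5.1.1 k1.2) k2.2) k3.2) k4.2) k5.1.2) k1.1) n2) n3

/-- The coordinate ring of the plane `(r, t)` with the zeros of the factors removed. -/
def factorRing (r t : L) (hΔ : diffFactor r t ∈ Algebra.adjoin ℂ {r, t}) : Subalgebra ℂ L :=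
  { (Algebra.adjoin ℂ {r, t}).toSubring.away (diffFactor r t) hΔ with
    algebraMap_mem' := fun c => Subring.le_away _ _ _ (Subalgebra.algebraMap_mem _ c) }

theorem diffFactor_mem (r t : L) : diffFactor r t ∈ Algebra.adjoin ℂ {r, t} := by
  have hr : r ∈ Algebra.adjoin ℂ {r, t} := Algebra.subset_adjoin (Or.inl rfl)
  have ht : t ∈ Algebra.adjoin ℂ {r, t} := Algebra.subset_adjoin (Or.inr rfl)
  have h1 : (1 : L) ∈ Algebra.adjoin ℂ {r, t} := one_mem _
  have h2 : (2 : L) ∈ Algebra.adjoin ℂ {r, t} := ofNat_mem _ 2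
  have ht2 := pow_mem ht 2
  exact mul_mem (mul_mem (mul_mem (mul_mem (mul_mem (mul_mem (mul_mem (mul_mem ht
    (add_mem (add_mem h1 ht) hr)) (add_mem (sub_mem h1 ht) hr)) (sub_mem (sub_mem h1 ht) hr))
    (sub_mem (add_mem h1 ht) hr)) (add_mem (sub_mem h1 ht2) (mul_mem h2 hr)))
    (sub_mem (sub_mem h1 ht2) (mul_mem h2 hr))) (add_mem (sub_mem (mul_mem (mul_mem h2 hr) ht) h1) ht2))
    (add_mem (sub_mem (mul_mem (mul_mem (neg_mem h2) hr) ht) h1) ht2)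

theorem le_factorRing (r t : L) : Algebra.adjoin ℂ {r, t} ≤ factorRing r t (diffFactor_mem r t) :=
  fun _ hx => Subring.le_away (Algebra.adjoin ℂ {r, t}).toSubring _ (diffFactor_mem r t) hx

theorem inv_mem_factorRing {r t f h : L} (hf : f * h = diffFactor r t)
    (hh : h ∈ Algebra.adjoin ℂ {r, t}) (h0 : diffFactor r t ≠ 0) :
    f⁻¹ ∈ factorRing r t (diffFactor_mem r t) := by
  have hf0 : f ≠ 0 := by
    rintro rfl
    rw [zero_mul] at hf
    exact h0 hf.symm
  refine ⟨1, ?_⟩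
  rw [pow_one, ← hf, mul_comm f, mul_assoc, mul_inv_cancel₀ hf0, mul_one]
  exact hh

/-- In the chart (r, t) the functions t₁ and t₂ are, up to powers of 2, products of factors of
`diffFactor` and their inverses. -/
theorem GenericParameter.differences_mem [CharZero L] (h : GenericParameter s t) :
    Algebra.adjoin ℂ {tOne s t, (tOne s t)⁻¹, tTwo s t, (tTwo s t)⁻¹}
      ≤ factorRing (coordR s t) t (diffFactor_mem _ _) := by
  have h0 := h.factor_ne_zero
  obtain ⟨c1, c2, -⟩ := h.toRegularParameter.coordR_relations
  obtain ⟨r, hr'⟩ : ∃ r, r = coordR s t := ⟨_, rfl⟩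
  rw [← hr'] at h0 c1 c2 ⊢
  have hr : r ∈ Algebra.adjoin ℂ {r, t} := Algebra.subset_adjoin (Or.inl rfl)
  have ht : t ∈ Algebra.adjoin ℂ {r, t} := Algebra.subset_adjoin (Or.inr rfl)
  have h1 : (1 : L) ∈ Algebra.adjoin ℂ {r, t} := one_mem _
  have h2 : (2 : L) ∈ Algebra.adjoin ℂ {r, t} := ofNat_mem _ 2
  have ht2 := pow_mem ht 2
  obtain ⟨l, el⟩ : ∃ l, l = 1 + t + r := ⟨_, rfl⟩
  obtain ⟨k, ek⟩ : ∃ l, l = 1 - t + r := ⟨_, rfl⟩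
  obtain ⟨l', el'⟩ : ∃ l, l = 1 - t - r := ⟨_, rfl⟩
  obtain ⟨k', ek'⟩ : ∃ l, l = 1 + t - r := ⟨_, rfl⟩
  obtain ⟨m0, e0⟩ : ∃ l, l = 1 - t ^ 2 + 2 * r := ⟨_, rfl⟩
  obtain ⟨m1, e1⟩ : ∃ l, l = 1 - t ^ 2 - 2 * r := ⟨_, rfl⟩
  obtain ⟨m2, e2⟩ : ∃ l, l = 2 * r * t - 1 + t ^ 2 := ⟨_, rfl⟩
  obtain ⟨m3, e3⟩ : ∃ l, l = -2 * r * t - 1 + t ^ 2 := ⟨_, rfl⟩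
  have al : l ∈ Algebra.adjoin ℂ {r, t} := el ▸ add_mem (add_mem h1 ht) hr
  have ak : k ∈ Algebra.adjoin ℂ {r, t} := ek ▸ add_mem (sub_mem h1 ht) hr
  have al' : l' ∈ Algebra.adjoin ℂ {r, t} := el' ▸ sub_mem (sub_mem h1 ht) hr
  have ak' : k' ∈ Algebra.adjoin ℂ {r, t} := ek' ▸ sub_mem (add_mem h1 ht) hr
  have a0 : m0 ∈ Algebra.adjoin ℂ {r, t} := e0 ▸ add_mem (sub_mem h1 ht2) (mul_mem h2 hr)
  have a1 : m1 ∈ Algebra.adjoin ℂ {r, t} := e1 ▸ sub_mem (sub_mem h1 ht2) (mul_mem h2 hr)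
  have a2 : m2 ∈ Algebra.adjoin ℂ {r, t} :=
    e2 ▸ add_mem (sub_mem (mul_mem (mul_mem h2 hr) ht) h1) ht2
  have a3 : m3 ∈ Algebra.adjoin ℂ {r, t} :=
    e3 ▸ add_mem (sub_mem (mul_mem (mul_mem (neg_mem h2) hr) ht) h1) ht2
  have hΔ : diffFactor r t = t * l * k * l' * k' * m0 * m1 * m2 * m3 := by
    rw [diffFactor, el, ek, el', ek', e0, e1, e2, e3]
  have W := le_factorRing r t
  have il := inv_mem_factorRing (f := l) (by rw [hΔ]; ring) (mul_mem (mul_mem (mul_mem (mul_mem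
    (mul_mem (mul_mem (mul_mem ht ak) al') ak') a0) a1) a2) a3) h0
  have ik := inv_mem_factorRing (f := k) (by rw [hΔ]; ring) (mul_mem (mul_mem (mul_mem (mul_mem
    (mul_mem (mul_mem (mul_mem ht al) al') ak') a0) a1) a2) a3) h0
  have i1 := inv_mem_factorRing (f := m1) (by rw [hΔ]; ring) (mul_mem (mul_mem (mul_mem (mul_mem
    (mul_mem (mul_mem (mul_mem ht al) ak) al') ak') a0) a2) a3) h0
  have i2 := inv_mem_factorRing (f := m2) (by rw [hΔ]; ring) (mul_mem (mul_mem (mul_mem (mul_mem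
    (mul_mem (mul_mem (mul_mem ht al) ak) al') ak') a0) a1) a3) h0
  have i3 := inv_mem_factorRing (f := m3) (by rw [hΔ]; ring) (mul_mem (mul_mem (mul_mem (mul_mem
    (mul_mem (mul_mem (mul_mem ht al) ak) al') ak') a0) a1) a2) h0
  rw [hΔ] at h0
  have n3 : m3 ≠ 0 := right_ne_zero_of_mul h0
  have n2 : m2 ≠ 0 := right_ne_zero_of_mul (left_ne_zero_of_mul h0)
  have two : (2 : L) ≠ 0 := by norm_num
  have itwo : (2 : L)⁻¹ ∈ factorRing r t (diffFactor_mem r t) := by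
    have := (factorRing r t (diffFactor_mem r t)).algebraMap_mem (2⁻¹ : ℂ)
    rwa [map_inv₀, map_ofNat] at this
  rw [← e2, ← e1, ← el] at c1
  rw [← e3, ← e1, ← ek] at c2
  have t1 := eq_div_of_mul_eq (mul_ne_zero two (pow_ne_zero 2 n2)) c1
  have t2 := eq_div_of_mul_eq (mul_ne_zero two (pow_ne_zero 2 n3)) c2
  have j1 : (tOne s t)⁻¹ = 2 * m2 ^ 2 * ((m1⁻¹) ^ 2 * l⁻¹) := by rw [t1, inv_div, div_eq_mul_inv, mul_inv, inv_pow]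
  have j2 : (tTwo s t)⁻¹ = 2 * m3 ^ 2 * ((m1⁻¹) ^ 2 * k⁻¹) := by rw [t2, inv_div, div_eq_mul_inv, mul_inv, inv_pow]
  have g1 : tOne s t = m1 ^ 2 * l * (2⁻¹ * (m2⁻¹) ^ 2) := by rw [t1, div_eq_mul_inv, mul_inv, inv_pow]
  have g2 : tTwo s t = m1 ^ 2 * k * (2⁻¹ * (m3⁻¹) ^ 2) := by rw [t2, div_eq_mul_inv, mul_inv, inv_pow]
  rw [Algebra.adjoin_le_iff]
  rintro x (rfl | rfl | rfl | rfl)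
  · rw [g1]; exact mul_mem (mul_mem (pow_mem (W a1) 2) (W al)) (mul_mem itwo (pow_mem i2 2))
  · rw [j1]; exact mul_mem (mul_mem (W h2) (pow_mem (W a2) 2)) (mul_mem (pow_mem i1 2) il)
  · rw [g2]; exact mul_mem (mul_mem (pow_mem (W a1) 2) (W ak)) (mul_mem itwo (pow_mem i3 2))
  · rw [j2]; exact mul_mem (mul_mem (W h2) (pow_mem (W a3) 2)) (mul_mem (pow_mem i1 2) ik)

/-- Where g is invertible the points 0, 1, ∞, t₁, t₂ stay apart at every valuation ring, so r, t and
the inverses of all factors lie in the local ring of the normalization. Conversely the normalization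
lies in ℂ[r,t] with the factors inverted, since ℂ[r,t] is integrally closed. These are the inputs of
`formallyUnramified_of_differences`. -/
theorem GenericParameter.isUnramifiedOver [CharZero L] (h : GenericParameter s t)
    (hic : ∀ x : L, IsIntegral (Algebra.adjoin ℂ {coordR s t, t}) x →
      x ∈ Algebra.adjoin ℂ {coordR s t, t})
    (A : Subalgebra ℂ L) (g : A)
    (hg : ∀ V : ValuationSubring L, A.toSubring ≤ V.toSubring → (g : L)⁻¹ ∈ V →
      UnitsAt V (tOne s t) (tTwo s t))
    (a1 : tOne s t ∈ A ∨ (tOne s t)⁻¹ ∈ A) (a2 : tTwo s t ∈ A ∨ (tTwo s t)⁻¹ ∈ A)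
    (hA : A ≤ Algebra.adjoin ℂ {tOne s t, (tOne s t)⁻¹, tTwo s t, (tTwo s t)⁻¹})
    (P : Ideal A) (hgP : g ∉ P) : IsUnramifiedOver A P := by
  intro Q hQ hQP
  have hgQ : algebraMap A (integralClosure A L) g ∉ Q := by
    rw [← hQP] at hgP
    exact hgP
  have hg0 : (g : L) ≠ 0 := by
    intro e
    apply hgQ
    rw [show g = 0 from Subtype.ext e, map_zero]
    exact Q.zero_mem
  -- An element of every valuation ring that contains A and g⁻¹ becomes integral over A after
  -- multiplication by a power of g, and g is a unit at Q.
  have rng : ∀ x : L, (∀ V : ValuationSubring L, A.toSubring ≤ V.toSubring → (g : L)⁻¹ ∈ V → x ∈ V) →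
      ∃ y, localToField A Q y = x := by
    intro x hx
    obtain ⟨n, hn⟩ := Subring.exists_isIntegral_pow_mul (R := A.toSubring) g.2 hg0 hx
    exact exists_localToField_eq A Q g.2 hgQ hn
  have hunits : ∀ V : ValuationSubring L, A.toSubring ≤ V.toSubring → (g : L)⁻¹ ∈ V →
      _ := fun V hV hgV => by
    have h2 : V.valuation 2 = 1 := by
      have k1 : (2 : L) ∈ V := ofNat_mem _ 2
      have k2 : (2 : L)⁻¹ ∈ V := hV (by
        have := A.algebraMap_mem (2⁻¹ : ℂ)
        rwa [map_inv₀, map_ofNat] at this)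
      rw [← V.valuation_le_one_iff] at k1 k2
      exact (V.valuation.eq_one_of_mul_eq_one k1 k2 (by
        rw [mul_inv_cancel₀ (by norm_num), map_one])).1
    exact ((hg V hV hgV).equalDifferences h.toRegularParameter h.one_sub_t_sq).choose_spec.units h2
  have inv : ∀ (V : ValuationSubring L) (x : L), V.valuation x = 1 → x⁻¹ ∈ V := fun V x hx => by
    rw [← V.valuation_le_one_iff, map_inv₀, hx, inv_one]
  obtain ⟨c1, c2, -⟩ := h.toRegularParameter.coordR_relations
  have hΔ0 := h.factor_ne_zero
  have hfac := hΔ0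
  simp only [diffFactor, ne_eq, mul_eq_zero, not_or] at hfac
  -- An element integral over A is integral over ℂ[r,t][1/Δ]. After clearing a power of Δ it is
  -- integral over ℂ[r,t], hence belongs to it.
  have hS : ∀ x : integralClosure A L, ∃ n : ℕ, diffFactor (coordR s t) t ^ n
      * localToField A Q (algebraMap _ _ x) ∈ Algebra.adjoin ℂ {coordR s t, t} := by
    intro x
    rw [localToField_algebraMap]
    have hx : IsIntegral A (x : L) := x.2
    have hle : A ≤ factorRing (coordR s t) t (diffFactor_mem _ _) := hA.trans h.differences_mem
    let _ : Algebra A ((Algebra.adjoin ℂ {coordR s t, t}).toSubring.away (diffFactor (coordR s t) t)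
      (diffFactor_mem _ _)) := (Subring.inclusion (R := L) (S := A.toSubring) hle).toAlgebra
    have : IsScalarTower A ((Algebra.adjoin ℂ {coordR s t, t}).toSubring.away
      (diffFactor (coordR s t) t) (diffFactor_mem _ _)) L := IsScalarTower.of_algebraMap_eq fun _ => rfl
    have hx' : IsIntegral ((Algebra.adjoin ℂ {coordR s t, t}).toSubring.away
      (diffFactor (coordR s t) t) (diffFactor_mem _ _)) (x : L) := hx.tower_top
    obtain ⟨n, hn⟩ := hx'.exists_pow_mul hΔ0
    exact ⟨n, hic _ hn⟩
  refine formallyUnramified_of_differences A (localToField A Q) (localToField_injective A Q)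
    (fun a => localToField_algebraMap A Q _)
    (rng _ fun V hV hgV => (V.valuation_le_one_iff _).1 (hunits V hV hgV).1)
    (rng _ fun V hV hgV => (V.valuation_le_one_iff _).1 (hunits V hV hgV).2.1)
    hfac.1.1.1.2 hfac.1.1.2
    (rng _ fun V hV hgV => inv V _ (hunits V hV hgV).2.2.2.2.2.2.2.1)
    (rng _ fun V hV hgV => inv V _ (hunits V hV hgV).2.2.2.2.2.2.2.2.1)
    c1 c2 a1 a2 h.one_zero h.two_zero
    (rng _ fun V hV hgV => (V.valuation_le_one_iff _).1 (hg V hV hgV).1.le)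
    (rng _ fun V hV hgV => (V.valuation_le_one_iff _).1 (hg V hV hgV).2.1.le)
    (diffFactor_mem _ _) hΔ0 (rng _ fun V hV hgV => inv V _ ?_) ?_
  · obtain ⟨-, -, u1, u2, u3, u4, u5, u6, u7, u8, u9⟩ := hunits V hV hgV
    rw [diffFactor]
    simp only [map_mul, u1, u2, u3, u4, u5, u6, u7, u8, u9, mul_one]
  · intro y
    obtain ⟨⟨x, q⟩, hxq⟩ := IsLocalization.surj Q.primeCompl y
    exact ⟨algebraMap _ _ x, algebraMap _ _ (q : integralClosure A L), IsLocalization.map_units _ q, hxq, hS x, hS q⟩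

end Chart

/-- The coordinate ring of a birational chart of the plane is integrally closed. -/
theorem FunctionField2.mem_adjoin_of_isIntegral {k : Type*} [Field k] {a b : FunctionField2 k}
    (h : IntermediateField.adjoin k {a, b} = ⊤) {x : FunctionField2 k}
    (hx : IsIntegral (Algebra.adjoin k {a, b}) x) : x ∈ Algebra.adjoin k {a, b} := by
  have : Algebra.IsAlgebraic (IntermediateField.adjoin k {a, b}) (FunctionField2 k) :=
    ⟨fun x => isAlgebraic_algebraMap
      (⟨x, h ▸ IntermediateField.mem_top⟩ : IntermediateField.adjoin k {a, b})⟩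
  have hi := algebraicIndependent_of_isAlgebraic a b
  have hr : Set.range ![a, b] = {a, b} := by simp [Matrix.range_cons, Set.pair_comm]
  have hc : IsIntegrallyClosed (Algebra.adjoin k {a, b}) := by
    have := IsIntegrallyClosed.of_equiv hi.aevalEquiv.toRingEquiv
    rwa [hr] at this
  have hf : IsFractionRing (Algebra.adjoin k {a, b}) (FunctionField2 k) :=
    IsFractionRing.of_field _ _ fun z => by
      have hz : z ∈ IntermediateField.adjoin k {a, b} := h ▸ IntermediateField.mem_top
      obtain ⟨r, hr, q, hq, rfl⟩ := IntermediateField.mem_adjoin_iff_div.1 hz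
      exact ⟨⟨r, hr⟩, ⟨q, hq⟩, rfl⟩
  obtain ⟨y, rfl⟩ := IsIntegrallyClosed.isIntegral_iff.1 hx
  exact y.2

section Coord

variable {k : Type*} [Field k] [CharZero k]

theorem genericParameter_coord : GenericParameter (coord k 0) (coord k 1) := by
  have key : ∀ (p : MvPolynomial (Fin 2) k) (x : FunctionField2 k), MvPolynomial.eval ![2, 2] p ≠ 0 →
      algebraMap _ _ p = x → x ≠ 0 := fun p x hp e =>
    e ▸ FunctionField2.algebraMap_ne_zero ![2, 2] hp
  have h : RegularParameter (coord k 0) (coord k 1) := regularParameter_coord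
  have hs := h.sm
  have hp := h.sp
  have hy := h.y
  have hy' := h.y'
  refine ⟨h, tOne_coord_ne.1, tOne_coord_ne.2, ?_, ?_, ?_⟩
  · refine div_ne_zero (neg_ne_zero.2 ?_) (mul_ne_zero (pow_ne_zero 2 hy') hp)
    rw [coord, coord]
    exact key ((-1 + MvPolynomial.X 1) * (MvPolynomial.X 0 * MvPolynomial.X 1 - MvPolynomial.X 1 + 1
      + 3 * MvPolynomial.X 0)) _ (by simp; norm_num)
      (by simp only [map_sub, map_mul, map_one, map_add, map_ofNat, map_neg])
  · intro e
    rw [tTwo, div_eq_one_iff_eq (mul_ne_zero (pow_ne_zero 2 hy') hp), ← sub_eq_zero] at e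
    revert e
    rw [coord, coord]
    exact key (-((-1 + MvPolynomial.X 1) * (MvPolynomial.X 0 * MvPolynomial.X 1 - MvPolynomial.X 1 + 1
      + 3 * MvPolynomial.X 0)) - (MvPolynomial.X 0 * MvPolynomial.X 1 - MvPolynomial.X 1
      + MvPolynomial.X 0 + 1) ^ 2 * (MvPolynomial.X 0 + 1)) _ (by simp; norm_num)
      (by simp only [map_sub, map_mul, map_one, map_add, map_ofNat, map_neg, map_pow])
  · intro e
    rw [tOne, tTwo, div_eq_div_iff (mul_ne_zero (pow_ne_zero 2 hy) hp)
      (mul_ne_zero (pow_ne_zero 2 hy') hp), ← sub_eq_zero] at e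
    revert e
    rw [coord, coord]
    exact key (-((MvPolynomial.X 1 + 1) * (MvPolynomial.X 0 * MvPolynomial.X 1 - MvPolynomial.X 1 - 1
      - 3 * MvPolynomial.X 0)) * ((MvPolynomial.X 0 * MvPolynomial.X 1 - MvPolynomial.X 1
      + MvPolynomial.X 0 + 1) ^ 2 * (MvPolynomial.X 0 + 1))
      - -((-1 + MvPolynomial.X 1) * (MvPolynomial.X 0 * MvPolynomial.X 1 - MvPolynomial.X 1 + 1
      + 3 * MvPolynomial.X 0)) * ((MvPolynomial.X 0 * MvPolynomial.X 1 - MvPolynomial.X 1 - 1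
      - MvPolynomial.X 0) ^ 2 * (MvPolynomial.X 0 + 1))) _ (by simp; norm_num)
      (by simp only [map_sub, map_mul, map_one, map_add, map_ofNat, map_neg, map_pow])

theorem adjoin_coordR : IntermediateField.adjoin k
    {coordR (coord k 0) (coord k 1), coord k 1} = ⊤ := by
  have h := genericParameter_coord (k := k)
  have ht := h.one_sub_t_sq
  obtain ⟨e0, e1, -⟩ := h.toRegularParameter.coordR_forms
  have hp := h.sp
  rw [eq_top_iff, ← FunctionField2.adjoin_coord k, IntermediateField.adjoin_le_iff]
  generalize coord k 1 = t at *
  generalize coord k 0 = s at *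
  have hr : coordR s t ∈ IntermediateField.adjoin k {coordR s t, t} :=
    IntermediateField.subset_adjoin _ _ (Or.inl rfl)
  have ht' : t ∈ IntermediateField.adjoin k {coordR s t, t} :=
    IntermediateField.subset_adjoin _ _ (Or.inr rfl)
  have hs : s = (1 - t ^ 2 + 2 * coordR s t) / (1 - t ^ 2 - 2 * coordR s t) := by
    rw [e0, e1]
    field_simp
  have a := sub_mem (one_mem _) (pow_mem ht' 2)
  have b := mul_mem (ofNat_mem (IntermediateField.adjoin k {coordR s t, t}) 2) hr
  have hs' := div_mem (add_mem a b) (sub_mem a b)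
  rw [← hs] at hs'
  rintro x (rfl | rfl)
  · exact hs'
  · exact ht'

end Coord

/-- The inclusion of the branch locus in the zero locus of `f`. -/
theorem isUnramifiedOver_of_unitsAt (a b : FunctionField2 ℂ)
    (ha : a = tOne (coord ℂ 0) (coord ℂ 1) ∨ a = (tOne (coord ℂ 0) (coord ℂ 1))⁻¹)
    (hb : b = tTwo (coord ℂ 0) (coord ℂ 1) ∨ b = (tTwo (coord ℂ 0) (coord ℂ 1))⁻¹)
    (g : Algebra.adjoin ℂ {a, b})
    (hg : ∀ V : ValuationSubring (FunctionField2 ℂ), V.valuation a ≤ 1 → V.valuation b ≤ 1 →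
      V.valuation (g : FunctionField2 ℂ) = 1 →
      UnitsAt V (tOne (coord ℂ 0) (coord ℂ 1)) (tTwo (coord ℂ 0) (coord ℂ 1)))
    (P : Ideal (Algebra.adjoin ℂ {a, b})) (hgP : g ∉ P) :
    IsUnramifiedOver (Algebra.adjoin ℂ {a, b}) P := by
  have h := genericParameter_coord (k := ℂ)
  have hic := fun x => FunctionField2.mem_adjoin_of_isIntegral (adjoin_coordR (k := ℂ)) (x := x)
  generalize coord ℂ 0 = s at *
  generalize coord ℂ 1 = t at *
  have ma : a ∈ Algebra.adjoin ℂ {a, b} := Algebra.subset_adjoin (Or.inl rfl)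
  have mb : b ∈ Algebra.adjoin ℂ {a, b} := Algebra.subset_adjoin (Or.inr rfl)
  have hg0 : (g : FunctionField2 ℂ) ≠ 0 := fun e => hgP (by
    rw [show g = 0 from Subtype.ext e]; exact P.zero_mem)
  refine h.isUnramifiedOver hic _ g (fun V hV hgV => ?_) ?_ ?_ ?_ P hgP
  · rw [← V.valuation_le_one_iff] at hgV
    exact hg V ((V.valuation_le_one_iff _).2 (hV ma)) ((V.valuation_le_one_iff _).2 (hV mb))
      (V.valuation.eq_one_of_mul_eq_one ((V.valuation_le_one_iff _).2 (hV g.2)) hgV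
        (by rw [mul_inv_cancel₀ hg0, map_one])).1
  · rcases ha with rfl | rfl
    exacts [Or.inl ma, Or.inr ma]
  · rcases hb with rfl | rfl
    exacts [Or.inl mb, Or.inr mb]
  · refine Algebra.adjoin_mono ?_
    rintro x (rfl | rfl)
    · rcases ha with rfl | rfl <;> simp
    · rcases hb with rfl | rfl <;> simp

/-! ### The discriminant factors as units, in each chart. -/

section Factors

variable {L : Type*} [Field L] (V : ValuationSubring L) {x y : L}

theorem ValuationSubring.factors_eq_one {x y z : L} (hx : V.valuation x ≤ 1) (hy : V.valuation y ≤ 1)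
    (hz : V.valuation z ≤ 1)
    (h : V.valuation (x * (x - 1) * y * (y - 1) * z) = 1) :
    V.valuation x = 1 ∧ V.valuation y = 1 ∧ V.valuation (x - 1) = 1 ∧ V.valuation (y - 1) = 1 ∧
      V.valuation z = 1 := by
  have h1 : V.valuation 1 ≤ 1 := (map_one _).le
  have hx' : V.valuation (x - 1) ≤ 1 := V.valuation.map_sub_le hx h1
  have hy' : V.valuation (y - 1) ≤ 1 := V.valuation.map_sub_le hy h1
  have m : ∀ {p q : L}, V.valuation p ≤ 1 → V.valuation q ≤ 1 → V.valuation (p * q) ≤ 1 :=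
    fun hp hq => by rw [map_mul]; exact mul_le_one' hp hq
  obtain ⟨h, k5⟩ := V.valuation.eq_one_of_mul_eq_one (m (m (m hx hx') hy) hy') hz h
  obtain ⟨h, k4⟩ := V.valuation.eq_one_of_mul_eq_one (m (m hx hx') hy) hy' h
  obtain ⟨h, k3⟩ := V.valuation.eq_one_of_mul_eq_one (m hx hx') hy h
  obtain ⟨k1, k2⟩ := V.valuation.eq_one_of_mul_eq_one hx hx' h
  exact ⟨k1, k3, k2, k4, k5⟩

theorem ValuationSubring.inv_sub_one_eq_one (hx : V.valuation x⁻¹ = 1) (h : V.valuation (x⁻¹ - 1) = 1) :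
    V.valuation x = 1 ∧ V.valuation (x - 1) = 1 := by
  have h1 : V.valuation x = 1 := by rw [← inv_inv x, map_inv₀, hx, inv_one]
  have h0 : x ≠ 0 := fun e => by simp [e] at h1
  refine ⟨h1, ?_⟩
  rw [show x - 1 = -(x * (x⁻¹ - 1)) by field_simp; ring, Valuation.map_neg, map_mul, h, h1, mul_one]

theorem unitsAt_of_factors (hx : V.valuation x ≤ 1) (hy : V.valuation y ≤ 1)
    (h : V.valuation (x * (x - 1) * y * (y - 1) * (x - y)) = 1) : UnitsAt V x y :=
  V.factors_eq_one hx hy (V.valuation.map_sub_le hx hy) h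

theorem unitsAt_of_factors_inv_left (hx : V.valuation x⁻¹ ≤ 1) (hy : V.valuation y ≤ 1)
    (h : V.valuation (x⁻¹ * (x⁻¹ - 1) * y * (y - 1) * (x⁻¹ * y - 1)) = 1) : UnitsAt V x y := by
  obtain ⟨k1, k2, k3, k4, k5⟩ := V.factors_eq_one hx hy (V.valuation.map_sub_le
    (by rw [map_mul]; exact mul_le_one' hx hy) (map_one _).le) h
  obtain ⟨l1, l3⟩ := V.inv_sub_one_eq_one k1 k3
  have h0 : x ≠ 0 := fun e => by simp [e] at l1
  refine ⟨l1, k2, l3, k4, ?_⟩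
  rw [show x - y = -(x * (x⁻¹ * y - 1)) by field_simp; ring, Valuation.map_neg, map_mul, l1, k5, mul_one]

theorem unitsAt_of_factors_inv_right (hx : V.valuation x ≤ 1) (hy : V.valuation y⁻¹ ≤ 1)
    (h : V.valuation (x * (x - 1) * y⁻¹ * (y⁻¹ - 1) * (x * y⁻¹ - 1)) = 1) : UnitsAt V x y := by
  obtain ⟨k1, k2, k3, k4, k5⟩ := V.factors_eq_one hx hy (V.valuation.map_sub_le
    (by rw [map_mul]; exact mul_le_one' hx hy) (map_one _).le) h
  obtain ⟨l2, l4⟩ := V.inv_sub_one_eq_one k2 k4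
  have h0 : y ≠ 0 := fun e => by simp [e] at l2
  refine ⟨k1, l2, k3, l4, ?_⟩
  rw [show x - y = y * (x * y⁻¹ - 1) by field_simp, map_mul, l2, k5, mul_one]

theorem unitsAt_of_factors_inv (hx : V.valuation x⁻¹ ≤ 1) (hy : V.valuation y⁻¹ ≤ 1)
    (h : V.valuation (x⁻¹ * (x⁻¹ - 1) * y⁻¹ * (y⁻¹ - 1) * (x⁻¹ - y⁻¹)) = 1) : UnitsAt V x y := by
  obtain ⟨k1, k2, k3, k4, k5⟩ := V.factors_eq_one hx hy (V.valuation.map_sub_le hx hy) h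
  obtain ⟨l1, l3⟩ := V.inv_sub_one_eq_one k1 k3
  obtain ⟨l2, l4⟩ := V.inv_sub_one_eq_one k2 k4
  have h0 : y ≠ 0 := fun e => by simp [e] at l2
  have h0' : x ≠ 0 := fun e => by simp [e] at l1
  refine ⟨l1, l2, l3, l4, ?_⟩
  rw [show x - y = -(x * y * (x⁻¹ - y⁻¹)) by field_simp; ring, Valuation.map_neg, map_mul, map_mul,
    l1, l2, k5, mul_one, mul_one]

end Factors

/-! ### Integrality of the coefficients of the cover -/

section SquareMinusCube

variable {L : Type*} [Field L] (V : ValuationSubring L)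

/-- Suppose p has a pole and put u = 1/p, h = q/p². Modulo u the relations say that (x² + x + h)²
plus a multiple of a cube of a linear polynomial is x⁴. Eliminating that cube leaves two quadratic
equations for h, which are incompatible when 21 is invertible. -/
theorem mem_of_inv_mem_of_square_minus_cube [CharZero L] (h21 : (21 : L)⁻¹ ∈ V)
    {p q m c : L} (hp : p ≠ 0) (hu : p⁻¹ ∈ V) (hh : q * p⁻¹ ^ 2 ∈ V) (z3 : 2 * p + m ∈ V)
    (z2 : p ^ 2 + 2 * q - 3 * m * c ∈ V) (z1 : 2 * q * p + 3 * m * c ^ 2 ∈ V)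
    (z0 : q ^ 2 = m * c ^ 3) : p ∈ V := by
  obtain ⟨u, eu⟩ : ∃ u, u = p⁻¹ := ⟨_, rfl⟩
  have up : u * p = 1 := by rw [eu, inv_mul_cancel₀ hp]
  obtain ⟨h, eh⟩ : ∃ h, h = q * p⁻¹ ^ 2 := ⟨_, rfl⟩
  rw [← eh] at hh
  rw [← eu] at hu eh
  generalize e3 : 2 * p + m = s3 at z3
  generalize e2 : p ^ 2 + 2 * q - 3 * m * c = s2 at z2
  generalize e1 : 2 * q * p + 3 * m * c ^ 2 = s1 at z1
  have k3 : m * u = s3 * u - 2 := by linear_combination u * e3 - 2 * up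
  have k2 : 3 * (m * c * u ^ 2) = 1 + 2 * h - s2 * u ^ 2 := by
    linear_combination -u ^ 2 * e2 + (u * p + 1) * up - 2 * eh
  have k1 : 3 * (m * c ^ 2 * u ^ 3) = s1 * u ^ 3 - 2 * h := by
    linear_combination u ^ 3 * e1 - 2 * q * u ^ 2 * up + 2 * eh
  have k0 : m * c ^ 3 * u ^ 4 = h ^ 2 := by
    rw [eh, ← z0]; ring
  have E1 : 3 * (s3 * u - 2) * (s1 * u ^ 3 - 2 * h) = (1 + 2 * h - s2 * u ^ 2) ^ 2 := by
    rw [← k1, ← k2, ← k3]; ring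
  have E2 : 9 * (s3 * u - 2) * h ^ 2 = (1 + 2 * h - s2 * u ^ 2) * (s1 * u ^ 3 - 2 * h) := by
    rw [← k1, ← k2, ← k3, ← k0]; ring
  have num : ∀ (n : ℕ) [n.AtLeastTwo], (OfNat.ofNat n : L) ∈ V := fun n _ => ofNat_mem V n
  obtain ⟨w1, ew1⟩ : ∃ w, w = 3 * s3 * s1 * u ^ 3 - 6 * s3 * h - 6 * s1 * u ^ 2
    + 2 * (1 + 2 * h) * s2 * u - s2 ^ 2 * u ^ 3 := ⟨_, rfl⟩
  obtain ⟨w2, ew2⟩ : ∃ w, w = 9 * s3 * h ^ 2 - (1 + 2 * h) * s1 * u ^ 2 + s2 * s1 * u ^ 4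
    - 2 * h * s2 * u := ⟨_, rfl⟩
  have m1 : w1 ∈ V := ew1 ▸ sub_mem (add_mem (sub_mem (sub_mem (mul_mem (mul_mem (mul_mem
    (num 3) z3) z1) (pow_mem hu 3)) (mul_mem (mul_mem (num 6) z3) hh)) (mul_mem (mul_mem (num 6) z1)
    (pow_mem hu 2))) (mul_mem (mul_mem (mul_mem (num 2) (add_mem (one_mem V) (mul_mem (num 2) hh))) z2)
    hu)) (mul_mem (pow_mem z2 2) (pow_mem hu 3))
  have m2 : w2 ∈ V := ew2 ▸ sub_mem (add_mem (sub_mem (mul_mem (mul_mem (num 9) z3) (pow_mem hh 2))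
    (mul_mem (mul_mem (add_mem (one_mem V) (mul_mem (num 2) hh)) z1) (pow_mem hu 2)))
    (mul_mem (mul_mem z2 z1) (pow_mem hu 4))) (mul_mem (mul_mem (mul_mem (num 2) hh) z2) hu)
  -- Modulo u the equations `E1` and `E2` reduce to 4h² - 8h + 1 = 0 and 14h² - 2h = 0.
  have r1 : 4 * h ^ 2 - 8 * h + 1 = u * w1 := by rw [ew1]; linear_combination -E1
  have r2 : 14 * h ^ 2 - 2 * h = u * w2 := by rw [ew2]; linear_combination -E2
  obtain ⟨l, el⟩ : ∃ l, l = 7 * w1 - 2 * w2 := ⟨_, rfl⟩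
  have rl : 7 - 52 * h = u * l := by rw [el]; linear_combination 7 * r1 - 2 * r2
  have ml : l ∈ V := el ▸ sub_mem (mul_mem (num 7) m1) (mul_mem (num 2) m2)
  -- Elimination of h from the two quadratics expresses 21 as a multiple of u, so p = 1/u is
  -- integral.
  have key : u * (7 * u * l ^ 2 - 1352 * w2 - 46 * l) = 21 := by
    linear_combination 1352 * r2 + 46 * rl - 7 * (7 - 52 * h + u * l) * rl
  have hpe : p = (7 * u * l ^ 2 - 1352 * w2 - 46 * l) * 21⁻¹ := by
    rw [eq_mul_inv_iff_mul_eq₀ (by norm_num), ← key]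
    linear_combination (7 * u * l ^ 2 - 1352 * w2 - 46 * l) * up
  rw [hpe]
  exact mul_mem (sub_mem (sub_mem (mul_mem (mul_mem (num 7) hu) (pow_mem ml 2))
    (mul_mem (num 1352) m2)) (mul_mem (num 46) ml)) h21

/-- If `(x² + px + q)² + m(x - c)³` has coefficients in a valuation ring and no constant term, then
`p` and `q` are in the valuation ring. -/
theorem mem_of_square_minus_cube [CharZero L] (hC : ∀ n : ℕ, (n : L)⁻¹ ∈ V)
    {p q m c : L} (z3 : 2 * p + m ∈ V) (z2 : p ^ 2 + 2 * q - 3 * m * c ∈ V)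
    (z1 : 2 * q * p + 3 * m * c ^ 2 ∈ V) (z0 : q ^ 2 = m * c ^ 3) : p ∈ V ∧ q ∈ V := by
  by_cases hqp : V.valuation q ≤ V.valuation p ^ 2
  · by_cases hp : V.valuation p ≤ 1
    · rw [← V.valuation_le_one_iff, ← V.valuation_le_one_iff]
      exact ⟨hp, hqp.trans (pow_le_one₀ zero_le hp)⟩
    · have hp0 : p ≠ 0 := by
        rintro rfl
        exact hp (by simp)
      refine absurd ((V.valuation_le_one_iff _).2 (mem_of_inv_mem_of_square_minus_cube V (by exact_mod_cast hC 21) hp0 ?_ ?_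
        z3 z2 z1 z0)) hp
      · exact (V.mem_or_inv_mem p).resolve_left fun h => hp ((V.valuation_le_one_iff _).2 h)
      · rw [← V.valuation_le_one_iff, map_mul, map_pow, map_inv₀, inv_pow]
        exact mul_inv_le_one_of_le₀ hqp zero_le
  · rw [not_le] at hqp
    by_cases hq : V.valuation q ≤ 1
    · rw [← V.valuation_le_one_iff, ← V.valuation_le_one_iff]
      refine ⟨?_, hq⟩
      by_contra hp
      exact absurd (hqp.trans_le hq) (not_lt.2 (one_le_pow₀ (not_le.1 hp).le))
    -- Here q is large and dominates p². Then mc has the value of q, while m² is smaller than q and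
    -- (mc²)² is smaller than q³. This contradicts m²(mc²)² = (mc)⁴.
    · exfalso
      rw [not_le] at hq
      have unit : ∀ n : ℕ, n ≠ 0 → V.valuation (n : L) = 1 := fun n hn =>
        (V.valuation.eq_one_of_mul_eq_one ((V.valuation_le_one_iff _).2 (natCast_mem V n))
          ((V.valuation_le_one_iff _).2 (hC n)) (by
            rw [mul_inv_cancel₀ (Nat.cast_ne_zero.2 hn), map_one])).1
      have u2 : V.valuation (2 : L) = 1 := by exact_mod_cast unit 2 (by norm_num)
      have u3 : V.valuation (3 : L) = 1 := by exact_mod_cast unit 3 (by norm_num)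
      rw [← V.valuation_le_one_iff] at z1 z2 z3
      have q0 : 0 < V.valuation q := zero_lt_one.trans hq
      have sub : ∀ {a b : L} {g}, V.valuation a ^ 2 < g → V.valuation b ^ 2 < g →
          V.valuation (a - b) ^ 2 < g := fun {a b g} ha hb => by
        rcases max_cases (V.valuation a) (V.valuation b) with ⟨e, -⟩ | ⟨e, -⟩
        · exact (pow_le_pow_left₀ zero_le (e ▸ V.valuation.map_sub a b) 2).trans_lt ha
        · exact (pow_le_pow_left₀ zero_le (e ▸ V.valuation.map_sub a b) 2).trans_lt hb
      have k3 : V.valuation m ^ 2 < V.valuation q := by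
        rw [show m = (2 * p + m) - 2 * p by ring]
        exact sub ((pow_le_one₀ zero_le z3).trans_lt hq) (by rwa [map_mul, u2, one_mul])
      have q1 : 1 < V.valuation q ^ 3 := one_lt_pow₀ hq (by norm_num)
      have k1 : V.valuation (m * c ^ 2) ^ 2 < V.valuation q ^ 3 := by
        rw [← one_mul (V.valuation (m * c ^ 2)), ← u3, ← map_mul,
          show 3 * (m * c ^ 2) = (2 * q * p + 3 * m * c ^ 2) - 2 * (q * p) by ring]
        refine sub ((pow_le_one₀ zero_le z1).trans_lt q1) ?_
        rw [map_mul, u2, one_mul, map_mul, mul_pow, pow_succ _ 2]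
        exact mul_lt_mul_of_pos_left hqp (pow_pos q0 2)
      have k2 : V.valuation (m * c) = V.valuation q := by
        rw [← one_mul (V.valuation (m * c)), ← u3, ← map_mul,
          show 3 * (m * c) = 2 * q + (p ^ 2 - (p ^ 2 + 2 * q - 3 * m * c)) by ring]
        rw [Valuation.map_add_eq_of_lt_left, map_mul, u2, one_mul]
        rw [map_mul, u2, one_mul]
        exact (V.valuation.map_sub _ _).trans_lt (max_lt (by rwa [map_pow]) (z2.trans_lt hq))
      have : V.valuation m ^ 2 * V.valuation (m * c ^ 2) ^ 2 = V.valuation q * V.valuation q ^ 3 := by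
        rw [← pow_succ', ← k2, ← map_pow, ← map_pow, ← map_mul, ← map_pow]
        congr 1
        ring
      exact (mul_lt_mul'' k3 k1 zero_le zero_le).ne this

end SquareMinusCube

/-! ### Integrality after scaling by w. -/

section Scaled

variable {L : Type*} [Field L] [CharZero L] {V : ValuationSubring L} {s t w : L}

/-- The substitution x ↦ wx turns the fibre into 0, w, wt₁, wt₂, multiplies a₁, k and c by w and
multiplies a₀ by w². The coefficients of the scaled fibre polynomial are then integral. -/
theorem RegularParameter.scaled_coeff_mem (h : RegularParameter s t) (hC : ∀ n : ℕ, (n : L)⁻¹ ∈ V)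
    (w0 : w ∈ V) (w1 : w * tOne s t ∈ V) (w2 : w * tTwo s t ∈ V) :
    w * coeffA1 s t ∈ V ∧ w ^ 2 * coeffA0 s t ∈ V := by
  obtain ⟨c3, c2, c1, c0⟩ := And.intro h.cubic (And.intro h.quadratic (And.intro h.linear h.constant))
  generalize coeffA0 s t ^ 2 / poleC s ^ 3 = m at *
  refine mem_of_square_minus_cube V (m := w * m) (c := w * poleC s) hC ?_ ?_ ?_ ?_
  · rw [show 2 * (w * coeffA1 s t) + w * m = -(w + w * tOne s t + w * tTwo s t) by
      linear_combination -w * c3]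
    exact neg_mem (add_mem (add_mem w0 w1) w2)
  · rw [show (w * coeffA1 s t) ^ 2 + 2 * (w ^ 2 * coeffA0 s t) - 3 * (w * m) * (w * poleC s)
      = w * (w * tOne s t) + w * (w * tTwo s t) + (w * tOne s t) * (w * tTwo s t) by
      linear_combination -w ^ 2 * c2]
    exact add_mem (add_mem (mul_mem w0 w1) (mul_mem w0 w2)) (mul_mem w1 w2)
  · rw [show 2 * (w ^ 2 * coeffA0 s t) * (w * coeffA1 s t) + 3 * (w * m) * (w * poleC s) ^ 2
      = -(w * (w * tOne s t) * (w * tTwo s t)) by linear_combination -w ^ 3 * c1]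
    exact neg_mem (mul_mem (mul_mem w0 w1) w2)
  · linear_combination w ^ 4 * c0

/-- `a₀ρ³` is the value of `x² + a₁x + a₀` at one of the points `0, 1, t₁, t₂`. -/
def IsCubeRatio {F : Type*} [Field F] (s t ρ : F) : Prop :=
  ∃ x : F, (x = 0 ∨ x = 1 ∨ x = tOne s t ∨ x = tTwo s t) ∧
    coeffA0 s t * ρ ^ 3 = x ^ 2 + coeffA1 s t * x + coeffA0 s t

omit [CharZero L] in
theorem isCubeRatio_one : IsCubeRatio s t 1 := ⟨0, Or.inl rfl, by ring⟩

omit [CharZero L] in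
theorem isCubeRatio_s : IsCubeRatio s t s := ⟨1, Or.inr (Or.inl rfl), by rw [coeffA1]; ring⟩

-- On the fibre P² is proportional to the cube of x - c, so the ratios of the values of P are cubes.
-- Relative to the point 0 the cube roots at 1, t₁, t₂ are s, 2s/(st-t-1-s) and -2s/(st-t+s+1).
omit [CharZero L] in
theorem RegularParameter.isCubeRatio_tOne (h : RegularParameter s t) :
    IsCubeRatio s t (2 * s / (s * t - t - 1 - s)) := by
  refine ⟨_, Or.inr (Or.inr (Or.inl rfl)), ?_⟩
  rw [coeffA1, coeffA0_eq, tOne]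
  obtain ⟨h1, h2, h3, h4⟩ := h
  generalize hy : s * t - t - 1 - s = y at *
  generalize hy' : s * t - t + s + 1 = y' at *
  field_simp
  rw [← hy, ← hy']
  ring

omit [CharZero L] in
theorem RegularParameter.isCubeRatio_tTwo (h : RegularParameter s t) :
    IsCubeRatio s t (-(2 * s) / (s * t - t + s + 1)) := by
  refine ⟨_, Or.inr (Or.inr (Or.inr rfl)), ?_⟩
  rw [coeffA1, coeffA0_eq, tTwo]
  obtain ⟨h1, h2, h3, h4⟩ := h
  generalize hy : s * t - t - 1 - s = y at *
  generalize hy' : s * t - t + s + 1 = y' at *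
  field_simp
  rw [← hy, ← hy']
  ring

/-- The cube of this element is w²P(x)·(w²P(x'))² for two points x, x' of the fibre, hence integral,
and a valuation ring contains the cube roots of its elements. -/
theorem RegularParameter.scaled_product_mem (h : RegularParameter s t) (hC : ∀ n : ℕ, (n : L)⁻¹ ∈ V)
    (w0 : w ∈ V) (w1 : w * tOne s t ∈ V) (w2 : w * tTwo s t ∈ V) {ρ ρ' : L}
    (hρ : IsCubeRatio s t ρ) (hρ' : IsCubeRatio s t ρ') :
    w ^ 2 * (coeffA0 s t * ρ * ρ' ^ 2) ∈ V := by
  obtain ⟨h1, h0⟩ := h.scaled_coeff_mem hC w0 w1 w2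
  have key : ∀ {ρ}, IsCubeRatio s t ρ → w ^ 2 * (coeffA0 s t * ρ ^ 3) ∈ V := by
    rintro ρ ⟨x, hx, e⟩
    have hx' : w * x ∈ V := by
      rcases hx with rfl | rfl | rfl | rfl
      · rw [mul_zero]; exact zero_mem V
      · rwa [mul_one]
      · exact w1
      · exact w2
    rw [e, show w ^ 2 * (x ^ 2 + coeffA1 s t * x + coeffA0 s t)
      = (w * x) ^ 2 + (w * coeffA1 s t) * (w * x) + w ^ 2 * coeffA0 s t by ring]
    exact add_mem (add_mem (pow_mem hx' 2) (mul_mem h1 hx')) h0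
  have k := mul_mem (key hρ) (pow_mem (key hρ') 2)
  rw [show w ^ 2 * (coeffA0 s t * ρ ^ 3) * (w ^ 2 * (coeffA0 s t * ρ' ^ 3)) ^ 2
    = (w ^ 2 * (coeffA0 s t * ρ * ρ' ^ 2)) ^ 3 by ring, ← V.valuation_le_one_iff, map_pow] at k
  rw [← V.valuation_le_one_iff]
  exact (pow_le_one_iff_of_nonneg zero_le (by norm_num)).1 k

end Scaled

/-- Intersects over all valuation rings that contain A. These integral functions are the ones whose
first order terms detect ramification. -/
theorem RegularParameter.isIntegral_scaled_product {L : Type*} [Field L] [Algebra ℂ L] {s t w : L}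
    (h : RegularParameter s t) (A : Subalgebra ℂ L) (w0 : w ∈ A) (w1 : w * tOne s t ∈ A)
    (w2 : w * tTwo s t ∈ A) {ρ ρ' : L} (hρ : IsCubeRatio s t ρ) (hρ' : IsCubeRatio s t ρ') :
    IsIntegral A (w ^ 2 * (coeffA0 s t * ρ * ρ' ^ 2)) := by
  have : CharZero L := charZero_of_injective_algebraMap (algebraMap ℂ L).injective
  obtain ⟨n, hn⟩ := Subring.exists_isIntegral_pow_mul (R := A.toSubring) (g := 1)
    (x := w ^ 2 * (coeffA0 s t * ρ * ρ' ^ 2)) A.one_mem one_ne_zero fun V hV _ =>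
    h.scaled_product_mem (fun n => hV (by
      have := A.algebraMap_mem ((n : ℂ)⁻¹)
      rwa [map_inv₀, map_natCast] at this)) (hV w0) (hV w1) (hV w2) hρ hρ'
  rwa [one_pow, one_mul] at hn

/-! ### A criterion for ramification -/

section Criterion

-- The reduction of ψ modulo X² and its constant part agree on A and agree modulo X. Both extend to
-- the local ring at Q, because elements outside Q have invertible constant term. If Q were
-- unramified they would coincide, but β separates them.
open scoped PowerSeries in
theorem not_isUnramifiedAt_of_powerSeries {A S K : Type*} [CommRing A] [CommRing S] [Algebra A S]
    [Field K] (ψ : S →+* K⟦X⟧) (hA : ∀ a, PowerSeries.coeff 1 (ψ (algebraMap A S a)) = 0) {β : S}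
    (hβ : PowerSeries.coeff 1 (ψ β) ≠ 0) (Q : Ideal S) [Q.IsPrime] (hQ : ∀ x, PowerSeries.constantCoeff (ψ x) = 0 → x ∈ Q) :
    ¬ Algebra.IsUnramifiedAt A Q := by
  intro hun
  have hun' : Algebra.FormallyUnramified A (Localization.AtPrime Q) := hun
  let m : K⟦X⟧ →+* K⟦X⟧ ⧸ Ideal.span {(PowerSeries.X : K⟦X⟧) ^ 2} := Ideal.Quotient.mk _
  let f₁ : S →+* K⟦X⟧ ⧸ Ideal.span {(PowerSeries.X : K⟦X⟧) ^ 2} := m.comp ψ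
  let f₂ : S →+* K⟦X⟧ ⧸ Ideal.span {(PowerSeries.X : K⟦X⟧) ^ 2} := m.comp (PowerSeries.C.comp (PowerSeries.constantCoeff.comp ψ))
  have hu : ∀ y : Q.primeCompl, PowerSeries.constantCoeff (ψ y) ≠ 0 := fun y h => y.2 (hQ _ h)
  have h₁ : ∀ y : Q.primeCompl, IsUnit (f₁ y) := fun y =>
    (PowerSeries.isUnit_iff_constantCoeff.2 (hu y).isUnit).map m
  have h₂ : ∀ y : Q.primeCompl, IsUnit (f₂ y) := fun y =>
    ((hu y).isUnit.map PowerSeries.C).map m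
  have hc : ∀ a, f₁ (algebraMap A S a) = f₂ (algebraMap A S a) := fun a => by
    refine Ideal.Quotient.eq.2 (Ideal.mem_span_singleton.2 (PowerSeries.X_pow_dvd_iff.2 fun n hn => ?_))
    interval_cases n
    · simp
    · rw [map_sub, hA]
      simp [PowerSeries.coeff_C]
  let _ : Algebra A (K⟦X⟧ ⧸ Ideal.span {(PowerSeries.X : K⟦X⟧) ^ 2}) := (f₁.comp (algebraMap A S)).toAlgebra
  let g₁ : Localization.AtPrime Q →ₐ[A] K⟦X⟧ ⧸ Ideal.span {(PowerSeries.X : K⟦X⟧) ^ 2} :=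
    { IsLocalization.lift h₁ with
      commutes' := fun a => by
        change IsLocalization.lift h₁ (algebraMap A (Localization.AtPrime Q) a) = _
        rw [IsScalarTower.algebraMap_apply A S (Localization.AtPrime Q), IsLocalization.lift_eq]
        rfl }
  let g₂ : Localization.AtPrime Q →ₐ[A] K⟦X⟧ ⧸ Ideal.span {(PowerSeries.X : K⟦X⟧) ^ 2} :=
    { IsLocalization.lift h₂ with
      commutes' := fun a => by
        change IsLocalization.lift h₂ (algebraMap A (Localization.AtPrime Q) a) = _
        rw [IsScalarTower.algebraMap_apply A S (Localization.AtPrime Q), IsLocalization.lift_eq, ← hc]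
        rfl }
  have hg₁ : ∀ x, g₁ (algebraMap S _ x) = f₁ x := fun x => IsLocalization.lift_eq h₁ x
  have hg₂ : ∀ x, g₂ (algebraMap S _ x) = f₂ x := fun x => IsLocalization.lift_eq h₂ x
  have hI : IsNilpotent (Ideal.span {m PowerSeries.X}) := ⟨2, by
    rw [Ideal.span_singleton_pow, ← map_pow, Ideal.zero_eq_bot, Ideal.span_singleton_eq_bot]
    exact Ideal.Quotient.eq_zero_iff_mem.2 (Ideal.mem_span_singleton_self _)⟩
  have hg : g₁ = g₂ := by
    refine Algebra.FormallyUnramified.ext (I := Ideal.span {m PowerSeries.X}) hI fun x => ?_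
    have : ((Ideal.Quotient.mk (Ideal.span {m PowerSeries.X})).comp (g₁ : Localization.AtPrime Q →+* _))
        = (Ideal.Quotient.mk (Ideal.span {m PowerSeries.X})).comp (g₂ : Localization.AtPrime Q →+* _) := by
      refine IsLocalization.ringHom_ext Q.primeCompl (RingHom.ext fun x => ?_)
      change Ideal.Quotient.mk _ (g₁ (algebraMap S _ x)) = Ideal.Quotient.mk _ (g₂ (algebraMap S _ x))
      rw [hg₁, hg₂]
      refine Ideal.Quotient.eq.2 (Ideal.mem_span_singleton.2 ?_)
      change m PowerSeries.X ∣ m (ψ x) - m (PowerSeries.C (PowerSeries.constantCoeff (ψ x)))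
      rw [← map_sub]
      exact map_dvd m (PowerSeries.X_dvd_iff.2 (by simp))
    exact RingHom.congr_fun this x
  have e := hg₁ β
  rw [hg, hg₂] at e
  have e' := Ideal.Quotient.eq.1 e
  rw [Ideal.mem_span_singleton, PowerSeries.X_pow_dvd_iff] at e'
  have e1 := e' 1 (by norm_num)
  rw [map_sub, sub_eq_zero] at e1
  exact hβ (by rw [← e1]; simp [PowerSeries.coeff_C])

end Criterion

/-! ### First order jets in Laurent series. -/

section Jet

variable {L K : Type*} [Field L] [Algebra ℂ L] [Field K] [Algebra ℂ K]

open scoped PowerSeries LaurentSeries in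
/-- The Laurent series of `z` is `c + dX + O(X²)`. -/
def HasJet (Ψ : L →ₐ[ℂ] K⸨X⸩) (z : L) (c d : K) : Prop :=
  ∃ p : K⟦X⟧, algebraMap K⟦X⟧ K⸨X⸩ p = Ψ z ∧ PowerSeries.constantCoeff p = c ∧ PowerSeries.coeff 1 p = d

namespace HasJet

open scoped PowerSeries LaurentSeries

variable {Ψ : L →ₐ[ℂ] K⸨X⸩} {z z' : L} {c d c' d' : K}

theorem add (h : HasJet Ψ z c d) (h' : HasJet Ψ z' c' d') : HasJet Ψ (z + z') (c + c') (d + d') := by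
  obtain ⟨p, h1, rfl, rfl⟩ := h
  obtain ⟨p', h1', rfl, rfl⟩ := h'
  exact ⟨p + p', by rw [map_add, map_add, h1, h1'], map_add _ _ _, map_add _ _ _⟩

theorem neg (h : HasJet Ψ z c d) : HasJet Ψ (-z) (-c) (-d) := by
  obtain ⟨p, h1, rfl, rfl⟩ := h
  exact ⟨-p, by rw [map_neg, map_neg, h1], map_neg _ _, map_neg _ _⟩

theorem sub (h : HasJet Ψ z c d) (h' : HasJet Ψ z' c' d') : HasJet Ψ (z - z') (c - c') (d - d') := by
  obtain ⟨p, h1, rfl, rfl⟩ := h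
  obtain ⟨p', h1', rfl, rfl⟩ := h'
  exact ⟨p - p', by rw [map_sub, map_sub, h1, h1'], map_sub _ _ _, map_sub _ _ _⟩

theorem mul (h : HasJet Ψ z c d) (h' : HasJet Ψ z' c' d') :
    HasJet Ψ (z * z') (c * c') (c * d' + d * c') := by
  obtain ⟨p, h1, rfl, rfl⟩ := h
  obtain ⟨p', h1', rfl, rfl⟩ := h'
  refine ⟨p * p', by rw [map_mul, map_mul, h1, h1'], map_mul _ _ _, ?_⟩
  rw [PowerSeries.coeff_mul, Finset.Nat.antidiagonal_succ]
  simp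

theorem inv (h : HasJet Ψ z c d) (hc : c ≠ 0) : HasJet Ψ z⁻¹ c⁻¹ (-d / c ^ 2) := by
  obtain ⟨p, h1, rfl, rfl⟩ := h
  have hp : p * p⁻¹ = 1 := PowerSeries.mul_inv_cancel p hc
  have h0 : PowerSeries.constantCoeff p⁻¹ = (PowerSeries.constantCoeff p)⁻¹ := PowerSeries.constantCoeff_inv p
  refine ⟨p⁻¹, ?_, h0, ?_⟩
  · rw [map_inv₀, ← h1]
    refine eq_inv_of_mul_eq_one_right ?_
    rw [← map_mul, hp, map_one]
  · have := congrArg (PowerSeries.coeff 1) hp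
    rw [PowerSeries.coeff_mul, Finset.Nat.antidiagonal_succ] at this
    simp [PowerSeries.coeff_one, h0] at this
    field_simp
    field_simp at this
    linear_combination this

theorem const (k : ℂ) : HasJet Ψ (algebraMap ℂ L k) (algebraMap ℂ K k) 0 := by
  refine ⟨PowerSeries.C (algebraMap ℂ K k), ?_, by simp, by simp⟩
  rw [AlgHom.commutes, HahnSeries.algebraMap_apply' ℤ k, PowerSeries.algebraMap_apply,
    LaurentSeries.coe_algebraMap]

theorem ne_zero (h : HasJet Ψ z c d) (hc : c ≠ 0) : z ≠ 0 := by
  obtain ⟨p, h1, rfl, rfl⟩ := h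
  rintro rfl
  rw [map_zero] at h1
  rw [(IsFractionRing.injective K⟦X⟧ K⸨X⸩).eq_iff' (map_zero _)] at h1
  exact hc (by rw [h1, map_zero])

theorem congr (h : HasJet Ψ z c d) (hz : z = z') (hc : c = c') (hd : d = d') :
    HasJet Ψ z' c' d' := by
  subst hz hc hd; exact h

end HasJet

open scoped LaurentSeries in
theorem exists_hasJet_of_mem_adjoin (Ψ : L →ₐ[ℂ] K⸨X⸩) {a b : L} {a' b' : K}
    (ha : HasJet Ψ a a' 0) (hb : HasJet Ψ b b' 0) {z : L} (hz : z ∈ Algebra.adjoin ℂ {a, b}) :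
    ∃ c, HasJet Ψ z c 0 := by
  induction hz using Algebra.adjoin_induction with
  | mem x hx =>
    rcases hx with rfl | rfl
    exacts [⟨_, ha⟩, ⟨_, hb⟩]
  | algebraMap r => exact ⟨_, HasJet.const r⟩
  | add x y _ _ hx hy =>
    obtain ⟨_, hx⟩ := hx
    obtain ⟨_, hy⟩ := hy
    exact ⟨_, (hx.add hy).congr rfl rfl (add_zero 0)⟩
  | mul x y _ _ hx hy =>
    obtain ⟨_, hx⟩ := hx
    obtain ⟨_, hy⟩ := hy
    exact ⟨_, (hx.mul hy).congr rfl rfl (by simp)⟩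

-- Power series are integrally closed, so Ψ maps the normalization into them. The kernel of the
-- constant term is a prime whose trace on A lies in P. A prime above P that contains this kernel is
-- ramified by `not_isUnramifiedAt_of_powerSeries`.
open scoped PowerSeries LaurentSeries in
theorem not_isUnramifiedOver_of_hasJet (Ψ : L →ₐ[ℂ] K⸨X⸩) {A : Subalgebra ℂ L}
    (hA : ∀ z ∈ A, ∃ c, HasJet Ψ z c 0) {β : L} {c d : K} (hβ : HasJet Ψ β c d) (hd : d ≠ 0)
    (hi : IsIntegral A β) (P : Ideal A) [P.IsPrime]
    (hP : ∀ z : A, ∀ d, HasJet Ψ z 0 d → z ∈ P) : ¬ IsUnramifiedOver A P := by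
  have hS : ∀ z : integralClosure A L, Ψ z ∈ (algebraMap K⟦X⟧ K⸨X⸩).range := fun z => by
    have hz : IsIntegral A (z : L) := z.2
    obtain ⟨f, hf, hfz⟩ := hz
    choose φ hφ _ _ using fun x : A => (hA x x.2).choose_spec
    have hφ' : ∀ x : A, Ψ (x : L) ∈ (algebraMap K⟦X⟧ K⸨X⸩).range := fun x => ⟨_, hφ x⟩
    have : IsIntegral K⟦X⟧ (Ψ z) := by
      let e : A →+* (algebraMap K⟦X⟧ K⸨X⸩).range :=
        ((Ψ : L →+* K⸨X⸩).comp (algebraMap A L)).codRestrict _ hφ'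
      have h1 : IsIntegral (algebraMap K⟦X⟧ K⸨X⸩).range (Ψ z) := by
        refine ⟨f.map e, hf.map e, ?_⟩
        rw [Polynomial.eval₂_map]
        have := congrArg Ψ hfz
        rw [map_zero, ← AlgHom.coe_toRingHom, Polynomial.hom_eval₂] at this
        exact this
      obtain ⟨f', hf', h'⟩ := h1
      have hs : Function.Surjective (algebraMap K⟦X⟧ K⸨X⸩).rangeRestrict :=
        (algebraMap K⟦X⟧ K⸨X⸩).rangeRestrict_surjective
      obtain ⟨f'', h1, -, h2⟩ := Polynomial.lifts_and_natDegree_eq_and_monic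
        ((Polynomial.mem_lifts f').2 (Polynomial.map_surjective _ hs f')) hf'
      refine ⟨f'', h2, ?_⟩
      rw [← h1, Polynomial.eval₂_map] at h'
      exact h'
    obtain ⟨p, hp⟩ := IsIntegrallyClosed.isIntegral_iff.1 this
    exact ⟨p, hp⟩
  have hinj : Function.Injective (algebraMap K⟦X⟧ K⸨X⸩) := IsFractionRing.injective _ _
  obtain ⟨ψ, hψ⟩ : ∃ ψ : integralClosure A L →+* K⟦X⟧, ∀ z, algebraMap K⟦X⟧ K⸨X⸩ (ψ z) = Ψ z := by
    let e := RingEquiv.ofBijective (algebraMap K⟦X⟧ K⸨X⸩).rangeRestrict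
      ⟨fun x y h => hinj (congrArg Subtype.val h), (algebraMap K⟦X⟧ K⸨X⸩).rangeRestrict_surjective⟩
    refine ⟨(e.symm : _ →+* K⟦X⟧).comp
      (((Ψ : L →+* K⸨X⸩).comp (algebraMap (integralClosure A L) L)).codRestrict _ hS), fun z => ?_⟩
    exact congrArg Subtype.val (e.apply_symm_apply ⟨Ψ z, hS z⟩)
  have jet : ∀ {z : integralClosure A L} {c d : K}, HasJet Ψ z c d →
      PowerSeries.constantCoeff (ψ z) = c ∧ PowerSeries.coeff 1 (ψ z) = d := by
    rintro z c d ⟨p, h1, h2, h3⟩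
    rw [← hψ] at h1
    rw [← hinj h1]
    exact ⟨h2, h3⟩
  let Q₀ : Ideal (integralClosure A L) := RingHom.ker ((PowerSeries.constantCoeff (R := K)).comp ψ)
  have hQ₀ : Q₀.IsPrime := RingHom.ker_isPrime _
  -- The centre Q₀ of the jet may lie over a prime smaller than P, and going up produces a prime
  -- exactly over P. This treats the special points of a branch curve together with its generic
  -- point.
  have hle : Q₀.comap (algebraMap A (integralClosure A L)) ≤ P := fun z hz =>
    hP z (PowerSeries.coeff 1 (ψ (algebraMap A _ z))) ⟨_, hψ _, hz, rfl⟩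
  obtain ⟨Q, hQ1, hQ2, hQ3⟩ := Ideal.exists_ideal_over_prime_of_isIntegral_of_isPrime P Q₀ hle
  intro hun
  refine not_isUnramifiedAt_of_powerSeries (A := A) ψ (fun z => ?_) (β := ⟨β, hi⟩) ?_ Q
    (fun x hx => hQ1 hx) (hun Q hQ3)
  · obtain ⟨c, hc⟩ := hA z z.2
    exact (jet (z := algebraMap A _ z) hc).2
  · rw [(jet (z := ⟨β, hi⟩) hβ).2]
    exact hd

end Jet

section Embedding

open scoped PowerSeries LaurentSeries

theorem FunctionField2.exists_algHom {k F : Type*} [Field k] [Field F] [Algebra k F] {s t : F}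
    (h : AlgebraicIndependent k ![s, t]) :
    ∃ σ : FunctionField2 k →ₐ[k] F, σ (coord k 0) = s ∧ σ (coord k 1) = t := by
  have hi : Function.Injective (MvPolynomial.aeval (R := k) ![s, t]) := h
  refine ⟨IsFractionRing.liftAlgHom hi, ?_, ?_⟩ <;>
  · rw [coord, IsFractionRing.liftAlgHom_apply]
    simp

theorem FunctionField2.exists_endomorphism {k : Type*} [Field k] {s t : FunctionField2 k}
    (h : IntermediateField.adjoin k {s, t} = ⊤) :
    ∃ σ : FunctionField2 k →ₐ[k] FunctionField2 k, σ (coord k 0) = s ∧ σ (coord k 1) = t := by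
  have : Algebra.IsAlgebraic (IntermediateField.adjoin k {s, t}) (FunctionField2 k) :=
    ⟨fun x => isAlgebraic_algebraMap
      (⟨x, h ▸ IntermediateField.mem_top⟩ : IntermediateField.adjoin k {s, t})⟩
  exact FunctionField2.exists_algHom (algebraicIndependent_of_isAlgebraic s t)

theorem LaurentSeries.transcendental_X (K : Type*) [Field K] :
    Transcendental K (algebraMap K⟦X⟧ K⸨X⸩ PowerSeries.X) := by
  have h : algebraMap K[X] K⸨X⸩ X = algebraMap K⟦X⟧ K⸨X⸩ PowerSeries.X := by
    rw [LaurentSeries.coe_algebraMap, ← Polynomial.coe_X]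
    exact Polynomial.algebraMap_hahnSeries_apply ℤ Polynomial.X
  have : @IsScalarTower K K[X] K⸨X⸩ _ Algebra.toSMul Algebra.toSMul := by
    refine IsScalarTower.of_algebraMap_eq (R := K) (S := K[X]) (A := K⸨X⸩) fun c => ?_
    rw [Polynomial.algebraMap_hahnSeries_apply ℤ, HahnSeries.algebraMap_apply' ℤ c,
      PowerSeries.algebraMap_apply, Polynomial.algebraMap_apply, Polynomial.coe_C]
  rw [← h, transcendental_algebraMap_iff (FaithfulSMul.algebraMap_injective _ _)]
  exact Polynomial.transcendental_X K

/-- The first coordinate goes to X and the second to the constant y. They are independent because X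
is transcendental over K. -/
theorem FunctionField2.exists_laurent {K : Type*} [Field K] [Algebra ℂ K] {y : K}
    (hy : Transcendental ℂ y) : ∃ Ψ : FunctionField2 ℂ →ₐ[ℂ] K⸨X⸩,
      HasJet Ψ (coord ℂ 0) 0 1 ∧ HasJet Ψ (coord ℂ 1) y 0 := by
  have h1 : AlgebraicIndependent ℂ ![y] := algebraicIndependent_iff_transcendental.2 hy
  have h2 : AlgebraicIndependent K ![algebraMap K⟦X⟧ K⸨X⸩ PowerSeries.X] :=
    algebraicIndependent_iff_transcendental.2 (LaurentSeries.transcendental_X K)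
  have : @IsScalarTower ℂ K K⸨X⸩ _ Algebra.toSMul Algebra.toSMul := by
    refine IsScalarTower.of_algebraMap_eq (R := ℂ) (S := K) (A := K⸨X⸩) fun c => ?_
    rw [HahnSeries.algebraMap_apply' ℤ c, HahnSeries.algebraMap_apply' ℤ (algebraMap ℂ K c),
      PowerSeries.algebraMap_apply, PowerSeries.algebraMap_apply]
    rfl
  have h := (AlgebraicIndependent.sumElim_comp h1 h2).comp
    (![Sum.inl 0, Sum.inr 0] : Fin 2 → Fin 1 ⊕ Fin 1) (by decide)
  have e : (Sum.elim ![algebraMap K⟦X⟧ K⸨X⸩ PowerSeries.X] (algebraMap K K⸨X⸩ ∘ ![y]))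
      ∘ (![Sum.inl 0, Sum.inr 0] : Fin 2 → Fin 1 ⊕ Fin 1)
      = ![algebraMap K⟦X⟧ K⸨X⸩ PowerSeries.X, algebraMap K K⸨X⸩ y] := by
    funext i
    fin_cases i <;> rfl
  rw [e] at h
  obtain ⟨Ψ, hΨ0, hΨ1⟩ := FunctionField2.exists_algHom h
  refine ⟨Ψ, ⟨PowerSeries.X, hΨ0.symm, by simp, by simp⟩, ⟨PowerSeries.C y, ?_, by simp, by simp⟩⟩
  rw [hΨ1, HahnSeries.algebraMap_apply' ℤ y, PowerSeries.algebraMap_apply,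
    LaurentSeries.coe_algebraMap]
  rfl

end Embedding

namespace HasJet

open scoped PowerSeries LaurentSeries

variable {L K : Type*} [Field L] [Algebra ℂ L] [Field K] [Algebra ℂ K] {Ψ : L →ₐ[ℂ] K⸨X⸩}
  {z z' : L} {c d c' d' : K}

theorem one : HasJet Ψ 1 1 0 := (const 1).congr (map_one _) (map_one _) rfl

theorem ofNat (n : ℕ) [n.AtLeastTwo] : HasJet Ψ (OfNat.ofNat n) (OfNat.ofNat n) 0 :=
  (const (OfNat.ofNat n)).congr (map_ofNat _ n) (map_ofNat _ n) rfl

theorem sq (h : HasJet Ψ z c d) : HasJet Ψ (z ^ 2) (c ^ 2) (2 * c * d) :=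
  (h.mul h).congr (by ring) (by ring) (by ring)

theorem unique (h : HasJet Ψ z c d) (h' : HasJet Ψ z c' d') : c = c' ∧ d = d' := by
  obtain ⟨p, h1, rfl, rfl⟩ := h
  obtain ⟨p', h1', rfl, rfl⟩ := h'
  rw [← h1'] at h1
  rw [IsFractionRing.injective K⟦X⟧ K⸨X⸩ h1]
  exact ⟨rfl, rfl⟩

theorem ne_zero_of_deriv (h : HasJet Ψ z c d) (hd : d ≠ 0) : z ≠ 0 := by
  rintro rfl
  exact hd (h.unique ((const 0).congr (map_zero _) (map_zero _) rfl)).2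

theorem aeval (h : HasJet Ψ z c 0) (p : ℂ[X]) : HasJet Ψ (aeval z p) (aeval c p) 0 := by
  induction p using Polynomial.induction_on' with
  | add p q hp hq => exact (hp.add hq).congr (map_add _ _ _).symm (map_add _ _ _).symm (add_zero 0)
  | monomial n a =>
    rw [aeval_monomial, aeval_monomial]
    have hn : HasJet Ψ (z ^ n) (c ^ n) 0 := by
      induction n with
      | zero => exact one.congr (pow_zero z).symm (pow_zero c).symm rfl
      | succ n ih => exact (ih.mul h).congr (pow_succ z n).symm (pow_succ c n).symm (by simp)
    exact ((const a).mul hn).congr rfl rfl (by simp)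

end HasJet

open scoped LaurentSeries in
/-- If modulo `f` every element of the ring is a rational function of `x`, whose residue is
transcendental, then the elements with residue zero are in every prime ideal that contains `f`. -/
theorem mem_of_hasJet_zero {L K : Type*} [Field L] [Algebra ℂ L] [Field K] [Algebra ℂ K]
    {Ψ : L →ₐ[ℂ] K⸨X⸩} {a b : L} (hA : ∀ z ∈ Algebra.adjoin ℂ {a, b}, ∃ c, HasJet Ψ z c 0)
    {P : Ideal (Algebra.adjoin ℂ {a, b})} (hP : P.IsPrime) {f x : Algebra.adjoin ℂ {a, b}} {τ : K}
    (hf : HasJet Ψ (f : L) 0 0) (hfP : f ∈ P) (hx : HasJet Ψ (x : L) τ 0) (hτ : Transcendental ℂ τ)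
    (hab : ∀ y : Algebra.adjoin ℂ {a, b}, (y : L) = a ∨ (y : L) = b →
      ∃ p q : ℂ[X], aeval x q ∉ P ∧ f ∣ aeval x q * y - aeval x p)
    (z : Algebra.adjoin ℂ {a, b}) (d : K) (hz : HasJet Ψ (z : L) 0 d) : z ∈ P := by
  have key : ∀ z (hz : z ∈ Algebra.adjoin ℂ {a, b}),
      ∃ p q : ℂ[X], aeval x q ∉ P ∧ f ∣ aeval x q * ⟨z, hz⟩ - aeval x p := fun z hz => by
    induction hz using Algebra.adjoin_induction with
    | mem y hy => exact hab ⟨y, _⟩ hy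
    | algebraMap r =>
      refine ⟨C r, 1, by simpa using hP.one_notMem, ?_⟩
      rw [map_one, one_mul, aeval_C]
      exact ⟨0, by rw [mul_zero, sub_eq_zero]; rfl⟩
    | add y y' hy hy' h h' =>
      obtain ⟨p, q, h1, g, h2⟩ := h
      obtain ⟨p', q', h1', g', h2'⟩ := h'
      refine ⟨q' * p + q * p', q * q', ?_, aeval x q' * g + aeval x q * g', ?_⟩
      · rw [map_mul]
        exact fun h => (hP.mem_or_mem h).elim h1 h1'
      · rw [show (⟨y + y', _⟩ : Algebra.adjoin ℂ {a, b}) = ⟨y, hy⟩ + ⟨y', hy'⟩ from rfl, map_mul,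
          map_add, map_mul, map_mul]
        linear_combination aeval x q' * h2 + aeval x q * h2'
    | mul y y' hy hy' h h' =>
      obtain ⟨p, q, h1, g, h2⟩ := h
      obtain ⟨p', q', h1', g', h2'⟩ := h'
      refine ⟨p * p', q * q', ?_, aeval x q' * ⟨y', hy'⟩ * g + aeval x p * g', ?_⟩
      · rw [map_mul]
        exact fun h => (hP.mem_or_mem h).elim h1 h1'
      · rw [show (⟨y * y', _⟩ : Algebra.adjoin ℂ {a, b}) = ⟨y, hy⟩ * ⟨y', hy'⟩ from rfl, map_mul,
          map_mul]
        linear_combination aeval x q' * ⟨y', hy'⟩ * h2 + aeval x p * h2'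
  obtain ⟨p, q, h1, g, h2⟩ := key z z.2
  rw [sub_eq_iff_eq_add] at h2
  have h3 : aeval (x : L) q * (z : L) = (f : L) * (g : L) + aeval (x : L) p := by
    have := congrArg (Algebra.adjoin ℂ {a, b}).val h2
    rw [map_mul, map_add, map_mul, ← aeval_algHom_apply, ← aeval_algHom_apply] at this
    exact this
  obtain ⟨c, hc⟩ := hA g g.2
  have h4 := ((hx.aeval q).mul hz).unique (((hf.mul hc).add (hx.aeval p)).congr h3.symm rfl rfl)
  have hp : p = 0 := by
    by_contra hp
    exact hτ ⟨p, hp, by simpa using h4.1.symm⟩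
  rw [hp, map_zero, add_zero] at h2
  exact (hP.mem_or_mem (h2 ▸ P.mul_mem_right g hfP : aeval x q * z ∈ P)).resolve_left h1

/-! ### One-jets along the branch curves -/

/-- The symmetric form of the parametrization: up to an affine map the points 0, 1, t₁, t₂ are
1/M₀², 1/M₁², 1/M₂², 1/M₃². With x - c = τ² and P proportional to τ³ on the fibre, the four values
of τ are the roots of a quartic without linear term, so the sum of their inverses is zero; this is
the condition ΣMᵢ = 0. -/
theorem RegularParameter.of_sum_eq_zero {F : Type*} [Field F] [CharZero F] {M₀ M₁ M₂ M₃ : F}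
    (hM : M₀ + M₁ + M₂ + M₃ = 0) (h1 : M₁ ≠ 0) (h2 : M₂ ≠ 0) (h3 : M₃ ≠ 0)
    (hm : M₀ - M₁ ≠ 0) (hp : M₀ + M₁ ≠ 0) :
    RegularParameter (M₀ / M₁) ((M₂ - M₃) / (M₀ - M₁)) ∧
    tOne (M₀ / M₁) ((M₂ - M₃) / (M₀ - M₁))
      = M₁ ^ 2 * (M₀ ^ 2 - M₂ ^ 2) / (M₂ ^ 2 * (M₀ ^ 2 - M₁ ^ 2)) ∧
    tTwo (M₀ / M₁) ((M₂ - M₃) / (M₀ - M₁))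
      = M₁ ^ 2 * (M₀ ^ 2 - M₃ ^ 2) / (M₃ ^ 2 * (M₀ ^ 2 - M₁ ^ 2)) ∧
    coeffA0 (M₀ / M₁) ((M₂ - M₃) / (M₀ - M₁))
      = (M₂ * M₃ - M₀ * M₁) * M₁ ^ 3 / (M₂ * M₃ * (M₀ + M₁) * (M₀ - M₁) ^ 2) ∧
    2 * (M₀ / M₁) / (M₀ / M₁ * ((M₂ - M₃) / (M₀ - M₁)) - (M₂ - M₃) / (M₀ - M₁) - 1 - M₀ / M₁)
      = M₀ / M₂ := by
  have two : (2 : F) ≠ 0 := by norm_num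
  have em : M₀ / M₁ - 1 = (M₀ - M₁) / M₁ := by field_simp
  have ep : M₀ / M₁ + 1 = (M₀ + M₁) / M₁ := by field_simp
  have ey : M₀ / M₁ * ((M₂ - M₃) / (M₀ - M₁)) - (M₂ - M₃) / (M₀ - M₁) - 1 - M₀ / M₁
      = 2 * M₂ / M₁ := by
    field_simp
    linear_combination -hM
  have ey' : M₀ / M₁ * ((M₂ - M₃) / (M₀ - M₁)) - (M₂ - M₃) / (M₀ - M₁) + M₀ / M₁ + 1
      = -(2 * M₃) / M₁ := by
    field_simp
    linear_combination hM
  have hr : RegularParameter (M₀ / M₁) ((M₂ - M₃) / (M₀ - M₁)) := by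
    refine ⟨?_, ?_, ?_, ?_⟩
    · rw [em]; exact div_ne_zero hm h1
    · rw [ep]; exact div_ne_zero hp h1
    · rw [ey]; exact div_ne_zero (mul_ne_zero two h2) h1
    · rw [ey']; exact div_ne_zero (neg_ne_zero.2 (mul_ne_zero two h3)) h1
  have es : M₀ ^ 2 - M₁ ^ 2 = (M₀ - M₁) * (M₀ + M₁) := by ring
  refine ⟨hr, ?_, ?_, ?_, ?_⟩
  · rw [hr.tOne_eq, ey, es, show (M₀ / M₁) ^ 2 - 1 = (M₀ - M₁) * (M₀ + M₁) / M₁ ^ 2 by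
      field_simp; ring]
    field_simp
  · rw [hr.tTwo_eq, ey', es, show (M₀ / M₁) ^ 2 - 1 = (M₀ - M₁) * (M₀ + M₁) / M₁ ^ 2 by
      field_simp; ring]
    field_simp
  · rw [RegularParameter.coeffA0_eq, ey, ey', ep,
      show ((M₂ - M₃) / (M₀ - M₁)) ^ 2 - 1 = 4 * (M₀ * M₁ - M₂ * M₃) / (M₀ - M₁) ^ 2 by
        field_simp
        linear_combination (M₂ + M₃ - M₀ - M₁) * hM]
    field_simp
    ring
  · rw [ey]
    field_simp

/-- An element algebraic over ℂ is a constant, so only constants have to be excluded. For each of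
them a polynomial relation on y suffices. -/
theorem transcendental_of_forall_eq_algebraMap {K : Type*} [Field K] [Algebra ℂ K] {y c : K}
    (hy : Transcendental ℂ y) (h : ∀ k : ℂ, c = algebraMap ℂ K k → ∃ p : ℂ[X], p ≠ 0 ∧ aeval y p = 0) :
    Transcendental ℂ c := by
  intro hc
  have hi : IsIntegral ℂ c := hc.isIntegral
  obtain ⟨k, hk⟩ := minpoly.mem_range_of_degree_eq_one ℂ c
    (IsAlgClosed.degree_eq_one_of_irreducible ℂ (minpoly.irreducible hi))
  obtain ⟨p, hp⟩ := h k hk.symm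
  exact hy ⟨p, hp⟩

theorem Transcendental.add_algebraMap_ne_zero {K : Type*} [Field K] [Algebra ℂ K] {y : K}
    (hy : Transcendental ℂ y) (k : ℂ) : y + algebraMap ℂ K k ≠ 0 := by
  intro e
  rw [eq_neg_of_add_eq_zero_left e, ← map_neg] at hy
  exact hy (isAlgebraic_algebraMap _)

namespace HasJet

open scoped LaurentSeries

variable {L K : Type*} [Field L] [Algebra ℂ L] [Field K] [Algebra ℂ K] {Ψ : L →ₐ[ℂ] K⸨X⸩}
  {x z : L} {c d : K}

theorem uniformizer_mul (hx : HasJet Ψ x 0 1) (h : HasJet Ψ z c d) : HasJet Ψ (x * z) 0 c :=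
  (hx.mul h).congr rfl (by simp) (by simp)

theorem uniformizer_sq_mul (hx : HasJet Ψ x 0 1) (h : HasJet Ψ z c d) : HasJet Ψ (x ^ 2 * z) 0 0 :=
  (hx.uniformizer_mul (hx.uniformizer_mul h)).congr (by ring) rfl rfl

end HasJet

open scoped LaurentSeries in
/-- The functions `a` and `b` have no terms of order one and `β` has a simple zero. -/
structure RamifiedJet {L K : Type*} [Field L] [Algebra ℂ L] [Field K] [Algebra ℂ K]
    (Ψ : L →ₐ[ℂ] K⸨X⸩) (a b β : L) (a' b' : K) : Prop where
  left : HasJet Ψ a a' 0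
  right : HasJet Ψ b b' 0
  simple : ∃ d, d ≠ 0 ∧ HasJet Ψ β 0 d

section BaseJets

open scoped LaurentSeries

variable {K : Type*} [Field K] [Algebra ℂ K] {Ψ : FunctionField2 ℂ →ₐ[ℂ] K⸨X⸩} {y' : K}
  (hx : HasJet Ψ (coord ℂ 0) 0 1) (hy : HasJet Ψ (coord ℂ 1) y' 0) (ht : Transcendental ℂ y')

include hx hy ht

/-- Take (M₀, M₁, M₂, M₃) = (1, x, -1 - x - yx, yx). As x → 0 the values 1/M₁² and 1/M₃² grow like
x⁻², so after normalization 0 and t₁ collide. Then t₁ has a double zero, t₂ is y⁻² up to O(x²), and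
the cube root has a simple zero. -/
theorem exists_ramifiedJet_zero : ∃ s t : FunctionField2 ℂ, IntermediateField.adjoin ℂ {s, t} = ⊤ ∧
    ∃ c, Transcendental ℂ c ∧
      RamifiedJet Ψ (tOne s t) (tTwo s t) (coeffA0 s t * 1 * s ^ 2) 0 c := by
  have : CharZero K := charZero_of_injective_algebraMap (algebraMap ℂ K).injective
  have hy0 : y' ≠ 0 := by simpa using ht.add_algebraMap_ne_zero 0
  have hy1 : y' + 1 ≠ 0 := by simpa using ht.add_algebraMap_ne_zero 1
  have htop := FunctionField2.adjoin_coord ℂ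
  generalize coord ℂ 0 = x at *
  generalize coord ℂ 1 = y at *
  obtain ⟨M, eM⟩ : ∃ M, M = -1 - x - y * x := ⟨_, rfl⟩
  have hM : HasJet Ψ M (-1) (-1 - y') :=
    ((HasJet.one.neg.sub hx).sub (hy.mul hx)).congr eM.symm (by ring) (by ring)
  have hm : HasJet Ψ (1 - x) 1 (-1) := (HasJet.one.sub hx).congr rfl (by ring) (by ring)
  have hp : HasJet Ψ (1 + x) 1 1 := (HasJet.one.add hx).congr rfl (by ring) (by ring)
  have hs : HasJet Ψ (1 - x ^ 2) 1 0 := (HasJet.one.sub hx.sq).congr rfl (by ring) (by ring)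
  have x0 := hx.ne_zero_of_deriv one_ne_zero
  have y0 := hy.ne_zero hy0
  have M0 := hM.ne_zero (neg_ne_zero.2 one_ne_zero)
  have m0 := hm.ne_zero one_ne_zero
  have p0 := hp.ne_zero one_ne_zero
  have s0 := hs.ne_zero one_ne_zero
  obtain ⟨hr, e1, e2, e3, -⟩ := RegularParameter.of_sum_eq_zero (M₀ := 1) (M₁ := x) (M₂ := M)
    (M₃ := y * x) (by rw [eM]; ring) x0 M0 (mul_ne_zero y0 x0) m0 p0
  refine ⟨1 / x, (M - y * x) / (1 - x), ?_, (y' ^ 2)⁻¹, ?_, ⟨?_, ?_, ?_⟩⟩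
  · rw [eq_top_iff, ← htop, IntermediateField.adjoin_le_iff]
    set E := IntermediateField.adjoin ℂ {1 / x, (M - y * x) / (1 - x)}
    have k1 : 1 / x ∈ E := IntermediateField.subset_adjoin _ _ (Or.inl rfl)
    have k2 : (M - y * x) / (1 - x) ∈ E := IntermediateField.subset_adjoin _ _ (Or.inr rfl)
    have hxE : x ∈ E := by
      rw [one_div] at k1
      simpa using inv_mem k1
    have hyE : y ∈ E := by
      have : y = (-1 - x - (M - y * x) / (1 - x) * (1 - x)) / (2 * x) := by
        rw [div_mul_cancel₀ _ m0, eM]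
        field_simp
        ring
      rw [this]
      exact div_mem (sub_mem (sub_mem (neg_mem (one_mem E)) hxE) (mul_mem k2 (sub_mem (one_mem E) hxE)))
        (mul_mem (ofNat_mem E 2) hxE)
    rintro z (rfl | rfl)
    exacts [hxE, hyE]
  · refine transcendental_of_forall_eq_algebraMap ht fun k hk => ⟨C k * X ^ 2 - 1, fun e => ?_, ?_⟩
    · have := congrArg (eval 0) e
      simp at this
    · rw [map_sub, map_mul, aeval_C, map_pow, aeval_X, map_one, ← hk]
      field_simp
      ring
  · have hG := (HasJet.one.sub hM.sq).mul ((hM.sq.mul hs).inv (by simp))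
    refine (hx.uniformizer_sq_mul hG).congr ?_ rfl rfl
    rw [e1]
    field_simp
  · refine (((HasJet.one.sub (hy.sq.mul hx.sq)).mul ((hy.sq.mul hs).inv (by simp [hy0])))).congr ?_
      (by simp) (by simp)
    rw [e2, one_pow]
    field_simp
  · have hG := ((hM.mul hy).sub HasJet.one).mul (((hM.mul hy).mul (hp.mul hm.sq)).inv (by simp [hy0]))
    refine ⟨_, ?_, (hx.uniformizer_mul hG).congr ?_ rfl rfl⟩
    · refine mul_ne_zero ?_ (inv_ne_zero (by simp [hy0]))
      rw [show -1 * y' - 1 = -(y' + 1) by ring]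
      exact neg_ne_zero.2 hy1
    · rw [e3]
      field_simp

/-- Take (M₀, M₁, M₂, M₃) = (x, 1, -1 - x - yx, yx). Now 1/M₀² and 1/M₃² grow, so after
normalization 1 and t₁ collide. -/
theorem exists_ramifiedJet_one : ∃ s t : FunctionField2 ℂ, IntermediateField.adjoin ℂ {s, t} = ⊤ ∧
    ∃ c, Transcendental ℂ c ∧
      RamifiedJet Ψ (tOne s t) (tTwo s t) (coeffA0 s t * s * 1 ^ 2) 1 c := by
  have : CharZero K := charZero_of_injective_algebraMap (algebraMap ℂ K).injective
  have hy0 : y' ≠ 0 := by simpa using ht.add_algebraMap_ne_zero 0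
  have hy1 : y' + 1 ≠ 0 := by simpa using ht.add_algebraMap_ne_zero 1
  have htop := FunctionField2.adjoin_coord ℂ
  generalize coord ℂ 0 = x at *
  generalize coord ℂ 1 = y at *
  obtain ⟨M, eM⟩ : ∃ M, M = -1 - x - y * x := ⟨_, rfl⟩
  have hM : HasJet Ψ M (-1) (-1 - y') :=
    ((HasJet.one.neg.sub hx).sub (hy.mul hx)).congr eM.symm (by ring) (by ring)
  have hm : HasJet Ψ (x - 1) (-1) 1 := (hx.sub HasJet.one).congr rfl (by ring) (by ring)
  have hp : HasJet Ψ (x + 1) 1 1 := (hx.add HasJet.one).congr rfl (by ring) (by ring)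
  have hs : HasJet Ψ (x ^ 2 - 1) (-1) 0 := (hx.sq.sub HasJet.one).congr rfl (by ring) (by ring)
  have x0 := hx.ne_zero_of_deriv one_ne_zero
  have y0 := hy.ne_zero hy0
  have M0 := hM.ne_zero (neg_ne_zero.2 one_ne_zero)
  have m0 := hm.ne_zero (neg_ne_zero.2 one_ne_zero)
  have p0 := hp.ne_zero one_ne_zero
  have s0 := hs.ne_zero (neg_ne_zero.2 one_ne_zero)
  obtain ⟨hr, e1, e2, e3, -⟩ := RegularParameter.of_sum_eq_zero (M₀ := x) (M₁ := 1) (M₂ := M)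
    (M₃ := y * x) (by rw [eM]; ring) one_ne_zero M0 (mul_ne_zero y0 x0) m0 p0
  refine ⟨x / 1, (M - y * x) / (x - 1), ?_, (1 - y' ^ 2) * (-y' ^ 2)⁻¹, ?_, ⟨?_, ?_, ?_⟩⟩
  · rw [eq_top_iff, ← htop, IntermediateField.adjoin_le_iff]
    set E := IntermediateField.adjoin ℂ {x / 1, (M - y * x) / (x - 1)}
    have k1 : x / 1 ∈ E := IntermediateField.subset_adjoin _ _ (Or.inl rfl)
    have k2 : (M - y * x) / (x - 1) ∈ E := IntermediateField.subset_adjoin _ _ (Or.inr rfl)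
    have hxE : x ∈ E := by simpa using k1
    have hyE : y ∈ E := by
      have : y = (-1 - x - (M - y * x) / (x - 1) * (x - 1)) / (2 * x) := by
        rw [div_mul_cancel₀ _ m0, eM]
        field_simp
        ring
      rw [this]
      exact div_mem (sub_mem (sub_mem (neg_mem (one_mem E)) hxE) (mul_mem k2 (sub_mem hxE (one_mem E))))
        (mul_mem (ofNat_mem E 2) hxE)
    rintro z (rfl | rfl)
    exacts [hxE, hyE]
  · refine transcendental_of_forall_eq_algebraMap ht fun k hk =>
      ⟨C k * X ^ 2 + 1 - X ^ 2, fun e => ?_, ?_⟩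
    · have := congrArg (eval 0) e
      simp at this
    · simp only [map_sub, map_add, map_mul, aeval_C, map_pow, aeval_X, map_one, ← hk]
      field_simp
      ring
  · refine ((hx.sq.sub hM.sq).mul ((hM.sq.mul hs).inv (by simp))).congr ?_ (by ring) (by ring)
    rw [e1]
    field_simp
  · refine (((HasJet.one.sub hy.sq).mul ((hy.sq.mul hs).inv (by simp [hy0])))).congr ?_
      (by simp) (by simp)
    rw [e2]
    field_simp
  · have hG := ((hM.mul hy).sub HasJet.one).mul (((hM.mul hy).mul (hp.mul hm.sq)).inv (by simp [hy0]))
    refine ⟨_, ?_, (hx.uniformizer_mul hG).congr ?_ rfl rfl⟩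
    · refine mul_ne_zero ?_ (inv_ne_zero (by simp [hy0]))
      rw [show -1 * y' - 1 = -(y' + 1) by ring]
      exact neg_ne_zero.2 hy1
    · rw [e3]
      field_simp

/-- Take (M₀, M₁, M₂, M₃) = (x, yx, 1, -1 - x - yx). Now 1/M₀² and 1/M₁² grow, so after
normalization t₁ and t₂ collide. -/
theorem exists_ramifiedJet_diagonal : ∃ s t : FunctionField2 ℂ,
    IntermediateField.adjoin ℂ {s, t} = ⊤ ∧ ∃ c, Transcendental ℂ c ∧
      RamifiedJet Ψ (tOne s t) (tTwo s t)
        (coeffA0 s t * (2 * s / (s * t - t - 1 - s)) * 1 ^ 2) c c := by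
  have : CharZero K := charZero_of_injective_algebraMap (algebraMap ℂ K).injective
  have hy0 : y' ≠ 0 := by simpa using ht.add_algebraMap_ne_zero 0
  have hy1 : 1 + y' ≠ 0 := by simpa [add_comm] using ht.add_algebraMap_ne_zero 1
  have hy2 : 1 - y' ≠ 0 := by
    have := ht.add_algebraMap_ne_zero (-1)
    rw [map_neg, map_one] at this
    intro e
    exact this (by linear_combination -e)
  have htop := FunctionField2.adjoin_coord ℂ
  generalize coord ℂ 0 = x at *
  generalize coord ℂ 1 = y at *
  obtain ⟨M, eM⟩ : ∃ M, M = -1 - x - y * x := ⟨_, rfl⟩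
  have hM : HasJet Ψ M (-1) (-1 - y') :=
    ((HasJet.one.neg.sub hx).sub (hy.mul hx)).congr eM.symm (by ring) (by ring)
  have hm : HasJet Ψ (1 - y) (1 - y') 0 := (HasJet.one.sub hy).congr rfl rfl (by ring)
  have hp : HasJet Ψ (1 + y) (1 + y') 0 := (HasJet.one.add hy).congr rfl rfl (by ring)
  have x0 := hx.ne_zero_of_deriv one_ne_zero
  have y0 := hy.ne_zero hy0
  have M0 := hM.ne_zero (neg_ne_zero.2 one_ne_zero)
  have m0 := hm.ne_zero hy2
  have p0 := hp.ne_zero hy1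
  have em : x - y * x = x * (1 - y) := by ring
  have ep : x + y * x = x * (1 + y) := by ring
  obtain ⟨hr, e1, e2, e3, e4⟩ := RegularParameter.of_sum_eq_zero (M₀ := x) (M₁ := y * x) (M₂ := 1)
    (M₃ := M) (by rw [eM]; ring) (mul_ne_zero y0 x0) one_ne_zero M0
    (by rw [em]; exact mul_ne_zero x0 m0) (by rw [ep]; exact mul_ne_zero x0 p0)
  have es : x ^ 2 - (y * x) ^ 2 = x ^ 2 * ((1 - y) * (1 + y)) := by ring
  refine ⟨x / (y * x), (1 - M) / (x - y * x), ?_, -y' ^ 2 * ((1 - y') * (1 + y'))⁻¹, ?_,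
    ⟨?_, ?_, ?_⟩⟩
  · rw [eq_top_iff, ← htop, IntermediateField.adjoin_le_iff]
    set E := IntermediateField.adjoin ℂ {x / (y * x), (1 - M) / (x - y * x)}
    have k1 : x / (y * x) ∈ E := IntermediateField.subset_adjoin _ _ (Or.inl rfl)
    have k2 : (1 - M) / (x - y * x) ∈ E := IntermediateField.subset_adjoin _ _ (Or.inr rfl)
    have hyE : y ∈ E := by
      have : y = (x / (y * x))⁻¹ := by field_simp
      rw [this]
      exact inv_mem k1
    have hxE : x ∈ E := by
      have h2 : ((1 - M) / (x - y * x) * (1 - y) - (1 + y)) * x = 2 := by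
        rw [em, eM]
        field_simp
        ring
      rw [eq_div_of_mul_eq (left_ne_zero_of_mul (h2 ▸ two_ne_zero)) ((mul_comm _ _).trans h2)]
      exact div_mem (ofNat_mem E 2) (sub_mem (mul_mem k2 (sub_mem (one_mem E) hyE))
        (add_mem (one_mem E) hyE))
    rintro z (rfl | rfl)
    exacts [hxE, hyE]
  · refine transcendental_of_forall_eq_algebraMap ht fun k hk =>
      ⟨C k * (1 - X ^ 2) + X ^ 2, fun e => ?_, ?_⟩
    · have := congrArg (eval 1) e
      simp at this
    · simp only [map_sub, map_add, map_mul, aeval_C, map_pow, aeval_X, map_one, ← hk]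
      field_simp
      ring
  · refine ((hy.sq.mul (hx.sq.sub HasJet.one)).mul
      ((hm.mul hp).inv (mul_ne_zero hy2 hy1))).congr ?_ (by ring) (by ring)
    rw [e1, es]
    field_simp
  · have hG := (hx.uniformizer_sq_mul (hM.sq.inv (by simp))).sub HasJet.one
    refine ((hy.sq.mul hG).mul ((hm.mul hp).inv (mul_ne_zero hy2 hy1))).congr ?_ (by ring) (by ring)
    rw [e2, es]
    field_simp
  · have hG := ((hM.sub (hy.mul hx.sq)).mul ((hy.sq).mul hy)).mul
      ((hM.mul (hp.mul hm.sq)).inv (by simp [hy1, hy2]))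
    refine ⟨_, ?_, (hx.uniformizer_mul hG).congr ?_ rfl rfl⟩
    · exact mul_ne_zero (mul_ne_zero (by simp) (mul_ne_zero (pow_ne_zero 2 hy0) hy0))
        (inv_ne_zero (by simp [hy1, hy2]))
    · rw [e3, e4, em, ep]
      field_simp

/-- Take M₂ = 3x, so that t₁ has a double pole. The linear terms of the other two entries N and M
are chosen to make their sum with 3 and 3x zero and to remove the first order term of t₂. -/
theorem exists_ramifiedJet_infty : ∃ s t : FunctionField2 ℂ,
    IntermediateField.adjoin ℂ {s, t} = ⊤ ∧ ∃ c, Transcendental ℂ c ∧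
      RamifiedJet Ψ (tOne s t)⁻¹ (tTwo s t)
        ((tOne s t)⁻¹ ^ 2 * (coeffA0 s t * 1 * (2 * s / (s * t - t - 1 - s)) ^ 2)) 0 c := by
  have : CharZero K := charZero_of_injective_algebraMap (algebraMap ℂ K).injective
  have three : (3 : K) ≠ 0 := by norm_num
  have hy0 : y' ≠ 0 := by simpa using ht.add_algebraMap_ne_zero 0
  have hy1 : 1 + y' ≠ 0 := by simpa [add_comm] using ht.add_algebraMap_ne_zero 1
  have hy2 : 1 - y' ≠ 0 := by
    have := ht.add_algebraMap_ne_zero (-1)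
    rw [map_neg, map_one] at this
    intro e
    exact this (by linear_combination -e)
  have htop := FunctionField2.adjoin_coord ℂ
  generalize coord ℂ 0 = x at *
  generalize coord ℂ 1 = y at *
  obtain ⟨N, eN⟩ : ∃ N, N = 3 * y + (y - 1) * x := ⟨_, rfl⟩
  obtain ⟨M, eM⟩ : ∃ M, M = -3 - 3 * y - (y + 2) * x := ⟨_, rfl⟩
  have hN : HasJet Ψ N (3 * y') (y' - 1) :=
    (((HasJet.ofNat 3).mul hy).add ((hy.sub HasJet.one).mul hx)).congr eN.symm (by ring) (by ring)
  have hM : HasJet Ψ M (-(3 * (1 + y'))) (-(y' + 2)) :=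
    (((HasJet.ofNat 3).neg.sub ((HasJet.ofNat 3).mul hy)).sub ((hy.add (HasJet.ofNat 2)).mul hx)).congr
      eM.symm (by ring) (by ring)
  have hm : HasJet Ψ (3 - N) (3 * (1 - y')) (1 - y') :=
    ((HasJet.ofNat 3).sub hN).congr rfl (by ring) (by ring)
  have hp : HasJet Ψ (3 + N) (3 * (1 + y')) (y' - 1) :=
    ((HasJet.ofNat 3).add hN).congr rfl (by ring) (by ring)
  have hs : HasJet Ψ (1 - x ^ 2) 1 0 := (HasJet.one.sub hx.sq).congr rfl (by ring) (by ring)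
  have h3x : HasJet Ψ (3 + x) 3 1 := ((HasJet.ofNat 3).add hx).congr rfl (by ring) (by ring)
  have M' : -(3 * (1 + y')) ≠ 0 := neg_ne_zero.2 (mul_ne_zero three hy1)
  have N' : 3 * y' ≠ 0 := mul_ne_zero three hy0
  have m' : 3 * (1 - y') ≠ 0 := mul_ne_zero three hy2
  have p' : 3 * (1 + y') ≠ 0 := mul_ne_zero three hy1
  have x0 := hx.ne_zero_of_deriv one_ne_zero
  have M0 := hM.ne_zero M'
  have N0 := hN.ne_zero N'
  have m0 := hm.ne_zero m'
  have p0 := hp.ne_zero p'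
  have s0 := hs.ne_zero one_ne_zero
  have x3 := h3x.ne_zero three
  have three' : (3 : FunctionField2 ℂ) ≠ 0 := by norm_num
  obtain ⟨hr, e1, e2, e3, e4⟩ := RegularParameter.of_sum_eq_zero (M₀ := 3) (M₁ := N) (M₂ := 3 * x)
    (M₃ := M) (by rw [eM, eN]; ring) N0 (mul_ne_zero three' x0) M0 m0 p0
  have es : 3 ^ 2 - N ^ 2 = (3 - N) * (3 + N) := by ring
  have es' : 3 ^ 2 - (3 * x) ^ 2 = 3 ^ 2 * (1 - x ^ 2) := by ring
  have ei : (tOne (3 / N) ((3 * x - M) / (3 - N)))⁻¹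
      = x ^ 2 * ((3 - N) * (3 + N) * (N ^ 2 * (1 - x ^ 2))⁻¹) := by
    rw [e1, es, es']
    field_simp
  refine ⟨3 / N, (3 * x - M) / (3 - N), ?_, -(y' ^ 3 * (y' + 2)) * ((1 + y') ^ 3 * (1 - y'))⁻¹, ?_,
    ⟨?_, ?_, ?_⟩⟩
  · rw [eq_top_iff, ← htop, IntermediateField.adjoin_le_iff]
    set E := IntermediateField.adjoin ℂ {3 / N, (3 * x - M) / (3 - N)}
    have k1 : 3 / N ∈ E := IntermediateField.subset_adjoin _ _ (Or.inl rfl)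
    have k2 : (3 * x - M) / (3 - N) ∈ E := IntermediateField.subset_adjoin _ _ (Or.inr rfl)
    have hNE : N ∈ E := by
      have : N = 3 / (3 / N) := by field_simp
      rw [this]
      exact div_mem (ofNat_mem E 3) k1
    have hxE : x ∈ E := by
      have : x = ((3 * x - M) / (3 - N) * (3 - N) - 3 - N) / 6 := by
        rw [div_mul_cancel₀ _ m0, eM, eN]
        ring
      rw [this]
      exact div_mem (sub_mem (sub_mem (mul_mem k2 (sub_mem (ofNat_mem E 3) hNE)) (ofNat_mem E 3)) hNE)
        (ofNat_mem E 6)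
    have hyE : y ∈ E := by
      have : y = (N + x) / (3 + x) := by
        rw [eq_div_iff x3, eN]
        ring
      rw [this]
      exact div_mem (add_mem hNE hxE) (add_mem (ofNat_mem E 3) hxE)
    rintro z (rfl | rfl)
    exacts [hxE, hyE]
  · refine transcendental_of_forall_eq_algebraMap ht fun k hk =>
      ⟨C k * ((1 + X) ^ 3 * (1 - X)) + X ^ 3 * (X + 2), fun e => ?_, ?_⟩
    · have := congrArg (eval (-1)) e
      norm_num at this
    · simp only [map_sub, map_add, map_mul, aeval_C, map_pow, aeval_X, map_one, map_ofNat, ← hk]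
      field_simp
      ring
  · rw [ei]
    exact hx.uniformizer_sq_mul ((hm.mul hp).mul ((hN.sq.mul hs).inv (by simp [hy0])))
  · rw [e2, es, div_eq_mul_inv]
    refine ((hN.sq.mul ((HasJet.ofNat 3).sq.sub hM.sq)).mul ((hM.sq.mul (hm.mul hp)).inv ?_)).congr
      rfl ?_ ?_
    · exact mul_ne_zero (pow_ne_zero 2 M') (mul_ne_zero m' p')
    · field_simp
      ring
    · field_simp
      ring
  · have hG := (((hx.mul hM).sub hN).mul hp).mul ((hM.mul (hN.mul hs.sq)).inv (by simp [hy0, hy1]))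
    refine ⟨_, ?_, (hx.uniformizer_mul hG).congr ?_ rfl rfl⟩
    · exact mul_ne_zero (mul_ne_zero (by simp [hy0]) p') (inv_ne_zero (by simp [hy0, hy1]))
    · rw [ei, e3, e4]
      field_simp

end BaseJets

/-! ### The branch locus -/

namespace RamifiedJet

open scoped LaurentSeries

variable {L L' K : Type*} [Field L] [Algebra ℂ L] [Field L'] [Algebra ℂ L'] [Field K] [Algebra ℂ K]
  {Ψ : L →ₐ[ℂ] K⸨X⸩} {a b β w : L} {a' b' w' : K}

theorem comp {σ : L' →ₐ[ℂ] L} {a b β : L'} (h : RamifiedJet Ψ (σ a) (σ b) (σ β) a' b') :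
    RamifiedJet (Ψ.comp σ) a b β a' b' :=
  ⟨h.left, h.right, h.simple⟩

theorem symm (h : RamifiedJet Ψ a b β a' b') : RamifiedJet Ψ b a β b' a' :=
  ⟨h.right, h.left, h.simple⟩

theorem inv_left (h : RamifiedJet Ψ a b β a' b') (ha : a' ≠ 0) : RamifiedJet Ψ a⁻¹ b β a'⁻¹ b' :=
  ⟨(h.left.inv ha).congr rfl rfl (by simp), h.right, h.simple⟩

theorem inv_right (h : RamifiedJet Ψ a b β a' b') (hb : b' ≠ 0) : RamifiedJet Ψ a b⁻¹ β a' b'⁻¹ :=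
  (h.symm.inv_left hb).symm

theorem scale (h : RamifiedJet Ψ a b β a' b') (hw : HasJet Ψ w w' 0) (hw' : w' ≠ 0) :
    RamifiedJet Ψ a b (w ^ 2 * β) a' b' := by
  obtain ⟨d, hd, hj⟩ := h.simple
  exact ⟨h.left, h.right, _, mul_ne_zero (pow_ne_zero 2 hw') hd,
    (hw.sq.mul hj).congr rfl (by ring) (by ring)⟩

theorem scale_left (h : RamifiedJet Ψ a b β a' b') (ha : a' ≠ 0) :
    RamifiedJet Ψ a b (a ^ 2 * β) a' b' := h.scale h.left ha

theorem scale_right (h : RamifiedJet Ψ a b β a' b') (hb : b' ≠ 0) :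
    RamifiedJet Ψ a b (b ^ 2 * β) a' b' := h.scale h.right hb

theorem scale_mul (h : RamifiedJet Ψ a b β a' b') (ha : a' ≠ 0) (hb : b' ≠ 0) :
    RamifiedJet Ψ a b ((a * b) ^ 2 * β) a' b' :=
  h.scale ((h.left.mul h.right).congr rfl rfl (by simp)) (mul_ne_zero ha hb)

section Criterion

variable {P : Ideal (Algebra.adjoin ℂ {a, b})} (h : RamifiedJet Ψ a b β a' b')
  (hi : IsIntegral (Algebra.adjoin ℂ {a, b}) β) (hP : P.IsPrime) {f : Algebra.adjoin ℂ {a, b}}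
  (hf : f ∈ P)

include h hi hP hf

theorem not_isUnramifiedOver {x : Algebra.adjoin ℂ {a, b}} {τ : K} (hf0 : HasJet Ψ (f : L) 0 0)
    (hx : HasJet Ψ (x : L) τ 0) (hτ : Transcendental ℂ τ)
    (hab : ∀ y : Algebra.adjoin ℂ {a, b}, (y : L) = a ∨ (y : L) = b →
      ∃ p q : ℂ[X], aeval x q ∉ P ∧ f ∣ aeval x q * y - aeval x p) :
    ¬ IsUnramifiedOver (Algebra.adjoin ℂ {a, b}) P := by
  have hA := fun z (hz : z ∈ Algebra.adjoin ℂ {a, b}) => exists_hasJet_of_mem_adjoin Ψ h.left h.right hz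
  obtain ⟨d, hd, hj⟩ := h.simple
  exact not_isUnramifiedOver_of_hasJet Ψ hA hj hd hi P
    (mem_of_hasJet_zero hA hP hf0 hf hx hτ hab)

/-- Modulo f the function a is the constant k, so every element of the ring is a polynomial in b,
whose residue is transcendental. The variants below differ only in the curve f = 0. -/
theorem not_isUnramifiedOver_left (hb : Transcendental ℂ b') (k : ℂ) (hk : algebraMap ℂ K k = a')
    (hfa : (f : L) = a - algebraMap ℂ L k) : ¬ IsUnramifiedOver (Algebra.adjoin ℂ {a, b}) P := by
  refine h.not_isUnramifiedOver hi hP hf (x := ⟨b, Algebra.subset_adjoin (Or.inr rfl)⟩)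
    ((h.left.sub (HasJet.const k)).congr hfa.symm (by rw [hk, sub_self]) (sub_zero 0)) h.right hb ?_
  rintro y (hy | hy)
  · refine ⟨C k, 1, by simpa using hP.one_notMem, 1, Subtype.ext ?_⟩
    rw [map_one, one_mul, aeval_C, mul_one, hfa]
    exact congrArg (· - algebraMap ℂ L k) hy
  · refine ⟨X, 1, by simpa using hP.one_notMem, 0, Subtype.ext ?_⟩
    rw [map_one, one_mul, aeval_X, mul_zero, sub_eq_zero.2 (Subtype.ext hy)]

theorem not_isUnramifiedOver_right (ha : Transcendental ℂ a') (k : ℂ) (hk : algebraMap ℂ K k = b')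
    (hfb : (f : L) = b - algebraMap ℂ L k) : ¬ IsUnramifiedOver (Algebra.adjoin ℂ {a, b}) P := by
  refine h.not_isUnramifiedOver hi hP hf (x := ⟨a, Algebra.subset_adjoin (Or.inl rfl)⟩)
    ((h.right.sub (HasJet.const k)).congr hfb.symm (by rw [hk, sub_self]) (sub_zero 0)) h.left ha ?_
  rintro y (hy | hy)
  · refine ⟨X, 1, by simpa using hP.one_notMem, 0, Subtype.ext ?_⟩
    rw [map_one, one_mul, aeval_X, mul_zero, sub_eq_zero.2 (Subtype.ext hy)]
  · refine ⟨C k, 1, by simpa using hP.one_notMem, 1, Subtype.ext ?_⟩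
    rw [map_one, one_mul, aeval_C, mul_one, hfb]
    exact congrArg (· - algebraMap ℂ L k) hy

theorem not_isUnramifiedOver_diagonal (ha : Transcendental ℂ a') (hab : a' = b')
    (hfa : (f : L) = a - b) : ¬ IsUnramifiedOver (Algebra.adjoin ℂ {a, b}) P := by
  refine h.not_isUnramifiedOver hi hP hf (x := ⟨a, Algebra.subset_adjoin (Or.inl rfl)⟩)
    ((h.left.sub h.right).congr hfa.symm (by rw [hab, sub_self]) (sub_zero 0)) h.left ha ?_
  rintro y (hy | hy)
  · refine ⟨X, 1, by simpa using hP.one_notMem, 0, Subtype.ext ?_⟩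
    rw [map_one, one_mul, aeval_X, mul_zero, sub_eq_zero.2 (Subtype.ext hy)]
  · refine ⟨X, 1, by simpa using hP.one_notMem, -1, Subtype.ext ?_⟩
    rw [map_one, one_mul, aeval_X, mul_neg, mul_one]
    change (y : L) - a = -(f : L)
    rw [hy, hfa, neg_sub]

/-- In a chart with one coordinate inverted the diagonal is ab = 1. There b is 1/a modulo f, and a ∉
P because 1 would otherwise lie in P. -/
theorem not_isUnramifiedOver_hyperbola (ha : Transcendental ℂ a') (hab : a' * b' = 1)
    (hfa : (f : L) = a * b - 1) : ¬ IsUnramifiedOver (Algebra.adjoin ℂ {a, b}) P := by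
  have ma : a ∈ Algebra.adjoin ℂ {a, b} := Algebra.subset_adjoin (Or.inl rfl)
  have mb : b ∈ Algebra.adjoin ℂ {a, b} := Algebra.subset_adjoin (Or.inr rfl)
  have hfe : f = ⟨a, ma⟩ * ⟨b, mb⟩ - 1 := Subtype.ext hfa
  refine h.not_isUnramifiedOver hi hP hf (x := ⟨a, ma⟩)
    (((h.left.mul h.right).sub HasJet.one).congr hfa.symm (by rw [hab, sub_self]) (by simp)) h.left
    ha ?_
  rintro y (hy | hy)
  · refine ⟨X, 1, by simpa using hP.one_notMem, 0, Subtype.ext ?_⟩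
    rw [map_one, one_mul, aeval_X, mul_zero, sub_eq_zero.2 (Subtype.ext hy)]
  · refine ⟨1, X, fun hx => hP.one_notMem ?_, 1, ?_⟩
    · rw [aeval_X] at hx
      have := P.sub_mem (P.mul_mem_right ⟨b, mb⟩ hx) hf
      rwa [hfe, sub_sub_cancel] at this
    · rw [map_one, aeval_X, mul_one, hfe, show y = ⟨b, mb⟩ from Subtype.ext hy]

end Criterion

end RamifiedJet

/-! ### The jets in the coordinates (s, t). -/

section PlaneJets

open scoped LaurentSeries

variable {K : Type*} [Field K] [Algebra ℂ K] {y : K} (hy : Transcendental ℂ y)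

theorem map_formulas {F F' : Type*} [Field F] [Field F'] (σ : F →+* F') (s t : F) :
    σ (tOne s t) = tOne (σ s) (σ t) ∧ σ (tTwo s t) = tTwo (σ s) (σ t) ∧
      σ (coeffA0 s t) = coeffA0 (σ s) (σ t) := by
  refine ⟨?_, ?_, ?_⟩ <;>
  simp only [tOne, tTwo, coeffA0, map_div₀, map_neg, map_mul, map_add, map_sub, map_pow, map_one,
    map_ofNat]

theorem adjoin_pair_neg {k L : Type*} [Field k] [Field L] [Algebra k L] {s t : L}
    (h : IntermediateField.adjoin k {s, t} = ⊤) : IntermediateField.adjoin k {s, -t} = ⊤ := by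
  rw [eq_top_iff, ← h, IntermediateField.adjoin_le_iff]
  rintro x (rfl | rfl)
  · exact IntermediateField.subset_adjoin _ _ (Or.inl rfl)
  · have : -x ∈ IntermediateField.adjoin k {s, -x} :=
      IntermediateField.subset_adjoin _ _ (Or.inr rfl)
    simpa using neg_mem this

local notation "S" => coord ℂ 0
local notation "T" => coord ℂ 1

include hy

/-- The functions s, t of the base jet generate the function field. Composition with the
endomorphism that sends the coordinates to them yields a jet of the original plane. -/
theorem exists_plane_jet_zero : ∃ (Ψ : FunctionField2 ℂ →ₐ[ℂ] K⸨X⸩) (c : K), Transcendental ℂ c ∧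
    RamifiedJet Ψ (tOne S T) (tTwo S T) (coeffA0 S T * 1 * S ^ 2) 0 c := by
  obtain ⟨Ψ, h0, h1⟩ := FunctionField2.exists_laurent hy
  obtain ⟨s, t, htop, c, hc, h⟩ := exists_ramifiedJet_zero h0 h1 hy
  obtain ⟨σ, e0, e1⟩ := FunctionField2.exists_endomorphism htop
  obtain ⟨m1, m2, m3⟩ := map_formulas (σ : FunctionField2 ℂ →+* FunctionField2 ℂ) S T
  simp only [AlgHom.coe_toRingHom, e0, e1] at m1 m2 m3
  refine ⟨Ψ.comp σ, c, hc, RamifiedJet.comp ?_⟩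
  simpa only [map_mul, map_pow, map_one, m1, m2, m3, e0] using h

/-- The same jet composed with t ↦ -t, which exchanges the roles of t₁ and t₂. -/
theorem exists_plane_jet_zero' : ∃ (Ψ : FunctionField2 ℂ →ₐ[ℂ] K⸨X⸩) (c : K), Transcendental ℂ c ∧
    RamifiedJet Ψ (tTwo S T) (tOne S T) (coeffA0 S T * 1 * S ^ 2) 0 c := by
  obtain ⟨Ψ, h0, h1⟩ := FunctionField2.exists_laurent hy
  obtain ⟨s, t, htop, c, hc, h⟩ := exists_ramifiedJet_zero h0 h1 hy
  obtain ⟨σ, e0, e1⟩ := FunctionField2.exists_endomorphism (adjoin_pair_neg htop)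
  obtain ⟨m1, m2, m3⟩ := map_formulas (σ : FunctionField2 ℂ →+* FunctionField2 ℂ) S T
  simp only [AlgHom.coe_toRingHom, e0, e1, tOne_neg, tTwo_neg, coeffA0_neg] at m1 m2 m3
  refine ⟨Ψ.comp σ, c, hc, RamifiedJet.comp ?_⟩
  simpa only [map_mul, map_pow, map_one, m1, m2, m3, e0] using h

theorem exists_plane_jet_one : ∃ (Ψ : FunctionField2 ℂ →ₐ[ℂ] K⸨X⸩) (c : K), Transcendental ℂ c ∧
    RamifiedJet Ψ (tOne S T) (tTwo S T) (coeffA0 S T * S * 1 ^ 2) 1 c := by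
  obtain ⟨Ψ, h0, h1⟩ := FunctionField2.exists_laurent hy
  obtain ⟨s, t, htop, c, hc, h⟩ := exists_ramifiedJet_one h0 h1 hy
  obtain ⟨σ, e0, e1⟩ := FunctionField2.exists_endomorphism htop
  obtain ⟨m1, m2, m3⟩ := map_formulas (σ : FunctionField2 ℂ →+* FunctionField2 ℂ) S T
  simp only [AlgHom.coe_toRingHom, e0, e1] at m1 m2 m3
  refine ⟨Ψ.comp σ, c, hc, RamifiedJet.comp ?_⟩
  simpa only [map_mul, map_pow, map_one, m1, m2, m3, e0] using h

theorem exists_plane_jet_one' : ∃ (Ψ : FunctionField2 ℂ →ₐ[ℂ] K⸨X⸩) (c : K), Transcendental ℂ c ∧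
    RamifiedJet Ψ (tTwo S T) (tOne S T) (coeffA0 S T * S * 1 ^ 2) 1 c := by
  obtain ⟨Ψ, h0, h1⟩ := FunctionField2.exists_laurent hy
  obtain ⟨s, t, htop, c, hc, h⟩ := exists_ramifiedJet_one h0 h1 hy
  obtain ⟨σ, e0, e1⟩ := FunctionField2.exists_endomorphism (adjoin_pair_neg htop)
  obtain ⟨m1, m2, m3⟩ := map_formulas (σ : FunctionField2 ℂ →+* FunctionField2 ℂ) S T
  simp only [AlgHom.coe_toRingHom, e0, e1, tOne_neg, tTwo_neg, coeffA0_neg] at m1 m2 m3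
  refine ⟨Ψ.comp σ, c, hc, RamifiedJet.comp ?_⟩
  simpa only [map_mul, map_pow, map_one, m1, m2, m3, e0] using h

theorem exists_plane_jet_infty : ∃ (Ψ : FunctionField2 ℂ →ₐ[ℂ] K⸨X⸩) (c : K), Transcendental ℂ c ∧
    RamifiedJet Ψ (tOne S T)⁻¹ (tTwo S T)
      ((tOne S T)⁻¹ ^ 2 * (coeffA0 S T * 1 * (2 * S / (S * T - T - 1 - S)) ^ 2)) 0 c := by
  obtain ⟨Ψ, h0, h1⟩ := FunctionField2.exists_laurent hy
  obtain ⟨s, t, htop, c, hc, h⟩ := exists_ramifiedJet_infty h0 h1 hy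
  obtain ⟨σ, e0, e1⟩ := FunctionField2.exists_endomorphism htop
  obtain ⟨m1, m2, m3⟩ := map_formulas (σ : FunctionField2 ℂ →+* FunctionField2 ℂ) S T
  simp only [AlgHom.coe_toRingHom, e0, e1] at m1 m2 m3
  refine ⟨Ψ.comp σ, c, hc, RamifiedJet.comp ?_⟩
  simpa only [map_mul, map_pow, map_one, map_inv₀, map_div₀, map_sub, map_ofNat, m1, m2, m3, e0, e1]
    using h

theorem exists_plane_jet_infty' : ∃ (Ψ : FunctionField2 ℂ →ₐ[ℂ] K⸨X⸩) (c : K), Transcendental ℂ c ∧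
    RamifiedJet Ψ (tTwo S T)⁻¹ (tOne S T)
      ((tTwo S T)⁻¹ ^ 2 * (coeffA0 S T * 1 * (-(2 * S) / (S * T - T + S + 1)) ^ 2)) 0 c := by
  obtain ⟨Ψ, h0, h1⟩ := FunctionField2.exists_laurent hy
  obtain ⟨s, t, htop, c, hc, h⟩ := exists_ramifiedJet_infty h0 h1 hy
  obtain ⟨σ, e0, e1⟩ := FunctionField2.exists_endomorphism (adjoin_pair_neg htop)
  obtain ⟨m1, m2, m3⟩ := map_formulas (σ : FunctionField2 ℂ →+* FunctionField2 ℂ) S T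
  simp only [AlgHom.coe_toRingHom, e0, e1, tOne_neg, tTwo_neg, coeffA0_neg] at m1 m2 m3
  refine ⟨Ψ.comp σ, c, hc, RamifiedJet.comp ?_⟩
  have e : -(2 * s) / (s * -t - -t + s + 1) = 2 * s / (s * t - t - 1 - s) := by
    rw [neg_div, ← div_neg]
    congr 1
    ring
  simpa only [map_mul, map_pow, map_one, map_inv₀, map_div₀, map_sub, map_add, map_neg, map_ofNat,
    m1, m2, m3, e0, e1, e] using h

theorem exists_plane_jet_diagonal : ∃ (Ψ : FunctionField2 ℂ →ₐ[ℂ] K⸨X⸩) (c : K),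
    Transcendental ℂ c ∧ RamifiedJet Ψ (tOne S T) (tTwo S T)
      (coeffA0 S T * (2 * S / (S * T - T - 1 - S)) * 1 ^ 2) c c := by
  obtain ⟨Ψ, h0, h1⟩ := FunctionField2.exists_laurent hy
  obtain ⟨s, t, htop, c, hc, h⟩ := exists_ramifiedJet_diagonal h0 h1 hy
  obtain ⟨σ, e0, e1⟩ := FunctionField2.exists_endomorphism htop
  obtain ⟨m1, m2, m3⟩ := map_formulas (σ : FunctionField2 ℂ →+* FunctionField2 ℂ) S T
  simp only [AlgHom.coe_toRingHom, e0, e1] at m1 m2 m3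
  refine ⟨Ψ.comp σ, c, hc, RamifiedJet.comp ?_⟩
  simpa only [map_mul, map_pow, map_one, map_div₀, map_sub, map_ofNat, m1, m2, m3, e0, e1] using h

end PlaneJets

/-- A prime containing the product contains one of the five factors, so ramification may be shown
curve by curve. -/
theorem branchLocusIs_of_factors (a b z : FunctionField2 ℂ)
    (ha : a = tOne (coord ℂ 0) (coord ℂ 1) ∨ a = (tOne (coord ℂ 0) (coord ℂ 1))⁻¹)
    (hb : b = tTwo (coord ℂ 0) (coord ℂ 1) ∨ b = (tTwo (coord ℂ 0) (coord ℂ 1))⁻¹)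
    (hz : z ∈ Algebra.adjoin ℂ {a, b})
    (hunits : ∀ V : ValuationSubring (FunctionField2 ℂ), V.valuation a ≤ 1 → V.valuation b ≤ 1 →
      V.valuation (a * (a - 1) * b * (b - 1) * z) = 1 →
      UnitsAt V (tOne (coord ℂ 0) (coord ℂ 1)) (tTwo (coord ℂ 0) (coord ℂ 1)))
    (hram : ∀ P : Ideal (Algebra.adjoin ℂ {a, b}), P.IsPrime → ∀ f ∈ P,
      ((f : FunctionField2 ℂ) = a - algebraMap ℂ _ 0 ∨ (f : FunctionField2 ℂ) = a - algebraMap ℂ _ 1 ∨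
        (f : FunctionField2 ℂ) = b - algebraMap ℂ _ 0 ∨ (f : FunctionField2 ℂ) = b - algebraMap ℂ _ 1 ∨
        (f : FunctionField2 ℂ) = z) → ¬ IsUnramifiedOver (Algebra.adjoin ℂ {a, b}) P) :
    BranchLocusIs a b (a * (a - 1) * b * (b - 1) * z) := by
  have ma : a ∈ Algebra.adjoin ℂ {a, b} := Algebra.subset_adjoin (Or.inl rfl)
  have mb : b ∈ Algebra.adjoin ℂ {a, b} := Algebra.subset_adjoin (Or.inr rfl)
  refine ⟨⟨a, ma⟩ * (⟨a, ma⟩ - 1) * ⟨b, mb⟩ * (⟨b, mb⟩ - 1) * ⟨z, hz⟩, rfl, fun P hP =>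
    ⟨fun hun hg => ?_, isUnramifiedOver_of_unitsAt a b ha hb _ hunits P⟩⟩
  rcases hP.mem_or_mem hg with hg | hg
  · rcases hP.mem_or_mem hg with hg | hg
    · rcases hP.mem_or_mem hg with hg | hg
      · rcases hP.mem_or_mem hg with hg | hg
        · exact hram P hP _ hg (Or.inl (by rw [map_zero, sub_zero])) hun
        · exact hram P hP _ hg (Or.inr (Or.inl (by rw [map_one]; rfl))) hun
      · exact hram P hP _ hg (Or.inr (Or.inr (Or.inl (by rw [map_zero, sub_zero])))) hun
    · exact hram P hP _ hg (Or.inr (Or.inr (Or.inr (Or.inl (by rw [map_one]; rfl))))) hun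
  · exact hram P hP _ hg (Or.inr (Or.inr (Or.inr (Or.inr rfl)))) hun

/-! ### The four charts of ℙ¹ × ℙ¹. -/

section Charts

local notation "S" => coord ℂ 0
local notation "T" => coord ℂ 1
local notation "T₁" => tOne (coord ℂ 0) (coord ℂ 1)
local notation "T₂" => tTwo (coord ℂ 0) (coord ℂ 1)

theorem Transcendental.ne_zero' {K : Type*} [Field K] [Algebra ℂ K] {c : K}
    (h : Transcendental ℂ c) : c ≠ 0 := by
  simpa using h.add_algebraMap_ne_zero 0

theorem Transcendental.inv' {K : Type*} [Field K] [Algebra ℂ K] {c : K} (h : Transcendental ℂ c) :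
    Transcendental ℂ c⁻¹ := fun e => h (by simpa using e.inv)

theorem branchLocusIs_affine :
    BranchLocusIs T₁ T₂ (T₁ * (T₁ - 1) * T₂ * (T₂ - 1) * (T₁ - T₂)) := by
  have hy := RatFunc.transcendental_X (K := ℂ)
  have hg := genericParameter_coord (k := ℂ)
  have m1 : T₁ ∈ Algebra.adjoin ℂ {T₁, T₂} := Algebra.subset_adjoin (Or.inl rfl)
  have m2 : T₂ ∈ Algebra.adjoin ℂ {T₁, T₂} := Algebra.subset_adjoin (Or.inr rfl)
  refine branchLocusIs_of_factors _ _ _ (Or.inl rfl) (Or.inl rfl) (sub_mem m1 m2)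
    (fun V => unitsAt_of_factors V) ?_
  -- The scale w has to lie in the coordinate ring together with wt₁ and wt₂. In this chart w = 1;
  -- in the others w is the product of the inverted coordinates.
  have int := fun {ρ ρ'} => hg.isIntegral_scaled_product (ρ := ρ) (ρ' := ρ')
    (Algebra.adjoin ℂ {T₁, T₂}) (w := 1) (one_mem _) (by rwa [one_mul]) (by rwa [one_mul])
  rintro P hP f hf (e | e | e | e | e)
  · obtain ⟨Ψ, c, hc, h⟩ := exists_plane_jet_zero hy
    exact (h.scale HasJet.one one_ne_zero).not_isUnramifiedOver_left
      (int isCubeRatio_one isCubeRatio_s) hP hf hc 0 (map_zero _) e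
  · obtain ⟨Ψ, c, hc, h⟩ := exists_plane_jet_one hy
    exact (h.scale HasJet.one one_ne_zero).not_isUnramifiedOver_left
      (int isCubeRatio_s isCubeRatio_one) hP hf hc 1 (map_one _) e
  · obtain ⟨Ψ, c, hc, h⟩ := exists_plane_jet_zero' hy
    exact (h.symm.scale HasJet.one one_ne_zero).not_isUnramifiedOver_right
      (int isCubeRatio_one isCubeRatio_s) hP hf hc 0 (map_zero _) e
  · obtain ⟨Ψ, c, hc, h⟩ := exists_plane_jet_one' hy
    exact (h.symm.scale HasJet.one one_ne_zero).not_isUnramifiedOver_right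
      (int isCubeRatio_s isCubeRatio_one) hP hf hc 1 (map_one _) e
  · obtain ⟨Ψ, c, hc, h⟩ := exists_plane_jet_diagonal hy
    exact (h.scale HasJet.one one_ne_zero).not_isUnramifiedOver_diagonal
      (int hg.isCubeRatio_tOne isCubeRatio_one) hP hf hc rfl e

theorem branchLocusIs_inv_left :
    BranchLocusIs T₁⁻¹ T₂ (T₁⁻¹ * (T₁⁻¹ - 1) * T₂ * (T₂ - 1) * (T₁⁻¹ * T₂ - 1)) := by
  have hy := RatFunc.transcendental_X (K := ℂ)
  have hg := genericParameter_coord (k := ℂ)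
  have m1 : T₁⁻¹ ∈ Algebra.adjoin ℂ {T₁⁻¹, T₂} := Algebra.subset_adjoin (Or.inl rfl)
  have m2 : T₂ ∈ Algebra.adjoin ℂ {T₁⁻¹, T₂} := Algebra.subset_adjoin (Or.inr rfl)
  refine branchLocusIs_of_factors _ _ _ (Or.inr rfl) (Or.inl rfl)
    (sub_mem (mul_mem m1 m2) (one_mem _)) (fun V => unitsAt_of_factors_inv_left V) ?_
  have int := fun {ρ ρ'} => hg.isIntegral_scaled_product (ρ := ρ) (ρ' := ρ')
    (Algebra.adjoin ℂ {T₁⁻¹, T₂}) (w := T₁⁻¹) m1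
    (by rw [inv_mul_cancel₀ hg.one_zero]; exact one_mem _) (mul_mem m1 m2)
  rintro P hP f hf (e | e | e | e | e)
  · obtain ⟨Ψ, c, hc, h⟩ := exists_plane_jet_infty hy
    exact h.not_isUnramifiedOver_left (int isCubeRatio_one hg.isCubeRatio_tOne) hP hf hc 0
      (map_zero _) e
  · obtain ⟨Ψ, c, hc, h⟩ := exists_plane_jet_one hy
    exact ((h.inv_left one_ne_zero).scale_left (inv_ne_zero one_ne_zero)).not_isUnramifiedOver_left
      (int isCubeRatio_s isCubeRatio_one) hP hf hc 1 (by simp) e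
  · obtain ⟨Ψ, c, hc, h⟩ := exists_plane_jet_zero' hy
    exact ((h.symm.inv_left hc.ne_zero').scale_left (inv_ne_zero hc.ne_zero')).not_isUnramifiedOver_right
      (int isCubeRatio_one isCubeRatio_s) hP hf hc.inv' 0 (map_zero _) e
  · obtain ⟨Ψ, c, hc, h⟩ := exists_plane_jet_one' hy
    exact ((h.symm.inv_left hc.ne_zero').scale_left (inv_ne_zero hc.ne_zero')).not_isUnramifiedOver_right
      (int isCubeRatio_s isCubeRatio_one) hP hf hc.inv' 1 (map_one _) e
  · obtain ⟨Ψ, c, hc, h⟩ := exists_plane_jet_diagonal hy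
    exact ((h.inv_left hc.ne_zero').scale_left
      (inv_ne_zero hc.ne_zero')).not_isUnramifiedOver_hyperbola
      (int hg.isCubeRatio_tOne isCubeRatio_one) hP hf hc.inv' (inv_mul_cancel₀ hc.ne_zero') e

theorem branchLocusIs_inv_right :
    BranchLocusIs T₁ T₂⁻¹ (T₁ * (T₁ - 1) * T₂⁻¹ * (T₂⁻¹ - 1) * (T₁ * T₂⁻¹ - 1)) := by
  have hy := RatFunc.transcendental_X (K := ℂ)
  have hg := genericParameter_coord (k := ℂ)
  have m1 : T₁ ∈ Algebra.adjoin ℂ {T₁, T₂⁻¹} := Algebra.subset_adjoin (Or.inl rfl)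
  have m2 : T₂⁻¹ ∈ Algebra.adjoin ℂ {T₁, T₂⁻¹} := Algebra.subset_adjoin (Or.inr rfl)
  refine branchLocusIs_of_factors _ _ _ (Or.inl rfl) (Or.inr rfl)
    (sub_mem (mul_mem m1 m2) (one_mem _)) (fun V => unitsAt_of_factors_inv_right V) ?_
  have int := fun {ρ ρ'} => hg.isIntegral_scaled_product (ρ := ρ) (ρ' := ρ')
    (Algebra.adjoin ℂ {T₁, T₂⁻¹}) (w := T₂⁻¹) m2 (mul_mem m2 m1)
    (by rw [inv_mul_cancel₀ hg.two_zero]; exact one_mem _)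
  rintro P hP f hf (e | e | e | e | e)
  · obtain ⟨Ψ, c, hc, h⟩ := exists_plane_jet_zero hy
    exact ((h.inv_right hc.ne_zero').scale_right (inv_ne_zero hc.ne_zero')).not_isUnramifiedOver_left
      (int isCubeRatio_one isCubeRatio_s) hP hf hc.inv' 0 (map_zero _) e
  · obtain ⟨Ψ, c, hc, h⟩ := exists_plane_jet_one hy
    exact ((h.inv_right hc.ne_zero').scale_right (inv_ne_zero hc.ne_zero')).not_isUnramifiedOver_left
      (int isCubeRatio_s isCubeRatio_one) hP hf hc.inv' 1 (map_one _) e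
  · obtain ⟨Ψ, c, hc, h⟩ := exists_plane_jet_infty' hy
    exact h.symm.not_isUnramifiedOver_right (int isCubeRatio_one hg.isCubeRatio_tTwo) hP hf hc 0
      (map_zero _) e
  · obtain ⟨Ψ, c, hc, h⟩ := exists_plane_jet_one' hy
    exact ((h.symm.inv_right one_ne_zero).scale_right
      (inv_ne_zero one_ne_zero)).not_isUnramifiedOver_right
      (int isCubeRatio_s isCubeRatio_one) hP hf hc 1 (by simp) e
  · obtain ⟨Ψ, c, hc, h⟩ := exists_plane_jet_diagonal hy
    exact ((h.inv_right hc.ne_zero').scale_right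
      (inv_ne_zero hc.ne_zero')).not_isUnramifiedOver_hyperbola
      (int hg.isCubeRatio_tOne isCubeRatio_one) hP hf hc (mul_inv_cancel₀ hc.ne_zero') e

theorem branchLocusIs_inv :
    BranchLocusIs T₁⁻¹ T₂⁻¹ (T₁⁻¹ * (T₁⁻¹ - 1) * T₂⁻¹ * (T₂⁻¹ - 1) * (T₁⁻¹ - T₂⁻¹)) := by
  have hy := RatFunc.transcendental_X (K := ℂ)
  have hg := genericParameter_coord (k := ℂ)
  have m1 : T₁⁻¹ ∈ Algebra.adjoin ℂ {T₁⁻¹, T₂⁻¹} := Algebra.subset_adjoin (Or.inl rfl)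
  have m2 : T₂⁻¹ ∈ Algebra.adjoin ℂ {T₁⁻¹, T₂⁻¹} := Algebra.subset_adjoin (Or.inr rfl)
  refine branchLocusIs_of_factors _ _ _ (Or.inr rfl) (Or.inr rfl) (sub_mem m1 m2)
    (fun V => unitsAt_of_factors_inv V) ?_
  have int := fun {ρ ρ'} => hg.isIntegral_scaled_product (ρ := ρ) (ρ' := ρ')
    (Algebra.adjoin ℂ {T₁⁻¹, T₂⁻¹}) (w := T₁⁻¹ * T₂⁻¹) (mul_mem m1 m2)
    (by rwa [mul_right_comm, inv_mul_cancel₀ hg.one_zero, one_mul])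
    (by rwa [mul_assoc, inv_mul_cancel₀ hg.two_zero, mul_one])
  rintro P hP f hf (e | e | e | e | e)
  · obtain ⟨Ψ, c, hc, h⟩ := exists_plane_jet_infty hy
    -- The jet at infinity carries only the factor t₁⁻². The factor t₂⁻² needed in this chart has
    -- nonzero residue and no first order term, so the simple zero persists.
    have h' := (h.inv_right hc.ne_zero').scale_right (inv_ne_zero hc.ne_zero')
    rw [← mul_assoc, mul_comm (T₂⁻¹ ^ 2), ← mul_pow] at h'
    exact h'.not_isUnramifiedOver_left (int isCubeRatio_one hg.isCubeRatio_tOne) hP hf hc.inv' 0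
      (map_zero _) e
  · obtain ⟨Ψ, c, hc, h⟩ := exists_plane_jet_one hy
    exact (((h.inv_left one_ne_zero).inv_right hc.ne_zero').scale_mul (inv_ne_zero one_ne_zero)
      (inv_ne_zero hc.ne_zero')).not_isUnramifiedOver_left
      (int isCubeRatio_s isCubeRatio_one) hP hf hc.inv' 1 (by simp) e
  · obtain ⟨Ψ, c, hc, h⟩ := exists_plane_jet_infty' hy
    have h' := (h.symm.inv_left hc.ne_zero').scale_left (inv_ne_zero hc.ne_zero')
    rw [← mul_assoc, ← mul_pow] at h'
    exact h'.not_isUnramifiedOver_right (int isCubeRatio_one hg.isCubeRatio_tTwo) hP hf hc.inv' 0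
      (map_zero _) e
  · obtain ⟨Ψ, c, hc, h⟩ := exists_plane_jet_one' hy
    exact (((h.symm.inv_right one_ne_zero).inv_left hc.ne_zero').scale_mul
      (inv_ne_zero hc.ne_zero') (inv_ne_zero one_ne_zero)).not_isUnramifiedOver_right
      (int isCubeRatio_s isCubeRatio_one) hP hf hc.inv' 1 (by simp) e
  · obtain ⟨Ψ, c, hc, h⟩ := exists_plane_jet_diagonal hy
    exact (((h.inv_left hc.ne_zero').inv_right hc.ne_zero').scale_mul (inv_ne_zero hc.ne_zero')
      (inv_ne_zero hc.ne_zero')).not_isUnramifiedOver_diagonal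
      (int hg.isCubeRatio_tOne isCubeRatio_one) hP hf hc.inv' rfl e

end Charts

end

theorem mainTheorem10 (α : ℂ) (hα : α ^ 2 = -3) :
    -- the constraint `φ(1) = 1` defines a rational surface
    (∀ a₀ a₁ c : ℂ, a₀ ≠ 0 → c ≠ 0 → c ≠ 1 →
      (a₀ ^ 2 / c ^ 3 + (1 + a₁ + a₀) ^ 2 / (1 - c) ^ 3 = 0 ↔
        ∃! s : ℂ, a₁ = a₀ * (s ^ 3 - 1) - 1 ∧ c = 1 / (1 - s ^ 2))) ∧
    -- the covers of the prescribed type are exactly those of the family, with unique `(s,t)`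
    (∀ (φ : RatFunc ℂ) (τ₁ τ₂ ξ₁ ξ₂ : ℂ),
      IsNormalizedCover φ τ₁ τ₂ ξ₁ ξ₂ ↔
        ∃! x : ℂ × ℂ, Admissible x.1 x.2 ∧
          φ = coverRat (coeffA0 x.1 x.2) (coeffA1 x.1 x.2) (poleC x.1) ∧
          τ₁ = tOne x.1 x.2 ∧ τ₂ = tTwo x.1 x.2 ∧
          ξ₁ + ξ₂ = critSum x.1 x.2 ∧ ξ₁ * ξ₂ = critProd x.1 x.2) ∧
    -- `(u,v)` parametrizes rationally over `ℚ(α)` the double cover defined by `q₁, q₂`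
    (let k := IntermediateField.adjoin ℚ {α}
     let γ : FunctionField2 k := algebraMap k (FunctionField2 k)
       (IntermediateField.AdjoinSimple.gen ℚ α)
     let u := coord k 0
     let v := coord k 1
     let s := paramS γ u v
     let t := paramT γ u v
     solT1 γ u v = tOne s t ∧ solT2 γ u v = tTwo s t ∧
     solQ1 γ u v + solQ2 γ u v = critSum s t ∧ solQ1 γ u v * solQ2 γ u v = critProd s t ∧
     Module.finrank (IntermediateField.adjoin k {s, t}) (FunctionField2 k) = 2 ∧
     IntermediateField.adjoin k {s, t, solQ1 γ u v} = ⊤) ∧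
    -- `(t₁, t₂, q₁, q₂)(u,v)` is a complete algebraic solution of the Garnier system of rank 2
    (∃ h : MvPolynomial (Fin 2) ℂ, h ≠ 0 ∧
      (∀ x : Fin 2 → ℂ, MvPolynomial.eval x h ≠ 0 →
        let s := paramS α (x 0) (x 1)
        let t := paramT α (x 0) (x 1)
        IsNormalizedCover (coverRat (coeffA0 s t) (coeffA1 s t) (poleC s))
          (solT α x 0) (solT α x 1) (solQ α x 0) (solQ α x 1) ∧
        solQ α x 0 ≠ solQ α x 1) ∧
      ∀ θ : ℂ, ∃ n : Fin 2 → MvPolynomial (Fin 2) ℂ,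
        let p : (Fin 2 → ℂ) → Fin 2 → ℂ :=
          fun x k => MvPolynomial.eval x (n k) / MvPolynomial.eval x h
        ∀ x : Fin 2 → ℂ, MvPolynomial.eval x h ≠ 0 →
          -- the Fuchsian equation is equivalent to the pull-back of a hypergeometric equation
          (let s := paramS α (x 0) (x 1)
           let t := paramT α (x 0) (x 1)
           let a₀ := coeffA0 s t
           let a₁ := coeffA1 s t
           let c := poleC s
           ∃ a b : ℂ, ∀ z : ℂ, z ≠ 0 → z ≠ 1 → (∀ i, z ≠ solT α x i) → (∀ i, z ≠ solQ α x i) →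
             z ≠ c → z ^ 2 + a₁ * z + a₀ ≠ 0 →
             potential (fuchsF θ θ ![θ, θ] (solT α x) (solQ α x))
               (fuchsG a b (solT α x) (solQ α x)
                 (fun j => garnierH θ θ (1 / 3) ![θ, θ] j (solT α x) (solQ α x) (p x)) (p x)) z
             = pullbackPotential (coverMap a₀ a₁ c)
                 (hypergeometricPotential (1 / 2) θ (1 / 3)) z) ∧
          -- each good point lies on a holomorphic branch, which solves the Garnier system
          ∃ (V : Set (Fin 2 → ℂ)) (G : (Fin 2 → ℂ) → Fin 2 → ℂ),
            solT α x ∈ V ∧ G (solT α x) = x ∧ DifferentiableOn ℂ G V ∧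
            (∀ τ ∈ V, MvPolynomial.eval (G τ) h ≠ 0 ∧ solT α (G τ) = τ) ∧
            IsGarnierSolution θ θ (1 / 3) ![θ, θ] V
              (fun τ => solQ α (G τ)) (fun τ => p (G τ))) ∧
    -- `(s,t) ↦ (t₁,t₂)` has degree 9 and its branch locus in `ℙ¹ × ℙ¹` is exactly the union of
    -- the curves `tᵢ = 0, 1, ∞` and of the diagonal
    (let T₁ := tOne (coord ℂ 0) (coord ℂ 1)
     let T₂ := tTwo (coord ℂ 0) (coord ℂ 1)
     Module.finrank (IntermediateField.adjoin ℂ {T₁, T₂}) (FunctionField2 ℂ) = 9 ∧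
     BranchLocusIs T₁ T₂ (T₁ * (T₁ - 1) * T₂ * (T₂ - 1) * (T₁ - T₂)) ∧
     BranchLocusIs T₁⁻¹ T₂ (T₁⁻¹ * (T₁⁻¹ - 1) * T₂ * (T₂ - 1) * (T₁⁻¹ * T₂ - 1)) ∧
     BranchLocusIs T₁ T₂⁻¹ (T₁ * (T₁ - 1) * T₂⁻¹ * (T₂⁻¹ - 1) * (T₁ * T₂⁻¹ - 1)) ∧
     BranchLocusIs T₁⁻¹ T₂⁻¹
       (T₁⁻¹ * (T₁⁻¹ - 1) * T₂⁻¹ * (T₂⁻¹ - 1) * (T₁⁻¹ - T₂⁻¹))) := by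
  refine ⟨fun a₀ a₁ c => value_one_iff_existsUnique a₀ a₁ c, isNormalizedCover_iff, ?_,
    exists_algebraic_solution α hα, ?_⟩
  · exact plane_doubleCover α hα
  · exact ⟨finrank_adjoin_tOne_tTwo, branchLocusIs_affine, branchLocusIs_inv_left,
      branchLocusIs_inv_right, branchLocusIs_inv⟩
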